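/- Fix constants $0<c_1<c_2<\infty$. One observes $n$ i.i.d. pairs $(x_i,y_i)$ with $y_i=x_i^\top\theta_0+\epsilon_i$, where $x_i\sim N(0,\Sigma)$ in $\mathbb R^p$, all eigenvalues of $\Sigma$ lie in $[c_1,c_2]$, and the noise $\epsilon_i$ is independent of $x_i$ with mean $0$ and variance $\sigma^2\ge 0$. The dimension $p=p(n)\ge 1$ satisfies $p\log n/n\to 0$. Write $\|u\|_A=\sqrt{u^\top Au}$, $c_0=\sqrt{2/\pi}$, and $v^2=\|\theta_0\|_\Sigma^2+\sigma^2$. For an attack level $\delta\ge0$ let $\theta^*=\theta^*(\delta)$ be the minimizer over $\theta\in\mathbb R^p$ of the adversarial risk $\mathbb E_{x\sim N(0,\Sigma)}\max_{\|z-x\|\le\delta}(z^\top\theta-x^\top\theta_0)^2$. For a positive definite matrix $A$ and a vector $t\neq0$ put $$\delta_1(A,t)=\frac{c_0\|t\|}{\|t\|_{A^{-1}}},\qquad \delta_2(A,t)=\frac{\|t\|_{A^2}}{c_0\|t\|_A},\qquad \theta_{A,t}(\lambda)=(A+\lambda I_p)^{-1}At,\quad \theta_{A,t}(\infty)=0,$$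 and let $\lambda^*(A,t,\delta)$ be $0$ if $\delta\le\delta_1(A,t)$, $\infty$ if $\delta\ge\delta_2(A,t)$, and otherwise the solution $\lambda>0$ of $$\lambda\Big(1+\delta c_0\frac{\|\theta_{A,t}(\lambda)\|}{\|\theta_{A,t}(\lambda)-t\|_A}\Big)=\delta c_0\frac{\|\theta_{A,t}(\lambda)-t\|_A}{\|\theta_{A,t}(\lambda)\|}+\delta^2 .$$ The two-stage estimator is $\widehat\theta(\delta)=(\widehat\Sigma+\widehat\lambda I_p)^{-1}\widehat\Sigma\,\widehat\theta_0$ with $\widehat\lambda=\lambda^*(\widehat\Sigma,\widehat\theta_0,\delta)$ (so $\widehat\theta(\delta)=0$ if $\widehat\lambda=\infty$), where $\widehat\theta_0=(X^\top X)^{-1}X^\top y$ is the OLS estimate and $\widehat\Sigma=X^\top X/n$. Write $\delta_j=\delta_j(\Sigma,\theta_0)$. Then $\mathbb E\|\widehat\theta(\delta)-\theta^*(\delta)\|^2=\Theta(v^2p/n)$ in the following sense. Here "for all large $n$" is uniform in $\Sigma,\theta_0,\sigma$, the noise law, $\delta$ and (in 4) $R$. 1. (Upper bound.) There is $C=C(c_1,c_2)$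 such that for all large $n$ and every $\delta\ge0$, $\widehat\theta(\delta)$ is measurable up to null sets and $\mathbb E\|\widehat\theta(\delta)-\theta^*(\delta)\|^2\le C\,v^2p/n$. 2. (Lower bound between the thresholds.) For all $\kappa,\varepsilon>0$ there is $c=c(c_1,c_2,\kappa,\varepsilon)>0$ such that for all large $n$, if $\|\theta_0\|_\Sigma\ge\kappa\sigma$ and $(1+\varepsilon)\delta_1\le\delta\le(1-\varepsilon)\delta_2$, then $\mathbb E\|\widehat\theta(\delta)-\theta^*(\delta)\|^2\ge c\,v^2p/n$. 3. (Lower bound below the lower threshold.) For all $\kappa,K,\varepsilon>0$ there is $c=c(c_1,c_2,\kappa,K,\varepsilon)>0$ such that for all large $n$, if $\kappa\sigma\le\|\theta_0\|_\Sigma\le K\sigma$, $\mathbb E\epsilon_i^4\le K\sigma^4$ and $0\le\delta\le(1-\varepsilon)\delta_1$, then $\mathbb E\|\widehat\theta(\delta)-\theta^*(\delta)\|^2\ge c\,v^2p/n$. 4. (Minimax rate optimality.) For every $K>0$ there is $C=C(c_1,c_2,K)$ such that for all large $n$, all $R>0$, all $\sigma\le KR$, every noise law of mean $0$ and variance $\sigma^2$,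 and every measurable estimator $T_\delta=T_\delta(x_1,y_1,\dots,x_n,y_n)$, which may depend on $\delta$, $$\sup_{\Sigma,\theta_0,\delta}\mathbb E\|\widehat\theta(\delta)-\theta^*(\delta)\|^2\le C\,\sup_{\Sigma,\theta_0,\delta}\mathbb E\|T_\delta-\theta^*(\delta)\|^2,$$ both suprema being over all $\Sigma$ with eigenvalues in $[c_1,c_2]$, all $\|\theta_0\|\le R$ and all $\delta>0$. -/

import Mathlib

open MeasureTheory ProbabilityTheory Filter Topology Matrix
open scoped ENNReal

noncomputable section

namespace AdvLinReg

/-- Euclidean space of dimension `p`. -/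
abbrev Vec (p : ℕ) := EuclideanSpace ℝ (Fin p)

/-- The matrix-vector product, as a Euclidean vector. -/
def mulV {p : ℕ} (A : Matrix (Fin p) (Fin p) ℝ) (x : Vec p) : Vec p :=
  WithLp.toLp 2 (A *ᵥ WithLp.ofLp x)

/-- The weighted norm `√(xᵀ A x)`. -/
def wnorm {p : ℕ} (A : Matrix (Fin p) (Fin p) ℝ) (x : Vec p) : ℝ :=
  √(inner ℝ x (mulV A x))

/-- The constant `√(2/π)`, the first absolute moment of a standard Gaussian. -/
def c0 : ℝ := √(2 / Real.pi)

/-- Symmetric matrices all of whose eigenvalues lie in `[c₁, c₂]`. -/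
def CovClass {p : ℕ} (c₁ c₂ : ℝ) (A : Matrix (Fin p) (Fin p) ℝ) : Prop :=
  (A - c₁ • (1 : Matrix (Fin p) (Fin p) ℝ)).PosSemidef ∧
    (c₂ • (1 : Matrix (Fin p) (Fin p) ℝ) - A).PosSemidef

/-- `ν` is a law on the line with mean `0` and variance `σ²`. -/
def IsNoise (ν : Measure ℝ) (σ : ℝ) : Prop :=
  IsProbabilityMeasure ν ∧ MemLp (fun e : ℝ => e) 2 ν ∧ ∫ e, e ∂ν = 0 ∧ ∫ e, e ^ 2 ∂ν = σ ^ 2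

/-! ### The population target -/

/-- The population adversarial risk
`E_x max_{‖z - x‖ ≤ δ} (zᵀθ - xᵀθ₀)²` for `x ∼ N(0, A)`. -/
def advRisk {p : ℕ} (A : Matrix (Fin p) (Fin p) ℝ) (θ₀ : Vec p) (δ : ℝ) (θ : Vec p) : ℝ :=
  ∫ x, sSup ((fun z : Vec p => (inner ℝ z θ - inner ℝ x θ₀) ^ 2) '' Metric.closedBall x δ)
    ∂(multivariateGaussian (0 : Vec p) A)

/-- The minimizer of the adversarial risk. -/
def thetaStar {p : ℕ} (A : Matrix (Fin p) (Fin p) ℝ) (θ₀ : Vec p) (δ : ℝ) : Vec p :=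
  Classical.epsilon fun θ : Vec p => ∀ θ' : Vec p, advRisk A θ₀ δ θ ≤ advRisk A θ₀ δ θ'

/-! ### The two-stage estimator -/

/-- The lower threshold `c₀ ‖t‖ / ‖t‖_{A⁻¹}`. -/
def delta1 {p : ℕ} (A : Matrix (Fin p) (Fin p) ℝ) (t : Vec p) : ℝ :=
  c0 * ‖t‖ / wnorm A⁻¹ t

/-- The upper threshold `‖t‖_{A²} / (c₀ ‖t‖_A)`. -/
def delta2 {p : ℕ} (A : Matrix (Fin p) (Fin p) ℝ) (t : Vec p) : ℝ :=
  wnorm (A ^ 2) t / (c0 * wnorm A t)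

/-- The path `(A + l I)⁻¹ A t`, with value `0` at `l = ∞`. -/
def thetaPath {p : ℕ} (A : Matrix (Fin p) (Fin p) ℝ) (t : Vec p) (l : ℝ≥0∞) : Vec p :=
  if l = ⊤ then 0
  else mulV ((A + l.toReal • (1 : Matrix (Fin p) (Fin p) ℝ))⁻¹ * A) t

/-- The first-order condition that determines the level `l` on the path. -/
def PathEq {p : ℕ} (A : Matrix (Fin p) (Fin p) ℝ) (t : Vec p) (δ l : ℝ) : Prop :=
  l * (1 + δ * c0 * (‖thetaPath A t (ENNReal.ofReal l)‖ /
      wnorm A (thetaPath A t (ENNReal.ofReal l) - t)))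
    = δ * c0 * (wnorm A (thetaPath A t (ENNReal.ofReal l) - t) /
      ‖thetaPath A t (ENNReal.ofReal l)‖) + δ ^ 2

open Classical in
/-- The level `λ*`: it is `0` up to the lower threshold, `∞` from the upper threshold on, and the
solution of the first-order condition in between. -/
def lambdaStar {p : ℕ} (A : Matrix (Fin p) (Fin p) ℝ) (t : Vec p) (δ : ℝ) : ℝ≥0∞ :=
  if δ ≤ delta1 A t then 0
  else if delta2 A t ≤ δ then ⊤
  else ENNReal.ofReal (Classical.epsilon fun l : ℝ => 0 < l ∧ PathEq A t δ l)

/-- A data set of `n` pairs `(xᵢ, yᵢ)`. -/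
abbrev Data (p n : ℕ) := Fin n → Vec p × ℝ

/-- The design matrix, with rows `xᵢᵀ`. -/
def design {p n : ℕ} (D : Data p n) : Matrix (Fin n) (Fin p) ℝ :=
  Matrix.of fun i j => (D i).1 j

/-- The response vector. -/
def response {p n : ℕ} (D : Data p n) : Fin n → ℝ := fun i => (D i).2

/-- The ordinary least squares estimate `(XᵀX)⁻¹ Xᵀ y`. -/
def ols {p n : ℕ} (D : Data p n) : Vec p :=
  WithLp.toLp 2 (((design D)ᵀ * design D)⁻¹ *ᵥ ((design D)ᵀ *ᵥ response D))

/-- The sample covariance matrix `XᵀX / n`. -/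
def sampleCov {p n : ℕ} (D : Data p n) : Matrix (Fin p) (Fin p) ℝ :=
  (1 / (n : ℝ)) • ((design D)ᵀ * design D)

/-- The two-stage estimator `(S + λ̂ I)⁻¹ S t` with `t` the least squares estimate, `S` the sample
covariance matrix and `λ̂` the plug-in level. -/
def twoStage {p n : ℕ} (δ : ℝ) (D : Data p n) : Vec p :=
  thetaPath (sampleCov D) (ols D) (lambdaStar (sampleCov D) (ols D) δ)

/-! ### The linear model and the risk of an estimator -/

/-- The law of `n` independent observations `(x, y)` with `y = xᵀθ₀ + e`, `x ∼ N(0, A)` and `e ∼ ν`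
independent of `x`. -/
def dataLaw {p : ℕ} (n : ℕ) (A : Matrix (Fin p) (Fin p) ℝ) (θ₀ : Vec p) (ν : Measure ℝ) :
    Measure (Data p n) :=
  Measure.pi fun _ : Fin n =>
    ((multivariateGaussian (0 : Vec p) A).prod ν).map
      fun w : Vec p × ℝ => (w.1, inner ℝ w.1 θ₀ + w.2)

/-- The mean squared error `E ‖T - θ*(δ)‖²` of an estimator `T`. -/
def mse {p n : ℕ} (A : Matrix (Fin p) (Fin p) ℝ) (θ₀ : Vec p) (ν : Measure ℝ) (δ : ℝ)
    (T : Data p n → Vec p) : ℝ≥0∞ :=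
  ∫⁻ D, ENNReal.ofReal (‖T D - thetaStar A θ₀ δ‖ ^ 2) ∂(dataLaw n A θ₀ ν)

/-- The worst mean squared error, over covariance matrices with eigenvalues in `[c₁, c₂]`, signals
of norm at most `R` and attack levels `δ > 0`, of an estimator that may use `δ`. -/
def worstMse {p n : ℕ} (c₁ c₂ R : ℝ) (ν : Measure ℝ) (T : ℝ → Data p n → Vec p) : ℝ≥0∞ :=
  ⨆ (A : Matrix (Fin p) (Fin p) ℝ) (_ : CovClass c₁ c₂ A) (θ₀ : Vec p) (_ : ‖θ₀‖ ≤ R)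
    (δ : ℝ) (_ : 0 < δ), mse A θ₀ ν δ (T δ)

/-- The rate `v² p / n` with `v² = ‖θ₀‖²_A + σ²`. -/
def rate {p : ℕ} (n : ℕ) (A : Matrix (Fin p) (Fin p) ℝ) (θ₀ : Vec p) (σ : ℝ) : ℝ :=
  (wnorm A θ₀ ^ 2 + σ ^ 2) * (p : ℝ) / (n : ℝ)

/-- The dimension `p = p(n) ≥ 1` satisfies `p log n / n → 0`. -/
def DenseRegime (p : ℕ → ℕ) : Prop :=
  (∀ n, 1 ≤ p n) ∧ Tendsto (fun n : ℕ => (p n : ℝ) * Real.log n / n) atTop (𝓝 0)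

end AdvLinReg

end

/-!
The two-stage estimator is a plug-in: it is the population target with the covariance matrix `A` and
the signal `θ₀` replaced by the sample covariance matrix `S` and the least squares estimate. All four
parts rest on this, on a stability estimate for the target, and on moments of one vector, the score.

**The target.** For Gaussian covariates the adversarial risk of `θ` equals
`‖θ - θ₀‖_A² + 2 δ c₀ ‖θ - θ₀‖_A ‖θ‖ + δ² ‖θ‖²`,
which is strongly convex because `c₀ < 1` (`advObj_ge`). Subgradients of the
two norms at `θ₀`, at `0` and at interior points of the regularization path show that the minimizer
is the point of the path at the level `λ*` (`pathEst_min`, `thetaStar_eq`), the thresholds being the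
attack levels at which the two kinks cease to be critical.

**Upper bound.** Strong convexity turns a small subgradient of the perturbed objective into a small
distance to its minimizer. This gives `norm_pathEst_sub_pathEst_le`: the target moves by at most a
constant times `‖s - t‖ + ‖(S - A) b‖`, where `b` is a vector determined by the unperturbed problem.
As `S - A` acts on a fixed vector only, its contribution is of order `p / n` in mean square by a
direct computation of variances. The least squares error has mean square `σ²` times the trace of an
inverse Wishart matrix, which is bounded by Gaussian integration by parts
(`integral_ridgeInv_diag_le`). The event that `S` is ill conditioned has probability at most `p / n`
by a union bound over a grid (`rowLaw_not_covClass_le`); this is where `p log n / n → 0` enters.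

**Lower bounds for the estimator.** Below the lower threshold both the target and, with high
probability, the estimator are unpenalized, and the error is the least squares error. Between the
thresholds the first-order conditions at `A` and at `S` differ by `(S - A) u`, with `u` the difference
between `θ₀` and the target, plus a noise average, plus a multiple of the target that comes from the
unknown difference of the levels. Projecting off the target removes the last term
(`norm_score_le_of_equation`) and leaves a vector with mean square of order `v² p / n`, when `p ≥ 2`
and the signal is at least of the order of the noise. In dimension one nothing is left after
projection; there the estimator is an explicit function of the
sample variance times the least squares estimate, and averaging over the reflection of the covariates
removes the noise (`sq_score_le_one_dim`). Fourth moments control the exceptional cases.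

**Minimax rate.** The noise may vanish, so the lower bound comes from the unknown covariance matrix
alone. For `p ≥ 2` the signal is carried by the coordinate zero, whose covariate is correlated by
`± n^(-1/2)` with each of the others; between the thresholds the target has the sign of the
correlation in each coordinate (`thetaStar_corrCov`), and Assouad's lemma applies (`le_worstMse`). For
`p = 1` two variances at distance `n^(-1/2)` suffice (`le_worstMse_one_dim`). Both use the two-point
inequality `TiltsTo.two_point`, in which the designs are compared through a change of variables of
standard Gaussian vectors, conditionally on the noise.
-/

namespace AdvLinReg

variable {p : ℕ}

/-! ### Matrix-vector products, weighted norms and resolvents -/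

lemma mulV_add (A : Matrix (Fin p) (Fin p) ℝ) (x y : Vec p) :
    mulV A (x + y) = mulV A x + mulV A y := by
  ext i; simp [mulV, Matrix.mulVec_add]

lemma mulV_sub (A : Matrix (Fin p) (Fin p) ℝ) (x y : Vec p) :
    mulV A (x - y) = mulV A x - mulV A y := by
  ext i; simp [mulV, Matrix.mulVec_sub]

lemma mulV_neg (A : Matrix (Fin p) (Fin p) ℝ) (x : Vec p) : mulV A (-x) = -mulV A x := by
  ext i; simp [mulV, Matrix.mulVec_neg]

lemma mulV_smul (A : Matrix (Fin p) (Fin p) ℝ) (c : ℝ) (x : Vec p) :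
    mulV A (c • x) = c • mulV A x := by
  ext i; simp [mulV, Matrix.mulVec_smul]

@[simp] lemma mulV_zero (A : Matrix (Fin p) (Fin p) ℝ) : mulV A (0 : Vec p) = 0 := by
  ext i; simp [mulV]

lemma add_mulV (A B : Matrix (Fin p) (Fin p) ℝ) (x : Vec p) :
    mulV (A + B) x = mulV A x + mulV B x := by
  ext i; simp [mulV, Matrix.add_mulVec]

lemma sub_mulV (A B : Matrix (Fin p) (Fin p) ℝ) (x : Vec p) :
    mulV (A - B) x = mulV A x - mulV B x := by
  ext i; simp [mulV, Matrix.sub_mulVec]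

lemma smul_mulV (c : ℝ) (A : Matrix (Fin p) (Fin p) ℝ) (x : Vec p) :
    mulV (c • A) x = c • mulV A x := by
  ext i; simp [mulV, Matrix.smul_mulVec]

@[simp] lemma one_mulV (x : Vec p) : mulV (1 : Matrix (Fin p) (Fin p) ℝ) x = x := by
  ext i; simp [mulV]

@[simp] lemma zero_mulV (x : Vec p) : mulV (0 : Matrix (Fin p) (Fin p) ℝ) x = 0 := by
  ext i; simp [mulV]

lemma mulV_mulV (A B : Matrix (Fin p) (Fin p) ℝ) (x : Vec p) :
    mulV A (mulV B x) = mulV (A * B) x := by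
  ext i; simp [mulV, Matrix.mulVec_mulVec]

lemma inner_eq_dotProduct (x y : Vec p) :
    inner ℝ x y = WithLp.ofLp x ⬝ᵥ WithLp.ofLp y := by
  simp [PiLp.inner_apply, dotProduct, mul_comm]

lemma inner_mulV_left (A : Matrix (Fin p) (Fin p) ℝ) (x y : Vec p) :
    inner ℝ (mulV A x) y = inner ℝ x (mulV Aᵀ y) := by
  simp only [inner_eq_dotProduct, mulV]
  rw [Matrix.dotProduct_mulVec, Matrix.vecMul_transpose]

lemma continuous_mulV (A : Matrix (Fin p) (Fin p) ℝ) : Continuous (mulV A) := by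
  unfold mulV
  fun_prop

/-- The quadratic form of a positive semidefinite matrix is nonnegative. -/
lemma PosSemidef.inner_mulV_nonneg {A : Matrix (Fin p) (Fin p) ℝ} (hA : A.PosSemidef) (x : Vec p) :
    0 ≤ inner ℝ x (mulV A x) := by
  have := hA.dotProduct_mulVec_nonneg (WithLp.ofLp x)
  simpa [inner_eq_dotProduct, mulV] using this

lemma posSemidef_of_inner_mulV {A : Matrix (Fin p) (Fin p) ℝ} (hA : Aᵀ = A)
    (h : ∀ x : Vec p, 0 ≤ inner ℝ x (mulV A x)) : A.PosSemidef := by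
  refine Matrix.PosSemidef.of_dotProduct_mulVec_nonneg ?_ fun x => ?_
  · simpa [Matrix.IsHermitian, Matrix.conjTranspose_eq_transpose_of_trivial] using hA
  · simpa [inner_eq_dotProduct, mulV] using h (WithLp.toLp 2 x)

lemma PosDef.inner_mulV_pos {A : Matrix (Fin p) (Fin p) ℝ} (hA : A.PosDef) {x : Vec p}
    (hx : x ≠ 0) : 0 < inner ℝ x (mulV A x) := by
  have := hA.dotProduct_mulVec_pos (x := WithLp.ofLp x) (by
    intro h0; apply hx; ext i; simpa using congrFun h0 i)
  simpa [inner_eq_dotProduct, mulV] using this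

lemma PosSemidef.transpose_eq {A : Matrix (Fin p) (Fin p) ℝ} (hA : A.PosSemidef) : Aᵀ = A := by
  have := hA.isHermitian
  rwa [Matrix.IsHermitian, Matrix.conjTranspose_eq_transpose_of_trivial] at this

lemma inner_mulV_comm {A : Matrix (Fin p) (Fin p) ℝ} (hA : Aᵀ = A) (x y : Vec p) :
    inner ℝ (mulV A x) y = inner ℝ x (mulV A y) := by
  rw [inner_mulV_left, hA]

section wnorm

variable {A : Matrix (Fin p) (Fin p) ℝ}

lemma wnorm_nonneg (A : Matrix (Fin p) (Fin p) ℝ) (x : Vec p) : 0 ≤ wnorm A x := Real.sqrt_nonneg _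

lemma wnorm_sq (hA : A.PosSemidef) (x : Vec p) : wnorm A x ^ 2 = inner ℝ x (mulV A x) :=
  Real.sq_sqrt (PosSemidef.inner_mulV_nonneg hA x)

/-- The weighted norm of a positive semidefinite matrix is the Euclidean norm of a linear image. -/
lemma exists_wnorm_eq_norm (hA : A.PosSemidef) :
    ∃ B : Matrix (Fin p) (Fin p) ℝ, A = Bᵀ * B ∧ ∀ x, wnorm A x = ‖mulV B x‖ := by
  open scoped MatrixOrder in
  obtain ⟨B, hB⟩ := CStarAlgebra.nonneg_iff_eq_star_mul_self.mp hA.nonneg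
  have hB' : A = Bᵀ * B := by
    rw [hB, Matrix.star_eq_conjTranspose, Matrix.conjTranspose_eq_transpose_of_trivial]
  refine ⟨B, hB', fun x => ?_⟩
  rw [wnorm, hB', ← mulV_mulV, ← inner_mulV_left, real_inner_self_eq_norm_sq,
    Real.sqrt_sq (norm_nonneg _)]

lemma wnorm_add_le (hA : A.PosSemidef) (x y : Vec p) : wnorm A (x + y) ≤ wnorm A x + wnorm A y := by
  obtain ⟨B, -, hB⟩ := exists_wnorm_eq_norm hA
  simp only [hB, mulV_add]
  exact norm_add_le _ _

lemma wnorm_sub_le (hA : A.PosSemidef) (x y : Vec p) : wnorm A x - wnorm A y ≤ wnorm A (x - y) := by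
  obtain ⟨B, -, hB⟩ := exists_wnorm_eq_norm hA
  simp only [hB, mulV_sub]
  exact norm_sub_norm_le _ _

lemma wnorm_smul (A : Matrix (Fin p) (Fin p) ℝ) (c : ℝ) (x : Vec p) :
    wnorm A (c • x) = |c| * wnorm A x := by
  have h : inner ℝ (c • x) (mulV A (c • x)) = c ^ 2 * inner ℝ x (mulV A x) := by
    rw [mulV_smul, inner_smul_left, inner_smul_right]
    simp only [RCLike.conj_to_real]
    ring
  rw [wnorm, h, Real.sqrt_mul (sq_nonneg c), Real.sqrt_sq_eq_abs, wnorm]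

lemma wnorm_neg (A : Matrix (Fin p) (Fin p) ℝ) (x : Vec p) : wnorm A (-x) = wnorm A x := by
  simp [wnorm, mulV_neg]

lemma wnorm_sub_rev (A : Matrix (Fin p) (Fin p) ℝ) (x y : Vec p) :
    wnorm A (x - y) = wnorm A (y - x) := by
  rw [← wnorm_neg, neg_sub]

@[simp] lemma wnorm_zero (A : Matrix (Fin p) (Fin p) ℝ) : wnorm A (0 : Vec p) = 0 := by
  simp [wnorm]

lemma inner_mulV_le (hA : A.PosSemidef) (x y : Vec p) :
    inner ℝ x (mulV A y) ≤ wnorm A x * wnorm A y := by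
  obtain ⟨B, hAB, hB⟩ := exists_wnorm_eq_norm hA
  rw [hB, hB, hAB, ← mulV_mulV, ← inner_mulV_left]
  exact real_inner_le_norm _ _

lemma wnorm_pos (hA : A.PosDef) {x : Vec p} (hx : x ≠ 0) : 0 < wnorm A x :=
  Real.sqrt_pos.mpr (PosDef.inner_mulV_pos hA hx)

end wnorm

/-! ### Matrices with spectrum in `[L⁻¹, L]` -/

lemma CovClass.posDef {A : Matrix (Fin p) (Fin p) ℝ} {a b : ℝ} (ha : 0 < a) (hA : CovClass a b A) :
    A.PosDef := by
  have : A = (A - a • (1 : Matrix (Fin p) (Fin p) ℝ)) + a • (1 : Matrix (Fin p) (Fin p) ℝ) := by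
    simp
  rw [this]
  exact Matrix.PosDef.posSemidef_add hA.1 (Matrix.PosDef.one.smul ha)

lemma CovClass.le_inner {A : Matrix (Fin p) (Fin p) ℝ} {a b : ℝ} (hA : CovClass a b A)
    (x : Vec p) : a * ‖x‖ ^ 2 ≤ inner ℝ x (mulV A x) := by
  have := PosSemidef.inner_mulV_nonneg hA.1 x
  rw [sub_mulV, smul_mulV, one_mulV, inner_sub_right, inner_smul_right,
    real_inner_self_eq_norm_sq] at this
  linarith

lemma CovClass.inner_le {A : Matrix (Fin p) (Fin p) ℝ} {a b : ℝ} (hA : CovClass a b A)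
    (x : Vec p) : inner ℝ x (mulV A x) ≤ b * ‖x‖ ^ 2 := by
  have := PosSemidef.inner_mulV_nonneg hA.2 x
  rw [sub_mulV, smul_mulV, one_mulV, inner_sub_right, inner_smul_right,
    real_inner_self_eq_norm_sq] at this
  linarith

lemma covClass_of_inner {A : Matrix (Fin p) (Fin p) ℝ} {a b : ℝ} (hA : Aᵀ = A)
    (h1 : ∀ x : Vec p, a * ‖x‖ ^ 2 ≤ inner ℝ x (mulV A x))
    (h2 : ∀ x : Vec p, inner ℝ x (mulV A x) ≤ b * ‖x‖ ^ 2) : CovClass a b A := by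
  constructor
  · refine posSemidef_of_inner_mulV (by simp [hA]) fun x => ?_
    rw [sub_mulV, smul_mulV, one_mulV, inner_sub_right, inner_smul_right,
      real_inner_self_eq_norm_sq]
    linarith [h1 x]
  · refine posSemidef_of_inner_mulV (by simp [hA]) fun x => ?_
    rw [sub_mulV, smul_mulV, one_mulV, inner_sub_right, inner_smul_right,
      real_inner_self_eq_norm_sq]
    linarith [h2 x]

lemma CovClass.mono {A : Matrix (Fin p) (Fin p) ℝ} {a b a' b' : ℝ} (hA : CovClass a b A)
    (ha : a' ≤ a) (hb : b ≤ b') (hsymm : Aᵀ = A) : CovClass a' b' A := by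
  refine covClass_of_inner hsymm (fun x => le_trans ?_ (hA.le_inner x))
    (fun x => (hA.inner_le x).trans ?_) <;> gcongr

lemma CovClass.transpose_eq {A : Matrix (Fin p) (Fin p) ℝ} {a b : ℝ} (hA : CovClass a b A) :
    Aᵀ = A := by
  have := PosSemidef.transpose_eq hA.1
  simpa using this

section bounds

variable {A : Matrix (Fin p) (Fin p) ℝ} {L : ℝ}

lemma CovClass.wnorm_le (hL : 1 ≤ L) (hA : CovClass L⁻¹ L A) (x : Vec p) :
    wnorm A x ≤ L * ‖x‖ := by
  refine Real.sqrt_le_iff.mpr ⟨by positivity, (hA.inner_le x).trans ?_⟩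
  nlinarith [mul_nonneg (mul_nonneg (sub_nonneg.2 hL) (zero_le_one.trans hL)) (sq_nonneg ‖x‖)]

lemma CovClass.norm_le (hL : 1 ≤ L) (hA : CovClass L⁻¹ L A) (x : Vec p) :
    ‖x‖ ≤ L * wnorm A x := by
  have hL0 : 0 < L := by linarith
  have h := hA.le_inner x
  have hsq := wnorm_sq (hA.posDef (by positivity)).posSemidef x
  rw [← hsq, inv_mul_le_iff₀ hL0] at h
  refine abs_le_of_sq_le_sq' ?_ (mul_nonneg hL0.le (wnorm_nonneg _ _)) |>.2
  nlinarith [mul_nonneg (mul_nonneg (sub_nonneg.2 hL) hL0.le) (sq_nonneg (wnorm A x))]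

lemma CovClass.norm_mulV_le_wnorm (hL : 1 ≤ L) (hA : CovClass L⁻¹ L A) (x : Vec p) :
    ‖mulV A x‖ ≤ L * wnorm A x := by
  have hL0 : 0 < L := by linarith
  have hps := (hA.posDef (by positivity)).posSemidef
  have h1 := inner_mulV_le hps (mulV A x) x
  rw [real_inner_self_eq_norm_sq] at h1
  have h2 := hA.wnorm_le hL (mulV A x)
  rcases eq_or_ne (‖mulV A x‖) 0 with h0 | h0
  · rw [h0]; exact mul_nonneg hL0.le (wnorm_nonneg _ _)
  · have hpos : 0 < ‖mulV A x‖ := lt_of_le_of_ne (norm_nonneg _) h0.symm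
    have h3 : wnorm A (mulV A x) * wnorm A x ≤ L * ‖mulV A x‖ * wnorm A x :=
      mul_le_mul_of_nonneg_right h2 (wnorm_nonneg _ _)
    nlinarith

lemma CovClass.wnorm_le_norm_mulV (hL : 1 ≤ L) (hA : CovClass L⁻¹ L A) (x : Vec p) :
    wnorm A x ≤ L * ‖mulV A x‖ := by
  have hL0 : 0 < L := by linarith
  have hps := (hA.posDef (by positivity)).posSemidef
  have h1 := real_inner_le_norm x (mulV A x)
  rw [← wnorm_sq hps] at h1
  have h2 := hA.norm_le hL x
  rcases eq_or_ne (wnorm A x) 0 with h0 | h0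
  · rw [h0]; positivity
  · have hpos : 0 < wnorm A x := lt_of_le_of_ne (wnorm_nonneg _ _) h0.symm
    have h3 : ‖x‖ * ‖mulV A x‖ ≤ L * wnorm A x * ‖mulV A x‖ :=
      mul_le_mul_of_nonneg_right h2 (norm_nonneg _)
    nlinarith

lemma CovClass.norm_mulV_le (hL : 1 ≤ L) (hA : CovClass L⁻¹ L A) (x : Vec p) :
    ‖mulV A x‖ ≤ L * ‖x‖ := by
  have hL0 : 0 < L := by linarith
  have hps := (hA.posDef (by positivity)).posSemidef
  have h1 := inner_mulV_le hps (mulV A x) x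
  rw [real_inner_self_eq_norm_sq] at h1
  have e1 := wnorm_sq hps (mulV A x)
  have e2 := wnorm_sq hps x
  have b1 := hA.inner_le (mulV A x)
  have b2 := hA.inner_le x
  have n1 := wnorm_nonneg A x
  have n2 := wnorm_nonneg A (mulV A x)
  -- square the Cauchy-Schwarz bound and insert the upper spectral bound twice
  have h2 : (‖mulV A x‖ ^ 2) ^ 2 ≤ (L * ‖mulV A x‖ ^ 2) * (L * ‖x‖ ^ 2) := by
    calc (‖mulV A x‖ ^ 2) ^ 2 ≤ (wnorm A (mulV A x) * wnorm A x) ^ 2 := by gcongr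
      _ = wnorm A (mulV A x) ^ 2 * wnorm A x ^ 2 := by ring
      _ ≤ _ := by rw [e1, e2]; gcongr; exact PosSemidef.inner_mulV_nonneg hps _
  rcases eq_or_ne (‖mulV A x‖) 0 with h0 | h0
  · rw [h0]; positivity
  · have hpos : 0 < ‖mulV A x‖ := lt_of_le_of_ne (norm_nonneg _) h0.symm
    refine abs_le_of_sq_le_sq' ?_ (by positivity) |>.2
    have : 0 < ‖mulV A x‖ ^ 2 := by positivity
    nlinarith

end bounds

/-- The resolvent `(A + l I)⁻¹ x`. -/
noncomputable def res (A : Matrix (Fin p) (Fin p) ℝ) (l : ℝ) (x : Vec p) : Vec p :=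
  mulV (A + l • (1 : Matrix (Fin p) (Fin p) ℝ))⁻¹ x

section res

variable {A : Matrix (Fin p) (Fin p) ℝ} {l : ℝ}

lemma posDef_add_smul_one (hA : A.PosDef) (hl : 0 ≤ l) :
    (A + l • (1 : Matrix (Fin p) (Fin p) ℝ)).PosDef :=
  Matrix.PosDef.add_posSemidef hA (Matrix.PosSemidef.one.smul hl)

lemma isUnit_det_add (hA : A.PosDef) (hl : 0 ≤ l) :
    IsUnit (A + l • (1 : Matrix (Fin p) (Fin p) ℝ)).det :=
  (Matrix.isUnit_iff_isUnit_det _).mp (posDef_add_smul_one hA hl).isUnit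

lemma mulV_res_add (hA : A.PosDef) (hl : 0 ≤ l) (x : Vec p) :
    mulV A (res A l x) + l • res A l x = x := by
  have : mulV (A + l • (1 : Matrix (Fin p) (Fin p) ℝ)) (res A l x) = x := by
    rw [res, mulV_mulV, Matrix.mul_nonsing_inv _ (isUnit_det_add hA hl), one_mulV]
  rwa [add_mulV, smul_mulV, one_mulV] at this

lemma res_unique (hA : A.PosDef) (hl : 0 ≤ l) {x y : Vec p} (h : mulV A y + l • y = x) :
    y = res A l x := by
  rw [← h, res, ← one_mulV (p := p) y, ← smul_mulV, mulV_mulV, mul_one, ← add_mulV, mulV_mulV,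
    Matrix.nonsing_inv_mul _ (isUnit_det_add hA hl)]

lemma res_ne_zero (hA : A.PosDef) (hl : 0 ≤ l) {x : Vec p} (hx : x ≠ 0) : res A l x ≠ 0 := by
  intro h
  have := mulV_res_add hA hl x
  rw [h] at this
  simp at this
  exact hx this.symm

lemma thetaPath_ofReal (hA : A.PosDef) (hl : 0 ≤ l) (t : Vec p) :
    thetaPath A t (ENNReal.ofReal l) = t - l • res A l t := by
  rw [thetaPath, if_neg ENNReal.ofReal_ne_top, ENNReal.toReal_ofReal hl]
  have h1 : (A + l • (1 : Matrix (Fin p) (Fin p) ℝ))⁻¹ * A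
      = 1 - l • (A + l • (1 : Matrix (Fin p) (Fin p) ℝ))⁻¹ := by
    have h := Matrix.nonsing_inv_mul _ (isUnit_det_add hA hl)
    rw [mul_add, Matrix.mul_smul, mul_one] at h
    exact eq_sub_of_add_eq h
  rw [h1, sub_mulV, smul_mulV, one_mulV, res]

lemma thetaPath_eq_mulV_res (hA : A.PosDef) (hl : 0 ≤ l) (t : Vec p) :
    thetaPath A t (ENNReal.ofReal l) = mulV A (res A l t) := by
  rw [thetaPath_ofReal hA hl]
  nth_rw 1 [← mulV_res_add hA hl t]
  simp

lemma norm_thetaPath_le (hA : A.PosDef) (hl : 0 ≤ l) (t : Vec p) :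
    ‖thetaPath A t (ENNReal.ofReal l)‖ ≤ ‖t‖ := by
  rw [thetaPath_eq_mulV_res hA hl]
  have h := mulV_res_add hA hl t
  set a := res A l t
  have h0 : 0 ≤ inner ℝ (mulV A a) a := by
    rw [real_inner_comm]; exact PosSemidef.inner_mulV_nonneg hA.posSemidef a
  refine abs_le_of_sq_le_sq' ?_ (norm_nonneg _) |>.2
  rw [← h, norm_add_sq_real, inner_smul_right]
  nlinarith [sq_nonneg ‖l • a‖, mul_nonneg hl h0]

variable {L : ℝ}

lemma norm_res_le (hL : 1 ≤ L) (hA : CovClass L⁻¹ L A) (hl : 0 ≤ l) (x : Vec p) :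
    (1 + l) * ‖res A l x‖ ≤ L * ‖x‖ := by
  have hL0 : 0 < L := by linarith
  have hpd := hA.posDef (by positivity)
  have h := mulV_res_add hpd hl x
  set a := res A l x
  have h1 := real_inner_le_norm a x
  rw [← h, inner_add_right, inner_smul_right, real_inner_self_eq_norm_sq, h] at h1
  have h2 := hA.le_inner a
  have h3 : (1 + l) / L * ‖a‖ ^ 2 ≤ ‖a‖ * ‖x‖ := by
    have : (1 + l) / L ≤ L⁻¹ + l := by
      rw [div_le_iff₀ hL0, add_mul, inv_mul_cancel₀ hL0.ne']
      nlinarith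
    nlinarith [mul_le_mul_of_nonneg_right this (sq_nonneg ‖a‖)]
  rcases eq_or_ne (‖a‖) 0 with h0 | h0
  · rw [h0]; simp; positivity
  · have hpos : 0 < ‖a‖ := lt_of_le_of_ne (norm_nonneg _) h0.symm
    have h4 : (1 + l) / L * ‖a‖ ≤ ‖x‖ := by nlinarith
    rw [div_mul_eq_mul_div, div_le_iff₀ hL0] at h4
    linarith

lemma le_norm_res (hL : 1 ≤ L) (hA : CovClass L⁻¹ L A) (hl : 0 ≤ l) (x : Vec p) :
    ‖x‖ ≤ L * (1 + l) * ‖res A l x‖ := by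
  have hL0 : 0 < L := by linarith
  have hpd := hA.posDef (by positivity)
  have h := mulV_res_add hpd hl x
  set a := res A l x
  have h1 := norm_add_le (mulV A a) (l • a)
  rw [h, norm_smul, Real.norm_of_nonneg hl] at h1
  have h2 := hA.norm_mulV_le hL a
  nlinarith [mul_nonneg (mul_nonneg (sub_nonneg.2 hL) hl) (norm_nonneg a)]

end res

end AdvLinReg

namespace AdvLinReg

variable {p : ℕ}

/-! ### The adversarial objective and its minimizer -/

lemma c0_pos : 0 < c0 := Real.sqrt_pos.mpr (by positivity)

lemma c0_sq : c0 ^ 2 = 2 / Real.pi := Real.sq_sqrt (by positivity)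

lemma c0_sq_lt_one : c0 ^ 2 < 1 := by
  rw [c0_sq, div_lt_one Real.pi_pos]
  linarith [Real.pi_gt_three]

lemma c0_lt_one : c0 < 1 := by
  nlinarith [c0_sq_lt_one, c0_pos]

/-- The closed form of the adversarial risk of Gaussian covariates. -/
noncomputable def advObj (A : Matrix (Fin p) (Fin p) ℝ) (t : Vec p) (δ : ℝ) (θ : Vec p) : ℝ :=
  wnorm A (θ - t) ^ 2 + 2 * δ * c0 * wnorm A (θ - t) * ‖θ‖ + δ ^ 2 * ‖θ‖ ^ 2

/-- Strong convexity of the objective, in the form of a quadratic minorant. The vectors `a` and `b`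
are subgradients of `θ ↦ ‖θ - t‖_A` and of `θ ↦ ‖θ‖` at the base point `θ'`. The objective is
`(1 - c₀²) ‖θ - t‖²_A + (c₀ ‖θ - t‖_A + δ ‖θ‖)²`, the square of a nonnegative convex function plus a
strongly convex quadratic form, because `c₀ < 1`. -/
lemma advObj_ge {A : Matrix (Fin p) (Fin p) ℝ} {L δ : ℝ} (hL : 1 ≤ L) (hA : CovClass L⁻¹ L A)
    (hδ : 0 ≤ δ) {t θ' a b : Vec p} (ha : ∀ w, inner ℝ a w ≤ wnorm A w)
    (ha' : wnorm A (θ' - t) • a = mulV A (θ' - t)) (hb : ‖b‖ ≤ 1) (hb' : ‖θ'‖ • b = θ')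
    (θ : Vec p) :
    advObj A t δ θ' + 2 * inner ℝ (mulV A (θ' - t) + (δ * c0) • (‖θ'‖ • a + wnorm A (θ' - t) • b)
      + δ ^ 2 • θ') (θ - θ') + (1 - c0 ^ 2) * L⁻¹ * ‖θ - θ'‖ ^ 2 ≤ advObj A t δ θ := by
  have hpd := hA.posDef (by positivity)
  have hps := hpd.posSemidef
  set d := θ - θ' with hd
  set u' := wnorm A (θ' - t) with hu'
  set u := wnorm A (θ - t) with hu
  have hu0 : 0 ≤ u := wnorm_nonneg _ _
  have hu'0 : 0 ≤ u' := wnorm_nonneg _ _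
  have hG : inner ℝ (mulV A (θ' - t)) d = u' * inner ℝ a d := by
    rw [← ha', inner_smul_left]; simp
  have hB : inner ℝ θ' d = ‖θ'‖ * inner ℝ b d := by
    conv_lhs => rw [← hb', inner_smul_left]
    simp
  have hsum : θ - t = (θ' - t) + d := by rw [hd]; abel
  -- subgradient inequalities for the two norms
  have h1 : u' + inner ℝ a d ≤ u := by
    have h2 := ha (θ - t)
    have h3 : inner ℝ a (θ' - t) = u' := by
      rcases eq_or_ne u' 0 with h0 | h0
      · have e1 := ha (θ' - t)
        have e2 := ha (-(θ' - t))
        rw [wnorm_neg, inner_neg_right] at e2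
        rw [← hu', h0] at e1 e2
        rw [h0]; linarith
      · have h4 : inner ℝ (u' • a) (θ' - t) = u' ^ 2 := by
          rw [ha', inner_mulV_comm hA.transpose_eq, wnorm_sq hps]
        rw [inner_smul_left] at h4
        simp only [RCLike.conj_to_real] at h4
        exact mul_left_cancel₀ h0 (by rw [h4]; ring)
    rw [hsum, inner_add_right, h3, ← hsum] at h2
    exact h2
  have h2 : ‖θ'‖ + inner ℝ b d ≤ ‖θ‖ := by
    have h3 : inner ℝ b θ' = ‖θ'‖ := by
      rcases eq_or_ne θ' 0 with h0 | h0
      · simp [h0]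
      · have h4 : inner ℝ (‖θ'‖ • b) θ' = ‖θ'‖ ^ 2 := by
          rw [hb', real_inner_self_eq_norm_sq]
        rw [inner_smul_left] at h4
        simp only [RCLike.conj_to_real] at h4
        exact mul_left_cancel₀ (norm_ne_zero_iff.mpr h0) (by rw [h4]; ring)
    have h5 : inner ℝ b θ ≤ ‖θ‖ :=
      (real_inner_le_norm _ _).trans (by nlinarith [norm_nonneg θ])
    have h6 : θ = θ' + d := by rw [hd]; abel
    rw [h6, inner_add_right, h3, ← h6] at h5
    exact h5
  have h3 : u ^ 2 = u' ^ 2 + 2 * (u' * inner ℝ a d) + inner ℝ d (mulV A d) := by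
    rw [← hG, hu, hu', wnorm_sq hps, wnorm_sq hps, hsum, mulV_add, inner_add_left, inner_add_right,
      inner_add_right, ← inner_mulV_comm hA.transpose_eq (θ' - t) d,
      real_inner_comm d (mulV A (θ' - t))]
    ring
  have h4 := hA.le_inner d
  have hc1 := c0_sq_lt_one
  have hc0 := c0_pos
  have hX : 0 ≤ c0 * u' + δ * ‖θ'‖ := by positivity
  have hinner : inner ℝ (mulV A (θ' - t) + (δ * c0) • (‖θ'‖ • a + u' • b) + δ ^ 2 • θ') d
      = u' * inner ℝ a d + δ * c0 * (‖θ'‖ * inner ℝ a d + u' * inner ℝ b d)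
        + δ ^ 2 * (‖θ'‖ * inner ℝ b d) := by
    rw [inner_add_left, inner_add_left, inner_smul_left, inner_smul_left, inner_add_left,
      inner_smul_left, inner_smul_left, hG, hB]
    simp
  rw [hinner]
  unfold advObj
  rw [← hu, ← hu']
  have h5 : c0 * inner ℝ a d + δ * inner ℝ b d ≤ (c0 * u + δ * ‖θ‖) - (c0 * u' + δ * ‖θ'‖) := by
    nlinarith
  have h6 := mul_le_mul_of_nonneg_left h5 hX
  -- convexity of the square of `c₀ ‖θ - t‖_A + δ ‖θ‖`
  have h7 := sq_nonneg ((c0 * u + δ * ‖θ‖) - (c0 * u' + δ * ‖θ'‖))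
  have h8 : (1 - c0 ^ 2) * (L⁻¹ * ‖d‖ ^ 2) ≤ (1 - c0 ^ 2) * inner ℝ d (mulV A d) :=
    mul_le_mul_of_nonneg_left h4 (by linarith)
  have h9 : (1 - c0 ^ 2) * u ^ 2 = (1 - c0 ^ 2) * (u' ^ 2 + 2 * (u' * inner ℝ a d)
    + inner ℝ d (mulV A d)) := by rw [h3]
  nlinarith

/-- `θ'` is a critical point of the objective up to an error `G` in a subgradient, expressed through
the quadratic growth that strong convexity then gives. For `G = 0` it is the minimizer. -/
def NearCritical (A : Matrix (Fin p) (Fin p) ℝ) (t : Vec p) (δ L : ℝ) (θ' : Vec p) (G : ℝ) : Prop :=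
  ∀ θ, advObj A t δ θ' + (1 - c0 ^ 2) * L⁻¹ * ‖θ - θ'‖ ^ 2 ≤ advObj A t δ θ + 2 * G * ‖θ - θ'‖

/-- Near criticality is certified by one subgradient `a` of the weighted norm and one subgradient `b` of
the Euclidean norm. -/
lemma NearCritical.of_subgradient {A : Matrix (Fin p) (Fin p) ℝ} {L δ : ℝ} (hL : 1 ≤ L)
    (hA : CovClass L⁻¹ L A)
    (hδ : 0 ≤ δ) {t θ' a b : Vec p} (ha : ∀ w, inner ℝ a w ≤ wnorm A w)
    (ha' : wnorm A (θ' - t) • a = mulV A (θ' - t)) (hb : ‖b‖ ≤ 1) (hb' : ‖θ'‖ • b = θ') {G : ℝ}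
    (hG : ‖mulV A (θ' - t) + (δ * c0) • (‖θ'‖ • a + wnorm A (θ' - t) • b) + δ ^ 2 • θ'‖ ≤ G) :
    NearCritical A t δ L θ' G := by
  intro θ
  have h1 := advObj_ge hL hA hδ ha ha' hb hb' θ
  have h2 := abs_real_inner_le_norm (mulV A (θ' - t) +
    (δ * c0) • (‖θ'‖ • a + wnorm A (θ' - t) • b) + δ ^ 2 • θ') (θ - θ')
  have h3 := mul_le_mul_of_nonneg_right hG (norm_nonneg (θ - θ'))
  have h4 := (abs_le.mp (h2.trans h3)).1
  linarith

lemma NearCritical.norm_sub_le {A : Matrix (Fin p) (Fin p) ℝ} {t θ' θ : Vec p} {δ L G : ℝ}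
    (hG : 0 ≤ G) (h : NearCritical A t δ L θ' G) (hmin : advObj A t δ θ ≤ advObj A t δ θ') :
    (1 - c0 ^ 2) * L⁻¹ * ‖θ - θ'‖ ≤ 2 * G := by
  have h1 := h θ
  rcases eq_or_ne (‖θ - θ'‖) 0 with h0 | h0
  · rw [h0]; linarith
  · have hpos : 0 < ‖θ - θ'‖ := lt_of_le_of_ne (norm_nonneg _) h0.symm
    nlinarith

lemma NearCritical.unique {A : Matrix (Fin p) (Fin p) ℝ} {t θ' θ : Vec p} {δ L : ℝ} (hL : 1 ≤ L)
    (h : NearCritical A t δ L θ' 0) (hmin : advObj A t δ θ ≤ advObj A t δ θ') : θ = θ' := by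
  have h1 := h.norm_sub_le le_rfl hmin
  have h2 : 0 < (1 - c0 ^ 2) * L⁻¹ := mul_pos (by linarith [c0_sq_lt_one]) (by positivity)
  have h3 : ‖θ - θ'‖ = 0 := le_antisymm (by nlinarith [norm_nonneg (θ - θ')]) (norm_nonneg _)
  exact sub_eq_zero.mp (norm_eq_zero.mp h3)

lemma NearCritical.min {A : Matrix (Fin p) (Fin p) ℝ} {t θ' : Vec p} {δ L : ℝ} (hL : 1 ≤ L)
    (h : NearCritical A t δ L θ' 0) (θ : Vec p) : advObj A t δ θ' ≤ advObj A t δ θ := by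
  have h2 : 0 < (1 - c0 ^ 2) * L⁻¹ := mul_pos (by linarith [c0_sq_lt_one]) (by positivity)
  have := h θ
  nlinarith [sq_nonneg ‖θ - θ'‖]

/-- The ratio `‖A b‖ / ‖b‖_A`, in terms of which thresholds and levels are expressed. -/
noncomputable def ratio (A : Matrix (Fin p) (Fin p) ℝ) (b : Vec p) : ℝ := ‖mulV A b‖ / wnorm A b

section ratio

variable {A S : Matrix (Fin p) (Fin p) ℝ} {L : ℝ}

lemma ratio_smul (A : Matrix (Fin p) (Fin p) ℝ) {c : ℝ} (hc : c ≠ 0) (b : Vec p) :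
    ratio A (c • b) = ratio A b := by
  rw [ratio, ratio, mulV_smul, wnorm_smul, norm_smul, Real.norm_eq_abs,
    mul_div_mul_left _ _ (abs_ne_zero.mpr hc)]

lemma ratio_le (hL : 1 ≤ L) (hA : CovClass L⁻¹ L A) (b : Vec p) : ratio A b ≤ L :=
  div_le_of_le_mul₀ (wnorm_nonneg _ _) (by linarith) (hA.norm_mulV_le_wnorm hL b)

lemma le_ratio (hL : 1 ≤ L) (hA : CovClass L⁻¹ L A) {b : Vec p} (hb : b ≠ 0) : L⁻¹ ≤ ratio A b := by
  have hL0 : 0 < L := by linarith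
  rw [ratio, le_div_iff₀ (wnorm_pos (hA.posDef (by positivity)) hb), inv_mul_le_iff₀ hL0]
  exact hA.wnorm_le_norm_mulV hL b

lemma ratio_pos (hL : 1 ≤ L) (hA : CovClass L⁻¹ L A) {b : Vec p} (hb : b ≠ 0) : 0 < ratio A b :=
  lt_of_lt_of_le (by positivity) (le_ratio hL hA hb)

lemma ratio_mul_wnorm (hA : A.PosDef) {b : Vec p} (hb : b ≠ 0) :
    ratio A b * wnorm A b = ‖mulV A b‖ :=
  div_mul_cancel₀ _ (wnorm_pos hA hb).ne'

/-- The ratio is Lipschitz in both arguments; the matrix enters only through its action on `b`. -/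
lemma norm_mul_abs_ratio_sub_le (hL : 1 ≤ L) (hA : CovClass L⁻¹ L A) (hS : CovClass L⁻¹ L S)
    {b b' : Vec p} (hb : b ≠ 0) (hb' : b' ≠ 0) :
    ‖b'‖ * |ratio S b' - ratio A b| ≤ 2 * L ^ 3 * (‖b' - b‖ + ‖mulV (S - A) b‖) := by
  have hL0 : 0 < L := by linarith
  have hAp := hA.posDef (by positivity)
  have hSp := hS.posDef (by positivity)
  set x := ‖b' - b‖
  set y := ‖mulV (S - A) b‖
  set w := wnorm A b
  set w' := wnorm S b'
  set r := ratio A b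
  have hx : 0 ≤ x := norm_nonneg _
  have hy : 0 ≤ y := norm_nonneg _
  have hr : 0 < r := ratio_pos hL hA hb
  have hw' : 0 < w' := wnorm_pos hSp hb'
  have e1 : ratio S b' * w' = ‖mulV S b'‖ := ratio_mul_wnorm hSp hb'
  have e2 : r * w = ‖mulV A b‖ := ratio_mul_wnorm hAp hb
  have h1 : |‖mulV S b'‖ - ‖mulV A b‖| ≤ L * x + y := by
    refine (abs_norm_sub_norm_le _ _).trans ?_
    have : mulV S b' - mulV A b = mulV S (b' - b) + mulV (S - A) b := by
      rw [mulV_sub, sub_mulV]; abel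
    rw [this]
    exact (norm_add_le _ _).trans (add_le_add (hS.norm_mulV_le hL _) le_rfl)
  have h2 : |w' - wnorm S b| ≤ L * x := by
    have g1 := wnorm_sub_le hSp.posSemidef b' b
    have g2 := wnorm_sub_le hSp.posSemidef b b'
    rw [wnorm_sub_rev] at g2
    have g3 := hS.wnorm_le hL (b' - b)
    rw [abs_le]; constructor <;> linarith
  have h3 : |wnorm S b - w| ≤ L * y := by
    have hv : 0 < wnorm S b := wnorm_pos hSp hb
    have hw : 0 < w := wnorm_pos hAp hb
    have g1 : wnorm S b ^ 2 - w ^ 2 = inner ℝ b (mulV (S - A) b) := by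
      rw [wnorm_sq hSp.posSemidef, wnorm_sq hAp.posSemidef, sub_mulV, inner_sub_right]
    have g2 := abs_real_inner_le_norm b (mulV (S - A) b)
    have g3 := hA.norm_le hL b
    rw [← g1, sq_sub_sq, abs_mul, abs_of_pos (by positivity)] at g2
    have g4 : ‖b‖ * y ≤ L * w * y := mul_le_mul_of_nonneg_right g3 hy
    have g5 : w * |wnorm S b - w| ≤ w * (L * y) := by
      nlinarith [abs_nonneg (wnorm S b - w), mul_nonneg hv.le (abs_nonneg (wnorm S b - w))]
    exact le_of_mul_le_mul_left g5 hw
  have h4 : |w' - w| ≤ L * x + L * y := by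
    calc |w' - w| = |(w' - wnorm S b) + (wnorm S b - w)| := by ring_nf
      _ ≤ _ := (abs_add_le _ _).trans (add_le_add h2 h3)
  have h5 : w' * |ratio S b' - r| ≤ (L * x + y) + L * (L * x + L * y) := by
    rw [← abs_of_pos hw', ← abs_mul]
    have : w' * (ratio S b' - r) = (‖mulV S b'‖ - ‖mulV A b‖) - r * (w' - w) := by
      rw [← e1, ← e2]; ring
    rw [this]
    refine (abs_sub _ _).trans (add_le_add h1 ?_)
    rw [abs_mul, abs_of_pos hr]
    exact mul_le_mul (ratio_le hL hA b) h4 (abs_nonneg _) hL0.le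
  have h6 : ‖b'‖ * |ratio S b' - r| ≤ L * (w' * |ratio S b' - r|) := by
    rw [← mul_assoc]
    exact mul_le_mul_of_nonneg_right (hS.norm_le hL b') (abs_nonneg _)
  refine h6.trans ((mul_le_mul_of_nonneg_left h5 hL0.le).trans ?_)
  have hL2 : L ≤ L ^ 2 := by nlinarith
  have hL3 : L ^ 2 ≤ L ^ 3 := by nlinarith [sq_nonneg L]
  have : L * (L * x + y + L * (L * x + L * y)) = (L ^ 2 + L ^ 3) * x + (L + L ^ 3) * y := by ring
  rw [this]
  nlinarith

end ratio

end AdvLinReg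

namespace AdvLinReg

variable {p : ℕ}

/-! ### The regularization path -/

section path

variable {A S : Matrix (Fin p) (Fin p) ℝ} {L : ℝ}

lemma mulV_res_zero (hA : A.PosDef) (t : Vec p) : mulV A (res A 0 t) = t := by
  simpa using mulV_res_add hA le_rfl t

lemma delta1_eq (hA : A.PosDef) (t : Vec p) : delta1 A t = c0 * ratio A (res A 0 t) := by
  have h1 : wnorm A⁻¹ t = wnorm A (res A 0 t) := by
    rw [wnorm, wnorm, mulV_res_zero hA, real_inner_comm, res]
    simp
  rw [delta1, h1, ratio, mulV_res_zero hA, mul_div_assoc]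

lemma wnorm_sq_matrix (hA : Aᵀ = A) (t : Vec p) : wnorm (A ^ 2) t = ‖mulV A t‖ := by
  rw [wnorm, pow_two, ← mulV_mulV, ← inner_mulV_comm hA, real_inner_self_eq_norm_sq,
    Real.sqrt_sq (norm_nonneg _)]

lemma delta2_eq (hA : Aᵀ = A) (t : Vec p) : delta2 A t = ratio A t / c0 := by
  rw [delta2, wnorm_sq_matrix hA, ratio, mul_comm, div_mul_eq_div_div]

lemma pathEq_iff (hA : A.PosDef) {t : Vec p} (ht : t ≠ 0) {δ l : ℝ} (hl : 0 < l) :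
    PathEq A t δ l ↔ l + δ * c0 * ratio A (res A l t)
      = δ * c0 * (l / ratio A (res A l t)) + δ ^ 2 := by
  have hr := res_ne_zero hA hl.le ht
  have hw := wnorm_pos hA hr
  have e1 : thetaPath A t (ENNReal.ofReal l) - t = (-l) • res A l t := by
    rw [thetaPath_ofReal hA hl.le]; simp
  have e2 : wnorm A (thetaPath A t (ENNReal.ofReal l) - t) = l * wnorm A (res A l t) := by
    rw [e1, wnorm_smul, abs_neg, abs_of_pos hl]
  rw [PathEq, e2, thetaPath_eq_mulV_res hA hl.le, ratio]
  have e3 : l * (1 + δ * c0 * (‖mulV A (res A l t)‖ / (l * wnorm A (res A l t))))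
      = l + δ * c0 * (‖mulV A (res A l t)‖ / wnorm A (res A l t)) := by
    field_simp
  have e4 : l * wnorm A (res A l t) / ‖mulV A (res A l t)‖
      = l / (‖mulV A (res A l t)‖ / wnorm A (res A l t)) := by
    rw [div_div_eq_mul_div]
  rw [e3, e4]

/-- Along the path, the resolvent is rescaled so that it interpolates between `A⁻¹ t` at level `0`
and `t` at level `∞`. -/
noncomputable def resc (A : Matrix (Fin p) (Fin p) ℝ) (l : ℝ) (t : Vec p) : Vec p :=
  (1 + l) • res A l t

lemma norm_resc_le (hL : 1 ≤ L) (hA : CovClass L⁻¹ L A) {l : ℝ} (hl : 0 ≤ l) (t : Vec p) :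
    ‖resc A l t‖ ≤ L * ‖t‖ := by
  rw [resc, norm_smul, Real.norm_of_nonneg (by linarith)]
  exact norm_res_le hL hA hl t

lemma le_norm_resc (hL : 1 ≤ L) (hA : CovClass L⁻¹ L A) {l : ℝ} (hl : 0 ≤ l) (t : Vec p) :
    ‖t‖ ≤ L * ‖resc A l t‖ := by
  rw [resc, norm_smul, Real.norm_of_nonneg (by linarith), ← mul_assoc]
  exact le_norm_res hL hA hl t

lemma ratio_resc (A : Matrix (Fin p) (Fin p) ℝ) {l : ℝ} (hl : 0 ≤ l) (t : Vec p) :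
    ratio A (resc A l t) = ratio A (res A l t) :=
  ratio_smul A (by positivity) _

lemma resc_ne_zero (hA : A.PosDef) {l : ℝ} (hl : 0 ≤ l) {t : Vec p} (ht : t ≠ 0) :
    resc A l t ≠ 0 := smul_ne_zero (by positivity) (res_ne_zero hA hl ht)

/-- Perturbation of the rescaled resolvent: the matrix perturbation acts on the base point only. -/
lemma norm_resc_sub_le (hL : 1 ≤ L) (hA : CovClass L⁻¹ L A) (hS : CovClass L⁻¹ L S) {l : ℝ}
    (hl : 0 ≤ l) (t s : Vec p) :
    ‖resc S l s - resc A l t‖ ≤ L * (‖s - t‖ + ‖mulV (S - A) (resc A l t)‖) := by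
  have hAp := hA.posDef (by positivity)
  have hSp := hS.posDef (by positivity)
  have h1 : res S l s - res A l t = res S l ((s - t) - mulV (S - A) (res A l t)) := by
    refine res_unique hSp hl ?_
    have e1 := mulV_res_add hAp hl t
    have e2 := mulV_res_add hSp hl s
    have e3 : s - t = (mulV S (res S l s) + l • res S l s)
        - (mulV A (res A l t) + l • res A l t) := by rw [e1, e2]
    rw [mulV_sub, sub_mulV, smul_sub, e3]
    abel
  have h2 : mulV (S - A) (resc A l t) = (1 + l) • mulV (S - A) (res A l t) := mulV_smul _ _ _
  rw [resc, resc, ← smul_sub, norm_smul, Real.norm_of_nonneg (by linarith), h1]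
  refine (norm_res_le hL hS hl _).trans (mul_le_mul_of_nonneg_left ?_ (by linarith))
  refine (norm_sub_le _ _).trans (add_le_add le_rfl ?_)
  rw [← resc, h2, norm_smul, Real.norm_of_nonneg (by linarith)]
  nlinarith [norm_nonneg (mulV (S - A) (res A l t))]

lemma norm_resc_sub_self_le (hL : 1 ≤ L) (hA : CovClass L⁻¹ L A) {l : ℝ} (hl : 0 ≤ l)
    (t : Vec p) : (1 + l) * ‖resc A l t - t‖ ≤ 2 * L ^ 2 * ‖t‖ := by
  have hAp := hA.posDef (by positivity)
  have e1 := mulV_res_add hAp hl t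
  have h1 : resc A l t - t = res A l t - mulV A (res A l t) := by
    have e2 : mulV A (res A l t) = t - l • res A l t := eq_sub_of_add_eq e1
    rw [resc, add_smul, one_smul, e2]
    abel
  have h2 := hA.norm_mulV_le hL (res A l t)
  have h3 := norm_sub_le (res A l t) (mulV A (res A l t))
  have h4 := norm_res_le hL hA hl t
  rw [h1]
  have h5 : ‖res A l t - mulV A (res A l t)‖ ≤ 2 * L * ‖res A l t‖ := by
    nlinarith [norm_nonneg (res A l t)]
  calc (1 + l) * ‖res A l t - mulV A (res A l t)‖ ≤ (1 + l) * (2 * L * ‖res A l t‖) :=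
        mul_le_mul_of_nonneg_left h5 (by linarith)
    _ = 2 * L * ((1 + l) * ‖res A l t‖) := by ring
    _ ≤ 2 * L * (L * ‖t‖) := mul_le_mul_of_nonneg_left h4 (by linarith)
    _ = _ := by ring

lemma norm_res_sub_res_le (hL : 1 ≤ L) (hA : CovClass L⁻¹ L A) {l k : ℝ} (hl : 0 ≤ l) (hk : 0 ≤ k)
    (t : Vec p) : (1 + l) * ((1 + k) * ‖res A l t - res A k t‖) ≤ L ^ 2 * (|l - k| * ‖t‖) := by
  have hAp := hA.posDef (by positivity)
  have h1 : res A l t - res A k t = res A l ((k - l) • res A k t) := by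
    refine res_unique hAp hl ?_
    have e1 := mulV_res_add hAp hl t
    have e2 := mulV_res_add hAp hk t
    have : mulV A (res A l t - res A k t) + l • (res A l t - res A k t)
      = (mulV A (res A l t) + l • res A l t) - (mulV A (res A k t) + k • res A k t)
        + (k - l) • res A k t := by
      rw [mulV_sub, smul_sub, sub_smul]; abel
    rw [this, e1, e2]; simp
  have h2 := norm_res_le hL hA hl ((k - l) • res A k t)
  have h3 := norm_res_le hL hA hk t
  rw [← h1, norm_smul, Real.norm_eq_abs, abs_sub_comm] at h2
  calc (1 + l) * ((1 + k) * ‖res A l t - res A k t‖)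
      = (1 + k) * ((1 + l) * ‖res A l t - res A k t‖) := by ring
    _ ≤ (1 + k) * (L * (|l - k| * ‖res A k t‖)) := mul_le_mul_of_nonneg_left h2 (by linarith)
    _ = L * |l - k| * ((1 + k) * ‖res A k t‖) := by ring
    _ ≤ L * |l - k| * (L * ‖t‖) :=
        mul_le_mul_of_nonneg_left h3 (mul_nonneg (by linarith) (abs_nonneg _))
    _ = _ := by ring

lemma continuousOn_res (hL : 1 ≤ L) (hA : CovClass L⁻¹ L A) (t : Vec p) :
    ContinuousOn (fun l => res A l t) (Set.Ici 0) := by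
  have : LipschitzOnWith (Real.toNNReal (L ^ 2 * ‖t‖)) (fun l => res A l t) (Set.Ici 0) := by
    refine LipschitzOnWith.of_dist_le_mul fun l hl k hk => ?_
    rw [Set.mem_Ici] at hl hk
    rw [Real.coe_toNNReal _ (by positivity), dist_eq_norm, Real.dist_eq]
    have h := norm_res_sub_res_le hL hA hl hk t
    have h0 := norm_nonneg (res A l t - res A k t)
    have h1 : ‖res A l t - res A k t‖ ≤ (1 + l) * ((1 + k) * ‖res A l t - res A k t‖) := by
      rw [← mul_assoc]
      exact le_mul_of_one_le_left h0 (by nlinarith)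
    nlinarith
  exact this.continuousOn

/-- Between the thresholds the equation for the level has a solution. -/
lemma exists_pathEq (hL : 1 ≤ L) (hA : CovClass L⁻¹ L A) {t : Vec p} (ht : t ≠ 0) {δ : ℝ}
    (h1 : delta1 A t < δ) (h2 : δ < delta2 A t) : ∃ l : ℝ, 0 < l ∧ PathEq A t δ l := by
  have hL0 : 0 < L := by linarith
  have hAp := hA.posDef (by positivity)
  have hc := c0_pos
  rw [delta1_eq hAp] at h1
  rw [delta2_eq hA.transpose_eq, lt_div_iff₀ hc] at h2
  have hr0 := ratio_pos hL hA (res_ne_zero hAp le_rfl ht)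
  have hδ : 0 < δ := lt_trans (by positivity) h1
  set r := fun l : ℝ => ratio A (res A l t) with hr
  have hrpos : ∀ l, 0 ≤ l → 0 < r l := fun l hl => ratio_pos hL hA (res_ne_zero hAp hl ht)
  have hcont : ContinuousOn r (Set.Ici 0) := by
    have hc1 := continuousOn_res hL hA t
    refine ContinuousOn.div ((continuous_mulV A).norm.comp_continuousOn hc1) ?_ ?_
    · have : Continuous (wnorm A) := by
        unfold wnorm
        exact (continuous_id.inner (continuous_mulV A)).sqrt
      exact this.comp_continuousOn hc1
    · exact fun l hl => (wnorm_pos hAp (res_ne_zero hAp hl ht)).ne'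
  set g := fun l : ℝ => l + δ * c0 * r l - (δ * c0 * (l / r l) + δ ^ 2) with hg
  have hgc : ContinuousOn g (Set.Ici 0) := by
    refine ContinuousOn.sub ?_ ?_
    · exact continuousOn_id.add (continuousOn_const.mul hcont)
    · refine ContinuousOn.add (continuousOn_const.mul (continuousOn_id.div hcont ?_))
        continuousOn_const
      exact fun l hl => (hrpos l hl).ne'
  have hg0 : g 0 < 0 := by
    simp only [hg, hr, zero_div, mul_zero, zero_add]
    nlinarith
  obtain ⟨l, hl0, hl⟩ : ∃ l : ℝ, 0 ≤ l ∧ 0 < g l := by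
    -- as the level grows, the ratio tends to the ratio at `t`, which exceeds `c₀ δ`
    set e := ratio A t - δ * c0 with he
    have he0 : 0 < e := by simp only [he]; linarith
    have hn : 0 < ‖t‖ := norm_pos_iff.mpr ht
    set K := 4 * L ^ 6 with hK
    have key : ∀ l : ℝ, 0 ≤ l → (1 + l) * |r l - ratio A t| ≤ K := by
      intro l hl
      have k1 := norm_mul_abs_ratio_sub_le hL hA hA ht (resc_ne_zero hAp hl ht)
      rw [ratio_resc A hl] at k1
      have k2 := norm_resc_sub_self_le hL hA hl t
      have k3 := le_norm_resc hL hA hl t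
      simp only [sub_self, zero_mulV, norm_zero, add_zero] at k1
      have : ‖t‖ * ((1 + l) * |r l - ratio A t|) ≤ ‖t‖ * K := by
        calc ‖t‖ * ((1 + l) * |r l - ratio A t|)
            ≤ (L * ‖resc A l t‖) * ((1 + l) * |r l - ratio A t|) :=
              mul_le_mul_of_nonneg_right k3 (by positivity)
          _ = L * (1 + l) * (‖resc A l t‖ * |r l - ratio A t|) := by ring
          _ ≤ L * (1 + l) * (2 * L ^ 3 * ‖resc A l t - t‖) :=
              mul_le_mul_of_nonneg_left k1 (by positivity)
          _ = 2 * L ^ 4 * ((1 + l) * ‖resc A l t - t‖) := by ring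
          _ ≤ 2 * L ^ 4 * (2 * L ^ 2 * ‖t‖) := mul_le_mul_of_nonneg_left k2 (by positivity)
          _ = ‖t‖ * K := by rw [hK]; ring
      exact le_of_mul_le_mul_left this hn
    refine ⟨2 * K / e + 2 * L * (δ ^ 2 + 1) / e, by positivity, ?_⟩
    set l := 2 * K / e + 2 * L * (δ ^ 2 + 1) / e with hl
    have hl0 : 0 ≤ l := by positivity
    have k1 := key l hl0
    have k2 : e * l = 2 * K + 2 * L * (δ ^ 2 + 1) := by rw [hl]; field_simp
    have k3 := hrpos l hl0
    have k4 : e / 2 ≤ r l - δ * c0 := by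
      have hh : |r l - ratio A t| ≤ e / 2 := by
        by_contra hcon
        push Not at hcon
        have : (1 + l) * (e / 2) < (1 + l) * |r l - ratio A t| := by
          exact mul_lt_mul_of_pos_left hcon (by linarith)
        nlinarith [mul_nonneg hL0.le (add_nonneg (sq_nonneg δ) zero_le_one)]
      have := (abs_le.mp hh).1
      simp only [he] at this ⊢
      linarith
    have k5 : r l ≤ L := ratio_le hL hA _
    have k6 : g l * r l = l * (r l - δ * c0) + δ * c0 * r l ^ 2 - δ ^ 2 * r l := by
      simp only [hg]; field_simp; ring
    have k7 : 0 < g l * r l := by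
      rw [k6]
      have a1 : l * (e / 2) ≤ l * (r l - δ * c0) := mul_le_mul_of_nonneg_left k4 hl0
      have a2 : δ ^ 2 * r l ≤ δ ^ 2 * L := mul_le_mul_of_nonneg_left k5 (sq_nonneg _)
      have a3 : 0 ≤ δ * c0 * r l ^ 2 := by positivity
      have a4 : 0 < K := by positivity
      nlinarith
    exact pos_of_mul_pos_left k7 k3.le
  obtain ⟨k, hk, hk0⟩ := intermediate_value_Icc hl0 (hgc.mono Set.Icc_subset_Ici_self)
    ⟨hg0.le, hl.le⟩
  have hkpos : 0 < k := by
    refine lt_of_le_of_ne hk.1 fun h => ?_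
    rw [← h] at hk0
    linarith
  refine ⟨k, hkpos, (pathEq_iff hAp ht hkpos).mpr ?_⟩
  simp only [hg, hr] at hk0
  linarith

end path

end AdvLinReg

namespace AdvLinReg

variable {p : ℕ}

section critical

variable {A S : Matrix (Fin p) (Fin p) ℝ} {L : ℝ}

/-- Criticality of the signal itself, where the first norm of the objective has its kink. -/
lemma nearCritical_self (hL : 1 ≤ L) (hA : CovClass L⁻¹ L A) {t : Vec p} (ht : t ≠ 0) {δ : ℝ}
    (hδ : 0 ≤ δ) : NearCritical A t δ L t (δ * ‖t‖ * max 0 (δ - delta1 A t)) := by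
  have hAp := hA.posDef (by positivity)
  have hc := c0_pos
  set b := res A 0 t with hb
  have hbt : mulV A b = t := mulV_res_zero hAp t
  have hw : 0 < wnorm A b := wnorm_pos hAp (res_ne_zero hAp le_rfl ht)
  have hn : 0 < ‖t‖ := norm_pos_iff.mpr ht
  have hd : delta1 A t = c0 * (‖t‖ / wnorm A b) := by rw [delta1_eq hAp, ratio, ← hb, hbt]
  -- any small multiple of `t` is a subgradient of the weighted norm at the origin
  have hsub : ∀ s : ℝ, 0 ≤ s → s * wnorm A b ≤ 1 → ∀ w, inner ℝ ((-s) • t) w ≤ wnorm A w := by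
    intro s hs hs1 w
    have h1 := inner_mulV_le hAp.posSemidef (-w) b
    rw [hbt, wnorm_neg, inner_neg_left, real_inner_comm] at h1
    rw [inner_smul_left]
    simp only [RCLike.conj_to_real]
    nlinarith [wnorm_nonneg A w, mul_le_mul_of_nonneg_left h1 hs,
      mul_le_mul_of_nonneg_left hs1 (wnorm_nonneg A w)]
  have hb1 : ‖(‖t‖⁻¹ • t)‖ ≤ 1 := by
    rw [norm_smul, norm_inv, norm_norm, inv_mul_cancel₀ hn.ne']
  have hb2 : ‖t‖ • (‖t‖⁻¹ • t) = t := by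
    rw [smul_smul, mul_inv_cancel₀ hn.ne', one_smul]
  rcases le_or_gt δ (delta1 A t) with h | h
  · rw [max_eq_left (by linarith), mul_zero]
    have hs := hsub (δ / (c0 * ‖t‖)) (by positivity) (by
      rw [hd] at h
      rw [div_mul_eq_mul_div, div_le_one (by positivity)]
      rwa [mul_div_assoc', le_div_iff₀ hw] at h)
    refine NearCritical.of_subgradient hL hA hδ hs (by simp) hb1 hb2 (le_of_eq ?_)
    simp only [sub_self, wnorm_zero, mulV_zero, zero_add, zero_smul, add_zero]
    rw [smul_smul, smul_smul, ← add_smul, norm_smul]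
    have : δ * c0 * ‖t‖ * -(δ / (c0 * ‖t‖)) + δ ^ 2 = 0 := by field_simp; ring
    rw [this]; simp
  · rw [max_eq_right (by linarith)]
    have hs := hsub (wnorm A b)⁻¹ (by positivity) (by rw [inv_mul_cancel₀ hw.ne'])
    refine NearCritical.of_subgradient hL hA hδ hs (by simp) hb1 hb2 (le_of_eq ?_)
    simp only [sub_self, wnorm_zero, mulV_zero, zero_add, zero_smul, add_zero]
    rw [smul_smul, smul_smul, ← add_smul, norm_smul]
    have : δ * c0 * ‖t‖ * -(wnorm A b)⁻¹ + δ ^ 2 = δ * (δ - delta1 A t) := by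
      rw [hd]; field_simp; ring
    rw [this, Real.norm_of_nonneg (mul_nonneg hδ (by linarith))]
    ring

/-- Criticality of the origin, where the second norm of the objective has its kink. -/
lemma nearCritical_zero (hL : 1 ≤ L) (hA : CovClass L⁻¹ L A) {t : Vec p} (ht : t ≠ 0) {δ : ℝ}
    (hδ : 0 ≤ δ) : NearCritical A t δ L 0 (wnorm A t * max 0 (ratio A t - c0 * δ)) := by
  have hAp := hA.posDef (by positivity)
  have hc := c0_pos
  have hw : 0 < wnorm A t := wnorm_pos hAp ht
  have hr : 0 < ratio A t := ratio_pos hL hA ht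
  have hrw := ratio_mul_wnorm hAp ht
  have hn : 0 < ‖mulV A t‖ := by rw [← hrw]; positivity
  have ha : ∀ w, inner ℝ ((-(wnorm A t)⁻¹) • mulV A t) w ≤ wnorm A w := by
    intro w
    have h1 := inner_mulV_le hAp.posSemidef (-w) t
    rw [wnorm_neg, inner_neg_left, real_inner_comm] at h1
    rw [inner_smul_left]
    simp only [RCLike.conj_to_real]
    have h2 := mul_le_mul_of_nonneg_left h1 (inv_nonneg.mpr hw.le)
    have h3 : (wnorm A t)⁻¹ * (wnorm A w * wnorm A t) = wnorm A w := by field_simp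
    linarith
  have hw' : wnorm A (0 - t) = wnorm A t := by rw [zero_sub, wnorm_neg]
  have ha' : wnorm A (0 - t) • ((-(wnorm A t)⁻¹) • mulV A t) = mulV A (0 - t) := by
    rw [hw', smul_smul, mul_neg, mul_inv_cancel₀ hw.ne', zero_sub, mulV_neg, neg_smul, one_smul]
  have hb : ∀ s : ℝ, 0 ≤ s → s * ‖mulV A t‖ ≤ 1 → ‖s • mulV A t‖ ≤ 1 := by
    intro s hs hs1
    rwa [norm_smul, Real.norm_of_nonneg hs]
  rcases le_or_gt (ratio A t) (c0 * δ) with h | h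
  · rw [max_eq_left (by linarith), mul_zero]
    have hδ0 : 0 < δ := pos_of_mul_pos_right (hr.trans_le h) hc.le
    refine NearCritical.of_subgradient hL hA hδ ha ha' (hb (δ * c0 * wnorm A t)⁻¹ (by positivity) ?_)
      (by simp) (le_of_eq ?_)
    · rw [inv_mul_le_iff₀ (by positivity), ← hrw]
      nlinarith
    · rw [hw']
      simp only [norm_zero, zero_smul, zero_add, smul_zero, add_zero, zero_sub, mulV_neg]
      rw [smul_smul, smul_smul]
      have : δ * c0 * wnorm A t * (δ * c0 * wnorm A t)⁻¹ = 1 := by field_simp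
      rw [this]; simp
  · rw [max_eq_right (by linarith)]
    refine NearCritical.of_subgradient hL hA hδ ha ha' (hb (‖mulV A t‖)⁻¹ (by positivity) ?_)
      (by simp) (le_of_eq ?_)
    · rw [inv_mul_cancel₀ hn.ne']
    · rw [hw']
      simp only [norm_zero, zero_smul, zero_add, smul_zero, add_zero, zero_sub, mulV_neg]
      rw [smul_smul, smul_smul, ← neg_one_smul ℝ, ← add_smul, norm_smul]
      have : -1 + δ * c0 * wnorm A t * ‖mulV A t‖⁻¹ = -((ratio A t - c0 * δ) / ratio A t) := by
        rw [← hrw]; field_simp; ring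
      rw [this, norm_neg, Real.norm_of_nonneg (by
        have : 0 ≤ ratio A t - c0 * δ := by linarith
        positivity), ← hrw]
      field_simp

/-- Criticality of an interior point of the path. -/
lemma nearCritical_path (hL : 1 ≤ L) (hA : CovClass L⁻¹ L A) {t : Vec p} (ht : t ≠ 0) {δ l : ℝ}
    (hδ : 0 ≤ δ) (hl : 0 < l) : NearCritical A t δ L (thetaPath A t (ENNReal.ofReal l))
      (‖thetaPath A t (ENNReal.ofReal l)‖ *
        |δ ^ 2 - l + δ * c0 * (l / ratio A (res A l t) - ratio A (res A l t))|) := by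
  have hAp := hA.posDef (by positivity)
  have hb := res_ne_zero hAp hl.le ht
  have h1 := thetaPath_eq_mulV_res hAp hl.le t
  have h2 := thetaPath_ofReal hAp hl.le t
  have hrw := ratio_mul_wnorm hAp hb
  have hr := ratio_pos hL hA hb
  have hw := wnorm_pos hAp hb
  set b := res A l t
  set θ' := thetaPath A t (ENNReal.ofReal l)
  have hn : 0 < ‖θ'‖ := by rw [h1, ← hrw]; positivity
  have e1 : θ' - t = (-l) • b := by rw [h2]; simp
  have e2 : wnorm A (θ' - t) = l * wnorm A b := by
    rw [e1, wnorm_smul, abs_neg, abs_of_pos hl]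
  have e3 : mulV A (θ' - t) = (-l) • θ' := by rw [e1, mulV_smul, ← h1]
  have e4 : ‖θ'‖ = ratio A b * wnorm A b := by rw [h1, hrw]
  refine NearCritical.of_subgradient (a := (-(wnorm A b)⁻¹) • θ') (b := ‖θ'‖⁻¹ • θ') hL hA hδ ?_ ?_
    ?_ ?_ (le_of_eq ?_)
  · intro w
    have g1 := inner_mulV_le hAp.posSemidef (-w) b
    rw [← h1, wnorm_neg, inner_neg_left, real_inner_comm] at g1
    rw [inner_smul_left]
    simp only [RCLike.conj_to_real]
    have g2 := mul_le_mul_of_nonneg_left g1 (inv_nonneg.mpr hw.le)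
    have g3 : (wnorm A b)⁻¹ * (wnorm A w * wnorm A b) = wnorm A w := by field_simp
    linarith
  · rw [e2, e3, smul_smul]
    congr 1
    field_simp
  · rw [norm_smul, norm_inv, norm_norm, inv_mul_cancel₀ hn.ne']
  · rw [smul_smul, mul_inv_cancel₀ hn.ne', one_smul]
  · rw [e2, e3, smul_smul, smul_smul, ← add_smul, smul_smul, ← add_smul, ← add_smul, norm_smul,
      Real.norm_eq_abs, mul_comm]
    congr 2
    rw [e4]
    field_simp
    ring

/-- The point of the path selected by the level `λ*`. -/
noncomputable def pathEst (A : Matrix (Fin p) (Fin p) ℝ) (t : Vec p) (δ : ℝ) : Vec p :=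
  thetaPath A t (lambdaStar A t δ)

lemma pathEst_zero (A : Matrix (Fin p) (Fin p) ℝ) (δ : ℝ) : pathEst A 0 δ = 0 := by
  unfold pathEst thetaPath
  split_ifs <;> simp

lemma thetaPath_top (A : Matrix (Fin p) (Fin p) ℝ) (t : Vec p) : thetaPath A t ⊤ = 0 := by
  simp [thetaPath]

lemma thetaPath_zero_level (hA : A.PosDef) (t : Vec p) : thetaPath A t 0 = t := by
  have := thetaPath_ofReal hA le_rfl t
  simpa using this

/-- The three regimes of the selected level. -/
lemma lambdaStar_cases (hL : 1 ≤ L) (hA : CovClass L⁻¹ L A) {t : Vec p} (ht : t ≠ 0) (δ : ℝ) :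
    (δ ≤ delta1 A t ∧ lambdaStar A t δ = 0) ∨
    (delta1 A t < δ ∧ delta2 A t ≤ δ ∧ lambdaStar A t δ = ⊤) ∨
    (delta1 A t < δ ∧ δ < delta2 A t ∧
      ∃ l, 0 < l ∧ PathEq A t δ l ∧ lambdaStar A t δ = ENNReal.ofReal l) := by
  rcases le_or_gt δ (delta1 A t) with h | h
  · exact Or.inl ⟨h, by rw [lambdaStar, if_pos h]⟩
  rcases le_or_gt (delta2 A t) δ with h' | h'
  · exact Or.inr (Or.inl ⟨h, h', by rw [lambdaStar, if_neg h.not_ge, if_pos h']⟩)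
  · have := Classical.epsilon_spec (exists_pathEq hL hA ht h h')
    exact Or.inr (Or.inr ⟨h, h', _, this.1, this.2, by
      rw [lambdaStar, if_neg h.not_ge, if_neg h'.not_ge]⟩)

lemma delta1_pos (hL : 1 ≤ L) (hA : CovClass L⁻¹ L A) {t : Vec p} (ht : t ≠ 0) :
    0 < delta1 A t := by
  have hAp := hA.posDef (by positivity)
  rw [delta1_eq hAp]
  exact mul_pos c0_pos (ratio_pos hL hA (res_ne_zero hAp le_rfl ht))

/-- The selected point of the path is the minimizer of the objective. -/
lemma nearCritical_pathEst (hL : 1 ≤ L) (hA : CovClass L⁻¹ L A) {t : Vec p} (ht : t ≠ 0) {δ : ℝ}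
    (hδ : 0 ≤ δ) : NearCritical A t δ L (pathEst A t δ) 0 := by
  have hAp := hA.posDef (by positivity)
  unfold pathEst
  rcases lambdaStar_cases hL hA ht δ with ⟨h, e⟩ | ⟨-, h, e⟩ | ⟨-, -, l, hl, hp, e⟩
  · rw [e, thetaPath_zero_level hAp]
    have := nearCritical_self hL hA ht hδ
    rwa [max_eq_left (by linarith), mul_zero] at this
  · rw [e, thetaPath_top]
    have := nearCritical_zero hL hA ht hδ
    rw [delta2_eq hA.transpose_eq, div_le_iff₀ c0_pos] at h
    rwa [max_eq_left (by linarith), mul_zero] at this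
  · rw [e]
    have := nearCritical_path hL hA ht hδ hl
    rw [pathEq_iff hAp ht hl] at hp
    have h0 : δ ^ 2 - l + δ * c0 * (l / ratio A (res A l t) - ratio A (res A l t)) = 0 := by
      linarith
    rwa [h0, abs_zero, mul_zero] at this

lemma pathEst_min (hL : 1 ≤ L) (hA : CovClass L⁻¹ L A) (t : Vec p) {δ : ℝ}
    (hδ : 0 ≤ δ) (θ : Vec p) : advObj A t δ (pathEst A t δ) ≤ advObj A t δ θ := by
  rcases eq_or_ne t 0 with rfl | ht
  · rw [pathEst_zero]
    have hc := c0_pos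
    have := wnorm_nonneg A (θ - 0)
    simp only [advObj, sub_zero, wnorm_zero, norm_zero]
    have h1 := wnorm_nonneg A θ
    have h2 := norm_nonneg θ
    simp only [ne_eq, OfNat.ofNat_ne_zero, not_false_eq_true, zero_pow, mul_zero, add_zero]
    positivity
  · exact (nearCritical_pathEst hL hA ht hδ).min hL θ

lemma norm_pathEst_le (hA : A.PosDef) (t : Vec p) (δ : ℝ) : ‖pathEst A t δ‖ ≤ ‖t‖ := by
  unfold pathEst
  rcases eq_or_ne (lambdaStar A t δ) ⊤ with h | h
  · rw [h, thetaPath_top]; simp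
  · rw [← ENNReal.ofReal_toReal h]
    exact norm_thetaPath_le hA ENNReal.toReal_nonneg t

/-- The rescaled resolvent at the selected level. -/
noncomputable def basePoint (A : Matrix (Fin p) (Fin p) ℝ) (t : Vec p) (δ : ℝ) : Vec p :=
  if lambdaStar A t δ = ⊤ then t else resc A (lambdaStar A t δ).toReal t

lemma norm_basePoint_le (hL : 1 ≤ L) (hA : CovClass L⁻¹ L A) (t : Vec p) (δ : ℝ) :
    ‖basePoint A t δ‖ ≤ L * ‖t‖ := by
  unfold basePoint
  split_ifs
  · nlinarith [norm_nonneg t]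
  · exact norm_resc_le hL hA ENNReal.toReal_nonneg t

/-- The modulus of strong convexity of the objective over the class. -/
noncomputable def modulus (L : ℝ) : ℝ := (1 - c0 ^ 2) * L⁻¹

lemma modulus_pos (hL : 1 ≤ L) : 0 < modulus L :=
  mul_pos (by linarith [c0_sq_lt_one]) (by positivity)

lemma norm_pathEst_sub_le (hL : 1 ≤ L) (hS : CovClass L⁻¹ L S) {t θ' : Vec p} {δ G : ℝ}
    (hδ : 0 ≤ δ) (hG : 0 ≤ G) (h : NearCritical S t δ L θ' G) :
    ‖pathEst S t δ - θ'‖ ≤ 2 / modulus L * G := by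
  have := h.norm_sub_le hG (pathEst_min hL hS t hδ θ')
  rw [div_mul_eq_mul_div, le_div_iff₀ (modulus_pos hL)]
  rw [modulus]; linarith

/-- The stability constant over the class. -/
noncomputable def stabConst (L : ℝ) : ℝ := 8 * L ^ 8 / modulus L + 2 * L ^ 2

lemma stabConst_pos (hL : 1 ≤ L) : 0 < stabConst L := by
  have := modulus_pos hL
  unfold stabConst; positivity

set_option maxHeartbeats 1000000 in
/-- Stability of the minimizer. The perturbation of the covariance matrix enters only through its
action on the base point of the unperturbed problem. -/
theorem norm_pathEst_sub_pathEst_le (hL : 1 ≤ L) (hA : CovClass L⁻¹ L A) (hS : CovClass L⁻¹ L S)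
    (t s : Vec p) {δ : ℝ} (hδ : 0 ≤ δ) :
    ‖pathEst S s δ - pathEst A t δ‖
      ≤ stabConst L * (‖s - t‖ + ‖mulV (S - A) (basePoint A t δ)‖) := by
  have hL0 : 0 < L := by linarith
  have hAp := hA.posDef (by positivity)
  have hSp := hS.posDef (by positivity)
  have hm := modulus_pos hL
  have hc := c0_pos
  have hc1 := c0_lt_one
  set x := ‖s - t‖ with hx
  set y := ‖mulV (S - A) (basePoint A t δ)‖ with hy
  have hx0 : 0 ≤ x := norm_nonneg _
  have hy0 : 0 ≤ y := norm_nonneg _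
  have hC1 : 1 ≤ stabConst L := by
    have : 0 ≤ 8 * L ^ 8 / modulus L := by positivity
    unfold stabConst; nlinarith
  have htriv : x ≤ stabConst L * (x + y) := by nlinarith
  rcases eq_or_ne t 0 with ht | ht
  · refine le_trans ?_ htriv
    rw [hx, ht, pathEst_zero, sub_zero, sub_zero]
    exact norm_pathEst_le hSp s δ
  rcases eq_or_ne s 0 with hs | hs
  · refine le_trans ?_ htriv
    rw [hx, hs, pathEst_zero, zero_sub, zero_sub, norm_neg, norm_neg]
    exact norm_pathEst_le hAp t δ
  have hpow : L ^ 6 ≤ L ^ 8 := pow_le_pow_right₀ hL (by norm_num)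
  have hpow4 : L ^ 4 ≤ L ^ 8 := pow_le_pow_right₀ hL (by norm_num)
  -- the three regimes share the same conclusion once the gradient error is bounded
  have hfin : ∀ (θ' : Vec p) (G : ℝ), NearCritical S s δ L θ' G → 0 ≤ G →
      G ≤ 4 * L ^ 8 * (x + y) → ‖θ' - pathEst A t δ‖ ≤ 2 * L ^ 2 * (x + y) →
      ‖pathEst S s δ - pathEst A t δ‖ ≤ stabConst L * (x + y) := by
    intro θ' G h1 h2 h3 h4
    have h5 := norm_pathEst_sub_le hL hS hδ h2 h1
    calc ‖pathEst S s δ - pathEst A t δ‖ = ‖(pathEst S s δ - θ') + (θ' - pathEst A t δ)‖ := by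
          congr 1; abel
      _ ≤ 2 / modulus L * G + 2 * L ^ 2 * (x + y) := (norm_add_le _ _).trans (add_le_add h5 h4)
      _ ≤ 2 / modulus L * (4 * L ^ 8 * (x + y)) + 2 * L ^ 2 * (x + y) := by gcongr
      _ = stabConst L * (x + y) := by unfold stabConst; ring
  rcases lambdaStar_cases hL hA ht δ with ⟨h, e⟩ | ⟨-, h, e⟩ | ⟨-, h2, l, hl, hp, e⟩
  -- `δ` is below the lower threshold of `(A, t)`, so it exceeds that of `(S, s)` by little, and `s` is
  -- nearly critical
  · have hest : pathEst A t δ = t := by rw [pathEst, e, thetaPath_zero_level hAp]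
    have hbase : basePoint A t δ = resc A 0 t := by simp [basePoint, e]
    rw [hbase] at hy
    refine hfin s _ (nearCritical_self hL hS hs hδ) (by positivity) ?_ ?_
    · have hb' := resc_ne_zero hSp le_rfl hs
      have k1 := norm_mul_abs_ratio_sub_le hL hA hS (resc_ne_zero hAp le_rfl ht) hb'
      rw [ratio_resc S le_rfl, ratio_resc A le_rfl, ← hy] at k1
      have k2 := norm_resc_sub_le hL hA hS le_rfl t s
      rw [← hy, ← hx] at k2
      have k3 := le_norm_resc hL hS le_rfl s
      rw [delta1_eq hAp] at h
      have k4 : max 0 (δ - delta1 S s) ≤ |ratio S (res S 0 s) - ratio A (res A 0 t)| := by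
        refine max_le (abs_nonneg _) ?_
        rw [delta1_eq hSp]
        have := neg_abs_le (ratio S (res S 0 s) - ratio A (res A 0 t))
        nlinarith [abs_nonneg (ratio S (res S 0 s) - ratio A (res A 0 t))]
      have k5 : δ ≤ L := by
        have := ratio_le hL hA (res A 0 t)
        nlinarith [ratio_pos hL hA (res_ne_zero hAp le_rfl ht)]
      set Δ := |ratio S (res S 0 s) - ratio A (res A 0 t)|
      calc δ * ‖s‖ * max 0 (δ - delta1 S s) ≤ L * (L * ‖resc S 0 s‖) * Δ := by gcongr
        _ = L ^ 2 * (‖resc S 0 s‖ * Δ) := by ring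
        _ ≤ L ^ 2 * (2 * L ^ 3 * (L * (x + y) + y)) :=
          mul_le_mul_of_nonneg_left (k1.trans (by gcongr)) (by positivity)
        _ = 2 * L ^ 6 * (x + y) + 2 * L ^ 5 * y := by ring
        _ ≤ 4 * L ^ 8 * (x + y) := by
          have h7 : L ^ 5 * y ≤ L ^ 8 * y :=
            mul_le_mul_of_nonneg_right (pow_le_pow_right₀ hL (by norm_num)) hy0
          have h6 : L ^ 6 * (x + y) ≤ L ^ 8 * (x + y) :=
            mul_le_mul_of_nonneg_right hpow (by positivity)
          have h8 : 0 ≤ L ^ 8 * x := by positivity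
          linarith
    · rw [hest, ← hx]; nlinarith [one_le_pow₀ (n := 2) hL]
  -- likewise `0` is nearly critical above the upper threshold
  · have hest : pathEst A t δ = 0 := by rw [pathEst, e, thetaPath_top]
    have hbase : basePoint A t δ = t := by simp [basePoint, e]
    rw [hbase] at hy
    refine hfin 0 _ (nearCritical_zero hL hS hs hδ)
      (mul_nonneg (wnorm_nonneg _ _) (le_max_left _ _)) ?_ ?_
    · have k1 := norm_mul_abs_ratio_sub_le hL hA hS ht hs
      rw [← hy, ← hx] at k1
      rw [delta2_eq hA.transpose_eq, div_le_iff₀ hc] at h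
      have k4 : max 0 (ratio S s - c0 * δ) ≤ |ratio S s - ratio A t| := by
        refine max_le (abs_nonneg _) ?_
        have := le_abs_self (ratio S s - ratio A t)
        linarith
      calc wnorm S s * max 0 (ratio S s - c0 * δ) ≤ L * ‖s‖ * |ratio S s - ratio A t| := by
            gcongr
            exact hS.wnorm_le hL s
        _ = L * (‖s‖ * |ratio S s - ratio A t|) := by ring
        _ ≤ L * (2 * L ^ 3 * (x + y)) := by gcongr
        _ = 2 * L ^ 4 * (x + y) := by ring
        _ ≤ 4 * L ^ 8 * (x + y) := by gcongr; linarith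
    · rw [hest, sub_zero, norm_zero]; positivity
  -- between the thresholds, the point of the perturbed path at the unperturbed level is nearly critical
  · have hest : pathEst A t δ = thetaPath A t (ENNReal.ofReal l) := by rw [pathEst, e]
    have hbase : basePoint A t δ = resc A l t := by
      simp [basePoint, e, ENNReal.toReal_ofReal hl.le]
    rw [hbase] at hy
    have hb' := resc_ne_zero hSp hl.le hs
    have hb := resc_ne_zero hAp hl.le ht
    have k2 := norm_resc_sub_le hL hA hS hl.le t s
    rw [← hy, ← hx] at k2
    have k6 : (1 + l) • thetaPath S s (ENNReal.ofReal l) = mulV S (resc S l s) := by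
      rw [thetaPath_eq_mulV_res hSp hl.le, resc, mulV_smul]
    have k7 : (1 + l) • thetaPath A t (ENNReal.ofReal l) = mulV A (resc A l t) := by
      rw [thetaPath_eq_mulV_res hAp hl.le, resc, mulV_smul]
    refine hfin _ _ (nearCritical_path hL hS hs hδ hl) (by positivity) ?_ ?_
    · have k1 := norm_mul_abs_ratio_sub_le hL hA hS hb hb'
      rw [← hy] at k1
      rw [pathEq_iff hAp ht hl, ← ratio_resc A hl.le] at hp
      rw [← ratio_resc S hl.le]
      have r1 := ratio_pos hL hA hb
      have r2 := ratio_pos hL hS hb'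
      have r3 := le_ratio hL hA hb
      have r4 := le_ratio hL hS hb'
      set ρ := ratio A (resc A l t)
      set ρ' := ratio S (resc S l s)
      have k3 : δ ^ 2 - l + δ * c0 * (l / ρ' - ρ')
          = -(δ * c0 * (ρ' - ρ) * (1 + l / (ρ' * ρ))) := by
        have : δ ^ 2 - l = δ * c0 * ρ - δ * c0 * (l / ρ) := by linarith
        rw [this]; field_simp; ring
      have k4 : 1 + l / (ρ' * ρ) ≤ L ^ 2 * (1 + l) := by
        have : (ρ' * ρ)⁻¹ ≤ L ^ 2 := by
          rw [inv_le_comm₀ (by positivity) (by positivity)]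
          calc (L ^ 2)⁻¹ = L⁻¹ * L⁻¹ := by rw [pow_two, mul_inv]
            _ ≤ ρ' * ρ := by gcongr
        rw [div_eq_mul_inv]
        nlinarith
      have k5 : δ * c0 ≤ L := by
        rw [delta2_eq hA.transpose_eq, lt_div_iff₀ hc] at h2
        exact h2.le.trans (ratio_le hL hA t)
      have k8 : (1 + l) * ‖thetaPath S s (ENNReal.ofReal l)‖ ≤ L * ‖resc S l s‖ := by
        have := hS.norm_mulV_le hL (resc S l s)
        rw [← k6, norm_smul, Real.norm_of_nonneg (by linarith)] at this
        exact this
      rw [k3, abs_neg, abs_mul, abs_mul, abs_of_nonneg (by positivity : 0 ≤ δ * c0),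
        abs_of_pos (by positivity : 0 < 1 + l / (ρ' * ρ))]
      calc ‖thetaPath S s (ENNReal.ofReal l)‖ * (δ * c0 * |ρ' - ρ| * (1 + l / (ρ' * ρ)))
          ≤ ‖thetaPath S s (ENNReal.ofReal l)‖ * (L * |ρ' - ρ| * (L ^ 2 * (1 + l))) := by gcongr
        _ = L ^ 3 * |ρ' - ρ| * ((1 + l) * ‖thetaPath S s (ENNReal.ofReal l)‖) := by ring
        _ ≤ L ^ 3 * |ρ' - ρ| * (L * ‖resc S l s‖) := by gcongr
        _ = L ^ 4 * (‖resc S l s‖ * |ρ' - ρ|) := by ring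
        _ ≤ L ^ 4 * (2 * L ^ 3 * (L * (x + y) + y)) :=
          mul_le_mul_of_nonneg_left (k1.trans (by gcongr)) (by positivity)
        _ = 2 * L ^ 8 * (x + y) + 2 * L ^ 7 * y := by ring
        _ ≤ 4 * L ^ 8 * (x + y) := by
          have h7 : L ^ 7 * y ≤ L ^ 8 * y :=
            mul_le_mul_of_nonneg_right (pow_le_pow_right₀ hL (by norm_num)) hy0
          have h8 : 0 ≤ L ^ 8 * x := by positivity
          linarith
    · rw [hest]
      have k9 : (1 + l) * ‖thetaPath S s (ENNReal.ofReal l) - thetaPath A t (ENNReal.ofReal l)‖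
          ≤ L * (L * (x + y)) + y := by
        rw [← Real.norm_of_nonneg (by linarith : 0 ≤ 1 + l), ← norm_smul, smul_sub, k6, k7]
        have : mulV S (resc S l s) - mulV A (resc A l t)
            = mulV S (resc S l s - resc A l t) + mulV (S - A) (resc A l t) := by
          rw [mulV_sub, sub_mulV]; abel
        rw [this]
        refine (norm_add_le _ _).trans (add_le_add ?_ hy.ge)
        exact (hS.norm_mulV_le hL _).trans (by gcongr)
      refine (le_mul_of_one_le_left (norm_nonneg _) (by linarith : 1 ≤ 1 + l)).trans (k9.trans ?_)
      nlinarith [one_le_pow₀ (n := 2) hL]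

end critical

end AdvLinReg

namespace AdvLinReg

/-! ### Moments of the standard Gaussian -/

lemma integrable_gaussian_iff {g : ℝ → ℝ} :
    Integrable g (gaussianReal 0 1) ↔ Integrable (fun x => gaussianPDFReal 0 1 x * g x) := by
  rw [gaussianReal_of_var_ne_zero _ one_ne_zero,
    integrable_withDensity_iff_integrable_smul' (measurable_gaussianPDF 0 1)
      (ae_of_all _ fun _ => gaussianPDF_lt_top)]
  simp [toReal_gaussianPDF]

lemma integral_gaussian_eq (g : ℝ → ℝ) :
    ∫ x, g x ∂(gaussianReal 0 1) = ∫ x, gaussianPDFReal 0 1 x * g x := by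
  simpa using integral_gaussianReal_eq_integral_smul (μ := 0) (v := 1) (f := g) one_ne_zero

lemma gaussianPDFReal_std (x : ℝ) :
    gaussianPDFReal 0 1 x = (√(2 * Real.pi))⁻¹ * Real.exp (-(1 / 2) * x ^ 2) := by
  rw [gaussianPDFReal]
  simp only [NNReal.coe_one, mul_one, sub_zero]
  congr 2; ring

lemma hasDerivAt_gaussianPDFReal (x : ℝ) :
    HasDerivAt (gaussianPDFReal 0 1) (-(x * gaussianPDFReal 0 1 x)) x := by
  have h : HasDerivAt (fun x : ℝ => (√(2 * Real.pi))⁻¹ * Real.exp (-(1 / 2) * x ^ 2))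
      ((√(2 * Real.pi))⁻¹ * (Real.exp (-(1 / 2) * x ^ 2) * (-(1 / 2) * (2 * x)))) x := by
    have h1 : HasDerivAt (fun x : ℝ => -(1 / 2) * x ^ 2) (-(1 / 2) * (2 * x)) x := by
      simpa using (hasDerivAt_pow 2 x).const_mul (-(1 / 2) : ℝ)
    exact h1.exp.const_mul _
  have e : gaussianPDFReal 0 1 = fun x : ℝ => (√(2 * Real.pi))⁻¹ * Real.exp (-(1 / 2) * x ^ 2) :=
    funext gaussianPDFReal_std
  rw [e]
  convert h using 1
  ring

/-- Gaussian integration by parts (Stein's identity). -/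
lemma integral_mul_gaussian {f f' : ℝ → ℝ} (hf : ∀ x, HasDerivAt f (f' x) x)
    (h1 : Integrable (fun x => x * f x) (gaussianReal 0 1))
    (h2 : Integrable f' (gaussianReal 0 1)) (h3 : Integrable f (gaussianReal 0 1)) :
    ∫ x, x * f x ∂(gaussianReal 0 1) = ∫ x, f' x ∂(gaussianReal 0 1) := by
  rw [integrable_gaussian_iff] at h1 h2 h3
  have := integral_mul_deriv_eq_deriv_mul_of_integrable (u := f) (u' := f')
    (v := gaussianPDFReal 0 1) (v' := fun x => -(x * gaussianPDFReal 0 1 x))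
    (fun x _ => hf x) (fun x _ => hasDerivAt_gaussianPDFReal x)
    (by
      refine h1.neg.congr (ae_of_all _ fun x => ?_)
      change -(gaussianPDFReal 0 1 x * (x * f x)) = f x * -(x * gaussianPDFReal 0 1 x)
      ring) (by
      change Integrable (fun x => f' x * gaussianPDFReal 0 1 x)
      simpa only [mul_comm] using h2)
    (by
      change Integrable (fun x => f x * gaussianPDFReal 0 1 x)
      simpa only [mul_comm] using h3)
  rw [integral_gaussian_eq, integral_gaussian_eq]
  have e1 : ∫ x, gaussianPDFReal 0 1 x * (x * f x)
      = -∫ x, f x * -(x * gaussianPDFReal 0 1 x) := by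
    rw [← integral_neg]; congr 1; ext x; ring
  rw [e1, this, neg_neg]
  congr 1; ext x; ring

lemma integrable_pow_gaussian (k : ℕ) : Integrable (fun x : ℝ => x ^ k) (gaussianReal 0 1) := by
  have h := memLp_id_gaussianReal' (μ := 0) (v := 1) k (by simp)
  rcases Nat.eq_zero_or_pos k with rfl | hk
  · simp
  have := h.integrable_norm_pow hk.ne'
  refine this.mono' (by fun_prop) (ae_of_all _ fun x => ?_)
  simp

lemma integral_pow_gaussian_succ (k : ℕ) :
    ∫ x, x ^ (k + 2) ∂(gaussianReal 0 1) = (k + 1) * ∫ x, x ^ k ∂(gaussianReal 0 1) := by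
  have h := integral_mul_gaussian (f := fun x => x ^ (k + 1)) (f' := fun x => (k + 1) * x ^ k)
    (fun x => by simpa using hasDerivAt_pow (k + 1) x)
    (by simpa [pow_succ, mul_comm, mul_assoc] using integrable_pow_gaussian (k + 2))
    ((integrable_pow_gaussian k).const_mul _) (integrable_pow_gaussian _)
  rw [integral_const_mul] at h
  rw [← h]
  congr 1; ext x; ring

lemma integral_sq_gaussian : ∫ x, x ^ 2 ∂(gaussianReal 0 1) = 1 := by
  have := integral_pow_gaussian_succ 0
  simpa using this

lemma integral_pow_four_gaussian : ∫ x, x ^ 4 ∂(gaussianReal 0 1) = 3 := by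
  rw [integral_pow_gaussian_succ 2, integral_sq_gaussian]; norm_num

lemma integral_pow_eight_gaussian : ∫ x, x ^ 8 ∂(gaussianReal 0 1) = 105 := by
  rw [integral_pow_gaussian_succ 6, integral_pow_gaussian_succ 4, integral_pow_four_gaussian]
  norm_num

lemma integral_abs_gaussian : ∫ x, |x| ∂(gaussianReal 0 1) = c0 := by
  have h1 : ∀ x : ℝ, gaussianPDFReal 0 1 x * |x|
      = (fun y => (√(2 * Real.pi))⁻¹ * (y ^ (1 : ℝ) * Real.exp (-(1 / 2) * y ^ (2 : ℝ)))) |x| := by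
    intro x
    simp only [gaussianPDFReal_std, Real.rpow_one, Real.rpow_two, sq_abs]
    ring
  rw [integral_gaussian_eq]
  simp_rw [h1]
  rw [integral_comp_abs (f := fun y => (√(2 * Real.pi))⁻¹ *
    (y ^ (1 : ℝ) * Real.exp (-(1 / 2) * y ^ (2 : ℝ)))), integral_const_mul,
    integral_rpow_mul_exp_neg_mul_rpow (by norm_num) (by norm_num) (by norm_num)]
  norm_num
  rw [c0, Real.sqrt_div zero_le_two]
  have := Real.mul_self_sqrt (zero_le_two (α := ℝ))
  have h2 : √Real.pi ≠ 0 := by positivity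
  have h3 : √(2 : ℝ) ≠ 0 := by positivity
  field_simp
  nlinarith

lemma integrable_exp_sq_gaussian {s : ℝ} (hs : s < 1 / 2) :
    Integrable (fun x : ℝ => Real.exp (s * x ^ 2)) (gaussianReal 0 1) := by
  rw [integrable_gaussian_iff]
  have := (integrable_exp_neg_mul_sq (b := 1 / 2 - s) (by linarith)).const_mul (√(2 * Real.pi))⁻¹
  convert this using 2 with x
  rw [gaussianPDFReal_std, mul_assoc, ← Real.exp_add]
  congr 2; ring

lemma integral_exp_sq_gaussian {s : ℝ} (hs : s < 1 / 2) :
    ∫ x, Real.exp (s * x ^ 2) ∂(gaussianReal 0 1) = (√(1 - 2 * s))⁻¹ := by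
  rw [integral_gaussian_eq]
  have h1 : ∀ x : ℝ, gaussianPDFReal 0 1 x * Real.exp (s * x ^ 2)
      = (√(2 * Real.pi))⁻¹ * Real.exp (-(1 / 2 - s) * x ^ 2) := by
    intro x
    rw [gaussianPDFReal_std, mul_assoc, ← Real.exp_add]
    congr 2; ring
  simp_rw [h1]
  rw [integral_const_mul, integral_gaussian]
  have h2 : Real.pi / (1 / 2 - s) = (2 * Real.pi) / (1 - 2 * s) := by
    have : (1 / 2 - s) ≠ 0 := by linarith
    have : (1 - 2 * s) ≠ 0 := by linarith
    field_simp
  rw [h2, Real.sqrt_div (by positivity), ← mul_div_assoc, inv_mul_cancel₀ (by positivity), one_div]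

/-! ### Linear functionals of a Gaussian vector and the adversarial risk -/

variable {p : ℕ}

section

variable {A : Matrix (Fin p) (Fin p) ℝ}

/-- A linear functional of a centered Gaussian vector is a scaled standard Gaussian. -/
lemma map_inner_multivariateGaussian (hA : A.PosSemidef) (w : Vec p) :
    (multivariateGaussian (0 : Vec p) A).map (fun x => inner ℝ x w)
      = (gaussianReal 0 1).map (fun g => wnorm A w * g) := by
  have h0 : (fun x : Vec p => inner ℝ x w) = ⇑(innerSL ℝ w) := by
    ext x; simp [real_inner_comm]
  rw [h0, IsGaussian.map_eq_gaussianReal, gaussianReal_map_const_mul]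
  have h1 : (multivariateGaussian (0 : Vec p) A)[⇑(innerSL ℝ w)] = 0 := by
    have := (innerSL ℝ w).integral_comp_comm
      (IsGaussian.integrable_id (μ := multivariateGaussian (0 : Vec p) A))
    simpa using this
  have h2 : Var[⇑(innerSL ℝ w); multivariateGaussian (0 : Vec p) A] = wnorm A w ^ 2 := by
    rw [wnorm_sq hA]
    have h3 := covarianceBilin_self (μ := multivariateGaussian (0 : Vec p) A)
      IsGaussian.memLp_two_id w
    rw [covarianceBilin_multivariateGaussian hA] at h3
    rw [inner_eq_dotProduct, mulV, h3]
    rfl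
  rw [h1, h2, mul_zero, mul_one]
  congr 1
  ext
  simp [Real.coe_toNNReal _ (sq_nonneg (wnorm A w))]

lemma integral_inner_multivariateGaussian (hA : A.PosSemidef) (w : Vec p) {f : ℝ → ℝ}
    (hf : Continuous f) :
    ∫ x, f (inner ℝ x w) ∂(multivariateGaussian (0 : Vec p) A)
      = ∫ g, f (wnorm A w * g) ∂(gaussianReal 0 1) := by
  have h := congrArg (fun μ => ∫ y, f y ∂μ) (map_inner_multivariateGaussian hA w)
  rwa [integral_map (by fun_prop) hf.aestronglyMeasurable,
    integral_map (by fun_prop) hf.aestronglyMeasurable] at h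

lemma integrable_inner_multivariateGaussian (hA : A.PosSemidef) (w : Vec p) {f : ℝ → ℝ}
    (hf : Continuous f) :
    Integrable (fun x => f (inner ℝ x w)) (multivariateGaussian (0 : Vec p) A)
      ↔ Integrable (fun g => f (wnorm A w * g)) (gaussianReal 0 1) := by
  have h := map_inner_multivariateGaussian hA w
  have e1 := integrable_map_measure (μ := multivariateGaussian (0 : Vec p) A)
    (f := fun x => inner ℝ x w) (g := f) hf.aestronglyMeasurable (by fun_prop)
  have e2 := integrable_map_measure (μ := gaussianReal 0 1)
    (f := fun g => wnorm A w * g) (g := f) hf.aestronglyMeasurable (by fun_prop)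
  rw [h] at e1
  exact (e1.symm.trans e2)

lemma integrable_inner_pow (hA : A.PosSemidef) (w : Vec p) (k : ℕ) :
    Integrable (fun x => inner ℝ x w ^ k) (multivariateGaussian (0 : Vec p) A) := by
  rw [integrable_inner_multivariateGaussian hA w (f := fun y => y ^ k) (by fun_prop)]
  simp_rw [mul_pow]
  exact (integrable_pow_gaussian k).const_mul _

lemma integral_inner_pow (hA : A.PosSemidef) (w : Vec p) (k : ℕ) :
    ∫ x, inner ℝ x w ^ k ∂(multivariateGaussian (0 : Vec p) A)
      = wnorm A w ^ k * ∫ g, g ^ k ∂(gaussianReal 0 1) := by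
  rw [integral_inner_multivariateGaussian hA w (f := fun y => y ^ k) (by fun_prop)]
  simp_rw [mul_pow]
  rw [integral_const_mul]

lemma integral_abs_inner (hA : A.PosSemidef) (w : Vec p) :
    ∫ x, |inner ℝ x w| ∂(multivariateGaussian (0 : Vec p) A) = c0 * wnorm A w := by
  rw [integral_inner_multivariateGaussian hA w (f := fun y => |y|) (by fun_prop)]
  simp_rw [abs_mul, abs_of_nonneg (wnorm_nonneg A w)]
  rw [integral_const_mul, integral_abs_gaussian, mul_comm]

/-- The inner maximization of the adversarial risk. -/
lemma sSup_sq_sub (θ θ₀ x : Vec p) {δ : ℝ} (hδ : 0 ≤ δ) :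
    sSup ((fun z : Vec p => (inner ℝ z θ - inner ℝ x θ₀) ^ 2) '' Metric.closedBall x δ)
      = (|inner ℝ x (θ - θ₀)| + δ * ‖θ‖) ^ 2 := by
  have hdec : ∀ z : Vec p, inner ℝ z θ - inner ℝ x θ₀
      = inner ℝ x (θ - θ₀) + inner ℝ (z - x) θ := by
    intro z; rw [inner_sub_right, inner_sub_left]; ring
  refine IsGreatest.csSup_eq ⟨?_, ?_⟩
  · rcases eq_or_ne θ 0 with h0 | h0
    · refine ⟨x, by simpa using hδ, ?_⟩
      simp [h0]
    have hn : 0 < ‖θ‖ := norm_pos_iff.mpr h0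
    obtain ⟨s, hs1, hs2⟩ : ∃ s : ℝ, |s| = 1 ∧ inner ℝ x (θ - θ₀) = s * |inner ℝ x (θ - θ₀)| := by
      rcases le_or_gt 0 (inner ℝ x (θ - θ₀)) with h | h
      · exact ⟨1, by simp, by rw [abs_of_nonneg h, one_mul]⟩
      · exact ⟨-1, by simp, by rw [abs_of_neg h]; ring⟩
    refine ⟨x + (s * δ / ‖θ‖) • θ, ?_, ?_⟩
    · rw [mem_closedBall_iff_norm, add_sub_cancel_left, norm_smul, Real.norm_eq_abs, abs_div,
        abs_mul, hs1, one_mul, abs_of_nonneg hδ, abs_of_pos hn, div_mul_cancel₀ _ hn.ne']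
    · simp only
      rw [hdec, add_sub_cancel_left, inner_smul_left, real_inner_self_eq_norm_sq]
      simp only [RCLike.conj_to_real]
      have : s * δ / ‖θ‖ * ‖θ‖ ^ 2 = s * (δ * ‖θ‖) := by field_simp
      rw [this]
      have hs3 : s ^ 2 = 1 := by rw [← sq_abs, hs1, one_pow]
      have : inner ℝ x (θ - θ₀) + s * (δ * ‖θ‖) = s * (|inner ℝ x (θ - θ₀)| + δ * ‖θ‖) := by
        conv_lhs => rw [hs2]
        ring
      rw [this, mul_pow, hs3, one_mul]
  · rintro _ ⟨z, hz, rfl⟩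
    rw [mem_closedBall_iff_norm] at hz
    simp only
    rw [hdec, ← sq_abs]
    have h1 := abs_add_le (inner ℝ x (θ - θ₀)) (inner ℝ (z - x) θ)
    have h2 := abs_real_inner_le_norm (z - x) θ
    have h3 := mul_le_mul_of_nonneg_right hz (norm_nonneg θ)
    exact pow_le_pow_left₀ (abs_nonneg _) (by linarith) 2

lemma advRisk_eq (hA : A.PosSemidef) (θ₀ θ : Vec p) {δ : ℝ} (hδ : 0 ≤ δ) :
    advRisk A θ₀ δ θ = advObj A θ₀ δ θ := by
  unfold advRisk
  simp_rw [sSup_sq_sub θ θ₀ _ hδ]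
  have h1 : ∀ x : Vec p, (|inner ℝ x (θ - θ₀)| + δ * ‖θ‖) ^ 2
      = inner ℝ x (θ - θ₀) ^ 2 + 2 * δ * ‖θ‖ * |inner ℝ x (θ - θ₀)| + δ ^ 2 * ‖θ‖ ^ 2 := by
    intro x; rw [← sq_abs (inner ℝ x (θ - θ₀))]; ring
  simp_rw [h1]
  have i1 := integrable_inner_pow hA (θ - θ₀) 2
  have i2 : Integrable (fun x => |inner ℝ x (θ - θ₀)|) (multivariateGaussian (0 : Vec p) A) := by
    have := (integrable_inner_pow hA (θ - θ₀) 1).abs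
    simpa using this
  have i3 : Integrable (fun x => inner ℝ x (θ - θ₀) ^ 2 + 2 * δ * ‖θ‖ * |inner ℝ x (θ - θ₀)|)
    (multivariateGaussian (0 : Vec p) A) := i1.add (i2.const_mul _)
  rw [integral_add i3 (integrable_const _),
    integral_add i1 (i2.const_mul _), integral_const_mul, integral_abs_inner hA,
    integral_inner_pow hA, integral_sq_gaussian]
  simp [advObj]
  ring

/-- The population target is the point of the path selected by the level `λ*`. -/
lemma thetaStar_eq {L : ℝ} (hL : 1 ≤ L) (hA : CovClass L⁻¹ L A) (θ₀ : Vec p) {δ : ℝ} (hδ : 0 ≤ δ) :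
    thetaStar A θ₀ δ = pathEst A θ₀ δ := by
  have hAp := hA.posDef (by positivity)
  have hex : ∃ θ : Vec p, ∀ θ' : Vec p, advRisk A θ₀ δ θ ≤ advRisk A θ₀ δ θ' := by
    refine ⟨pathEst A θ₀ δ, fun θ' => ?_⟩
    rw [advRisk_eq hAp.posSemidef _ _ hδ, advRisk_eq hAp.posSemidef _ _ hδ]
    exact pathEst_min hL hA θ₀ hδ θ'
  have h := Classical.epsilon_spec hex (pathEst A θ₀ δ)
  rw [advRisk_eq hAp.posSemidef _ _ hδ, advRisk_eq hAp.posSemidef _ _ hδ] at h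
  rcases eq_or_ne θ₀ 0 with rfl | h0
  · rw [pathEst_zero] at h ⊢
    have hc := c0_pos
    by_contra hne
    have hw := wnorm_pos hAp hne
    change advObj A 0 δ (thetaStar A 0 δ) ≤ _ at h
    simp only [advObj, sub_zero, wnorm_zero, norm_zero] at h
    have h2 := norm_nonneg (thetaStar A 0 δ)
    have h3 : 0 ≤ 2 * δ * c0 * wnorm A (thetaStar A 0 δ) * ‖thetaStar A 0 δ‖ := by positivity
    have h4 : 0 ≤ δ ^ 2 * ‖thetaStar A 0 δ‖ ^ 2 := by positivity
    nlinarith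
  · exact (nearCritical_pathEst hL hA h0 hδ).unique hL h

end

end AdvLinReg

namespace AdvLinReg

/-! ### Second and fourth moments of sums of independent centered vectors -/

section sums

variable {p : ℕ} {E : Type*} [MeasurableSpace E] {μ : Measure E} [IsProbabilityMeasure μ]

lemma integrable_norm_of_sq {ξ : E → Vec p} (hm : Measurable ξ)
    (h2 : Integrable (fun x => ‖ξ x‖ ^ 2) μ) : Integrable ξ μ := by
  refine Integrable.mono' ((integrable_const 1).add h2) hm.aestronglyMeasurable
    (ae_of_all _ fun x => ?_)
  simp only [Pi.add_apply]
  nlinarith [sq_nonneg (‖ξ x‖ - 1)]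

lemma integrable_norm_sq_of_four {ξ : E → Vec p} (hm : Measurable ξ)
    (h4 : Integrable (fun x => ‖ξ x‖ ^ 4) μ) : Integrable (fun x => ‖ξ x‖ ^ 2) μ := by
  refine Integrable.mono' ((integrable_const 1).add h4)
    (hm.norm.pow_const 2).aestronglyMeasurable (ae_of_all _ fun x => ?_)
  simp only [Pi.add_apply, Real.norm_eq_abs, abs_pow, abs_norm]
  nlinarith [sq_nonneg (‖ξ x‖ ^ 2 - 1)]

lemma lintegral_norm_const_add_sq {ξ : E → Vec p} (hm : Measurable ξ)
    (h2 : Integrable (fun x => ‖ξ x‖ ^ 2) μ) (h0 : ∫ x, ξ x ∂μ = 0) (s : Vec p) :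
    ∫⁻ x, ENNReal.ofReal (‖ξ x + s‖ ^ 2) ∂μ
      = ENNReal.ofReal (∫ x, ‖ξ x‖ ^ 2 ∂μ) + ENNReal.ofReal (‖s‖ ^ 2) := by
  have h1 := integrable_norm_of_sq hm h2
  have e : ∀ x, ‖ξ x + s‖ ^ 2 = (‖ξ x‖ ^ 2 + 2 * inner ℝ (ξ x) s) + ‖s‖ ^ 2 := fun x =>
    norm_add_sq_real _ _
  have i1 : Integrable (fun x => 2 * inner ℝ (ξ x) s) μ := (h1.inner_const s).const_mul 2
  have i2 : Integrable (fun x => ‖ξ x‖ ^ 2 + 2 * inner ℝ (ξ x) s) μ := h2.add i1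
  rw [← ofReal_integral_eq_lintegral_ofReal, ← ENNReal.ofReal_add
    (integral_nonneg fun _ => by positivity) (by positivity)]
  · congr 1
    simp_rw [e]
    rw [integral_add i2 (integrable_const _), integral_add h2 i1, integral_const_mul]
    have : ∫ x, inner ℝ (ξ x) s ∂μ = 0 := by
      simp_rw [real_inner_comm s]
      rw [integral_inner h1 s, h0, inner_zero_right]
    rw [this]; simp
  · simp_rw [e]
    exact i2.add (integrable_const _)
  · exact ae_of_all _ fun x => by positivity

lemma lintegral_norm_const_add_four {ξ : E → Vec p} (hm : Measurable ξ)
    (h4 : Integrable (fun x => ‖ξ x‖ ^ 4) μ) (h0 : ∫ x, ξ x ∂μ = 0) (s : Vec p) :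
    ∫⁻ x, ENNReal.ofReal (‖ξ x + s‖ ^ 4) ∂μ
      ≤ ENNReal.ofReal (8 * ∫ x, ‖ξ x‖ ^ 2 ∂μ) * ENNReal.ofReal (‖s‖ ^ 2)
        + ENNReal.ofReal (3 * ∫ x, ‖ξ x‖ ^ 4 ∂μ) + ENNReal.ofReal (‖s‖ ^ 4) := by
  have h2 := integrable_norm_sq_of_four hm h4
  have h1 := integrable_norm_of_sq hm h2
  have m2 : 0 ≤ ∫ x, ‖ξ x‖ ^ 2 ∂μ := integral_nonneg fun _ => by positivity
  have m4 : 0 ≤ ∫ x, ‖ξ x‖ ^ 4 ∂μ := integral_nonneg fun _ => by positivity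
  have e : ∀ x, ‖ξ x + s‖ ^ 4 ≤ ((8 * ‖s‖ ^ 2) * ‖ξ x‖ ^ 2 + (4 * ‖s‖ ^ 2) * inner ℝ (ξ x) s)
      + (3 * ‖ξ x‖ ^ 4 + ‖s‖ ^ 4) := by
    intro x
    have k1 : ‖ξ x + s‖ ^ 2 = ‖ξ x‖ ^ 2 + 2 * inner ℝ (ξ x) s + ‖s‖ ^ 2 := norm_add_sq_real _ _
    have k2 : inner ℝ (ξ x) s ^ 2 ≤ ‖ξ x‖ ^ 2 * ‖s‖ ^ 2 := by
      rw [← mul_pow, ← sq_abs]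
      exact pow_le_pow_left₀ (abs_nonneg _) (abs_real_inner_le_norm _ _) 2
    have k3 : ‖ξ x + s‖ ^ 4 = (‖ξ x + s‖ ^ 2) ^ 2 := by ring
    rw [k3, k1]
    nlinarith [sq_nonneg (inner ℝ (ξ x) s - ‖ξ x‖ ^ 2)]
  have i1 : Integrable (fun x => (4 * ‖s‖ ^ 2) * inner ℝ (ξ x) s) μ :=
    (h1.inner_const s).const_mul _
  have i2 : Integrable (fun x => (8 * ‖s‖ ^ 2) * ‖ξ x‖ ^ 2 + (4 * ‖s‖ ^ 2) * inner ℝ (ξ x) s) μ :=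
    (h2.const_mul _).add i1
  have i3 : Integrable (fun x => 3 * ‖ξ x‖ ^ 4 + ‖s‖ ^ 4) μ :=
    (h4.const_mul _).add (integrable_const _)
  have i4 : Integrable (fun x => ((8 * ‖s‖ ^ 2) * ‖ξ x‖ ^ 2 + (4 * ‖s‖ ^ 2) * inner ℝ (ξ x) s)
      + (3 * ‖ξ x‖ ^ 4 + ‖s‖ ^ 4)) μ := i2.add i3
  refine (lintegral_mono fun x => ENNReal.ofReal_le_ofReal (e x)).trans ?_
  rw [← ofReal_integral_eq_lintegral_ofReal i4
    (ae_of_all _ fun x => le_trans (by positivity) (e x)), ← ENNReal.ofReal_mul (by positivity),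
    ← ENNReal.ofReal_add (by positivity) (by positivity),
    ← ENNReal.ofReal_add (by positivity) (by positivity)]
  refine ENNReal.ofReal_le_ofReal (le_of_eq ?_)
  have h5 : ∫ x, inner ℝ (ξ x) s ∂μ = 0 := by
    simp_rw [real_inner_comm s]
    rw [integral_inner h1 s, h0, inner_zero_right]
  rw [integral_add i2 i3, integral_add (h2.const_mul _) i1,
    integral_add (h4.const_mul _) (integrable_const _), integral_const_mul, integral_const_mul,
    integral_const_mul, h5]
  simp
  ring

/-- The first coordinate of a product measure can be integrated out first. -/
lemma lintegral_pi_succ {n : ℕ} {f : (Fin (n + 1) → E) → ℝ≥0∞} (hf : Measurable f) :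
    ∫⁻ x, f x ∂(Measure.pi fun _ : Fin (n + 1) => μ)
      = ∫⁻ y, ∫⁻ x, f (Fin.cons x y) ∂μ ∂(Measure.pi fun _ : Fin n => μ) := by
  have h := measurePreserving_piFinSuccAbove (fun _ : Fin (n + 1) => μ) 0
  rw [← h.symm.lintegral_comp hf]
  change ∫⁻ z, f ((MeasurableEquiv.piFinSuccAbove (fun _ => E) 0).symm z)
    ∂(μ.prod (Measure.pi fun _ : Fin n => μ)) = _
  rw [lintegral_prod_symm]
  · refine lintegral_congr fun y => lintegral_congr fun x => ?_
    congr 1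
    exact Fin.insertNth_zero' x y
  · exact (hf.comp (MeasurableEquiv.measurable _)).aemeasurable

lemma lintegral_norm_sum_sq {n : ℕ} (φ : Fin n → E → Vec p) (hm : ∀ i, Measurable (φ i))
    (h2 : ∀ i, Integrable (fun x => ‖φ i x‖ ^ 2) μ) (h0 : ∀ i, ∫ x, φ i x ∂μ = 0) :
    ∫⁻ x, ENNReal.ofReal (‖∑ i, φ i (x i)‖ ^ 2) ∂(Measure.pi fun _ : Fin n => μ)
      = ENNReal.ofReal (∑ i, ∫ x, ‖φ i x‖ ^ 2 ∂μ) := by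
  induction n with
  | zero => simp
  | succ n ih =>
    rw [lintegral_pi_succ (by fun_prop)]
    simp only [Fin.sum_univ_succ, Fin.cons_zero, Fin.cons_succ]
    simp_rw [fun s => lintegral_norm_const_add_sq (hm 0) (h2 0) (h0 0) s]
    rw [lintegral_add_left measurable_const, lintegral_const, measure_univ, mul_one,
      ih (fun i => φ i.succ) (fun i => hm _) (fun i => h2 _) (fun i => h0 _),
      ENNReal.ofReal_add (integral_nonneg fun _ => by positivity)
        (Finset.sum_nonneg fun i _ => integral_nonneg fun _ => by positivity)]

lemma lintegral_norm_sum_four_le {n : ℕ} (φ : Fin n → E → Vec p) (hm : ∀ i, Measurable (φ i))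
    (h4 : ∀ i, Integrable (fun x => ‖φ i x‖ ^ 4) μ) (h0 : ∀ i, ∫ x, φ i x ∂μ = 0) :
    ∫⁻ x, ENNReal.ofReal (‖∑ i, φ i (x i)‖ ^ 4) ∂(Measure.pi fun _ : Fin n => μ)
      ≤ ENNReal.ofReal (4 * (∑ i, ∫ x, ‖φ i x‖ ^ 2 ∂μ) ^ 2 + 3 * ∑ i, ∫ x, ‖φ i x‖ ^ 4 ∂μ) := by
  induction n with
  | zero => simp
  | succ n ih =>
    have m2 : ∀ i, 0 ≤ ∫ x, ‖φ i x‖ ^ 2 ∂μ := fun i => integral_nonneg fun _ => by positivity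
    have m4 : ∀ i, 0 ≤ ∫ x, ‖φ i x‖ ^ 4 ∂μ := fun i => integral_nonneg fun _ => by positivity
    have s2 : 0 ≤ ∑ i : Fin n, ∫ x, ‖φ i.succ x‖ ^ 2 ∂μ := Finset.sum_nonneg fun i _ => m2 _
    have s4 : 0 ≤ ∑ i : Fin n, ∫ x, ‖φ i.succ x‖ ^ 4 ∂μ := Finset.sum_nonneg fun i _ => m4 _
    rw [lintegral_pi_succ (by fun_prop)]
    simp only [Fin.sum_univ_succ, Fin.cons_zero, Fin.cons_succ]
    refine (lintegral_mono fun y => lintegral_norm_const_add_four (hm 0) (h4 0) (h0 0) _).trans ?_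
    rw [lintegral_add_left (by fun_prop), lintegral_add_right _ measurable_const,
      lintegral_const_mul _ (by fun_prop),
      lintegral_norm_sum_sq (fun i => φ i.succ) (fun i => hm _)
        (fun i => integrable_norm_sq_of_four (hm _) (h4 _)) (fun i => h0 _),
      lintegral_const, measure_univ, mul_one]
    refine (add_le_add le_rfl
      (ih (fun i => φ i.succ) (fun i => hm _) (fun i => h4 _) (fun i => h0 _))).trans ?_
    rw [← ENNReal.ofReal_mul (mul_nonneg (by norm_num) (m2 0)),
      ← ENNReal.ofReal_add (mul_nonneg (mul_nonneg (by norm_num) (m2 0)) s2)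
        (mul_nonneg (by norm_num) (m4 0)),
      ← ENNReal.ofReal_add]
    · refine ENNReal.ofReal_le_ofReal ?_
      nlinarith [sq_nonneg (∫ x, ‖φ 0 x‖ ^ 2 ∂μ)]
    · exact add_nonneg (mul_nonneg (mul_nonneg (by norm_num) (m2 0)) s2)
        (mul_nonneg (by norm_num) (m4 0))
    · exact add_nonneg (mul_nonneg (by norm_num) (sq_nonneg _)) (mul_nonneg (by norm_num) s4)

end sums

end AdvLinReg

namespace AdvLinReg

/-! ### Moments of quadratic functions of a Gaussian vector -/

section quad

variable {p : ℕ} {A : Matrix (Fin p) (Fin p) ℝ}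

/-- `f` is integrable with integral `I`. -/
def HasInt {E : Type*} [MeasurableSpace E] (μ : Measure E) (f : E → ℝ) (I : ℝ) : Prop :=
  Integrable f μ ∧ ∫ x, f x ∂μ = I

lemma HasInt.add {E : Type*} [MeasurableSpace E] {μ : Measure E} {f g : E → ℝ} {I J : ℝ}
    (hf : HasInt μ f I) (hg : HasInt μ g J) : HasInt μ (fun x => f x + g x) (I + J) :=
  ⟨hf.1.add hg.1, by rw [integral_add hf.1 hg.1, hf.2, hg.2]⟩

lemma HasInt.const_mul {E : Type*} [MeasurableSpace E] {μ : Measure E} {f : E → ℝ} {I : ℝ}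
    (hf : HasInt μ f I) (c : ℝ) : HasInt μ (fun x => c * f x) (c * I) :=
  ⟨hf.1.const_mul c, by rw [integral_const_mul, hf.2]⟩

lemma hasInt_const {E : Type*} [MeasurableSpace E] (μ : Measure E) [IsProbabilityMeasure μ]
    (c : ℝ) : HasInt μ (fun _ => c) c := ⟨integrable_const c, by simp⟩

lemma HasInt.congr {E : Type*} [MeasurableSpace E] {μ : Measure E} {f g : E → ℝ} {I J : ℝ}
    (hf : HasInt μ f I) (h : ∀ x, g x = f x) (hIJ : J = I) : HasInt μ g J := by
  have : g = f := funext h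
  rw [this, hIJ]; exact hf

lemma hasInt_sum {E ι : Type*} [MeasurableSpace E] {μ : Measure E} (s : Finset ι)
    {f : ι → E → ℝ} {I : ι → ℝ} (h : ∀ i ∈ s, HasInt μ (f i) (I i)) :
    HasInt μ (fun x => ∑ i ∈ s, f i x) (∑ i ∈ s, I i) :=
  ⟨integrable_finsetSum _ fun i hi => (h i hi).1, by
    rw [integral_finsetSum _ fun i hi => (h i hi).1]
    exact Finset.sum_congr rfl fun i hi => (h i hi).2⟩

lemma hasInt_inner (hA : A.PosSemidef) (w : Vec p) :
    HasInt (multivariateGaussian (0 : Vec p) A) (fun x => inner ℝ x w) 0 := by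
  have h := integral_inner_pow hA w 1
  have h' := integrable_inner_pow hA w 1
  simp only [pow_one, integral_id_gaussianReal, mul_zero] at h h'
  exact ⟨h', h⟩

lemma hasInt_inner_sq (hA : A.PosSemidef) (w : Vec p) :
    HasInt (multivariateGaussian (0 : Vec p) A) (fun x => inner ℝ x w ^ 2)
      (inner ℝ w (mulV A w)) :=
  ⟨integrable_inner_pow hA w 2, by
    rw [integral_inner_pow hA w 2, integral_sq_gaussian, mul_one, wnorm_sq hA]⟩

lemma hasInt_inner_cube (hA : A.PosSemidef) (w : Vec p) :
    HasInt (multivariateGaussian (0 : Vec p) A) (fun x => inner ℝ x w ^ 3) 0 :=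
  ⟨integrable_inner_pow hA w 3, by
    rw [integral_inner_pow hA w 3, integral_pow_gaussian_succ 1]
    simp⟩

lemma hasInt_inner_four (hA : A.PosSemidef) (w : Vec p) :
    HasInt (multivariateGaussian (0 : Vec p) A) (fun x => inner ℝ x w ^ 4)
      (3 * inner ℝ w (mulV A w) ^ 2) :=
  ⟨integrable_inner_pow hA w 4, by
    rw [integral_inner_pow hA w 4, integral_pow_four_gaussian, ← wnorm_sq hA]; ring⟩

lemma hasInt_inner_eight (hA : A.PosSemidef) (w : Vec p) :
    HasInt (multivariateGaussian (0 : Vec p) A) (fun x => inner ℝ x w ^ 8)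
      (105 * inner ℝ w (mulV A w) ^ 4) :=
  ⟨integrable_inner_pow hA w 8, by
    rw [integral_inner_pow hA w 8, integral_pow_eight_gaussian, ← wnorm_sq hA]; ring⟩

lemma inner_mulV_add (hA : A.PosSemidef) (u w : Vec p) :
    inner ℝ (u + w) (mulV A (u + w))
      = inner ℝ u (mulV A u) + 2 * inner ℝ u (mulV A w) + inner ℝ w (mulV A w) := by
  have : inner ℝ w (mulV A u) = inner ℝ u (mulV A w) := by
    rw [real_inner_comm, inner_mulV_comm (PosSemidef.transpose_eq hA)]
  rw [mulV_add, inner_add_left, inner_add_right, inner_add_right, this]; ring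

lemma inner_mulV_sub (hA : A.PosSemidef) (u w : Vec p) :
    inner ℝ (u - w) (mulV A (u - w))
      = inner ℝ u (mulV A u) - 2 * inner ℝ u (mulV A w) + inner ℝ w (mulV A w) := by
  rw [sub_eq_add_neg, inner_mulV_add hA, mulV_neg, inner_neg_neg, inner_neg_right]; ring

/-- Mixed Gaussian moments, by polarization of the pure ones. -/
lemma hasInt_inner_mul_inner (hA : A.PosSemidef) (u w : Vec p) :
    HasInt (multivariateGaussian (0 : Vec p) A) (fun x => inner ℝ x u * inner ℝ x w)
      (inner ℝ u (mulV A w)) := by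
  refine (((hasInt_inner_sq hA (u + w)).const_mul (1 / 4)).add
    ((hasInt_inner_sq hA (u - w)).const_mul (-1 / 4))).congr (fun x => ?_) ?_
  · rw [inner_add_right, inner_sub_right]; ring
  · rw [inner_mulV_add hA, inner_mulV_sub hA]; ring

lemma hasInt_inner_mul_inner_sq (hA : A.PosSemidef) (u w : Vec p) :
    HasInt (multivariateGaussian (0 : Vec p) A) (fun x => inner ℝ x u * inner ℝ x w ^ 2) 0 := by
  refine ((((hasInt_inner_cube hA (u + w)).const_mul (1 / 6)).add
    ((hasInt_inner_cube hA (u - w)).const_mul (1 / 6))).add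
    ((hasInt_inner_cube hA u).const_mul (-1 / 3))).congr (fun x => ?_) (by ring)
  rw [inner_add_right, inner_sub_right]; ring

lemma hasInt_inner_sq_mul_inner_sq (hA : A.PosSemidef) (u w : Vec p) :
    HasInt (multivariateGaussian (0 : Vec p) A) (fun x => inner ℝ x u ^ 2 * inner ℝ x w ^ 2)
      (inner ℝ u (mulV A u) * inner ℝ w (mulV A w) + 2 * inner ℝ u (mulV A w) ^ 2) := by
  refine (((((hasInt_inner_four hA (u + w)).const_mul (1 / 12)).add
    ((hasInt_inner_four hA (u - w)).const_mul (1 / 12))).add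
    ((hasInt_inner_four hA u).const_mul (-1 / 6))).add
    ((hasInt_inner_four hA w).const_mul (-1 / 6))).congr (fun x => ?_) ?_
  · rw [inner_add_right, inner_sub_right]; ring
  · rw [inner_mulV_add hA, inner_mulV_sub hA]; ring

/-- Second moment of the centered product of two affine functionals. -/
lemma hasInt_sq_affine (hA : A.PosSemidef) (u w : Vec p) (e : ℝ) :
    HasInt (multivariateGaussian (0 : Vec p) A)
      (fun x => ((inner ℝ x u + e) * inner ℝ x w - inner ℝ u (mulV A w)) ^ 2)
      ((inner ℝ u (mulV A u) + e ^ 2) * inner ℝ w (mulV A w) + inner ℝ u (mulV A w) ^ 2) := by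
  refine ((((((hasInt_inner_sq_mul_inner_sq hA u w).add
    ((hasInt_inner_mul_inner_sq hA u w).const_mul (2 * e))).add
    ((hasInt_inner_sq hA w).const_mul (e ^ 2))).add
    ((hasInt_inner_mul_inner hA u w).const_mul (-2 * inner ℝ u (mulV A w)))).add
    ((hasInt_inner hA w).const_mul (-2 * inner ℝ u (mulV A w) * e))).add
    (hasInt_const _ (inner ℝ u (mulV A w) ^ 2))).congr (fun x => ?_) ?_
  · ring
  · ring

/-- The projection off the direction `d`, for `‖d‖ = 1`, and the identity for `d = 0`. -/
noncomputable def offProj (d x : Vec p) : Vec p := x - inner ℝ x d • d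

lemma inner_offProj_left (d x y : Vec p) : inner ℝ (offProj d x) y = inner ℝ x (offProj d y) := by
  simp only [offProj, inner_sub_left, inner_sub_right, inner_smul_left, inner_smul_right,
    RCLike.conj_to_real]
  rw [real_inner_comm d y, real_inner_comm y d]; ring

lemma offProj_add (d x y : Vec p) : offProj d (x + y) = offProj d x + offProj d y := by
  simp only [offProj, inner_add_left, add_smul]; abel

lemma offProj_smul (d : Vec p) (c : ℝ) (x : Vec p) : offProj d (c • x) = c • offProj d x := by
  simp only [offProj, inner_smul_left, smul_sub, smul_smul, RCLike.conj_to_real]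

@[simp] lemma offProj_zero_left (x : Vec p) : offProj 0 x = x := by simp [offProj]

lemma norm_offProj_sq {d : Vec p} (hd : ‖d‖ = 1 ∨ d = 0) (x : Vec p) :
    ‖offProj d x‖ ^ 2 = ‖x‖ ^ 2 - inner ℝ x d ^ 2 := by
  rcases hd with hd | rfl
  · rw [offProj, norm_sub_sq_real, inner_smul_right, norm_smul, hd, mul_one, Real.norm_eq_abs,
      sq_abs]
    ring
  · simp

lemma norm_offProj_le {d : Vec p} (hd : ‖d‖ = 1 ∨ d = 0) (x : Vec p) : ‖offProj d x‖ ≤ ‖x‖ := by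
  refine abs_le_of_sq_le_sq' ?_ (norm_nonneg _) |>.2
  rw [norm_offProj_sq hd]; nlinarith [sq_nonneg (inner ℝ x d)]

lemma continuous_offProj (d : Vec p) : Continuous (offProj d) := by
  unfold offProj; fun_prop

/-- The coordinate vectors. -/
noncomputable def unitVec (j : Fin p) : Vec p := EuclideanSpace.single j (1 : ℝ)

lemma inner_unitVec (x : Vec p) (j : Fin p) : inner ℝ x (unitVec j) = x j := by
  simp [unitVec, EuclideanSpace.inner_single_right]

lemma norm_unitVec (j : Fin p) : ‖(unitVec j : Vec p)‖ = 1 := by simp [unitVec]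

lemma norm_sq_eq_sum_unitVec (x : Vec p) : ‖x‖ ^ 2 = ∑ j, inner ℝ x (unitVec j) ^ 2 := by
  simp_rw [inner_unitVec]
  exact EuclideanSpace.real_norm_sq_eq x

lemma sum_norm_offProj_unitVec {d : Vec p} (hd : ‖d‖ = 1 ∨ d = 0) :
    ∑ j, ‖offProj d (unitVec j : Vec p)‖ ^ 2 = p - ‖d‖ ^ 2 := by
  simp_rw [norm_offProj_sq hd, norm_unitVec]
  rw [Finset.sum_sub_distrib, norm_sq_eq_sum_unitVec d]
  simp [real_inner_comm]

/-- The centered vector `(⟨x, u⟩ + e) x - A u`, projected off `d`. -/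
noncomputable def quadVec (A : Matrix (Fin p) (Fin p) ℝ) (d u : Vec p) (e : ℝ) (x : Vec p) :
    Vec p := offProj d ((inner ℝ x u + e) • x - mulV A u)

lemma continuous_quadVec (A : Matrix (Fin p) (Fin p) ℝ) (d u : Vec p) (e : ℝ) :
    Continuous (quadVec A d u e) := (continuous_offProj d).comp (by fun_prop)

lemma inner_quadVec (hA : A.PosSemidef) (d u : Vec p) (e : ℝ) (x w : Vec p) :
    inner ℝ (quadVec A d u e x) w = (inner ℝ x u + e) * inner ℝ x (offProj d w)
      - inner ℝ u (mulV A (offProj d w)) := by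
  rw [quadVec, inner_offProj_left, inner_sub_left, inner_smul_left,
    inner_mulV_comm (PosSemidef.transpose_eq hA)]
  simp

lemma hasInt_norm_quadVec_sq (hA : A.PosSemidef) (d u : Vec p) (e : ℝ) :
    HasInt (multivariateGaussian (0 : Vec p) A) (fun x => ‖quadVec A d u e x‖ ^ 2)
      (∑ j, ((inner ℝ u (mulV A u) + e ^ 2)
        * inner ℝ (offProj d (unitVec j)) (mulV A (offProj d (unitVec j)))
        + inner ℝ u (mulV A (offProj d (unitVec j))) ^ 2)) := by
  refine (hasInt_sum Finset.univ fun j _ => hasInt_sq_affine hA u (offProj d (unitVec j)) e).congr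
    (fun x => ?_) rfl
  rw [norm_sq_eq_sum_unitVec]
  exact Finset.sum_congr rfl fun j _ => by rw [inner_quadVec hA]

lemma integral_quadVec (hA : A.PosSemidef) (d u : Vec p) (e : ℝ) :
    ∫ x, quadVec A d u e x ∂(multivariateGaussian (0 : Vec p) A) = 0 := by
  have hi : Integrable (quadVec A d u e) (multivariateGaussian (0 : Vec p) A) :=
    integrable_norm_of_sq (continuous_quadVec A d u e).measurable (hasInt_norm_quadVec_sq hA d u e).1
  refine ext_inner_left ℝ fun w => ?_
  rw [← integral_inner hi w, inner_zero_right]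
  have h : HasInt (multivariateGaussian (0 : Vec p) A) (fun x => inner ℝ w (quadVec A d u e x)) 0 := by
    refine (((hasInt_inner_mul_inner hA u (offProj d w)).add
      ((hasInt_inner hA (offProj d w)).const_mul e)).add
      (hasInt_const _ (-inner ℝ u (mulV A (offProj d w))))).congr (fun x => ?_) (by ring)
    rw [real_inner_comm, inner_quadVec hA]; ring
  exact h.2

variable {L : ℝ}

lemma integral_norm_quadVec_sq_ge (hL : 1 ≤ L) (hA : CovClass L⁻¹ L A) {d : Vec p}
    (hd : ‖d‖ = 1 ∨ d = 0) (u : Vec p) (e : ℝ) :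
    (wnorm A u ^ 2 + e ^ 2) * (L⁻¹ * (p - ‖d‖ ^ 2))
      ≤ ∫ x, ‖quadVec A d u e x‖ ^ 2 ∂(multivariateGaussian (0 : Vec p) A) := by
  have hps := (hA.posDef (by positivity)).posSemidef
  rw [(hasInt_norm_quadVec_sq hps d u e).2, ← sum_norm_offProj_unitVec hd, wnorm_sq hps,
    Finset.mul_sum, Finset.mul_sum]
  refine Finset.sum_le_sum fun j _ => ?_
  have h1 := hA.le_inner (offProj d (unitVec j))
  have h2 := PosSemidef.inner_mulV_nonneg hps u
  have h3 := mul_le_mul_of_nonneg_left h1 (add_nonneg h2 (sq_nonneg e))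
  nlinarith [sq_nonneg (inner ℝ u (mulV A (offProj d (unitVec j))))]

lemma integral_norm_quadVec_sq_le (hL : 1 ≤ L) (hA : CovClass L⁻¹ L A) {d : Vec p}
    (hd : ‖d‖ = 1 ∨ d = 0) (u : Vec p) (e : ℝ) :
    ∫ x, ‖quadVec A d u e x‖ ^ 2 ∂(multivariateGaussian (0 : Vec p) A)
      ≤ 2 * L ^ 2 * p * (‖u‖ ^ 2 + e ^ 2) := by
  have hL0 : 0 < L := by linarith
  have hps := (hA.posDef (by positivity)).posSemidef
  rw [(hasInt_norm_quadVec_sq hps d u e).2]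
  have h : ∀ j : Fin p, (inner ℝ u (mulV A u) + e ^ 2)
        * inner ℝ (offProj d (unitVec j)) (mulV A (offProj d (unitVec j)))
        + inner ℝ u (mulV A (offProj d (unitVec j))) ^ 2 ≤ 2 * L ^ 2 * (‖u‖ ^ 2 + e ^ 2) := by
    intro j
    set w := offProj d (unitVec j : Vec p)
    have h1 : ‖w‖ ^ 2 ≤ 1 := by
      have := norm_offProj_le hd (unitVec j)
      rw [norm_unitVec] at this
      exact pow_le_one₀ (norm_nonneg _) this
    have h2 := hA.inner_le w
    have h3 := hA.inner_le u
    have h4 : inner ℝ u (mulV A w) ^ 2 ≤ inner ℝ u (mulV A u) * inner ℝ w (mulV A w) := by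
      rw [← wnorm_sq hps, ← wnorm_sq hps, ← mul_pow, sq_le_sq,
        abs_of_nonneg (mul_nonneg (wnorm_nonneg A u) (wnorm_nonneg A w)), abs_le]
      have k1 := inner_mulV_le hps u w
      have k2 := inner_mulV_le hps (-u) w
      rw [inner_neg_left, wnorm_neg] at k2
      constructor <;> linarith
    have n1 := PosSemidef.inner_mulV_nonneg hps u
    have n2 := PosSemidef.inner_mulV_nonneg hps w
    have h5 : inner ℝ w (mulV A w) ≤ L := by nlinarith
    have h6 : inner ℝ u (mulV A u) * inner ℝ w (mulV A w) ≤ L * ‖u‖ ^ 2 * L := by gcongr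
    have h7 : e ^ 2 * inner ℝ w (mulV A w) ≤ e ^ 2 * L := by gcongr
    have h8 : e ^ 2 * L ≤ 2 * L ^ 2 * e ^ 2 := by
      rw [mul_comm]
      exact mul_le_mul_of_nonneg_right (by nlinarith) (sq_nonneg e)
    nlinarith
  refine (Finset.sum_le_sum fun j _ => h j).trans (le_of_eq ?_)
  simp; ring

lemma norm_four_le (x : Vec p) : ‖x‖ ^ 4 ≤ p * ∑ j, inner ℝ x (unitVec j) ^ 4 := by
  have h := sq_sum_le_card_mul_sum_sq (s := Finset.univ)
    (f := fun j : Fin p => inner ℝ x (unitVec j) ^ 2)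
  rw [← norm_sq_eq_sum_unitVec] at h
  simp only [Finset.card_univ, Fintype.card_fin] at h
  calc ‖x‖ ^ 4 = (‖x‖ ^ 2) ^ 2 := by ring
    _ ≤ _ := h
    _ = _ := by congr 1; exact Finset.sum_congr rfl fun j _ => by ring

/-- The fourth moment is of the order of the square of the second one. -/
lemma integral_norm_quadVec_four_le (hL : 1 ≤ L) (hA : CovClass L⁻¹ L A) {d : Vec p}
    (hd : ‖d‖ = 1 ∨ d = 0) (u : Vec p) (e : ℝ) :
    Integrable (fun x => ‖quadVec A d u e x‖ ^ 4) (multivariateGaussian (0 : Vec p) A) ∧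
    ∫ x, ‖quadVec A d u e x‖ ^ 4 ∂(multivariateGaussian (0 : Vec p) A)
      ≤ 7000 * L ^ 8 * p ^ 2 * (‖u‖ ^ 4 + e ^ 4) := by
  have hL0 : 0 < L := by linarith
  have hps := (hA.posDef (by positivity)).posSemidef
  set γ := multivariateGaussian (0 : Vec p) A
  -- the vector is dominated by the unprojected one, and mixed moments by pure ones
  have hdom : ∀ x : Vec p, ‖quadVec A d u e x‖ ^ 4 ≤ ∑ j, p * (32 * (‖u‖⁻¹ ^ 4 * inner ℝ x u ^ 8
      + ‖u‖ ^ 4 * inner ℝ x (unitVec j) ^ 8) + 64 * (e ^ 4 * inner ℝ x (unitVec j) ^ 4))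
      + 8 * (L * ‖u‖) ^ 4 := by
    intro x
    set α := inner ℝ x u
    have k1 : ‖quadVec A d u e x‖ ≤ |α + e| * ‖x‖ + L * ‖u‖ := by
      refine (norm_offProj_le hd _).trans ((norm_sub_le _ _).trans (add_le_add ?_ ?_))
      · rw [norm_smul, Real.norm_eq_abs]
      · exact hA.norm_mulV_le hL u
    have k2 : ∀ a b : ℝ, (a + b) ^ 4 ≤ 8 * (a ^ 4 + b ^ 4) := by
      intro a b
      nlinarith [sq_nonneg (a - b), sq_nonneg (a + b), sq_nonneg (a ^ 2 - b ^ 2), sq_nonneg (a * b),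
        mul_nonneg (sq_nonneg (a - b)) (sq_nonneg (a + b)), mul_nonneg (sq_nonneg (a - b))
        (sq_nonneg (a - b)), sq_nonneg ((a - b) ^ 2)]
    have k3 : ‖quadVec A d u e x‖ ^ 4 ≤ 8 * ((|α + e| * ‖x‖) ^ 4 + (L * ‖u‖) ^ 4) :=
      (pow_le_pow_left₀ (norm_nonneg _) k1 4).trans (k2 _ _)
    have k4 : (|α + e| * ‖x‖) ^ 4 ≤ 8 * (α ^ 4 + e ^ 4) * (p * ∑ j, inner ℝ x (unitVec j) ^ 4) := by
      rw [mul_pow, show |α + e| ^ 4 = (α + e) ^ 4 from by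
        rw [show (4 : ℕ) = 2 * 2 from rfl, pow_mul, sq_abs, ← pow_mul]]
      exact mul_le_mul (k2 _ _) (norm_four_le x) (by positivity) (by positivity)
    have k5 : ∀ j : Fin p, α ^ 4 * inner ℝ x (unitVec j) ^ 4
        ≤ (‖u‖⁻¹ ^ 4 * α ^ 8 + ‖u‖ ^ 4 * inner ℝ x (unitVec j) ^ 8) / 2 := by
      intro j
      set b := inner ℝ x (unitVec j : Vec p)
      rcases eq_or_ne u 0 with h0 | h0
      · have : α = 0 := by simp [α, h0]
        rw [this, h0]; simp
      · have hn : 0 < ‖u‖ := norm_pos_iff.mpr h0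
        have e1 : α ^ 4 * b ^ 4 = (‖u‖⁻¹ ^ 2 * α ^ 4) * (‖u‖ ^ 2 * b ^ 4) := by
          field_simp
        have := two_mul_le_add_sq (‖u‖⁻¹ ^ 2 * α ^ 4) (‖u‖ ^ 2 * b ^ 4)
        rw [e1]
        nlinarith
    have k6 : ∑ j : Fin p, α ^ 4 * inner ℝ x (unitVec j : Vec p) ^ 4
        ≤ ∑ j : Fin p, (‖u‖⁻¹ ^ 4 * α ^ 8 + ‖u‖ ^ 4 * inner ℝ x (unitVec j) ^ 8) / 2 :=
      Finset.sum_le_sum fun j _ => k5 j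
    calc ‖quadVec A d u e x‖ ^ 4
        ≤ 8 * (8 * (α ^ 4 + e ^ 4) * (p * ∑ j, inner ℝ x (unitVec j) ^ 4) + (L * ‖u‖) ^ 4) :=
          k3.trans (by gcongr)
      _ = p * (64 * (∑ j : Fin p, α ^ 4 * inner ℝ x (unitVec j : Vec p) ^ 4)
          + 64 * ∑ j : Fin p, e ^ 4 * inner ℝ x (unitVec j : Vec p) ^ 4) + 8 * (L * ‖u‖) ^ 4 := by
          rw [← Finset.mul_sum, ← Finset.mul_sum]; ring
      _ ≤ p * (64 * (∑ j : Fin p, (‖u‖⁻¹ ^ 4 * α ^ 8 + ‖u‖ ^ 4 * inner ℝ x (unitVec j) ^ 8) / 2)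
          + 64 * ∑ j : Fin p, e ^ 4 * inner ℝ x (unitVec j : Vec p) ^ 4) + 8 * (L * ‖u‖) ^ 4 := by
          gcongr
      _ = _ := by
          rw [Finset.mul_sum, Finset.mul_sum, ← Finset.sum_add_distrib, Finset.mul_sum]
          congr 1
          exact Finset.sum_congr rfl fun j _ => by ring
  have hI := (hasInt_sum (μ := γ) Finset.univ fun (j : Fin p) _ =>
    ((((((hasInt_inner_eight hps u).const_mul (‖u‖⁻¹ ^ 4)).add
      ((hasInt_inner_eight hps (unitVec j)).const_mul (‖u‖ ^ 4))).const_mul 32).add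
      (((hasInt_inner_four hps (unitVec j)).const_mul (e ^ 4)).const_mul 64)).const_mul
      (p : ℝ))).add (hasInt_const γ (8 * (L * ‖u‖) ^ 4))
  have hint : Integrable (fun x => ‖quadVec A d u e x‖ ^ 4) γ := by
    refine hI.1.mono' ((continuous_quadVec A d u e).norm.pow 4).aestronglyMeasurable
      (ae_of_all _ fun x => ?_)
    rw [Real.norm_of_nonneg (by positivity)]
    exact hdom x
  refine ⟨hint, ?_⟩
  refine (integral_mono hint hI.1 hdom).trans ?_
  rw [hI.2]
  have hp : ∀ j : Fin p, (p : ℝ) * (32 * (‖u‖⁻¹ ^ 4 * (105 * inner ℝ u (mulV A u) ^ 4)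
      + ‖u‖ ^ 4 * (105 * inner ℝ (unitVec j) (mulV A (unitVec j)) ^ 4))
      + 64 * (e ^ 4 * (3 * inner ℝ (unitVec j) (mulV A (unitVec j)) ^ 2)))
      ≤ p * (6720 * L ^ 8 * ‖u‖ ^ 4 + 192 * L ^ 8 * e ^ 4) := by
    intro j
    have h2 := hA.inner_le (unitVec j)
    rw [norm_unitVec, one_pow, mul_one] at h2
    have h3 := hA.inner_le u
    have n1 := PosSemidef.inner_mulV_nonneg hps u
    have n2 := PosSemidef.inner_mulV_nonneg hps (unitVec j)
    have e1 : ‖u‖⁻¹ ^ 4 * inner ℝ u (mulV A u) ^ 4 ≤ L ^ 4 * ‖u‖ ^ 4 := by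
      rcases eq_or_ne u 0 with h0 | h0
      · simp [h0]
      · have hn : 0 < ‖u‖ := norm_pos_iff.mpr h0
        calc ‖u‖⁻¹ ^ 4 * inner ℝ u (mulV A u) ^ 4 ≤ ‖u‖⁻¹ ^ 4 * (L * ‖u‖ ^ 2) ^ 4 := by gcongr
          _ = _ := by field_simp
    have e2 : inner ℝ (unitVec j) (mulV A (unitVec j)) ^ 4 ≤ L ^ 4 := by gcongr
    have e3 : inner ℝ (unitVec j) (mulV A (unitVec j)) ^ 2 ≤ L ^ 2 := by gcongr
    have l4 : L ^ 4 ≤ L ^ 8 := pow_le_pow_right₀ hL (by norm_num)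
    have l2 : L ^ 2 ≤ L ^ 8 := pow_le_pow_right₀ hL (by norm_num)
    have e4 : ‖u‖ ^ 4 * inner ℝ (unitVec j) (mulV A (unitVec j)) ^ 4 ≤ ‖u‖ ^ 4 * L ^ 8 := by
      gcongr; exact e2.trans l4
    have e5 : e ^ 4 * inner ℝ (unitVec j) (mulV A (unitVec j)) ^ 2 ≤ e ^ 4 * L ^ 8 := by
      gcongr; exact e3.trans l2
    have e6 : L ^ 4 * ‖u‖ ^ 4 ≤ L ^ 8 * ‖u‖ ^ 4 := by gcongr
    refine mul_le_mul_of_nonneg_left ?_ (by positivity)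
    linarith
  refine (add_le_add (Finset.sum_le_sum fun j _ => hp j) le_rfl).trans ?_
  rw [Finset.sum_const, Finset.card_univ, Fintype.card_fin, nsmul_eq_mul]
  have l4 : L ^ 4 ≤ L ^ 8 := pow_le_pow_right₀ hL (by norm_num)
  have n8 : 0 ≤ L ^ 8 * e ^ 4 := by positivity
  rcases Nat.eq_zero_or_pos p with h0 | h0
  · subst h0
    have : u = 0 := Subsingleton.elim _ _
    simp [this]
  · have hp1 : (1 : ℝ) ≤ (p : ℝ) ^ 2 := one_le_pow₀ (by exact_mod_cast h0)
    have q1 : (L * ‖u‖) ^ 4 ≤ p ^ 2 * (L ^ 8 * ‖u‖ ^ 4) := by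
      calc (L * ‖u‖) ^ 4 = 1 * (L ^ 4 * ‖u‖ ^ 4) := by ring
        _ ≤ p ^ 2 * (L ^ 8 * ‖u‖ ^ 4) := by gcongr
    have q2 : 0 ≤ (p : ℝ) ^ 2 * (L ^ 8 * e ^ 4) := by positivity
    have q3 : 0 ≤ (p : ℝ) ^ 2 * (L ^ 8 * ‖u‖ ^ 4) := by positivity
    nlinarith

end quad

end AdvLinReg

namespace AdvLinReg

/-! ### The sample covariance matrix and the score -/

section score

variable {p n : ℕ}

/-- The sample covariance matrix `(1/n) ∑ᵢ xᵢ xᵢᵀ` of the covariates. -/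
noncomputable def gram (X : Fin n → Vec p) : Matrix (Fin p) (Fin p) ℝ :=
  (1 / (n : ℝ)) • ((Matrix.of fun i j => X i j)ᵀ * (Matrix.of fun i j => X i j))

/-- The average `(1/n) ∑ᵢ eᵢ xᵢ`. -/
noncomputable def crossAvg (X : Fin n → Vec p) (e : Fin n → ℝ) : Vec p :=
  (1 / (n : ℝ)) • ∑ i, e i • X i

/-- The average `(1/n) ∑ᵢ eᵢ²`. -/
noncomputable def avgSq (e : Fin n → ℝ) : ℝ := (1 / (n : ℝ)) * ∑ i, e i ^ 2

/-- The law of `n` independent centered Gaussian vectors. -/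
noncomputable def rowLaw (n : ℕ) (A : Matrix (Fin p) (Fin p) ℝ) : Measure (Fin n → Vec p) :=
  Measure.pi fun _ => multivariateGaussian (0 : Vec p) A

instance (A : Matrix (Fin p) (Fin p) ℝ) : IsProbabilityMeasure (rowLaw n A) := by
  unfold rowLaw; infer_instance

lemma avgSq_nonneg (e : Fin n → ℝ) : 0 ≤ avgSq e := by unfold avgSq; positivity

lemma mulV_gram (X : Fin n → Vec p) (u : Vec p) :
    mulV (gram X) u = (1 / (n : ℝ)) • ∑ i, inner ℝ (X i) u • X i := by
  unfold gram
  rw [smul_mulV]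
  congr 1
  unfold mulV
  rw [← Matrix.mulVec_mulVec]
  ext j
  simp only [Matrix.mulVec, dotProduct, Matrix.transpose_apply, Matrix.of_apply,
    WithLp.ofLp_sum, WithLp.ofLp_smul, Finset.sum_apply, Pi.smul_apply, smul_eq_mul,
    inner_eq_dotProduct]
  exact Finset.sum_congr rfl fun i _ => mul_comm _ _

lemma inner_mulV_gram (X : Fin n → Vec p) (v u : Vec p) :
    inner ℝ v (mulV (gram X) u) = (1 / (n : ℝ)) * ∑ i, inner ℝ (X i) u * inner ℝ (X i) v := by
  rw [mulV_gram, inner_smul_right, inner_sum]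
  congr 1
  exact Finset.sum_congr rfl fun i _ => by rw [inner_smul_right, real_inner_comm v]

lemma gram_transpose (X : Fin n → Vec p) : (gram X)ᵀ = gram X := by
  simp [gram, Matrix.transpose_smul, Matrix.transpose_mul]

lemma posSemidef_gram (X : Fin n → Vec p) : (gram X).PosSemidef := by
  refine posSemidef_of_inner_mulV (gram_transpose X) fun v => ?_
  rw [inner_mulV_gram]
  have : 0 ≤ ∑ i, inner ℝ (X i) v * inner ℝ (X i) v :=
    Finset.sum_nonneg fun i _ => mul_self_nonneg _
  positivity

lemma wnorm_gram_sq (X : Fin n → Vec p) (v : Vec p) :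
    wnorm (gram X) v ^ 2 = (1 / (n : ℝ)) * ∑ i, inner ℝ (X i) v ^ 2 := by
  rw [wnorm_sq (posSemidef_gram X), inner_mulV_gram]
  simp_rw [sq]

/-- The centered average `(S - A) u + (1/n) ∑ᵢ eᵢ xᵢ`, projected off `d`. -/
noncomputable def score (A : Matrix (Fin p) (Fin p) ℝ) (d u : Vec p) (e : Fin n → ℝ)
    (X : Fin n → Vec p) : Vec p :=
  offProj d (mulV (gram X - A) u + crossAvg X e)

lemma score_eq_sum (hn : 0 < n) (A : Matrix (Fin p) (Fin p) ℝ) (d u : Vec p) (e : Fin n → ℝ)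
    (X : Fin n → Vec p) :
    score A d u e X = (1 / (n : ℝ)) • ∑ i, quadVec A d u (e i) (X i) := by
  have hsum : ∀ f : Fin n → Vec p, ∑ i, offProj d (f i) = offProj d (∑ i, f i) := by
    intro f
    induction (Finset.univ : Finset (Fin n)) using Finset.induction_on with
    | empty => simp [offProj]
    | insert a s ha ih => rw [Finset.sum_insert ha, Finset.sum_insert ha, ih, offProj_add]
  have hn' : (n : ℝ) ≠ 0 := by positivity
  unfold score quadVec
  rw [hsum, ← offProj_smul, sub_mulV, mulV_gram, crossAvg]
  congr 1
  rw [Finset.sum_sub_distrib, Finset.sum_const, Finset.card_univ, Fintype.card_fin, smul_sub,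
    ← Nat.cast_smul_eq_nsmul ℝ, smul_smul, one_div, inv_mul_cancel₀ hn', one_smul]
  simp_rw [add_smul, Finset.sum_add_distrib, smul_add]
  abel

variable {A : Matrix (Fin p) (Fin p) ℝ} {L : ℝ} {d : Vec p}

lemma norm_score_pow (hn : 0 < n) (d u : Vec p) (e : Fin n → ℝ) (X : Fin n → Vec p) (k : ℕ) :
    ENNReal.ofReal (‖score A d u e X‖ ^ k) = ENNReal.ofReal ((1 / (n : ℝ)) ^ k)
      * ENNReal.ofReal (‖∑ i, quadVec A d u (e i) (X i)‖ ^ k) := by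
  rw [score_eq_sum hn, norm_smul, mul_pow, Real.norm_of_nonneg (by positivity),
    ENNReal.ofReal_mul (by positivity)]

lemma lintegral_norm_score_sq (hn : 0 < n) (hL : 1 ≤ L) (hA : CovClass L⁻¹ L A) (d u : Vec p)
    (e : Fin n → ℝ) :
    ∫⁻ X, ENNReal.ofReal (‖score A d u e X‖ ^ 2) ∂(rowLaw n A)
      = ENNReal.ofReal ((1 / (n : ℝ)) ^ 2
        * ∑ i, ∫ x, ‖quadVec A d u (e i) x‖ ^ 2 ∂(multivariateGaussian (0 : Vec p) A)) := by
  have hps := (hA.posDef (by positivity)).posSemidef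
  simp_rw [norm_score_pow hn]
  rw [lintegral_const_mul' _ _ ENNReal.ofReal_ne_top, ENNReal.ofReal_mul (by positivity), rowLaw,
    lintegral_norm_sum_sq (fun i => quadVec A d u (e i))
      (fun i => (continuous_quadVec A d u (e i)).measurable)
      (fun i => (hasInt_norm_quadVec_sq hps d u (e i)).1) (fun i => integral_quadVec hps d u (e i))]

/-- Lower bound for the mean square of the score. -/
lemma lintegral_norm_score_sq_ge (hn : 0 < n) (hL : 1 ≤ L) (hA : CovClass L⁻¹ L A)
    (hd : ‖d‖ = 1 ∨ d = 0) (u : Vec p) (e : Fin n → ℝ) :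
    ENNReal.ofReal (L⁻¹ * (p - ‖d‖ ^ 2) * (wnorm A u ^ 2 + avgSq e) / n)
      ≤ ∫⁻ X, ENNReal.ofReal (‖score A d u e X‖ ^ 2) ∂(rowLaw n A) := by
  rw [lintegral_norm_score_sq hn hL hA]
  apply ENNReal.ofReal_le_ofReal
  have hn' : (0 : ℝ) < n := by positivity
  calc L⁻¹ * (p - ‖d‖ ^ 2) * (wnorm A u ^ 2 + avgSq e) / n
      = (1 / (n : ℝ)) ^ 2 * ∑ i, (wnorm A u ^ 2 + e i ^ 2) * (L⁻¹ * (p - ‖d‖ ^ 2)) := by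
        rw [← Finset.sum_mul, Finset.sum_add_distrib, Finset.sum_const, Finset.card_univ,
          Fintype.card_fin, nsmul_eq_mul, avgSq]
        field_simp
    _ ≤ _ := by
        refine mul_le_mul_of_nonneg_left (Finset.sum_le_sum fun i _ => ?_) (by positivity)
        exact integral_norm_quadVec_sq_ge hL hA hd u (e i)

lemma lintegral_norm_score_sq_le (hn : 0 < n) (hL : 1 ≤ L) (hA : CovClass L⁻¹ L A)
    (hd : ‖d‖ = 1 ∨ d = 0) (u : Vec p) (e : Fin n → ℝ) :
    ∫⁻ X, ENNReal.ofReal (‖score A d u e X‖ ^ 2) ∂(rowLaw n A)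
      ≤ ENNReal.ofReal (2 * L ^ 2 * (‖u‖ ^ 2 + avgSq e) * (p / n)) := by
  rw [lintegral_norm_score_sq hn hL hA]
  apply ENNReal.ofReal_le_ofReal
  have hn' : (0 : ℝ) < n := by positivity
  calc _ ≤ (1 / (n : ℝ)) ^ 2 * ∑ i, 2 * L ^ 2 * p * (‖u‖ ^ 2 + e i ^ 2) := by
        refine mul_le_mul_of_nonneg_left (Finset.sum_le_sum fun i _ => ?_) (by positivity)
        exact integral_norm_quadVec_sq_le hL hA hd u (e i)
    _ = _ := by
        rw [← Finset.mul_sum, Finset.sum_add_distrib, Finset.sum_const, Finset.card_univ,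
          Fintype.card_fin, nsmul_eq_mul, avgSq]
        field_simp

lemma lintegral_norm_score_four_le (hn : 0 < n) (hL : 1 ≤ L) (hA : CovClass L⁻¹ L A)
    (hd : ‖d‖ = 1 ∨ d = 0) (u : Vec p) (e : Fin n → ℝ) :
    ∫⁻ X, ENNReal.ofReal (‖score A d u e X‖ ^ 4) ∂(rowLaw n A)
      ≤ ENNReal.ofReal (21016 * L ^ 8 * (‖u‖ ^ 2 + avgSq e) ^ 2 * (p / n) ^ 2) := by
  have hps := (hA.posDef (by positivity)).posSemidef
  have hn' : (0 : ℝ) < n := by positivity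
  simp_rw [norm_score_pow hn]
  rw [lintegral_const_mul' _ _ ENNReal.ofReal_ne_top, rowLaw]
  refine (mul_le_mul_right (lintegral_norm_sum_four_le (fun i => quadVec A d u (e i))
      (fun i => (continuous_quadVec A d u (e i)).measurable)
      (fun i => (integral_norm_quadVec_four_le hL hA hd u (e i)).1)
      (fun i => integral_quadVec hps d u (e i))) _).trans ?_
  rw [← ENNReal.ofReal_mul (by positivity)]
  apply ENNReal.ofReal_le_ofReal
  have h2 : ∑ i, ∫ x, ‖quadVec A d u (e i) x‖ ^ 2 ∂(multivariateGaussian (0 : Vec p) A)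
      ≤ 2 * L ^ 2 * p * (n * (‖u‖ ^ 2 + avgSq e)) := by
    refine (Finset.sum_le_sum fun i _ =>
      integral_norm_quadVec_sq_le hL hA hd u (e i)).trans (le_of_eq ?_)
    rw [← Finset.mul_sum, Finset.sum_add_distrib, Finset.sum_const, Finset.card_univ,
          Fintype.card_fin, nsmul_eq_mul, avgSq]
    field_simp
  have h20 : 0 ≤ ∑ i, ∫ x, ‖quadVec A d u (e i) x‖ ^ 2 ∂(multivariateGaussian (0 : Vec p) A) :=
    Finset.sum_nonneg fun i _ => integral_nonneg fun _ => by positivity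
  have h4 : ∑ i, ∫ x, ‖quadVec A d u (e i) x‖ ^ 4 ∂(multivariateGaussian (0 : Vec p) A)
      ≤ 7000 * L ^ 8 * p ^ 2 * (n * ‖u‖ ^ 4 + (n * avgSq e) ^ 2) := by
    refine (Finset.sum_le_sum fun i _ =>
      (integral_norm_quadVec_four_le hL hA hd u (e i)).2).trans ?_
    rw [← Finset.mul_sum, Finset.sum_add_distrib, Finset.sum_const, Finset.card_univ,
          Fintype.card_fin, nsmul_eq_mul]
    have e1 : n * avgSq e = ∑ i, e i ^ 2 := by rw [avgSq]; field_simp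
    have e2 : ∑ i, e i ^ 4 ≤ (∑ i, e i ^ 2) ^ 2 := by
      have := Finset.sum_sq_le_sq_sum_of_nonneg (s := Finset.univ) (f := fun i => e i ^ 2)
        (fun i _ => sq_nonneg _)
      simpa [← pow_mul] using this
    rw [e1]
    gcongr
  have w0 := avgSq_nonneg e
  have l4 : L ^ 4 ≤ L ^ 8 := pow_le_pow_right₀ hL (by norm_num)
  have n1 : (1 : ℝ) ≤ n := by exact_mod_cast hn
  have h2' : (∑ i, ∫ x, ‖quadVec A d u (e i) x‖ ^ 2 ∂(multivariateGaussian (0 : Vec p) A)) ^ 2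
      ≤ 4 * L ^ 8 * (p ^ 2 * n ^ 2 * (‖u‖ ^ 2 + avgSq e) ^ 2) := by
    calc _ ≤ (2 * L ^ 2 * p * (n * (‖u‖ ^ 2 + avgSq e))) ^ 2 := pow_le_pow_left₀ h20 h2 2
      _ = 4 * L ^ 4 * (p ^ 2 * n ^ 2 * (‖u‖ ^ 2 + avgSq e) ^ 2) := by ring
      _ ≤ _ := by gcongr
  have h4' : n * ‖u‖ ^ 4 + (n * avgSq e) ^ 2 ≤ n ^ 2 * (‖u‖ ^ 2 + avgSq e) ^ 2 := by
    have : (n : ℝ) * ‖u‖ ^ 4 ≤ n ^ 2 * ‖u‖ ^ 4 := by gcongr; nlinarith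
    have h : 0 ≤ (n : ℝ) ^ 2 * (‖u‖ ^ 2 * avgSq e) := by positivity
    nlinarith
  calc _ ≤ (1 / (n : ℝ)) ^ 4 * (4 * (4 * L ^ 8 * (p ^ 2 * n ^ 2 * (‖u‖ ^ 2 + avgSq e) ^ 2))
        + 3 * (7000 * L ^ 8 * p ^ 2 * (n ^ 2 * (‖u‖ ^ 2 + avgSq e) ^ 2))) := by
        gcongr
        exact h4.trans (by gcongr)
    _ = _ := by field_simp; ring

lemma continuous_gram : Continuous (gram : (Fin n → Vec p) → Matrix (Fin p) (Fin p) ℝ) := by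
  unfold gram
  fun_prop

lemma continuous_score (A : Matrix (Fin p) (Fin p) ℝ) (d u : Vec p) (e : Fin n → ℝ) :
    Continuous (score A d u e) := by
  have h : score A d u e = fun X => offProj d ((1 / (n : ℝ)) • ∑ i, inner ℝ (X i) u • X i
      - mulV A u + (1 / (n : ℝ)) • ∑ i, e i • X i) := by
    funext X
    rw [score, sub_mulV, mulV_gram, crossAvg]
  rw [h]
  exact (continuous_offProj d).comp (by fun_prop)

end score

end AdvLinReg

namespace AdvLinReg

/-! ### Concentration of the sample covariance matrix -/

section concentration

variable {p n : ℕ} {A : Matrix (Fin p) (Fin p) ℝ}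

lemma integrable_exp_sum_sq (hA : A.PosSemidef) (v : Vec p) {t : ℝ} (ht : t * wnorm A v ^ 2 < 1 / 2) :
    Integrable (fun X : Fin n → Vec p => Real.exp (t * ∑ i, inner ℝ (X i) v ^ 2)) (rowLaw n A) := by
  have h : ∀ X : Fin n → Vec p, Real.exp (t * ∑ i, inner ℝ (X i) v ^ 2)
      = ∏ i, Real.exp (t * inner ℝ (X i) v ^ 2) := fun X => by
    rw [Finset.mul_sum, Real.exp_sum]
  simp_rw [h, rowLaw]
  refine Integrable.fintype_prod (f := fun _ x => Real.exp (t * inner ℝ x v ^ 2)) fun _ => ?_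
  refine (integrable_inner_multivariateGaussian hA v (f := fun y => Real.exp (t * y ^ 2))
    (by fun_prop)).mpr ?_
  simp_rw [mul_pow, ← mul_assoc]
  exact integrable_exp_sq_gaussian ht

lemma integral_exp_sum_sq (hA : A.PosSemidef) (v : Vec p) {t : ℝ} (ht : t * wnorm A v ^ 2 < 1 / 2) :
    ∫ X : Fin n → Vec p, Real.exp (t * ∑ i, inner ℝ (X i) v ^ 2) ∂(rowLaw n A)
      = (√(1 - 2 * (t * wnorm A v ^ 2)))⁻¹ ^ n := by
  have h : ∀ X : Fin n → Vec p, Real.exp (t * ∑ i, inner ℝ (X i) v ^ 2)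
      = ∏ i, Real.exp (t * inner ℝ (X i) v ^ 2) := fun X => by
    rw [Finset.mul_sum, Real.exp_sum]
  simp_rw [h, rowLaw]
  rw [integral_fintype_prod_eq_pow (fun x : Vec p => Real.exp (t * inner ℝ x v ^ 2)),
    Fintype.card_fin, integral_inner_multivariateGaussian hA v
    (f := fun y => Real.exp (t * y ^ 2)) (by fun_prop)]
  simp_rw [mul_pow, ← mul_assoc]
  rw [integral_exp_sq_gaussian ht]
  ring_nf

lemma exp_bounds : √2 ≤ Real.exp (4 / 5) ∧ (√2)⁻¹ * Real.exp (1 / 8) ≤ Real.exp (-(1 / 5)) := by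
  have h2 := Real.log_two_gt_d9
  have h3 := Real.log_two_lt_d9
  have e : √2 = Real.exp (Real.log 2 / 2) := by
    rw [Real.exp_half, Real.exp_log (by norm_num)]
  rw [e]
  constructor
  · exact Real.exp_le_exp.mpr (by linarith)
  · rw [← Real.exp_neg, ← Real.exp_add]
    exact Real.exp_le_exp.mpr (by linarith)

/-- In a fixed direction the empirical and the population norms are comparable, up to an
exponentially small probability. -/
lemma rowLaw_direction_le (hA : A.PosDef) (hn : 0 < n) (v : Vec p) :
    (rowLaw n A) {X | ¬ (wnorm A v / 2 ≤ wnorm (gram X) v ∧ wnorm (gram X) v ≤ 2 * wnorm A v)}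
      ≤ ENNReal.ofReal (2 * Real.exp (-(n / 5))) := by
  rcases eq_or_ne v 0 with h0 | h0
  · simp [h0, wnorm_zero]
  have hps := hA.posSemidef
  have hs : 0 < wnorm A v := wnorm_pos hA h0
  set s := wnorm A v with hsdef
  have hn' : (0 : ℝ) < n := by positivity
  obtain ⟨b1, b2⟩ := exp_bounds
  set Q : (Fin n → Vec p) → ℝ := fun X => ∑ i, inner ℝ (X i) v ^ 2 with hQ
  have hsub : {X : Fin n → Vec p | ¬ (s / 2 ≤ wnorm (gram X) v ∧ wnorm (gram X) v ≤ 2 * s)}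
      ⊆ {X | 4 * n * s ^ 2 ≤ Q X} ∪ {X | Q X ≤ n * s ^ 2 / 4} := by
    intro X hX
    by_contra hcon
    simp only [Set.mem_union, Set.mem_ofPred_eq, not_or, not_le] at hcon
    have hg : n * wnorm (gram X) v ^ 2 = Q X := by
      rw [wnorm_gram_sq]; field_simp; rfl
    have w0 := wnorm_nonneg (gram X) v
    refine hX ⟨?_, ?_⟩
    · have : (s / 2) ^ 2 ≤ wnorm (gram X) v ^ 2 := by
        have := hcon.2
        rw [← hg] at this
        have : n * (s / 2) ^ 2 < n * wnorm (gram X) v ^ 2 := by linarith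
        exact (lt_of_mul_lt_mul_left this hn'.le).le
      exact abs_le_of_sq_le_sq' this w0 |>.2
    · have : wnorm (gram X) v ^ 2 ≤ (2 * s) ^ 2 := by
        have := hcon.1
        rw [← hg] at this
        have : n * wnorm (gram X) v ^ 2 < n * (2 * s) ^ 2 := by linarith
        exact (lt_of_mul_lt_mul_left this hn'.le).le
      exact abs_le_of_sq_le_sq' this (by positivity) |>.2
  -- Chernoff bounds, at the parameters `1 / (4 s²)` and `-1 / (2 s²)`
  have c1 : (rowLaw n A).real {X | 4 * n * s ^ 2 ≤ Q X} ≤ Real.exp (-(n / 5)) := by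
    have ht : 1 / (4 * s ^ 2) * wnorm A v ^ 2 < 1 / 2 := by
      rw [← hsdef]; field_simp; norm_num
    have := measure_ge_le_exp_mul_mgf (μ := rowLaw n A) (X := Q) (t := 1 / (4 * s ^ 2))
      (4 * n * s ^ 2) (by positivity) (integrable_exp_sum_sq hps v ht)
    refine this.trans ?_
    rw [mgf, integral_exp_sum_sq hps v ht, ← hsdef]
    have e1 : 1 - 2 * (1 / (4 * s ^ 2) * s ^ 2) = 2⁻¹ := by field_simp; norm_num
    have e2 : -(1 / (4 * s ^ 2)) * (4 * n * s ^ 2) = n * (-1) := by field_simp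
    rw [e1, e2, Real.sqrt_inv, inv_inv, Real.exp_nat_mul, ← mul_pow,
      show -((n : ℝ) / 5) = n * (-(1 / 5)) by ring, Real.exp_nat_mul]
    gcongr
    calc Real.exp (-1) * √2 ≤ Real.exp (-1) * Real.exp (4 / 5) := by gcongr
      _ = _ := by rw [← Real.exp_add]; norm_num
  have c2 : (rowLaw n A).real {X | Q X ≤ n * s ^ 2 / 4} ≤ Real.exp (-(n / 5)) := by
    have ht : -1 / (2 * s ^ 2) * wnorm A v ^ 2 < 1 / 2 := by
      rw [← hsdef]; field_simp; norm_num
    have := measure_le_le_exp_mul_mgf (μ := rowLaw n A) (X := Q) (t := -1 / (2 * s ^ 2))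
      (n * s ^ 2 / 4) (by rw [neg_div]; exact neg_nonpos.mpr (by positivity))
      (integrable_exp_sum_sq hps v ht)
    refine this.trans ?_
    rw [mgf, integral_exp_sum_sq hps v ht, ← hsdef]
    have e1 : 1 - 2 * (-1 / (2 * s ^ 2) * s ^ 2) = 2 := by field_simp; norm_num
    have e2 : -(-1 / (2 * s ^ 2)) * (n * s ^ 2 / 4) = n * (1 / 8) := by field_simp; norm_num
    rw [e1, e2, Real.exp_nat_mul, ← mul_pow, show -((n : ℝ) / 5) = n * (-(1 / 5)) by ring,
      Real.exp_nat_mul, mul_comm]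
    gcongr
  refine (measure_mono hsub).trans ((measure_union_le _ _).trans ?_)
  rw [two_mul, ENNReal.ofReal_add (Real.exp_pos _).le (Real.exp_pos _).le]
  refine add_le_add ?_ ?_
  · rw [← ofReal_measureReal]; exact ENNReal.ofReal_le_ofReal c1
  · rw [← ofReal_measureReal]; exact ENNReal.ofReal_le_ofReal c2

/-- The points of the cube `[-1, 1]ᵖ` with coordinates in `(1/n) ℤ`. -/
noncomputable def gridPoint (p n : ℕ) (k : Fin p → Fin (2 * n + 1)) : Vec p :=
  WithLp.toLp 2 fun j => ((k j : ℕ) : ℝ) / n - 1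

lemma exists_gridPoint (hn : 0 < n) (v : Vec p) (hv : ∀ j, |v j| ≤ 1) :
    ∃ k, ∀ j, |v j - gridPoint p n k j| ≤ 1 / n := by
  have hn' : (0 : ℝ) < n := by positivity
  have h0 : ∀ j, 0 ≤ n * (v j + 1) := fun j =>
    mul_nonneg hn'.le (by linarith [(abs_le.mp (hv j)).1])
  have h1 : ∀ j, ⌊n * (v j + 1)⌋₊ < 2 * n + 1 := fun j => by
    rw [Nat.floor_lt (h0 j)]
    push_cast
    nlinarith [(abs_le.mp (hv j)).2]
  refine ⟨fun j => ⟨⌊n * (v j + 1)⌋₊, h1 j⟩, fun j => ?_⟩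
  have f1 := Nat.floor_le (h0 j)
  have f2 := Nat.lt_floor_add_one (n * (v j + 1))
  have e : v j - gridPoint p n (fun j => ⟨⌊n * (v j + 1)⌋₊, h1 j⟩) j
      = (n * (v j + 1) - ⌊n * (v j + 1)⌋₊) / n := by
    simp only [gridPoint]; field_simp; ring
  rw [e, abs_of_nonneg (div_nonneg (by linarith) hn'.le)]
  gcongr
  linarith

lemma sum_smul_unitVec (v : Vec p) : ∑ j, v j • (unitVec j : Vec p) = v := by
  ext i
  simp [unitVec, Finset.sum_apply, Pi.single_apply]

lemma wnorm_le_sum {S : Matrix (Fin p) (Fin p) ℝ} (hS : S.PosSemidef) (v : Vec p) :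
    wnorm S v ≤ ∑ j, |v j| * wnorm S (unitVec j) := by
  conv_lhs => rw [← sum_smul_unitVec v]
  induction (Finset.univ : Finset (Fin p)) using Finset.induction_on with
  | empty => simp [wnorm_zero]
  | insert a s ha ih =>
    rw [Finset.sum_insert ha, Finset.sum_insert ha]
    refine (wnorm_add_le hS _ _).trans (add_le_add (le_of_eq (wnorm_smul _ _ _)) ih)

lemma norm_le_sum (v : Vec p) : ‖v‖ ≤ ∑ j, |v j| := by
  conv_lhs => rw [← sum_smul_unitVec v]
  refine (norm_sum_le _ _).trans (le_of_eq (Finset.sum_congr rfl fun j _ => ?_))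
  rw [norm_smul, norm_unitVec, mul_one, Real.norm_eq_abs]

/-- Two-sided control on the grid extends to all directions. -/
lemma covClass_of_gridPoint {ℓ : ℝ} (hℓ : 1 ≤ ℓ) (hA : CovClass ℓ⁻¹ ℓ A) (hn : 0 < n)
    (hpn : 10 * ℓ ^ 2 * p ≤ n) {S : Matrix (Fin p) (Fin p) ℝ} (hS : S.PosSemidef)
    (h : ∀ k, wnorm A (gridPoint p n k) / 2 ≤ wnorm S (gridPoint p n k)
      ∧ wnorm S (gridPoint p n k) ≤ 2 * wnorm A (gridPoint p n k)) :
    CovClass (16 * ℓ ^ 2)⁻¹ (16 * ℓ ^ 2) S := by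
  have hn' : (0 : ℝ) < n := by positivity
  have hℓ0 : 0 < ℓ := by linarith
  have hps := (hA.posDef (by positivity)).posSemidef
  -- the coordinate vectors are themselves grid points
  have hunit : ∀ j : Fin p, wnorm S (unitVec j) ≤ 2 * ℓ := by
    intro j
    have hk : gridPoint p n (fun i => if i = j then ⟨2 * n, by omega⟩ else ⟨n, by omega⟩)
        = unitVec j := by
      ext i
      by_cases hi : i = j
      · simp [gridPoint, unitVec, hi]; field_simp; norm_num
      · simp [gridPoint, unitVec, hi]; field_simp; norm_num
    have := (h (fun i => if i = j then ⟨2 * n, by omega⟩ else ⟨n, by omega⟩)).2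
    rw [hk] at this
    refine this.trans ?_
    have := hA.wnorm_le hℓ (unitVec j)
    rw [norm_unitVec] at this
    linarith
  set η : ℝ := p / n with hη
  have hη0 : 0 ≤ η := by positivity
  have hη1 : 10 * ℓ ^ 2 * η ≤ 1 := by
    rw [hη, ← mul_div_assoc, div_le_one hn']; exact hpn
  have key : ∀ v : Vec p, ‖v‖ = 1 → (4 * ℓ)⁻¹ ≤ wnorm S v ∧ wnorm S v ≤ 3 * ℓ := by
    intro v hv
    obtain ⟨k, hk⟩ := exists_gridPoint (n := n) hn v fun j => by
      rw [← Real.norm_eq_abs]; exact (PiLp.norm_apply_le v j).trans hv.le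
    set v' := gridPoint p n k
    have hsum : ∑ j, |(v - v') j| ≤ η := by
      refine (Finset.sum_le_sum fun j _ => hk j).trans (le_of_eq ?_)
      simp [hη]; field_simp
    -- rounding to the grid costs at most `η = p / n` in the `ℓ¹` norm, hence in both norms
    have d1 : ‖v - v'‖ ≤ η := (norm_le_sum _).trans hsum
    have d2 : wnorm S (v - v') ≤ η * (2 * ℓ) := by
      refine (wnorm_le_sum hS _).trans ?_
      calc ∑ j, |(v - v') j| * wnorm S (unitVec j) ≤ ∑ j, |(v - v') j| * (2 * ℓ) :=
            Finset.sum_le_sum fun j _ => mul_le_mul_of_nonneg_left (hunit j) (abs_nonneg _)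
        _ ≤ _ := by rw [← Finset.sum_mul]; gcongr
    have n1 : ‖v'‖ ≤ 1 + η := by
      have := norm_sub_norm_le v' v
      rw [norm_sub_rev] at this; linarith
    have n2 : 1 - η ≤ ‖v'‖ := by
      have := norm_sub_norm_le v v'; linarith
    have a1 : wnorm A v' ≤ ℓ * (1 + η) :=
      (hA.wnorm_le hℓ v').trans (by gcongr)
    have a2 : 1 - η ≤ ℓ * wnorm A v' := n2.trans (hA.norm_le hℓ v')
    obtain ⟨g1, g2⟩ := h k
    have s1 := wnorm_sub_le hS v v'
    have s2 := wnorm_sub_le hS v' v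
    rw [wnorm_sub_rev] at s2
    have hη2 : 10 * η ≤ 1 := by nlinarith [mul_nonneg hη0 (sub_nonneg.2 (one_le_pow₀ hℓ (n := 2)))]
    constructor
    · rw [inv_le_iff_one_le_mul₀ (by positivity)]
      have t1 : wnorm A v' / 2 - η * (2 * ℓ) ≤ wnorm S v := by linarith
      have t2 : (wnorm A v' / 2 - η * (2 * ℓ)) * (4 * ℓ) ≤ wnorm S v * (4 * ℓ) := by gcongr
      nlinarith
    · nlinarith
  refine covClass_of_inner (PosSemidef.transpose_eq hS) (fun x => ?_) (fun x => ?_)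
  all_goals
    rcases eq_or_ne x 0 with h0 | h0
    · simp [h0]
    have hx : 0 < ‖x‖ := norm_pos_iff.mpr h0
    obtain ⟨k1, k2⟩ := key (‖x‖⁻¹ • x) (by rw [norm_smul, norm_inv, norm_norm, inv_mul_cancel₀ hx.ne'])
    rw [wnorm_smul, abs_of_nonneg (by positivity)] at k1 k2
    rw [← wnorm_sq hS]
    have w0 := wnorm_nonneg S x
  · rw [inv_mul_le_iff₀ (by positivity)]
    rw [inv_mul_eq_div, le_div_iff₀ hx, inv_mul_le_iff₀ (by positivity)] at k1
    calc ‖x‖ ^ 2 ≤ (4 * ℓ * wnorm S x) ^ 2 := by gcongr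
      _ = _ := by ring
  · rw [inv_mul_le_iff₀ hx] at k2
    calc wnorm S x ^ 2 ≤ (‖x‖ * (3 * ℓ)) ^ 2 := by gcongr
      _ ≤ _ := by nlinarith [mul_nonneg (sq_nonneg ‖x‖) (sq_nonneg ℓ)]

/-- The sample covariance matrix stays well conditioned, outside an event of probability at most
`p / n`. -/
lemma rowLaw_not_covClass_le {ℓ : ℝ} (hℓ : 1 ≤ ℓ) (hA : CovClass ℓ⁻¹ ℓ A) (hp : 1 ≤ p)
    (hn : 400 ≤ n) (hpn : 10 * ℓ ^ 2 * p ≤ n) (hlog : p * Real.log n ≤ n / 20) :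
    (rowLaw n A) {X | ¬ CovClass (16 * ℓ ^ 2)⁻¹ (16 * ℓ ^ 2) (gram X)}
      ≤ ENNReal.ofReal (p / n) := by
  have hn0 : 0 < n := by omega
  have hn' : (400 : ℝ) ≤ n := by exact_mod_cast hn
  have hsub : {X : Fin n → Vec p | ¬ CovClass (16 * ℓ ^ 2)⁻¹ (16 * ℓ ^ 2) (gram X)}
      ⊆ ⋃ k : Fin p → Fin (2 * n + 1), {X | ¬ (wnorm A (gridPoint p n k) / 2
        ≤ wnorm (gram X) (gridPoint p n k)
        ∧ wnorm (gram X) (gridPoint p n k) ≤ 2 * wnorm A (gridPoint p n k))} := by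
    intro X hX
    by_contra hcon
    simp only [Set.mem_iUnion, Set.mem_ofPred_eq, not_exists, not_not] at hcon
    exact hX (covClass_of_gridPoint hℓ hA hn0 hpn (posSemidef_gram X) hcon)
  refine (measure_mono hsub).trans ((measure_iUnion_fintype_le _ _).trans ?_)
  refine (Finset.sum_le_sum fun k _ =>
    rowLaw_direction_le (hA.posDef (by positivity)) hn0 (gridPoint p n k)).trans ?_
  rw [Finset.sum_const, Finset.card_univ, Fintype.card_fun, Fintype.card_fin, Fintype.card_fin,
    ← ENNReal.ofReal_nsmul]
  apply ENNReal.ofReal_le_ofReal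
  rw [nsmul_eq_mul]
  push_cast
  -- the number of grid points is offset by the exponentially small probability
  have h1 : (2 * (n : ℝ) + 1) ^ p ≤ Real.exp (n / 10) := by
    calc (2 * (n : ℝ) + 1) ^ p ≤ ((n : ℝ) ^ 2) ^ p := by gcongr; nlinarith
      _ = Real.exp (p * (2 * Real.log n)) := by
          rw [Real.exp_nat_mul, two_mul, Real.exp_add, Real.exp_log (by linarith), sq]
      _ ≤ _ := Real.exp_le_exp.mpr (by linarith)
  have h2 : (n : ℝ) * 2 ≤ Real.exp (n / 10) := by
    have := Real.quadratic_le_exp_of_nonneg (x := (n : ℝ) / 10) (by positivity)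
    nlinarith
  have hp' : (1 : ℝ) ≤ p := by exact_mod_cast hp
  calc (2 * (n : ℝ) + 1) ^ p * (2 * Real.exp (-(n / 5)))
      ≤ Real.exp (n / 10) * (2 * Real.exp (-(n / 5))) := by gcongr
    _ = 2 * Real.exp (-(n / 10)) := by
        rw [mul_left_comm, ← Real.exp_add]; congr 2; ring
    _ ≤ p / n := by
        rw [le_div_iff₀ (by linarith), Real.exp_neg, mul_assoc, mul_comm, mul_assoc,
          inv_mul_le_iff₀ (Real.exp_pos _)]
        nlinarith [Real.exp_pos ((n : ℝ) / 10)]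

end concentration

end AdvLinReg

namespace AdvLinReg

/-! ### The mean of the inverse Wishart matrix -/

section stein

variable {ι : Type*} [Fintype ι] [DecidableEq ι]

/-- Resampling one coordinate of a product measure preserves it. -/
lemma measurePreserving_update (μ : Measure ℝ) [IsProbabilityMeasure μ] (k : ι) :
    MeasurePreserving (fun q : (ι → ℝ) × ℝ => Function.update q.1 k q.2)
      ((Measure.pi fun _ : ι => μ).prod μ) (Measure.pi fun _ : ι => μ) := by
  have hm : Measurable (fun q : (ι → ℝ) × ℝ => Function.update q.1 k q.2) := by
    refine measurable_pi_lambda _ fun i => ?_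
    by_cases h : i = k
    · subst h; simpa using measurable_snd
    · have h1 : Measurable fun c : (ι → ℝ) × ℝ => c.1 i := (measurable_pi_apply i).comp measurable_fst
      simpa [Function.update_of_ne h] using h1
  refine ⟨hm, (Measure.pi_eq fun s hs => ?_).symm⟩
  rw [Measure.map_apply hm (MeasurableSet.univ_pi hs)]
  have e : (fun q : (ι → ℝ) × ℝ => Function.update q.1 k q.2) ⁻¹' (Set.univ.pi s)
      = (Set.univ.pi (Function.update s k Set.univ)) ×ˢ (s k) := by
    ext ⟨x, y⟩
    simp only [Set.mem_preimage, Set.mem_pi, Set.mem_univ, true_implies, Set.mem_prod]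
    constructor
    · intro h
      refine ⟨fun i => ?_, by simpa using h k⟩
      by_cases hi : i = k
      · subst hi; simp
      · simpa [Function.update_of_ne hi] using h i
    · rintro ⟨h1, h2⟩ i
      by_cases hi : i = k
      · subst hi; simpa using h2
      · simpa [Function.update_of_ne hi] using h1 i
  rw [e, Measure.prod_prod, Measure.pi_pi, ← Finset.mul_prod_erase _ _ (Finset.mem_univ k),
    ← Finset.mul_prod_erase (Finset.univ) (fun i => μ (s i)) (Finset.mem_univ k)]
  simp only [Function.update_self, measure_univ, one_mul]
  rw [mul_comm]
  congr 1
  refine Finset.prod_congr rfl fun i hi => ?_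
  rw [Function.update_of_ne (Finset.ne_of_mem_erase hi)]

/-- Integration by parts in one coordinate of a standard Gaussian vector. -/
lemma integral_coord_mul_gaussian (k : ι) {F F' : (ι → ℝ) → ℝ} (hF : Measurable F)
    (hF' : Measurable F') {C : ℝ} (bF : ∀ z, |F z| ≤ C) (bF' : ∀ z, |F' z| ≤ C)
    (h : ∀ z, HasDerivAt (fun t => F (Function.update z k t)) (F' z) (z k)) :
    ∫ z, z k * F z ∂(Measure.pi fun _ : ι => gaussianReal 0 1)
      = ∫ z, F' z ∂(Measure.pi fun _ : ι => gaussianReal 0 1) := by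
  have hmp := measurePreserving_update (gaussianReal 0 1) k
  set π := Measure.pi fun _ : ι => gaussianReal 0 1
  have hk : Integrable (fun z : ι → ℝ => z k) π := by
    have h1 : Integrable (fun x : ℝ => x) (gaussianReal 0 1) := by
      simpa using integrable_pow_gaussian 1
    exact (measurePreserving_eval (fun _ : ι => gaussianReal 0 1) k).integrable_comp_of_integrable h1
  have i1 : Integrable (fun z : ι → ℝ => z k * F z) π := by
    refine (hk.norm.mul_const C).mono' (by fun_prop) (ae_of_all _ fun z => ?_)
    rw [norm_mul]
    exact mul_le_mul_of_nonneg_left (bF z) (norm_nonneg _)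
  have i2 : Integrable F' π := by
    refine (integrable_const C).mono' hF'.aestronglyMeasurable (ae_of_all _ fun z => bF' z)
  have e : ∀ {H : (ι → ℝ) → ℝ}, Integrable H π → ∫ z, H z ∂π
      = ∫ z, ∫ t, H (Function.update z k t) ∂(gaussianReal 0 1) ∂π := by
    intro H hH
    rw [← hmp.map_eq] at hH
    conv_lhs => rw [show π = _ from hmp.map_eq.symm]
    rw [integral_map hmp.measurable.aemeasurable hH.1, integral_prod]
    exact (integrable_map_measure hH.1 hmp.measurable.aemeasurable).mp hH
  rw [e i1, e i2]
  congr 1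
  funext z
  simp only [Function.update_self]
  have hu : Measurable fun t : ℝ => Function.update z k t := measurable_update z
  have g : ∀ {H : (ι → ℝ) → ℝ}, Measurable H → (∀ z, |H z| ≤ C) →
      Integrable (fun t => H (Function.update z k t)) (gaussianReal 0 1) := fun hH hb =>
    (integrable_const C).mono' (hH.comp hu).aestronglyMeasurable (ae_of_all _ fun t => hb _)
  refine integral_mul_gaussian (fun t => ?_) ?_ (g hF' bF') (g hF bF)
  · simpa using h (Function.update z k t)
  · have h1 : Integrable (fun x : ℝ => x) (gaussianReal 0 1) := by
      simpa using integrable_pow_gaussian 1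
    refine (h1.norm.mul_const C).mono' ?_ (ae_of_all _ fun t => ?_)
    · exact (measurable_id.mul (hF.comp hu)).aestronglyMeasurable
    · rw [norm_mul]
      exact mul_le_mul_of_nonneg_left (bF _) (norm_nonneg _)

end stein

section wishart

variable {p n : ℕ}

/-- The regularized inverse `(ZᵀZ + η I)⁻¹`. -/
noncomputable def ridgeInv (η : ℝ) (Z : Matrix (Fin n) (Fin p) ℝ) : Matrix (Fin p) (Fin p) ℝ :=
  (Zᵀ * Z + η • (1 : Matrix (Fin p) (Fin p) ℝ))⁻¹

variable {η : ℝ}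

lemma posDef_ridge (hη : 0 < η) (Z : Matrix (Fin n) (Fin p) ℝ) :
    (Zᵀ * Z + η • (1 : Matrix (Fin p) (Fin p) ℝ)).PosDef := by
  refine Matrix.PosDef.posSemidef_add ?_ (Matrix.PosDef.one.smul hη)
  have := Matrix.posSemidef_conjTranspose_mul_self Z
  simpa using this

lemma isUnit_det_ridge (hη : 0 < η) (Z : Matrix (Fin n) (Fin p) ℝ) :
    IsUnit (Zᵀ * Z + η • (1 : Matrix (Fin p) (Fin p) ℝ)).det :=
  (posDef_ridge hη Z).det_pos.ne'.isUnit

lemma ridge_mul_ridgeInv (hη : 0 < η) (Z : Matrix (Fin n) (Fin p) ℝ) :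
    Zᵀ * Z * ridgeInv η Z = 1 - η • ridgeInv η Z := by
  have := Matrix.mul_nonsing_inv _ (isUnit_det_ridge hη Z)
  rw [Matrix.add_mul, Matrix.smul_mul, Matrix.one_mul] at this
  exact eq_sub_of_add_eq this

lemma ridgeInv_transpose (η : ℝ) (Z : Matrix (Fin n) (Fin p) ℝ) :
    (ridgeInv η Z)ᵀ = ridgeInv η Z := by
  simp [ridgeInv, Matrix.transpose_nonsing_inv, Matrix.transpose_mul]

lemma sum_sq_mul_ridgeInv (hη : 0 < η) (Z : Matrix (Fin n) (Fin p) ℝ) (j : Fin p) :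
    ∑ i, (Z * ridgeInv η Z) i j ^ 2
      = ridgeInv η Z j j - η * ∑ l, ridgeInv η Z l j ^ 2 := by
  have h : (Z * ridgeInv η Z)ᵀ * (Z * ridgeInv η Z)
      = ridgeInv η Z - η • ((ridgeInv η Z)ᵀ * ridgeInv η Z) := by
    rw [Matrix.transpose_mul, Matrix.mul_assoc, ← Matrix.mul_assoc Zᵀ, ridge_mul_ridgeInv hη,
      Matrix.mul_sub, Matrix.mul_one, Matrix.mul_smul, ridgeInv_transpose]
  have := congrFun (congrFun h j) j
  simp only [Matrix.mul_apply, Matrix.transpose_apply, Matrix.sub_apply, Matrix.smul_apply,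
    smul_eq_mul, ← sq] at this
  simpa [Matrix.mul_apply] using this

lemma ridgeInv_diag_nonneg (hη : 0 < η) (Z : Matrix (Fin n) (Fin p) ℝ) (j : Fin p) :
    0 ≤ ridgeInv η Z j j := by
  have h := sum_sq_mul_ridgeInv hη Z j
  have h1 : 0 ≤ ∑ i, (Z * ridgeInv η Z) i j ^ 2 := Finset.sum_nonneg fun _ _ => sq_nonneg _
  have h2 : 0 ≤ ∑ l, ridgeInv η Z l j ^ 2 := Finset.sum_nonneg fun _ _ => sq_nonneg _
  have := mul_nonneg hη.le h2
  linarith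

lemma ridgeInv_diag_le (hη : 0 < η) (Z : Matrix (Fin n) (Fin p) ℝ) (j : Fin p) :
    ridgeInv η Z j j ≤ η⁻¹ := by
  have h := sum_sq_mul_ridgeInv hη Z j
  have h1 : 0 ≤ ∑ i, (Z * ridgeInv η Z) i j ^ 2 := Finset.sum_nonneg fun _ _ => sq_nonneg _
  have h2 : ridgeInv η Z j j ^ 2 ≤ ∑ l, ridgeInv η Z l j ^ 2 :=
    Finset.single_le_sum (f := fun l => ridgeInv η Z l j ^ 2) (fun _ _ => sq_nonneg _)
      (Finset.mem_univ j)
  have h3 := mul_le_mul_of_nonneg_left h2 hη.le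
  have h0 := ridgeInv_diag_nonneg hη Z j
  rw [← one_div, le_div_iff₀ hη]
  rcases h0.eq_or_lt with h0 | h0
  · rw [← h0]; simp
  · nlinarith

lemma sq_mul_ridgeInv_le (hη : 0 < η) (Z : Matrix (Fin n) (Fin p) ℝ) (i : Fin n) (j : Fin p) :
    (Z * ridgeInv η Z) i j ^ 2 ≤ ridgeInv η Z j j := by
  have h := sum_sq_mul_ridgeInv hη Z j
  have h1 : (Z * ridgeInv η Z) i j ^ 2 ≤ ∑ i, (Z * ridgeInv η Z) i j ^ 2 :=
    Finset.single_le_sum (f := fun l => (Z * ridgeInv η Z) l j ^ 2) (fun _ _ => sq_nonneg _)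
      (Finset.mem_univ i)
  have h2 : 0 ≤ ∑ l, ridgeInv η Z l j ^ 2 := Finset.sum_nonneg fun _ _ => sq_nonneg _
  have := mul_nonneg hη.le h2
  linarith

/-- The leverages lie in `[0, 1]`. -/
lemma leverage_mem (hη : 0 < η) (Z : Matrix (Fin n) (Fin p) ℝ) (i : Fin n) :
    0 ≤ (Z * ridgeInv η Z * Zᵀ) i i ∧ (Z * ridgeInv η Z * Zᵀ) i i ≤ 1 := by
  set M := Z * ridgeInv η Z * Zᵀ with hM
  have ht : Mᵀ = M := by
    rw [hM, Matrix.transpose_mul, Matrix.transpose_mul, ridgeInv_transpose, Matrix.transpose_transpose,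
      Matrix.mul_assoc]
  have h : Mᵀ * M = M - η • ((Z * ridgeInv η Z) * (Z * ridgeInv η Z)ᵀ) := by
    rw [ht, hM, Matrix.transpose_mul, ridgeInv_transpose]
    calc Z * ridgeInv η Z * Zᵀ * (Z * ridgeInv η Z * Zᵀ)
        = Z * ridgeInv η Z * (Zᵀ * Z * ridgeInv η Z) * Zᵀ := by simp only [Matrix.mul_assoc]
      _ = _ := by
        rw [ridge_mul_ridgeInv hη, Matrix.mul_sub, Matrix.sub_mul, Matrix.mul_one, Matrix.mul_smul,
          Matrix.smul_mul]
        simp only [Matrix.mul_assoc]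
  have h' := congrFun (congrFun h i) i
  simp only [Matrix.mul_apply (M := Mᵀ), Matrix.mul_apply (M := Z * ridgeInv η Z) (N := (_)ᵀ),
    Matrix.transpose_apply, Matrix.sub_apply, Matrix.smul_apply, smul_eq_mul, ← sq] at h'
  have h1 : M i i ^ 2 ≤ ∑ l, M l i ^ 2 :=
    Finset.single_le_sum (f := fun l => M l i ^ 2) (fun _ _ => sq_nonneg _) (Finset.mem_univ i)
  have h2 : 0 ≤ ∑ l, (Z * ridgeInv η Z) i l ^ 2 := Finset.sum_nonneg fun _ _ => sq_nonneg _
  have h3 := mul_nonneg hη.le h2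
  constructor <;> nlinarith

lemma continuous_ridgeInv (hη : 0 < η) :
    Continuous (ridgeInv η : Matrix (Fin n) (Fin p) ℝ → Matrix (Fin p) (Fin p) ℝ) := by
  refine continuous_iff_continuousAt.mpr fun Z => ?_
  unfold ridgeInv
  refine ContinuousAt.comp (g := fun M : Matrix (Fin p) (Fin p) ℝ => M⁻¹)
    (f := fun Z : Matrix (Fin n) (Fin p) ℝ => Zᵀ * Z + η • (1 : Matrix (Fin p) (Fin p) ℝ)) ?_
    (by fun_prop)
  refine continuousAt_matrix_inv _ ?_
  rw [Ring.inverse_eq_inv']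
  exact continuousAt_inv₀ (posDef_ridge hη Z).det_pos.ne'

/-- The derivative of an entry of `Z (ZᵀZ + η I)⁻¹` in the same entry of `Z`. -/
lemma hasDerivAt_mul_ridgeInv (hη : 0 < η) (Z : Matrix (Fin n) (Fin p) ℝ) (i : Fin n) (j : Fin p) :
    HasDerivAt (fun h : ℝ => ((Z + h • Matrix.single i j (1 : ℝ))
        * ridgeInv η (Z + h • Matrix.single i j (1 : ℝ))) i j)
      (ridgeInv η Z j j * (1 - (Z * ridgeInv η Z * Zᵀ) i i) - (Z * ridgeInv η Z) i j ^ 2) 0 := by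
  set E : Matrix (Fin n) (Fin p) ℝ := Matrix.single i j 1 with hE
  set G : ℝ → Matrix (Fin p) (Fin p) ℝ := fun h => ridgeInv η (Z + h • E) with hG
  have hcont : Continuous G := (continuous_ridgeInv hη).comp (by fun_prop)
  -- the slope, by the resolvent identity
  set D : ℝ → Matrix (Fin n) (Fin p) ℝ := fun h =>
    E * G h - Z * (G h * (Eᵀ * (Z + h • E) + Zᵀ * E) * G 0) with hD
  have hres : ∀ h, (Z + h • E) * G h - Z * G 0 = h • D h := by
    intro h
    have r1 : G h * ((Z + h • E)ᵀ * (Z + h • E) + η • 1) = 1 :=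
      Matrix.nonsing_inv_mul _ (isUnit_det_ridge hη _)
    have r2 : (Zᵀ * Z + η • 1) * G 0 = 1 := by
      have := Matrix.mul_nonsing_inv _ (isUnit_det_ridge hη (Z + (0 : ℝ) • E))
      simpa [hG, ridgeInv] using this
    have r3 : G h - G 0 = - (h • (G h * (Eᵀ * (Z + h • E) + Zᵀ * E) * G 0)) := by
      have e : ((Z + h • E)ᵀ * (Z + h • E) + η • (1 : Matrix (Fin p) (Fin p) ℝ)) - (Zᵀ * Z + η • 1)
          = h • (Eᵀ * (Z + h • E) + Zᵀ * E) := by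
        simp only [Matrix.transpose_add, Matrix.transpose_smul, Matrix.add_mul, Matrix.mul_add,
          Matrix.smul_mul, Matrix.mul_smul, smul_add]
        abel
      calc G h - G 0 = G h * ((Zᵀ * Z + η • 1) * G 0)
            - (G h * ((Z + h • E)ᵀ * (Z + h • E) + η • 1)) * G 0 := by
              rw [r1, r2, Matrix.mul_one, Matrix.one_mul]
        _ = - (G h * (((Z + h • E)ᵀ * (Z + h • E) + η • (1 : Matrix (Fin p) (Fin p) ℝ))
              - (Zᵀ * Z + η • 1)) * G 0) := by
              rw [Matrix.mul_sub, Matrix.sub_mul]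
              simp only [Matrix.mul_assoc]
              abel
        _ = _ := by rw [e, Matrix.mul_smul, Matrix.smul_mul]
    calc (Z + h • E) * G h - Z * G 0 = h • (E * G h) + Z * (G h - G 0) := by
          rw [Matrix.add_mul, Matrix.smul_mul, Matrix.mul_sub]; abel
      _ = _ := by
          rw [r3, hD, smul_sub, Matrix.mul_neg, Matrix.mul_smul]
          abel
  have hDc : Continuous fun h => D h i j := by
    have : Continuous D := by
      rw [hD]; fun_prop
    exact this.matrix_elem i j
  have hD0 : D 0 i j = ridgeInv η Z j j * (1 - (Z * ridgeInv η Z * Zᵀ) i i)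
      - (Z * ridgeInv η Z) i j ^ 2 := by
    have hG0 : G 0 = ridgeInv η Z := by simp [hG]
    set g := ridgeInv η Z
    have e1 : ∀ (B : Matrix (Fin p) (Fin p) ℝ), (E * B) i j = B j j := fun B => by
      simp [hE]
    have e2 : ∀ (B : Matrix (Fin n) (Fin p) ℝ) (C : Matrix (Fin n) (Fin p) ℝ),
        (B * (Eᵀ * C)) i j = B i j * C i j := fun B C => by
      rw [← Matrix.mul_assoc, hE, Matrix.transpose_single, Matrix.mul_apply, Finset.sum_eq_single i]
      · simp
      · intro b _ hb
        simp [Matrix.mul_single_apply_of_ne, hb]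
      · simp
    have e3 : ∀ (B : Matrix (Fin n) (Fin n) ℝ) (C : Matrix (Fin p) (Fin p) ℝ),
        (B * (E * C)) i j = B i i * C j j := fun B C => by
      rw [Matrix.mul_apply, Finset.sum_eq_single i]
      · simp [hE]
      · intro b _ hb
        simp [hE, Matrix.single_mul_apply_of_ne, hb]
      · simp
    have e4 : D 0 = E * g - ((Z * g) * (Eᵀ * (Z * g)) + (Z * g * Zᵀ) * (E * g)) := by
      rw [hD]
      simp only [zero_smul, add_zero, hG0, Matrix.mul_add, Matrix.add_mul, Matrix.mul_assoc]
    rw [e4, Matrix.sub_apply, Matrix.add_apply, e1, e2, e3]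
    ring
  rw [hasDerivAt_iff_tendsto_slope_zero, ← hD0]
  refine ((hDc.tendsto 0).mono_left nhdsWithin_le_nhds).congr' ?_
  filter_upwards [self_mem_nhdsWithin] with h hh
  have hh' : h ≠ 0 := hh
  have := congrFun (congrFun (hres h) i) j
  rw [Matrix.sub_apply, Matrix.smul_apply, smul_eq_mul] at this
  simp only [zero_add, zero_smul, add_zero, smul_eq_mul]
  rw [eq_inv_mul_iff_mul_eq₀ hh', ← this]
  simp [hG]

end wishart

end AdvLinReg

namespace AdvLinReg

section wishart

variable {p n : ℕ}

/-- A matrix from its array of entries. -/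
def ofArray (z : Fin n × Fin p → ℝ) : Matrix (Fin n) (Fin p) ℝ := Matrix.of fun i j => z (i, j)

lemma ofArray_update (z : Fin n × Fin p → ℝ) (i : Fin n) (j : Fin p) (t : ℝ) :
    ofArray (Function.update z (i, j) t)
      = ofArray z + (t - z (i, j)) • Matrix.single i j (1 : ℝ) := by
  ext a b
  simp only [ofArray, Matrix.of_apply, Matrix.add_apply, Matrix.smul_apply, Matrix.single_apply,
    smul_eq_mul, Function.update_apply, Prod.mk.injEq]
  by_cases h : a = i ∧ b = j
  · obtain ⟨rfl, rfl⟩ := h; simp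
  · have h' : ¬ (i = a ∧ j = b) := fun hh => h ⟨hh.1.symm, hh.2.symm⟩
    simp [h, h']

lemma continuous_ofArray : Continuous (ofArray : (Fin n × Fin p → ℝ) → Matrix (Fin n) (Fin p) ℝ) :=
  continuous_matrix fun i j => continuous_apply (i, j)

/-- The mean of a diagonal entry of the regularized inverse Wishart matrix, by integration by parts
in each entry of the column. -/
lemma integral_ridgeInv_diag_le {η : ℝ} (hη : 0 < η) (hnp : p + 1 < n) (j : Fin p) :
    ∫ z, ridgeInv η (ofArray z) j j ∂(Measure.pi fun _ : Fin n × Fin p => gaussianReal 0 1)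
      ≤ 1 / ((n : ℝ) - p - 1) := by
  set π := Measure.pi fun _ : Fin n × Fin p => gaussianReal 0 1
  set G : (Fin n × Fin p → ℝ) → Matrix (Fin p) (Fin p) ℝ := fun z => ridgeInv η (ofArray z) with hG
  have hGc : Continuous G := (continuous_ridgeInv hη).comp continuous_ofArray
  have hZ := continuous_ofArray (n := n) (p := p)
  set C : ℝ := η⁻¹ + 1
  have hη' : 0 < η⁻¹ := inv_pos.mpr hη
  set F : Fin n → (Fin n × Fin p → ℝ) → ℝ := fun i z => (ofArray z * G z) i j with hF
  set F' : Fin n → (Fin n × Fin p → ℝ) → ℝ := fun i z =>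
    G z j j * (1 - (ofArray z * G z * (ofArray z)ᵀ) i i) - (ofArray z * G z) i j ^ 2 with hF'
  have cF : ∀ i, Continuous (F i) := fun i => (hZ.matrix_mul hGc).matrix_elem i j
  have cF' : ∀ i, Continuous (F' i) := fun i =>
    ((hGc.matrix_elem j j).mul (continuous_const.sub
      (((hZ.matrix_mul hGc).matrix_mul hZ.matrix_transpose).matrix_elem i i))).sub ((cF i).pow 2)
  have bG : ∀ z, 0 ≤ G z j j ∧ G z j j ≤ η⁻¹ := fun z =>
    ⟨ridgeInv_diag_nonneg hη _ j, ridgeInv_diag_le hη _ j⟩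
  have bF : ∀ i z, |F i z| ≤ C := by
    intro i z
    have h := sq_mul_ridgeInv_le hη (ofArray z) i j
    rw [abs_le]
    have := (bG z).2
    constructor <;> nlinarith [sq_nonneg (F i z - 1), sq_nonneg (F i z + 1)]
  have bF' : ∀ i z, |F' i z| ≤ C := by
    intro i z
    have h := sq_mul_ridgeInv_le hη (ofArray z) i j
    obtain ⟨l0, l1⟩ := leverage_mem hη (ofArray z) i
    obtain ⟨g0, g1⟩ := bG z
    have e : F' i z = G z j j * (1 - (ofArray z * G z * (ofArray z)ᵀ) i i)
      - (ofArray z * G z) i j ^ 2 := rfl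
    change 0 ≤ (ofArray z * G z * (ofArray z)ᵀ) i i at l0
    change (ofArray z * G z * (ofArray z)ᵀ) i i ≤ 1 at l1
    change (ofArray z * G z) i j ^ 2 ≤ G z j j at h
    have m0 : 0 ≤ G z j j * (1 - (ofArray z * G z * (ofArray z)ᵀ) i i) :=
      mul_nonneg g0 (by linarith)
    have m1 : G z j j * (1 - (ofArray z * G z * (ofArray z)ᵀ) i i) ≤ G z j j :=
      mul_le_of_le_one_right g0 (by linarith)
    rw [e, abs_le]
    have := sq_nonneg ((ofArray z * G z) i j)
    constructor <;> linarith
  -- Stein's identity in the entry `(i, j)`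
  have hst : ∀ i, ∫ z, z (i, j) * F i z ∂π = ∫ z, F' i z ∂π := by
    intro i
    refine integral_coord_mul_gaussian (i, j) (cF i).measurable (cF' i).measurable (bF i) (bF' i)
      fun z => ?_
    have h := hasDerivAt_mul_ridgeInv hη (ofArray z) i j
    have h2 : HasDerivAt (fun t : ℝ => t - z (i, j)) 1 (z (i, j)) :=
      (hasDerivAt_id _).sub_const _
    have h3 := HasDerivAt.comp (h₂ := fun h : ℝ => ((ofArray z + h • Matrix.single i j (1 : ℝ))
        * ridgeInv η (ofArray z + h • Matrix.single i j (1 : ℝ))) i j) (z (i, j))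
      (by rw [sub_self]; exact h) h2
    rw [mul_one] at h3
    refine h3.congr_of_eventuallyEq (Eventually.of_forall fun t => ?_)
    simp only [hF, hG, ofArray_update, Function.comp]
  have iF' : ∀ i, Integrable (F' i) π := fun i =>
    (integrable_const C).mono' (cF' i).aestronglyMeasurable (ae_of_all _ (bF' i))
  have iG : Integrable (fun z => G z j j) π :=
    (integrable_const η⁻¹).mono' (hGc.matrix_elem j j).aestronglyMeasurable
      (ae_of_all _ fun z => by rw [Real.norm_of_nonneg (bG z).1]; exact (bG z).2)
  have izF : ∀ i, Integrable (fun z => z (i, j) * F i z) π := by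
    intro i
    have h1 : Integrable (fun x : ℝ => x) (gaussianReal 0 1) := by
      simpa using integrable_pow_gaussian 1
    have hk : Integrable (fun z : Fin n × Fin p → ℝ => z (i, j)) π :=
      (measurePreserving_eval (fun _ : Fin n × Fin p => gaussianReal 0 1)
        (i, j)).integrable_comp_of_integrable h1
    refine (hk.norm.mul_const C).mono' (by fun_prop) (ae_of_all _ fun z => ?_)
    rw [norm_mul]
    exact mul_le_mul_of_nonneg_left (bF i z) (norm_nonneg _)
  -- the two sides of the identity, summed over the column
  have hleft : ∀ z, ∑ i, z (i, j) * F i z ≤ 1 := by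
    intro z
    have h := congrFun (congrFun (ridge_mul_ridgeInv hη (ofArray z)) j) j
    rw [Matrix.mul_assoc, Matrix.mul_apply, Matrix.sub_apply, Matrix.one_apply_eq,
      Matrix.smul_apply, smul_eq_mul] at h
    have h' : ∑ i, z (i, j) * F i z = 1 - η * G z j j := h
    rw [h']
    nlinarith [mul_nonneg hη.le (bG z).1]
  have hright : ∀ z, ((n : ℝ) - p - 1) * G z j j ≤ ∑ i, F' i z := by
    intro z
    have h1 := sum_sq_mul_ridgeInv hη (ofArray z) j
    have h2 : 0 ≤ ∑ l, ridgeInv η (ofArray z) l j ^ 2 := Finset.sum_nonneg fun _ _ => sq_nonneg _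
    have h3 : ∑ i, (ofArray z * G z * (ofArray z)ᵀ) i i ≤ p := by
      change Matrix.trace (ofArray z * G z * (ofArray z)ᵀ) ≤ p
      rw [Matrix.trace_mul_comm, ← Matrix.mul_assoc, ridge_mul_ridgeInv hη, Matrix.trace_sub,
        Matrix.trace_one, Fintype.card_fin, Matrix.trace_smul, smul_eq_mul]
      have : 0 ≤ Matrix.trace (ridgeInv η (ofArray z)) :=
        Finset.sum_nonneg fun i _ => ridgeInv_diag_nonneg hη _ i
      nlinarith [mul_nonneg hη.le this]
    have h4 : ∑ i, F' i z = G z j j * (n - ∑ i, (ofArray z * G z * (ofArray z)ᵀ) i i)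
        - ∑ i, (ofArray z * ridgeInv η (ofArray z)) i j ^ 2 := by
      simp only [hF', hG, Finset.sum_sub_distrib, ← Finset.mul_sum, Finset.sum_const,
        Finset.card_univ, Fintype.card_fin, nsmul_eq_mul, mul_one]
    rw [h4, h1]
    have g0 := (bG z).1
    have := mul_nonneg hη.le h2
    have := mul_le_mul_of_nonneg_left h3 g0
    change _ ≤ G z j j * _ - (G z j j - _)
    nlinarith
  have hpos : (0 : ℝ) < n - p - 1 := by
    have : ((p + 1 : ℕ) : ℝ) < n := by exact_mod_cast hnp
    push_cast at this; linarith
  rw [le_div_iff₀ hpos]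
  calc (∫ z, G z j j ∂π) * ((n : ℝ) - p - 1) = ∫ z, ((n : ℝ) - p - 1) * G z j j ∂π := by
        rw [integral_const_mul, mul_comm]
    _ ≤ ∫ z, ∑ i, F' i z ∂π :=
        integral_mono (iG.const_mul _) (integrable_finsetSum _ fun i _ => iF' i) hright
    _ = ∫ z, ∑ i, z (i, j) * F i z ∂π := by
        rw [integral_finsetSum _ fun i _ => iF' i, integral_finsetSum _ fun i _ => izF i]
        exact Finset.sum_congr rfl fun i _ => (hst i).symm
    _ ≤ ∫ _, (1 : ℝ) ∂π :=
        integral_mono (integrable_finsetSum _ fun i _ => izF i) (integrable_const _) hleft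
    _ = 1 := by simp

/-- The regularization is removed by Fatou's lemma. A singular matrix has the inverse `0` here, which is
harmless for an upper bound. -/
lemma lintegral_wishart_inv_diag_le (hnp : p + 1 < n) (j : Fin p) :
    ∫⁻ z, ENNReal.ofReal (((ofArray z)ᵀ * ofArray z)⁻¹ j j)
        ∂(Measure.pi fun _ : Fin n × Fin p => gaussianReal 0 1)
      ≤ ENNReal.ofReal (1 / ((n : ℝ) - p - 1)) := by
  set π := Measure.pi fun _ : Fin n × Fin p => gaussianReal 0 1
  set η : ℕ → ℝ := fun k => 1 / ((k : ℝ) + 1) with hη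
  have hη0 : ∀ k, 0 < η k := fun k => by positivity
  have hηt : Tendsto η atTop (𝓝 0) := tendsto_one_div_add_atTop_nhds_zero_nat
  have hk : ∀ k, ∫⁻ z, ENNReal.ofReal (ridgeInv (η k) (ofArray z) j j) ∂π
      ≤ ENNReal.ofReal (1 / ((n : ℝ) - p - 1)) := by
    intro k
    have hc : Continuous fun z : Fin n × Fin p → ℝ => ridgeInv (η k) (ofArray z) j j :=
      ((continuous_ridgeInv (hη0 k)).comp continuous_ofArray).matrix_elem j j
    rw [← ofReal_integral_eq_lintegral_ofReal]
    · exact ENNReal.ofReal_le_ofReal (integral_ridgeInv_diag_le (hη0 k) hnp j)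
    · exact (integrable_const (η k)⁻¹).mono' hc.aestronglyMeasurable (ae_of_all _ fun z => by
        rw [Real.norm_of_nonneg (ridgeInv_diag_nonneg (hη0 k) _ j)]
        exact ridgeInv_diag_le (hη0 k) _ j)
    · exact ae_of_all _ fun z => ridgeInv_diag_nonneg (hη0 k) _ j
  have hlim : ∀ z : Fin n × Fin p → ℝ, ENNReal.ofReal (((ofArray z)ᵀ * ofArray z)⁻¹ j j)
      ≤ liminf (fun k => ENNReal.ofReal (ridgeInv (η k) (ofArray z) j j)) atTop := by
    intro z
    by_cases hdet : ((ofArray z)ᵀ * ofArray z).det = 0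
    · rw [Matrix.nonsing_inv_apply_not_isUnit _ (by simpa using hdet)]
      simp
    · have hc : ContinuousAt (fun M : Matrix (Fin p) (Fin p) ℝ => M⁻¹) ((ofArray z)ᵀ * ofArray z) := by
        refine continuousAt_matrix_inv _ ?_
        rw [Ring.inverse_eq_inv']
        exact continuousAt_inv₀ hdet
      have ht : Tendsto (fun k => (ofArray z)ᵀ * ofArray z + η k • (1 : Matrix (Fin p) (Fin p) ℝ))
          atTop (𝓝 ((ofArray z)ᵀ * ofArray z)) := by
        have := (tendsto_const_nhds (x := (ofArray z)ᵀ * ofArray z)).add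
          (hηt.smul_const (1 : Matrix (Fin p) (Fin p) ℝ))
        simpa using this
      have h2 := ((continuous_id.matrix_elem j j).tendsto _).comp (hc.tendsto.comp ht)
      have h3 := (ENNReal.continuous_ofReal.tendsto _).comp h2
      exact h3.liminf_eq.ge
  calc _ ≤ ∫⁻ z, liminf (fun k => ENNReal.ofReal (ridgeInv (η k) (ofArray z) j j)) atTop ∂π :=
        lintegral_mono hlim
    _ ≤ liminf (fun k => ∫⁻ z, ENNReal.ofReal (ridgeInv (η k) (ofArray z) j j) ∂π) atTop := by
        refine lintegral_liminf_le fun k => ENNReal.measurable_ofReal.comp ?_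
        exact (((continuous_ridgeInv (hη0 k)).comp continuous_ofArray).matrix_elem j j).measurable
    _ ≤ _ := liminf_le_of_le (by isBoundedDefault) fun b hb => by
        obtain ⟨k, hk'⟩ := hb.exists
        exact hk'.trans (hk k)

end wishart

end AdvLinReg

namespace AdvLinReg

/-! ### Linear images of Gaussian vectors -/

section gaussian

variable {p n : ℕ}

lemma continuous_mulV_toLp (B : Matrix (Fin p) (Fin p) ℝ) :
    Continuous fun z : Fin p → ℝ => mulV B (WithLp.toLp 2 z) :=
  (continuous_mulV B).comp (PiLp.continuous_toLp 2 _)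

/-- A Gaussian vector with covariance `B Bᵀ` is the image under `B` of independent standard
Gaussians. -/
lemma multivariateGaussian_eq_map (B : Matrix (Fin p) (Fin p) ℝ) :
    multivariateGaussian (0 : Vec p) (B * Bᵀ)
      = (Measure.pi fun _ : Fin p => gaussianReal 0 1).map
          fun z => mulV B (WithLp.toLp 2 z) := by
  have hps : (B * Bᵀ).PosSemidef := by
    have := Matrix.posSemidef_self_mul_conjTranspose B
    simpa using this
  have e : (Measure.pi fun _ : Fin p => gaussianReal 0 1).map (fun z => mulV B (WithLp.toLp 2 z))
      = (stdGaussian (Vec p)).map (mulV B) := by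
    rw [← map_pi_eq_stdGaussian, Measure.map_map (continuous_mulV B).measurable (by fun_prop)]
    rfl
  rw [e]
  have : IsProbabilityMeasure ((stdGaussian (Vec p)).map (mulV B)) :=
    Measure.isProbabilityMeasure_map (continuous_mulV B).measurable.aemeasurable
  refine Measure.ext_of_charFun (funext fun t => ?_)
  rw [charFun_multivariateGaussian hps, charFun_apply, integral_map
    (continuous_mulV B).measurable.aemeasurable (by fun_prop)]
  simp_rw [inner_mulV_left]
  rw [← charFun_apply, charFun_stdGaussian]
  congr 1
  have h : inner ℝ t (mulV (B * Bᵀ) t) = ‖mulV Bᵀ t‖ ^ 2 := by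
    rw [← mulV_mulV, ← real_inner_self_eq_norm_sq, inner_mulV_left, Matrix.transpose_transpose]
  rw [inner_eq_dotProduct] at h
  have h' : WithLp.ofLp t ⬝ᵥ (B * Bᵀ) *ᵥ WithLp.ofLp t = ‖mulV Bᵀ t‖ ^ 2 := h
  rw [h']
  simp [neg_div]

/-- The rows `B zᵢ` formed from an array. -/
noncomputable def rowsOf (B : Matrix (Fin p) (Fin p) ℝ) (z : Fin n × Fin p → ℝ) : Fin n → Vec p :=
  fun i => mulV B (WithLp.toLp 2 fun j => z (i, j))

lemma continuous_rowsOf (B : Matrix (Fin p) (Fin p) ℝ) :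
    Continuous (rowsOf B : (Fin n × Fin p → ℝ) → Fin n → Vec p) :=
  continuous_pi fun i => (continuous_mulV_toLp B).comp (by fun_prop)

lemma map_curry_pi (μ : Measure ℝ) [IsProbabilityMeasure μ] :
    (Measure.pi fun _ : Fin n × Fin p => μ).map (fun z i j => z (i, j))
      = Measure.pi fun _ : Fin n => Measure.pi fun _ : Fin p => μ := by
  have hc : Measurable fun (z : Fin n × Fin p → ℝ) (i : Fin n) (j : Fin p) => z (i, j) := by
    fun_prop
  have hu : Measurable fun (w : Fin n → Fin p → ℝ) (k : Fin n × Fin p) => w k.1 k.2 :=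
    measurable_pi_lambda _ fun k =>
      (measurable_pi_apply k.2).comp (measurable_pi_apply k.1)
  have h : (Measure.pi fun _ : Fin n => Measure.pi fun _ : Fin p => μ).map
      (fun w (k : Fin n × Fin p) => w k.1 k.2) = Measure.pi fun _ : Fin n × Fin p => μ := by
    refine (Measure.pi_eq fun s hs => ?_).symm
    rw [Measure.map_apply hu (MeasurableSet.univ_pi hs)]
    have e : (fun (w : Fin n → Fin p → ℝ) (k : Fin n × Fin p) => w k.1 k.2) ⁻¹' Set.univ.pi s
        = Set.univ.pi fun i => Set.univ.pi fun j => s (i, j) := by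
      ext w; simp
    rw [e, Measure.pi_pi]
    simp_rw [Measure.pi_pi]
    rw [Fintype.prod_prod_type]
  rw [← h, Measure.map_map hc hu]
  exact Measure.map_id

lemma rowLaw_eq_map (B : Matrix (Fin p) (Fin p) ℝ) :
    rowLaw n (B * Bᵀ) = (Measure.pi fun _ : Fin n × Fin p => gaussianReal 0 1).map (rowsOf B) := by
  have e : (rowsOf B : (Fin n × Fin p → ℝ) → Fin n → Vec p)
      = (fun w i => mulV B (WithLp.toLp 2 (w i))) ∘ (fun z i j => z (i, j)) := rfl
  have hB := continuous_mulV_toLp B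
  have hm : Measurable fun (w : Fin n → Fin p → ℝ) i => mulV B (WithLp.toLp 2 (w i)) :=
    measurable_pi_lambda _ fun i => hB.measurable.comp (measurable_pi_apply i)
  rw [e, ← Measure.map_map hm (by fun_prop), map_curry_pi, rowLaw,
    multivariateGaussian_eq_map]
  have : IsProbabilityMeasure ((Measure.pi fun _ : Fin p => gaussianReal 0 1).map
      fun z => mulV B (WithLp.toLp 2 z)) :=
    Measure.isProbabilityMeasure_map hB.measurable.aemeasurable
  exact (Measure.pi_map_pi (μ := fun _ : Fin n => Measure.pi fun _ : Fin p => gaussianReal 0 1)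
    (f := fun _ z => mulV B (WithLp.toLp 2 z)) fun _ => hB.measurable.aemeasurable).symm

end gaussian

/-! ### The least squares error -/

section ols

variable {p n : ℕ}

/-- The data set with covariates `X`, signal `θ₀` and noise `e`. -/
noncomputable def mkData (θ₀ : Vec p) (X : Fin n → Vec p) (e : Fin n → ℝ) : Data p n :=
  fun i => (X i, inner ℝ (X i) θ₀ + e i)

/-- The error `S⁻¹ (1/n) ∑ᵢ eᵢ xᵢ` of the least squares estimate. -/
noncomputable def olsErr (X : Fin n → Vec p) (e : Fin n → ℝ) : Vec p :=
  mulV (gram X)⁻¹ (crossAvg X e)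

lemma gram_inv (hn : 0 < n) (X : Fin n → Vec p) :
    (gram X)⁻¹ = (n : ℝ) • ((Matrix.of fun i j => X i j)ᵀ * (Matrix.of fun i j => X i j))⁻¹ := by
  have hn' : (n : ℝ) ≠ 0 := by positivity
  set W := (Matrix.of fun i j => X i j)ᵀ * (Matrix.of fun i j => X i j) with hW
  have hg : gram X = (1 / (n : ℝ)) • W := rfl
  by_cases hdet : IsUnit W.det
  · refine Matrix.inv_eq_right_inv ?_
    rw [hg, Matrix.smul_mul, Matrix.mul_smul, smul_smul, Matrix.mul_nonsing_inv _ hdet]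
    simp [hn']
  · rw [Matrix.nonsing_inv_apply_not_isUnit _ hdet, Matrix.nonsing_inv_apply_not_isUnit, smul_zero]
    rw [hg, Matrix.det_smul]
    simpa [hn'] using hdet

lemma ols_mkData (hn : 0 < n) (θ₀ : Vec p) (X : Fin n → Vec p) (e : Fin n → ℝ) :
    ols (mkData θ₀ X e) = mulV (gram X)⁻¹ (mulV (gram X) θ₀ + crossAvg X e) := by
  have hn' : (n : ℝ) ≠ 0 := by positivity
  have h : mulV (gram X) θ₀ + crossAvg X e
      = (1 / (n : ℝ)) • WithLp.toLp 2 ((design (mkData θ₀ X e))ᵀ *ᵥ response (mkData θ₀ X e)) := by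
    rw [mulV_gram, crossAvg, ← smul_add, ← Finset.sum_add_distrib]
    congr 1
    ext j
    simp only [design, mkData, response, Matrix.mulVec, dotProduct, Matrix.transpose_apply,
      Matrix.of_apply, WithLp.ofLp_sum, WithLp.ofLp_smul, WithLp.ofLp_add, Finset.sum_apply,
      Pi.smul_apply, Pi.add_apply, smul_eq_mul]
    exact Finset.sum_congr rfl fun i _ => by ring
  rw [h, mulV_smul, gram_inv hn, smul_mulV, smul_smul, one_div, inv_mul_cancel₀ hn', one_smul]
  rfl

lemma ols_mkData_of_posDef (hn : 0 < n) (θ₀ : Vec p) {X : Fin n → Vec p} (e : Fin n → ℝ)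
    (hX : (gram X).PosDef) : ols (mkData θ₀ X e) = θ₀ + olsErr X e := by
  rw [ols_mkData hn, mulV_add, mulV_mulV, Matrix.nonsing_inv_mul _ hX.det_pos.ne'.isUnit, one_mulV,
    olsErr]

lemma posDef_gram_of_det {X : Fin n → Vec p} (h : (gram X).det ≠ 0) : (gram X).PosDef :=
  (posSemidef_gram X).posDef_iff_det_ne_zero.mpr h

lemma ols_mkData_of_det (hn : 0 < n) (θ₀ : Vec p) {X : Fin n → Vec p} (e : Fin n → ℝ)
    (hX : (gram X).det = 0) : ols (mkData θ₀ X e) = 0 := by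
  rw [ols_mkData hn, Matrix.nonsing_inv_apply_not_isUnit _ (by simpa using hX), zero_mulV]

lemma twoStage_mkData (δ : ℝ) (hn : 0 < n) (θ₀ : Vec p) {X : Fin n → Vec p} (e : Fin n → ℝ)
    (hX : (gram X).PosDef) :
    twoStage δ (mkData θ₀ X e) = pathEst (gram X) (θ₀ + olsErr X e) δ := by
  rw [← ols_mkData_of_posDef hn θ₀ e hX]; rfl

/-- The two-stage estimator never exceeds the least squares estimate. -/
lemma norm_twoStage_le (δ : ℝ) (hn : 0 < n) (θ₀ : Vec p) (X : Fin n → Vec p) (e : Fin n → ℝ) :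
    ‖twoStage δ (mkData θ₀ X e)‖ ≤ ‖θ₀‖ + ‖olsErr X e‖ := by
  by_cases h : (gram X).det = 0
  · have : twoStage δ (mkData θ₀ X e) = pathEst (gram X) (ols (mkData θ₀ X e)) δ := rfl
    rw [this, ols_mkData_of_det hn θ₀ e h, pathEst_zero, norm_zero]
    positivity
  · have hX := posDef_gram_of_det h
    rw [twoStage_mkData δ hn θ₀ e hX]
    exact (norm_pathEst_le hX _ δ).trans (norm_add_le _ _)

/-- The rows of `X (XᵀX)⁻¹`. -/
noncomputable def hatRow (X : Fin n → Vec p) (i : Fin n) : Vec p :=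
  WithLp.toLp 2 (((Matrix.of fun i j => X i j)
    * ((Matrix.of fun i j => X i j)ᵀ * (Matrix.of fun i j => X i j))⁻¹) i)

lemma olsErr_eq_sum (hn : 0 < n) (X : Fin n → Vec p) (e : Fin n → ℝ) :
    olsErr X e = ∑ i, e i • hatRow X i := by
  have hn' : (n : ℝ) ≠ 0 := by positivity
  set M : Matrix (Fin n) (Fin p) ℝ := Matrix.of fun i j => X i j with hM
  have h1 : ∀ i, mulV (Mᵀ * M)⁻¹ (X i) = hatRow X i := by
    intro i
    have ht : ((Mᵀ * M)⁻¹)ᵀ = (Mᵀ * M)⁻¹ := by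
      rw [Matrix.transpose_nonsing_inv, Matrix.transpose_mul, Matrix.transpose_transpose]
    ext j
    simp only [mulV, hatRow, Matrix.mulVec, dotProduct, Matrix.mul_apply, ← hM]
    refine Finset.sum_congr rfl fun l _ => ?_
    rw [← congrFun (congrFun ht j) l, Matrix.transpose_apply, mul_comm]
    rfl
  have hsum : ∀ (B : Matrix (Fin p) (Fin p) ℝ) (f : Fin n → Vec p),
      mulV B (∑ i, f i) = ∑ i, mulV B (f i) := by
    intro B f
    induction (Finset.univ : Finset (Fin n)) using Finset.induction_on with
    | empty => simp
    | insert a s ha ih => rw [Finset.sum_insert ha, Finset.sum_insert ha, mulV_add, ih]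
  rw [olsErr, gram_inv hn, crossAvg, smul_mulV, mulV_smul, smul_smul, one_div,
    mul_inv_cancel₀ hn', one_smul, hsum]
  exact Finset.sum_congr rfl fun i _ => by rw [mulV_smul, h1]

/-- The mean square of the least squares error over the noise. -/
lemma lintegral_norm_olsErr_sq (hn : 0 < n) {σ : ℝ} {ν : Measure ℝ} (hν : IsNoise ν σ)
    (X : Fin n → Vec p) :
    ∫⁻ e, ENNReal.ofReal (‖olsErr X e‖ ^ 2) ∂(Measure.pi fun _ : Fin n => ν)
      = ENNReal.ofReal (σ ^ 2 * ∑ i, ‖hatRow X i‖ ^ 2) := by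
  obtain ⟨hprob, h2, h0, hσ⟩ := hν
  simp_rw [olsErr_eq_sum hn]
  have hi : Integrable (fun e : ℝ => e) ν := h2.integrable (by norm_num)
  rw [lintegral_norm_sum_sq (μ := ν) (fun i (e : ℝ) => e • hatRow X i)
    (fun i => by fun_prop) (fun i => ?_) (fun i => ?_)]
  · congr 1
    rw [Finset.mul_sum]
    refine Finset.sum_congr rfl fun i _ => ?_
    simp_rw [norm_smul, mul_pow, Real.norm_eq_abs, sq_abs]
    rw [integral_mul_const, hσ]
  · simp_rw [norm_smul, mul_pow, Real.norm_eq_abs, sq_abs]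
    exact (h2.integrable_sq).mul_const _
  · rw [integral_smul_const, h0, zero_smul]

lemma sum_norm_hatRow_rowsOf {L : ℝ} (hL : 1 ≤ L) {A B : Matrix (Fin p) (Fin p) ℝ}
    (hAB : A = Bᵀ * B) (hBt : Bᵀ = B) (hA : CovClass L⁻¹ L A) (z : Fin n × Fin p → ℝ) :
    ∑ i, ‖hatRow (rowsOf B z) i‖ ^ 2 ≤ L ^ 2 * ∑ j, ((ofArray z)ᵀ * ofArray z)⁻¹ j j := by
  have hL0 : 0 < L := by linarith
  have hpd := hA.posDef (inv_pos.mpr hL0)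
  set Z := ofArray z with hZ
  set W := Zᵀ * Z with hW
  have hM : (Matrix.of fun i j => rowsOf B z i j : Matrix (Fin n) (Fin p) ℝ) = Z * B := by
    ext i j
    simp only [rowsOf, mulV, Matrix.mulVec, dotProduct, Matrix.of_apply, Matrix.mul_apply]
    refine Finset.sum_congr rfl fun l _ => ?_
    rw [← congrFun (congrFun hBt j) l, Matrix.transpose_apply, mul_comm]
    rfl
  have hdB : IsUnit B.det := by
    have h := hpd.det_pos.ne'
    rw [hAB, Matrix.det_mul] at h
    exact (right_ne_zero_of_mul h).isUnit
  have hH : (Z * B) * ((Z * B)ᵀ * (Z * B))⁻¹ = Z * W⁻¹ * B⁻¹ := by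
    have : (Z * B)ᵀ * (Z * B) = B * (W * B) := by
      rw [Matrix.transpose_mul, hBt, hW]; simp only [Matrix.mul_assoc]
    rw [this, Matrix.mul_inv_rev, Matrix.mul_inv_rev]
    calc Z * B * (B⁻¹ * W⁻¹ * B⁻¹) = Z * (B * B⁻¹) * W⁻¹ * B⁻¹ := by simp only [Matrix.mul_assoc]
      _ = _ := by rw [Matrix.mul_nonsing_inv _ hdB, Matrix.mul_one]
  have hrow : ∀ i, mulV B (hatRow (rowsOf B z) i) = WithLp.toLp 2 ((Z * W⁻¹) i) := by
    intro i
    rw [hatRow, hM, hH]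
    ext j
    have : Z * W⁻¹ * B⁻¹ * B = Z * W⁻¹ := by
      rw [Matrix.mul_assoc, Matrix.nonsing_inv_mul _ hdB, Matrix.mul_one]
    simp only [mulV, Matrix.mulVec, dotProduct]
    conv_rhs => rw [← this]
    rw [Matrix.mul_apply]
    refine Finset.sum_congr rfl fun l _ => ?_
    rw [← congrFun (congrFun hBt j) l, Matrix.transpose_apply, mul_comm]
  have hle : ∀ i, ‖hatRow (rowsOf B z) i‖ ^ 2 ≤ L ^ 2 * ∑ j, (Z * W⁻¹) i j ^ 2 := by
    intro i
    set r := hatRow (rowsOf B z) i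
    have h1 := hA.norm_le hL r
    have h2 : wnorm A r ^ 2 = ∑ j, (Z * W⁻¹) i j ^ 2 := by
      rw [wnorm_sq hpd.posSemidef, hAB, ← mulV_mulV, ← inner_mulV_left, real_inner_self_eq_norm_sq,
        hrow, EuclideanSpace.real_norm_sq_eq]
    rw [← h2, ← mul_pow]
    exact pow_le_pow_left₀ (norm_nonneg _) h1 2
  refine (Finset.sum_le_sum fun i _ => hle i).trans (le_of_eq ?_)
  rw [← Finset.mul_sum]
  congr 1
  have ht : (W⁻¹)ᵀ = W⁻¹ := by
    rw [Matrix.transpose_nonsing_inv, hW, Matrix.transpose_mul, Matrix.transpose_transpose]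
  have hq : (Z * W⁻¹)ᵀ * (Z * W⁻¹) = W⁻¹ := by
    rw [Matrix.transpose_mul, ht, Matrix.mul_assoc, ← Matrix.mul_assoc Zᵀ, ← hW]
    by_cases hd : IsUnit W.det
    · rw [Matrix.mul_nonsing_inv _ hd, Matrix.mul_one]
    · rw [Matrix.nonsing_inv_apply_not_isUnit _ hd]; simp
  rw [Finset.sum_comm]
  refine Finset.sum_congr rfl fun j _ => ?_
  rw [← congrFun (congrFun hq j) j, Matrix.mul_apply]
  exact Finset.sum_congr rfl fun i _ => by rw [Matrix.transpose_apply, sq]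

end ols

end AdvLinReg

namespace AdvLinReg

section ols

variable {p n : ℕ} {L : ℝ} {A : Matrix (Fin p) (Fin p) ℝ}

lemma measurable_olsErr :
    Measurable fun q : (Fin n → Vec p) × (Fin n → ℝ) => olsErr q.1 q.2 := by
  have hinv : ∀ i j, Measurable fun X : Fin n → Vec p => (gram X)⁻¹ i j := by
    have hdet : Continuous fun X : Fin n → Vec p => (gram X).det := continuous_gram.matrix_det
    have hadj : Continuous fun X : Fin n → Vec p => (gram X).adjugate :=
      continuous_gram.matrix_adjugate
    intro i j
    simp_rw [Matrix.inv_def, Ring.inverse_eq_inv']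
    exact hdet.measurable.inv.mul (hadj.matrix_elem i j).measurable
  have hc : Measurable fun q : (Fin n → Vec p) × (Fin n → ℝ) => crossAvg q.1 q.2 := by
    unfold crossAvg; fun_prop
  unfold olsErr mulV
  refine (PiLp.continuous_toLp 2 _).measurable.comp (measurable_pi_lambda _ fun i => ?_)
  simp only [Matrix.mulVec, dotProduct]
  refine Finset.measurable_sum _ fun j _ => Measurable.mul ?_ ?_
  · exact (hinv i j).comp measurable_fst
  · exact (measurable_pi_apply j).comp ((PiLp.continuous_ofLp 2 _).measurable.comp hc)

/-- The mean square of the least squares error, from the mean of the inverse Wishart matrix. -/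
lemma lintegral_lintegral_olsErr_le (hL : 1 ≤ L) (hA : CovClass L⁻¹ L A) (hnp : p + 1 < n)
    {σ : ℝ} {ν : Measure ℝ} (hν : IsNoise ν σ) :
    ∫⁻ X, ∫⁻ e, ENNReal.ofReal (‖olsErr X e‖ ^ 2) ∂(Measure.pi fun _ : Fin n => ν) ∂(rowLaw n A)
      ≤ ENNReal.ofReal (σ ^ 2 * L ^ 2 * (p / ((n : ℝ) - p - 1))) := by
  have hn : 0 < n := by omega
  have hprob := hν.1
  have hpos : (0 : ℝ) < n - p - 1 := by
    have : ((p + 1 : ℕ) : ℝ) < n := by exact_mod_cast hnp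
    push_cast at this; linarith
  have hpd := hA.posDef (by positivity)
  obtain ⟨B, hAB, hBt⟩ : ∃ B : Matrix (Fin p) (Fin p) ℝ, A = Bᵀ * B ∧ Bᵀ = B := by
    open scoped MatrixOrder in
    have h0 : 0 ≤ A := hpd.posSemidef.nonneg
    have hs : (CFC.sqrt A)ᵀ = CFC.sqrt A := by
      have := (CFC.sqrt_nonneg A).isSelfAdjoint.star_eq
      rwa [Matrix.star_eq_conjTranspose, Matrix.conjTranspose_eq_transpose_of_trivial] at this
    exact ⟨CFC.sqrt A, by rw [hs, CFC.sqrt_mul_sqrt_self A h0], hs⟩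
  have hm : Measurable fun X : Fin n → Vec p =>
      ∫⁻ e, ENNReal.ofReal (‖olsErr X e‖ ^ 2) ∂(Measure.pi fun _ : Fin n => ν) :=
    Measurable.lintegral_prod_right'
      (f := fun q : (Fin n → Vec p) × (Fin n → ℝ) => ENNReal.ofReal (‖olsErr q.1 q.2‖ ^ 2))
      ((measurable_olsErr.norm.pow_const 2).ennreal_ofReal)
  have hAB' : A = B * Bᵀ := by rw [hBt]; rwa [hBt] at hAB
  have e0 : rowLaw n A
      = (Measure.pi fun _ : Fin n × Fin p => gaussianReal 0 1).map (rowsOf B) := by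
    rw [hAB', rowLaw_eq_map]
  rw [e0, lintegral_map hm (continuous_rowsOf B).measurable]
  simp_rw [lintegral_norm_olsErr_sq hn hν]
  have hWn : ∀ (z : Fin n × Fin p → ℝ) (j : Fin p), 0 ≤ ((ofArray z)ᵀ * ofArray z)⁻¹ j j := by
    intro z j
    have h : ((ofArray z)ᵀ * ofArray z).PosSemidef := by
      simpa using Matrix.posSemidef_conjTranspose_mul_self (ofArray z)
    exact h.inv.diag_nonneg
  calc ∫⁻ z, ENNReal.ofReal (σ ^ 2 * ∑ i, ‖hatRow (rowsOf B z) i‖ ^ 2)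
        ∂(Measure.pi fun _ : Fin n × Fin p => gaussianReal 0 1)
      ≤ ∫⁻ z, ENNReal.ofReal (σ ^ 2 * L ^ 2) * ∑ j, ENNReal.ofReal (((ofArray z)ᵀ * ofArray z)⁻¹ j j)
        ∂(Measure.pi fun _ : Fin n × Fin p => gaussianReal 0 1) := by
        refine lintegral_mono fun z => ?_
        rw [← ENNReal.ofReal_sum_of_nonneg fun j _ => hWn z j, ← ENNReal.ofReal_mul (by positivity)]
        apply ENNReal.ofReal_le_ofReal
        rw [mul_assoc]
        exact mul_le_mul_of_nonneg_left (sum_norm_hatRow_rowsOf hL hAB hBt hA z) (sq_nonneg σ)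
    _ = ENNReal.ofReal (σ ^ 2 * L ^ 2) * ∑ j, ∫⁻ z, ENNReal.ofReal (((ofArray z)ᵀ * ofArray z)⁻¹ j j)
        ∂(Measure.pi fun _ : Fin n × Fin p => gaussianReal 0 1) := by
        have hmj : ∀ j, Measurable fun z : Fin n × Fin p → ℝ =>
            ENNReal.ofReal (((ofArray z)ᵀ * ofArray z)⁻¹ j j) := by
          intro j
          have hc : Continuous fun z : Fin n × Fin p → ℝ => (ofArray z)ᵀ * ofArray z :=
            continuous_ofArray.matrix_transpose.matrix_mul continuous_ofArray
          simp_rw [Matrix.inv_def, Ring.inverse_eq_inv']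
          exact (hc.matrix_det.measurable.inv.mul
            (hc.matrix_adjugate.matrix_elem j j).measurable).ennreal_ofReal
        rw [lintegral_const_mul _ (Finset.measurable_sum _ fun j _ => hmj j),
          lintegral_finsetSum _ fun j _ => hmj j]
    _ ≤ ENNReal.ofReal (σ ^ 2 * L ^ 2) * ∑ _j : Fin p, ENNReal.ofReal (1 / ((n : ℝ) - p - 1)) := by
        gcongr with j
        exact lintegral_wishart_inv_diag_le hnp j
    _ = _ := by
        rw [Finset.sum_const, Finset.card_univ, Fintype.card_fin, ← ENNReal.ofReal_nsmul,
          ← ENNReal.ofReal_mul (by positivity), nsmul_eq_mul]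
        congr 2
        ring

end ols

/-! ### The law of the data and the measurability of the estimator -/

section law

variable {p n : ℕ}

lemma continuous_mkData (θ₀ : Vec p) :
    Continuous fun q : (Fin n → Vec p) × (Fin n → ℝ) => mkData θ₀ q.1 q.2 := by
  unfold mkData; fun_prop

lemma dataLaw_eq_map (A : Matrix (Fin p) (Fin p) ℝ) (θ₀ : Vec p) (ν : Measure ℝ)
    [IsProbabilityMeasure ν] :
    dataLaw n A θ₀ ν = ((rowLaw n A).prod (Measure.pi fun _ : Fin n => ν)).map
      fun q => mkData θ₀ q.1 q.2 := by
  set γ := multivariateGaussian (0 : Vec p) A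
  have hm : Measurable fun w : Vec p × ℝ => (w.1, inner ℝ w.1 θ₀ + w.2) := by fun_prop
  have h1 := measurePreserving_arrowProdEquivProdArrow (Vec p) ℝ (Fin n) (fun _ => γ) (fun _ => ν)
  have hp : IsProbabilityMeasure ((γ.prod ν).map fun w : Vec p × ℝ => (w.1, inner ℝ w.1 θ₀ + w.2)) :=
    Measure.isProbabilityMeasure_map hm.aemeasurable
  rw [rowLaw, ← h1.map_eq, Measure.map_map (continuous_mkData θ₀).measurable h1.measurable, dataLaw,
    ← Measure.pi_map_pi (μ := fun _ : Fin n => γ.prod ν)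
      (f := fun _ (w : Vec p × ℝ) => (w.1, inner ℝ w.1 θ₀ + w.2)) fun _ => hm.aemeasurable]
  rfl

/-- The sum of the absolute values of the entries. -/
def entrySum (M : Matrix (Fin p) (Fin p) ℝ) : ℝ := ∑ i, ∑ j, |M i j|

lemma norm_mulV_le_entrySum (M : Matrix (Fin p) (Fin p) ℝ) (x : Vec p) :
    ‖mulV M x‖ ≤ entrySum M * ‖x‖ := by
  refine (norm_le_sum _).trans ?_
  rw [entrySum, Finset.sum_mul]
  refine Finset.sum_le_sum fun i _ => ?_
  rw [Finset.sum_mul]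
  change |∑ j, M i j * x j| ≤ _
  refine (Finset.abs_sum_le_sum_abs (fun j => M i j * x j) _).trans (Finset.sum_le_sum fun j _ => ?_)
  rw [abs_mul]
  exact mul_le_mul_of_nonneg_left (PiLp.norm_apply_le x j) (abs_nonneg _)

lemma continuous_entrySum : Continuous (entrySum : Matrix (Fin p) (Fin p) ℝ → ℝ) := by
  unfold entrySum
  exact continuous_finsetSum _ fun i _ => continuous_finsetSum _ fun j _ =>
    (continuous_id.matrix_elem i j).abs

/-- Symmetric matrices near a positive definite one have their eigenvalues in a common compact
interval. -/
lemma exists_covClass_nhds {S₀ : Matrix (Fin p) (Fin p) ℝ} (hS₀ : S₀.PosDef) :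
    ∃ L : ℝ, 1 ≤ L ∧ ∀ᶠ S in 𝓝 S₀, Sᵀ = S → CovClass L⁻¹ L S := by
  obtain ⟨B, hB, hBn⟩ := exists_wnorm_eq_norm hS₀.posSemidef
  have hdB : IsUnit B.det := by
    have h := hS₀.det_pos.ne'
    rw [hB, Matrix.det_mul] at h
    exact (right_ne_zero_of_mul h).isUnit
  set b := entrySum B⁻¹ with hb
  have hb0 : 0 ≤ b := Finset.sum_nonneg fun _ _ => Finset.sum_nonneg fun _ _ => abs_nonneg _
  have hlow : ∀ x : Vec p, ‖x‖ ^ 2 ≤ (b + 1) ^ 2 * inner ℝ x (mulV S₀ x) := by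
    intro x
    have h := norm_mulV_le_entrySum B⁻¹ (mulV B x)
    rw [mulV_mulV, Matrix.nonsing_inv_mul _ hdB, one_mulV] at h
    rw [← wnorm_sq hS₀.posSemidef, hBn, ← mul_pow]
    refine pow_le_pow_left₀ (norm_nonneg _) (h.trans ?_) 2
    gcongr; linarith
  set L : ℝ := 2 * (b + 1) ^ 2 + entrySum S₀ + 1 with hL
  have hs0 : 0 ≤ entrySum S₀ := Finset.sum_nonneg fun _ _ => Finset.sum_nonneg fun _ _ => abs_nonneg _
  have hL1 : 1 ≤ L := by rw [hL]; nlinarith [sq_nonneg (b + 1)]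
  refine ⟨L, hL1, ?_⟩
  have hε : (0 : ℝ) < (2 * (b + 1) ^ 2)⁻¹ := by positivity
  have hev : ∀ᶠ S in 𝓝 S₀, entrySum (S - S₀) < (2 * (b + 1) ^ 2)⁻¹ := by
    have hc : Continuous fun S : Matrix (Fin p) (Fin p) ℝ => entrySum (S - S₀) :=
      continuous_entrySum.comp (by fun_prop)
    have h0 : entrySum (S₀ - S₀) < (2 * (b + 1) ^ 2)⁻¹ := by
      rw [sub_self]; simpa [entrySum] using hε
    exact hc.continuousAt.eventually_lt continuousAt_const h0
  filter_upwards [hev] with S hS hSt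
  have hdiff : ∀ x : Vec p, |inner ℝ x (mulV (S - S₀) x)| ≤ (2 * (b + 1) ^ 2)⁻¹ * ‖x‖ ^ 2 := by
    intro x
    refine (abs_real_inner_le_norm _ _).trans ?_
    have := (norm_mulV_le_entrySum (S - S₀) x).trans
      (mul_le_mul_of_nonneg_right hS.le (norm_nonneg x))
    nlinarith [norm_nonneg x]
  have hdec : ∀ x : Vec p, inner ℝ x (mulV S x)
      = inner ℝ x (mulV S₀ x) + inner ℝ x (mulV (S - S₀) x) := fun x => by
    rw [sub_mulV, inner_sub_right]; ring
  refine covClass_of_inner hSt (fun x => ?_) (fun x => ?_)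
  · have h1 := hlow x
    have h2 := (abs_le.mp (hdiff x)).1
    rw [hdec]
    have h3 : (2 * (b + 1) ^ 2)⁻¹ * ‖x‖ ^ 2 + (2 * (b + 1) ^ 2)⁻¹ * ‖x‖ ^ 2
        ≤ inner ℝ x (mulV S₀ x) := by
      have e : (2 * (b + 1) ^ 2)⁻¹ * ‖x‖ ^ 2 + (2 * (b + 1) ^ 2)⁻¹ * ‖x‖ ^ 2
        = ‖x‖ ^ 2 / (b + 1) ^ 2 := by field_simp; ring
      rw [e, div_le_iff₀ (by positivity)]; linarith
    have h4 : L⁻¹ * ‖x‖ ^ 2 ≤ (2 * (b + 1) ^ 2)⁻¹ * ‖x‖ ^ 2 := by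
      gcongr; rw [hL]; linarith
    linarith
  · have h2 := (abs_le.mp (hdiff x)).2
    rw [hdec]
    have h1 : inner ℝ x (mulV S₀ x) ≤ entrySum S₀ * ‖x‖ ^ 2 := by
      have := (real_inner_le_norm x (mulV S₀ x)).trans
        (mul_le_mul_of_nonneg_left (norm_mulV_le_entrySum S₀ x) (norm_nonneg x))
      linarith [show ‖x‖ * (entrySum S₀ * ‖x‖) = entrySum S₀ * ‖x‖ ^ 2 by ring]
    have h3 : (2 * (b + 1) ^ 2)⁻¹ ≤ 2 * (b + 1) ^ 2 := by
      have : 1 ≤ 2 * (b + 1) ^ 2 := by nlinarith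
      exact (inv_le_one_of_one_le₀ this).trans this
    have h4 := mul_le_mul_of_nonneg_right h3 (sq_nonneg ‖x‖)
    have := sq_nonneg ‖x‖
    rw [hL]
    linarith

/-- The plug-in estimator is continuous where the Gram matrix is invertible and vanishes elsewhere. -/
lemma measurable_twoStage (hn : 0 < n) {δ : ℝ} (hδ : 0 ≤ δ) :
    Measurable (twoStage (p := p) (n := n) δ) := by
  classical
  have hn' : (n : ℝ) ≠ 0 := by positivity
  have hdes : Continuous (design : Data p n → Matrix (Fin n) (Fin p) ℝ) := by
    unfold design
    exact continuous_matrix fun i j => by simp only [Matrix.of_apply]; fun_prop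
  have hresp : Continuous (response : Data p n → Fin n → ℝ) := by unfold response; fun_prop
  have hW : Continuous fun D : Data p n => (design D)ᵀ * design D :=
    hdes.matrix_transpose.matrix_mul hdes
  have hS : Continuous (sampleCov : Data p n → Matrix (Fin p) (Fin p) ℝ) := by
    unfold sampleCov; exact hW.const_smul (1 / (n : ℝ))
  set U : Set (Data p n) := {D | ((design D)ᵀ * design D).det ≠ 0} with hU
  have hUo : IsOpen U := isOpen_ne.preimage hW.matrix_det
  have hols : ContinuousOn (ols : Data p n → Vec p) U := by
    intro D hD
    refine ContinuousAt.continuousWithinAt ?_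
    have h1 : ContinuousAt (fun D : Data p n => ((design D)ᵀ * design D)⁻¹) D := by
      refine ContinuousAt.comp (g := fun M : Matrix (Fin p) (Fin p) ℝ => M⁻¹) ?_ hW.continuousAt
      refine continuousAt_matrix_inv _ ?_
      rw [Ring.inverse_eq_inv']
      exact continuousAt_inv₀ hD
    have h2 : ContinuousAt (fun D : Data p n => (design D)ᵀ *ᵥ response D) D :=
      (hdes.matrix_transpose.matrix_mulVec hresp).continuousAt
    have h3 : ContinuousAt (fun D : Data p n => ((design D)ᵀ * design D)⁻¹ *ᵥ
        ((design D)ᵀ *ᵥ response D)) D := by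
      have hc : Continuous fun q : Matrix (Fin p) (Fin p) ℝ × (Fin p → ℝ) => q.1 *ᵥ q.2 :=
        continuous_fst.matrix_mulVec continuous_snd
      exact hc.continuousAt.comp (h1.prodMk h2)
    exact (PiLp.continuous_toLp 2 _).continuousAt.comp h3
  have hcont : ContinuousOn (twoStage (p := p) (n := n) δ) U := by
    intro D hD
    have hps : (sampleCov D).PosSemidef := posSemidef_gram fun i => (D i).1
    have hpd : (sampleCov D).PosDef := by
      refine hps.posDef_iff_det_ne_zero.mpr ?_
      rw [sampleCov, Matrix.det_smul]
      exact mul_ne_zero (by positivity) hD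
    -- near `D` the stability estimate holds with a constant independent of the data
    obtain ⟨L, hL, hev⟩ := exists_covClass_nhds hpd
    have hAD : CovClass L⁻¹ L (sampleCov D) := hev.self_of_nhds (PosSemidef.transpose_eq hps)
    have hev' : ∀ᶠ D' in 𝓝[U] D, CovClass L⁻¹ L (sampleCov D') := by
      filter_upwards [(hS.tendsto D).mono_left nhdsWithin_le_nhds hev] with D' hD'
      exact hD' (PosSemidef.transpose_eq (posSemidef_gram fun i => (D' i).1))
    have hlim : Tendsto (fun D' => stabConst L * (‖ols D' - ols D‖
        + ‖mulV (sampleCov D' - sampleCov D) (basePoint (sampleCov D) (ols D) δ)‖)) (𝓝[U] D) (𝓝 0) := by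
      have t1 : Tendsto (fun D' => ‖ols D' - ols D‖) (𝓝[U] D) (𝓝 0) := by
        have := ((hols D hD).sub (continuousWithinAt_const (b := ols D))).norm
        simpa [ContinuousWithinAt] using this
      have t2 : Tendsto (fun D' => ‖mulV (sampleCov D' - sampleCov D)
          (basePoint (sampleCov D) (ols D) δ)‖) (𝓝[U] D) (𝓝 0) := by
        have hc : Continuous fun D' : Data p n => ‖mulV (sampleCov D' - sampleCov D)
            (basePoint (sampleCov D) (ols D) δ)‖ := by
          unfold mulV
          exact ((PiLp.continuous_toLp 2 _).comp
            ((hS.sub continuous_const).matrix_mulVec continuous_const)).norm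
        have := (hc.tendsto D).mono_left (nhdsWithin_le_nhds (s := U))
        simpa using this
      simpa using (t1.add t2).const_mul (stabConst L)
    rw [ContinuousWithinAt, tendsto_iff_norm_sub_tendsto_zero]
    refine squeeze_zero' (Eventually.of_forall fun _ => norm_nonneg _) ?_ hlim
    filter_upwards [hev'] with D' hD'
    exact norm_pathEst_sub_pathEst_le hL hAD hD' (ols D) (ols D') hδ
  have hpw : twoStage (p := p) (n := n) δ
      = U.piecewise (twoStage δ) (fun _ => (0 : Vec p)) := by
    funext D
    by_cases hD : D ∈ U
    · rw [Set.piecewise_eq_of_mem _ _ _ hD]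
    · rw [Set.piecewise_eq_of_notMem _ _ _ hD]
      have hdet : ((design D)ᵀ * design D).det = 0 := by
        by_contra h; exact hD h
      -- the inverse of a singular matrix is `0` by convention, and so is the least squares estimate
      have h0 : ols D = 0 := by
        rw [ols, Matrix.nonsing_inv_apply_not_isUnit _ (by simpa using hdet)]
        simp
      change pathEst (sampleCov D) (ols D) δ = 0
      rw [h0, pathEst_zero]
  rw [hpw]
  exact hcont.measurable_piecewise continuousOn_const hUo.measurableSet

/-- The mean squared error as an iterated integral. -/
lemma mse_eq {A : Matrix (Fin p) (Fin p) ℝ} {θ₀ : Vec p} {ν : Measure ℝ} [IsProbabilityMeasure ν]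
    {δ : ℝ} {T : Data p n → Vec p} (hT : Measurable T) :
    mse A θ₀ ν δ T = ∫⁻ X, ∫⁻ e, ENNReal.ofReal (‖T (mkData θ₀ X e) - thetaStar A θ₀ δ‖ ^ 2)
      ∂(Measure.pi fun _ : Fin n => ν) ∂(rowLaw n A) := by
  have hm : Measurable fun D : Data p n => ENNReal.ofReal (‖T D - thetaStar A θ₀ δ‖ ^ 2) := by
    fun_prop
  rw [mse, dataLaw_eq_map, lintegral_map hm (continuous_mkData θ₀).measurable,
    lintegral_prod]
  exact (hm.comp (continuous_mkData θ₀).measurable).aemeasurable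

lemma mse_eq_swap {A : Matrix (Fin p) (Fin p) ℝ} {θ₀ : Vec p} {ν : Measure ℝ}
    [IsProbabilityMeasure ν] {δ : ℝ} {T : Data p n → Vec p} (hT : Measurable T) :
    mse A θ₀ ν δ T = ∫⁻ e, ∫⁻ X, ENNReal.ofReal (‖T (mkData θ₀ X e) - thetaStar A θ₀ δ‖ ^ 2)
      ∂(rowLaw n A) ∂(Measure.pi fun _ : Fin n => ν) := by
  have hm : Measurable fun D : Data p n => ENNReal.ofReal (‖T D - thetaStar A θ₀ δ‖ ^ 2) := by
    fun_prop
  rw [mse, dataLaw_eq_map, lintegral_map hm (continuous_mkData θ₀).measurable,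
    lintegral_prod_symm]
  exact (hm.comp (continuous_mkData θ₀).measurable).aemeasurable

end law

end AdvLinReg

namespace AdvLinReg

/-! ### The upper bound -/

section upper

variable {p n : ℕ} {ℓ : ℝ}

/-- The sample size is large compared with the dimension, for eigenvalues in `[1/ℓ, ℓ]`. -/
structure LargeSample (ℓ : ℝ) (p n : ℕ) : Prop where
  one_le : 1 ≤ p
  le_n : 400 ≤ n
  dim_le : 10 * ℓ ^ 2 * p ≤ n
  log_le : p * Real.log n ≤ n / 20

lemma LargeSample.pos (h : LargeSample ℓ p n) : 0 < n := by have := h.le_n; omega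

lemma LargeSample.prob_le (h : LargeSample ℓ p n) (hℓ : 1 ≤ ℓ) {A : Matrix (Fin p) (Fin p) ℝ}
    (hA : CovClass ℓ⁻¹ ℓ A) :
    (rowLaw n A) {X | ¬ CovClass (16 * ℓ ^ 2)⁻¹ (16 * ℓ ^ 2) (gram X)} ≤ ENNReal.ofReal (p / n) :=
  rowLaw_not_covClass_le hℓ hA h.one_le h.le_n h.dim_le h.log_le

lemma CovClass.widen (hℓ : 1 ≤ ℓ) {A : Matrix (Fin p) (Fin p) ℝ} (hA : CovClass ℓ⁻¹ ℓ A) :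
    CovClass (16 * ℓ ^ 2)⁻¹ (16 * ℓ ^ 2) A := by
  have h : ℓ ≤ 16 * ℓ ^ 2 := by nlinarith
  exact hA.mono (by gcongr) h hA.transpose_eq

lemma one_le_widen (hℓ : 1 ≤ ℓ) : 1 ≤ 16 * ℓ ^ 2 := by nlinarith

lemma lintegral_olsErr_le (h : LargeSample ℓ p n) (hℓ : 1 ≤ ℓ) {A : Matrix (Fin p) (Fin p) ℝ}
    (hA : CovClass ℓ⁻¹ ℓ A) {σ : ℝ} {ν : Measure ℝ} (hν : IsNoise ν σ) :
    ∫⁻ X, ∫⁻ e, ENNReal.ofReal (‖olsErr X e‖ ^ 2) ∂(Measure.pi fun _ : Fin n => ν) ∂(rowLaw n A)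
      ≤ ENNReal.ofReal (2 * ℓ ^ 2 * σ ^ 2 * (p / n)) := by
  have hn : (400 : ℝ) ≤ n := by exact_mod_cast h.le_n
  have hd := h.dim_le
  have hp : 10 * (p : ℝ) ≤ n := by
    refine le_trans ?_ hd
    have : (0 : ℝ) ≤ p := by positivity
    nlinarith [one_le_pow₀ hℓ (n := 2)]
  have hnp : p + 1 < n := by
    have : ((p + 1 : ℕ) : ℝ) < n := by push_cast; linarith
    exact_mod_cast this
  refine (lintegral_lintegral_olsErr_le hℓ hA hnp hν).trans (ENNReal.ofReal_le_ofReal ?_)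
  have hpos : (0 : ℝ) < n - p - 1 := by linarith
  have h2 : (p : ℝ) / (n - p - 1) ≤ 2 * (p / n) := by
    rw [← mul_div_assoc, div_le_div_iff₀ hpos (by linarith)]
    have : (0 : ℝ) ≤ p := by positivity
    nlinarith
  calc σ ^ 2 * ℓ ^ 2 * (p / ((n : ℝ) - p - 1)) ≤ σ ^ 2 * ℓ ^ 2 * (2 * (p / n)) := by gcongr
    _ = _ := by ring

/-- On the event that the sample covariance matrix is well conditioned, the error is bounded by
stability of the minimizer; elsewhere it is bounded by the least squares error and the signal. -/
lemma sq_norm_twoStage_sub_le (hn : 0 < n) (hℓ : 1 ≤ ℓ) {A : Matrix (Fin p) (Fin p) ℝ}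
    (hA : CovClass ℓ⁻¹ ℓ A) (θ₀ : Vec p) {δ : ℝ} (hδ : 0 ≤ δ) (X : Fin n → Vec p) (e : Fin n → ℝ) :
    ENNReal.ofReal (‖twoStage δ (mkData θ₀ X e) - thetaStar A θ₀ δ‖ ^ 2)
      ≤ ENNReal.ofReal (2 * stabConst (16 * ℓ ^ 2) ^ 2 + 2) * ENNReal.ofReal (‖olsErr X e‖ ^ 2)
        + (ENNReal.ofReal (2 * stabConst (16 * ℓ ^ 2) ^ 2)
            * ENNReal.ofReal (‖score A 0 (basePoint A θ₀ δ) 0 X‖ ^ 2)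
          + {X | ¬ CovClass (16 * ℓ ^ 2)⁻¹ (16 * ℓ ^ 2) (gram X)}.indicator
            (fun _ => ENNReal.ofReal (8 * ‖θ₀‖ ^ 2)) X) := by
  set L := 16 * ℓ ^ 2
  set K := stabConst L
  have hL : 1 ≤ L := one_le_widen hℓ
  have hAL : CovClass L⁻¹ L A := hA.widen hℓ
  have hθ := thetaStar_eq hℓ hA θ₀ hδ
  have hsc : score A 0 (basePoint A θ₀ δ) 0 X = mulV (gram X - A) (basePoint A θ₀ δ) := by
    simp [score, crossAvg]
  by_cases hX : CovClass L⁻¹ L (gram X)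
  · have hpd := hX.posDef (inv_pos.mpr (by linarith))
    have h1 := norm_pathEst_sub_pathEst_le hL hAL hX θ₀ (θ₀ + olsErr X e) hδ
    rw [add_sub_cancel_left, ← twoStage_mkData δ hn θ₀ e hpd, ← hθ, ← hsc] at h1
    have hK : 0 < K := stabConst_pos hL
    rw [Set.indicator_of_notMem (by simpa using hX), add_zero, ← ENNReal.ofReal_mul (by positivity),
      ← ENNReal.ofReal_mul (by positivity), ← ENNReal.ofReal_add (by positivity) (by positivity)]
    apply ENNReal.ofReal_le_ofReal
    set a := ‖olsErr X e‖
    set b := ‖score A 0 (basePoint A θ₀ δ) 0 X‖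
    calc _ ≤ (K * (a + b)) ^ 2 := pow_le_pow_left₀ (norm_nonneg _) h1 2
      _ ≤ 2 * K ^ 2 * a ^ 2 + 2 * K ^ 2 * b ^ 2 := by nlinarith [sq_nonneg (K * (a - b))]
      _ ≤ _ := by nlinarith [sq_nonneg a]
  · have h1 := norm_twoStage_le δ hn θ₀ X e
    have h2 : ‖thetaStar A θ₀ δ‖ ≤ ‖θ₀‖ := by
      rw [hθ]; exact norm_pathEst_le (hA.posDef (inv_pos.mpr (by linarith))) θ₀ δ
    rw [Set.indicator_of_mem (by simpa using hX)]
    refine le_trans ?_ (add_le_add_right le_add_self _)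
    rw [← ENNReal.ofReal_mul (by positivity), ← ENNReal.ofReal_add (by positivity) (by positivity)]
    apply ENNReal.ofReal_le_ofReal
    set a := ‖olsErr X e‖
    have h3 := (norm_sub_le (twoStage δ (mkData θ₀ X e)) (thetaStar A θ₀ δ)).trans (add_le_add h1 h2)
    calc _ ≤ (‖θ₀‖ + a + ‖θ₀‖) ^ 2 := pow_le_pow_left₀ (norm_nonneg _) h3 2
      _ ≤ 2 * a ^ 2 + 8 * ‖θ₀‖ ^ 2 := by nlinarith [sq_nonneg (a - 2 * ‖θ₀‖)]
      _ ≤ _ := by nlinarith [mul_nonneg (sq_nonneg K) (sq_nonneg a)]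

/-- The constant of the upper bound: a part for the noise and a part for the fluctuations of the sample
covariance matrix. -/
noncomputable def riskConst (ℓ : ℝ) : ℝ :=
  (2 * stabConst (16 * ℓ ^ 2) ^ 2 + 2) * (2 * ℓ ^ 2)
    + (2 * stabConst (16 * ℓ ^ 2) ^ 2 * (2 * ℓ ^ 4) + 8) * ℓ ^ 2

lemma riskConst_pos (hℓ : 1 ≤ ℓ) : 0 < riskConst ℓ := by unfold riskConst; positivity

/-- The mean squared error of the two-stage estimator is at most of the order of `v² p / n`. -/
theorem mse_twoStage_le (h : LargeSample ℓ p n) (hℓ : 1 ≤ ℓ) {A : Matrix (Fin p) (Fin p) ℝ}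
    (hA : CovClass ℓ⁻¹ ℓ A) (θ₀ : Vec p) {σ : ℝ} {ν : Measure ℝ} (hν : IsNoise ν σ) {δ : ℝ}
    (hδ : 0 ≤ δ) :
    mse (n := n) A θ₀ ν δ (twoStage δ) ≤ ENNReal.ofReal (riskConst ℓ * rate n A θ₀ σ) := by
  have hprob := hν.1
  have hn := h.pos
  have hℓ0 : 0 < ℓ := by linarith
  set K := stabConst (16 * ℓ ^ 2)
  rw [mse_eq (measurable_twoStage hn hδ)]
  set bad : Set (Fin n → Vec p) := {X | ¬ CovClass (16 * ℓ ^ 2)⁻¹ (16 * ℓ ^ 2) (gram X)}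
  set π := Measure.pi fun _ : Fin n => ν
  set b := basePoint A θ₀ δ
  have hmo : ∀ X : Fin n → Vec p, Measurable fun e => ENNReal.ofReal (‖olsErr X e‖ ^ 2) := fun X =>
    ((measurable_olsErr.comp measurable_prodMk_left).norm.pow_const 2).ennreal_ofReal
  have hmX : Measurable fun X : Fin n → Vec p => ∫⁻ e, ENNReal.ofReal (‖olsErr X e‖ ^ 2) ∂π :=
    Measurable.lintegral_prod_right'
      (f := fun q : (Fin n → Vec p) × (Fin n → ℝ) => ENNReal.ofReal (‖olsErr q.1 q.2‖ ^ 2))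
      ((measurable_olsErr.norm.pow_const 2).ennreal_ofReal)
  have hms : Measurable fun X : Fin n → Vec p => ENNReal.ofReal (‖score A 0 b 0 X‖ ^ 2) :=
    ((continuous_score A 0 b 0).measurable.norm.pow_const 2).ennreal_ofReal
  have hb : ‖b‖ ^ 2 ≤ ℓ ^ 2 * ‖θ₀‖ ^ 2 := by
    rw [← mul_pow]
    exact pow_le_pow_left₀ (norm_nonneg _) (norm_basePoint_le hℓ hA θ₀ δ) 2
  have hθ : ‖θ₀‖ ^ 2 ≤ ℓ ^ 2 * wnorm A θ₀ ^ 2 := by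
    rw [← mul_pow]
    exact pow_le_pow_left₀ (norm_nonneg _) (hA.norm_le hℓ θ₀) 2
  -- the fluctuation `S - A` is only needed at the fixed vector `b`, where its mean square is of the order
  -- of `p / n`
  have s1 : ∫⁻ X, ENNReal.ofReal (‖score A 0 b 0 X‖ ^ 2) ∂(rowLaw n A)
      ≤ ENNReal.ofReal (2 * ℓ ^ 4 * ‖θ₀‖ ^ 2 * (p / n)) := by
    refine (lintegral_norm_score_sq_le hn hℓ hA (Or.inr rfl) b 0).trans (ENNReal.ofReal_le_ofReal ?_)
    have : avgSq (0 : Fin n → ℝ) = 0 := by simp [avgSq]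
    rw [this, add_zero]
    calc 2 * ℓ ^ 2 * ‖b‖ ^ 2 * (p / n) ≤ 2 * ℓ ^ 2 * (ℓ ^ 2 * ‖θ₀‖ ^ 2) * (p / n) := by gcongr
      _ = _ := by ring
  calc ∫⁻ X, ∫⁻ e, ENNReal.ofReal (‖twoStage δ (mkData θ₀ X e) - thetaStar A θ₀ δ‖ ^ 2) ∂π ∂(rowLaw n A)
      ≤ ∫⁻ X, (ENNReal.ofReal (2 * K ^ 2 + 2) * ∫⁻ e, ENNReal.ofReal (‖olsErr X e‖ ^ 2) ∂π)
        + (ENNReal.ofReal (2 * K ^ 2) * ENNReal.ofReal (‖score A 0 b 0 X‖ ^ 2)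
          + bad.indicator (fun _ => ENNReal.ofReal (8 * ‖θ₀‖ ^ 2)) X) ∂(rowLaw n A) := by
        refine lintegral_mono fun X => ?_
        refine (lintegral_mono fun e => sq_norm_twoStage_sub_le hn hℓ hA θ₀ hδ X e).trans ?_
        rw [lintegral_add_left ((hmo X).const_mul _), lintegral_const_mul _ (hmo X), lintegral_const,
          measure_univ, mul_one]
    _ ≤ ENNReal.ofReal (2 * K ^ 2 + 2) * ENNReal.ofReal (2 * ℓ ^ 2 * σ ^ 2 * (p / n))
        + (ENNReal.ofReal (2 * K ^ 2) * ENNReal.ofReal (2 * ℓ ^ 4 * ‖θ₀‖ ^ 2 * (p / n))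
          + ENNReal.ofReal (8 * ‖θ₀‖ ^ 2) * ENNReal.ofReal (p / n)) := by
        rw [lintegral_add_left (hmX.const_mul _), lintegral_add_left (hms.const_mul _),
          lintegral_const_mul _ hmX, lintegral_const_mul _ hms]
        gcongr
        · exact lintegral_olsErr_le h hℓ hA hν
        · exact (lintegral_indicator_const_le _ _).trans
            (mul_le_mul_right (h.prob_le hℓ hA) _)
    _ ≤ _ := by
        rw [← ENNReal.ofReal_mul (by positivity), ← ENNReal.ofReal_mul (by positivity),
          ← ENNReal.ofReal_mul (by positivity), ← ENNReal.ofReal_add (by positivity) (by positivity),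
          ← ENNReal.ofReal_add (by positivity) (by positivity)]
        apply ENNReal.ofReal_le_ofReal
        have hr : (0 : ℝ) ≤ p / n := by positivity
        have e1 : rate n A θ₀ σ = (wnorm A θ₀ ^ 2 + σ ^ 2) * (p / n) := by
          rw [rate, mul_div_assoc]
        rw [e1, riskConst]
        have k1 : (2 * K ^ 2 * (2 * ℓ ^ 4) + 8) * ‖θ₀‖ ^ 2
            ≤ (2 * K ^ 2 * (2 * ℓ ^ 4) + 8) * (ℓ ^ 2 * wnorm A θ₀ ^ 2) := by gcongr
        have k2 : 0 ≤ (2 * K ^ 2 + 2) * (2 * ℓ ^ 2) * wnorm A θ₀ ^ 2 := by positivity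
        have k3 : 0 ≤ (2 * K ^ 2 * (2 * ℓ ^ 4) + 8) * ℓ ^ 2 * σ ^ 2 := by positivity
        calc _ = ((2 * K ^ 2 + 2) * (2 * ℓ ^ 2) * σ ^ 2
              + (2 * K ^ 2 * (2 * ℓ ^ 4) + 8) * ‖θ₀‖ ^ 2) * (p / n) := by ring
          _ ≤ (((2 * K ^ 2 + 2) * (2 * ℓ ^ 2) + (2 * K ^ 2 * (2 * ℓ ^ 4) + 8) * ℓ ^ 2)
              * (wnorm A θ₀ ^ 2 + σ ^ 2)) * (p / n) := by
              refine mul_le_mul_of_nonneg_right ?_ hr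
              nlinarith
          _ = _ := by ring

end upper

end AdvLinReg

namespace AdvLinReg

/-! ### The lower bound below the lower threshold -/

section noise

variable {n : ℕ} {ν : Measure ℝ} [IsProbabilityMeasure ν]

lemma lintegral_avg (hn : 0 < n) {f : ℝ → ℝ} (hf : Measurable f) (h0 : ∀ x, 0 ≤ f x)
    (hi : Integrable f ν) :
    ∫⁻ e, ENNReal.ofReal ((1 / (n : ℝ)) * ∑ i, f (e i)) ∂(Measure.pi fun _ : Fin n => ν)
      = ENNReal.ofReal (∫ x, f x ∂ν) := by
  have hn' : (n : ℝ) ≠ 0 := by positivity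
  have h : ∀ e : Fin n → ℝ, ENNReal.ofReal ((1 / (n : ℝ)) * ∑ i, f (e i))
      = ENNReal.ofReal (1 / (n : ℝ)) * ∑ i, ENNReal.ofReal (f (e i)) := fun e => by
    rw [ENNReal.ofReal_mul (by positivity), ENNReal.ofReal_sum_of_nonneg fun i _ => h0 _]
  have hm : ∀ i : Fin n, Measurable fun e : Fin n → ℝ => ENNReal.ofReal (f (e i)) := fun i =>
    (hf.comp (measurable_pi_apply i)).ennreal_ofReal
  simp_rw [h]
  rw [lintegral_const_mul _ (Finset.measurable_sum _ fun i _ => hm i),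
    lintegral_finsetSum _ fun i _ => hm i]
  have h1 : ∀ i : Fin n, ∫⁻ e, ENNReal.ofReal (f (e i)) ∂(Measure.pi fun _ : Fin n => ν)
      = ENNReal.ofReal (∫ x, f x ∂ν) := by
    intro i
    rw [ofReal_integral_eq_lintegral_ofReal hi (ae_of_all _ h0)]
    exact (measurePreserving_eval (fun _ : Fin n => ν) i).lintegral_comp hf.ennreal_ofReal
  simp_rw [h1]
  rw [Finset.sum_const, Finset.card_univ, Fintype.card_fin, ← ENNReal.ofReal_nsmul,
    ← ENNReal.ofReal_mul (by positivity), nsmul_eq_mul]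
  congr 1
  field_simp

lemma lintegral_avgSq (hn : 0 < n) {σ : ℝ} (hν : IsNoise ν σ) :
    ∫⁻ e, ENNReal.ofReal (avgSq e) ∂(Measure.pi fun _ : Fin n => ν) = ENNReal.ofReal (σ ^ 2) := by
  have := lintegral_avg (ν := ν) hn (f := fun x => x ^ 2) (by fun_prop) (fun x => sq_nonneg x)
    hν.2.1.integrable_sq
  rw [hν.2.2.2] at this
  exact this

lemma avgSq_sq_le (e : Fin n → ℝ) : avgSq e ^ 2 ≤ (1 / (n : ℝ)) * ∑ i, e i ^ 4 := by
  rcases Nat.eq_zero_or_pos n with h0 | h0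
  · subst h0; simp [avgSq]
  have hn' : (0 : ℝ) < n := by positivity
  have h := sq_sum_le_card_mul_sum_sq (s := Finset.univ) (f := fun i => e i ^ 2)
  simp only [Finset.card_univ, Fintype.card_fin, ← pow_mul] at h
  calc avgSq e ^ 2 = (1 / (n : ℝ)) ^ 2 * (∑ i, e i ^ 2) ^ 2 := by rw [avgSq, mul_pow]
    _ ≤ (1 / (n : ℝ)) ^ 2 * (n * ∑ i, e i ^ 4) := by gcongr
    _ = _ := by field_simp

lemma lintegral_avgSq_sq_le (hn : 0 < n) {M : ℝ} (h4 : MemLp (fun e : ℝ => e) 4 ν)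
    (hM : ∫ e, e ^ 4 ∂ν ≤ M) :
    ∫⁻ e, ENNReal.ofReal (avgSq e ^ 2) ∂(Measure.pi fun _ : Fin n => ν) ≤ ENNReal.ofReal M := by
  have hi : Integrable (fun x : ℝ => x ^ 4) ν := by
    have := h4.integrable_norm_pow (p := 4) (by norm_num)
    simpa [Even.pow_abs (by decide : Even 4)] using this
  have := lintegral_avg (ν := ν) hn (f := fun x => x ^ 4) (by fun_prop)
    (fun x => by positivity) hi
  refine (lintegral_mono fun e => ENNReal.ofReal_le_ofReal (avgSq_sq_le e)).trans ?_
  rw [this]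
  exact ENNReal.ofReal_le_ofReal hM

lemma measurable_avgSq : Measurable (avgSq : (Fin n → ℝ) → ℝ) := by
  unfold avgSq; fun_prop

/-- From a bound with a remainder of half the size. -/
lemma ofReal_le_of_le_add_half {a C : ℝ} (hC : 0 < C) {m r : ℝ≥0∞} (ha : 0 ≤ a)
    (h : ENNReal.ofReal a ≤ ENNReal.ofReal C * m + r) (hr : r ≤ ENNReal.ofReal (a / 2)) :
    ENNReal.ofReal (a / (2 * C)) ≤ m := by
  have h1 : ENNReal.ofReal (a / 2) + ENNReal.ofReal (a / 2)
      ≤ ENNReal.ofReal C * m + ENNReal.ofReal (a / 2) := by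
    rw [← ENNReal.ofReal_add (by positivity) (by positivity), add_halves]
    exact h.trans (by gcongr)
  have h2 := (ENNReal.add_le_add_iff_right ENNReal.ofReal_ne_top).mp h1
  have h3 : a / (2 * C) = C⁻¹ * (a / 2) := by field_simp
  rw [h3, ENNReal.ofReal_mul (by positivity), ENNReal.ofReal_inv_of_pos hC]
  calc (ENNReal.ofReal C)⁻¹ * ENNReal.ofReal (a / 2)
      ≤ (ENNReal.ofReal C)⁻¹ * (ENNReal.ofReal C * m) := by gcongr
    _ = m := by
        rw [← mul_assoc, ENNReal.inv_mul_cancel (by simpa using hC) ENNReal.ofReal_ne_top, one_mul]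

end noise

section below

variable {p n : ℕ} {L : ℝ} {A : Matrix (Fin p) (Fin p) ℝ}

lemma olsErr_eq_res (X : Fin n → Vec p) (e : Fin n → ℝ) :
    olsErr X e = res (gram X) 0 (crossAvg X e) := by
  simp [olsErr, res]

lemma norm_olsErr_le (hL : 1 ≤ L) {X : Fin n → Vec p} (hX : CovClass L⁻¹ L (gram X))
    (e : Fin n → ℝ) : ‖olsErr X e‖ ≤ L * ‖crossAvg X e‖ := by
  have := norm_res_le hL hX le_rfl (crossAvg X e)
  rw [olsErr_eq_res]
  simpa using this

lemma mulV_gram_olsErr {X : Fin n → Vec p} (hX : (gram X).PosDef) (e : Fin n → ℝ) :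
    mulV (gram X) (olsErr X e) = crossAvg X e := by
  rw [olsErr_eq_res, mulV_res_zero hX]

lemma pathEst_of_le_delta1 (hA : A.PosDef) (t : Vec p) {δ : ℝ} (h : δ ≤ delta1 A t) :
    pathEst A t δ = t := by
  rw [pathEst, lambdaStar, if_pos h, thetaPath_zero_level hA]

/-- Strictly below the lower threshold, the estimator is the least squares estimate as soon as the
empirical quantities are close to the population ones. -/
lemma pathEst_eq_of_small (hL : 1 ≤ L) (hA : CovClass L⁻¹ L A) {X : Fin n → Vec p}
    (hX : CovClass L⁻¹ L (gram X)) {θ₀ : Vec p} (hθ : θ₀ ≠ 0) {δ ε : ℝ} (hε : 0 < ε) (hε1 : ε ≤ 1)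
    (hδ : δ ≤ (1 - ε) * delta1 A θ₀) (e : Fin n → ℝ)
    (hN : ‖crossAvg X e‖ ≤ ε / (12 * L ^ 7) * ‖θ₀‖)
    (hM : ‖mulV (gram X - A) (res A 0 θ₀)‖ ≤ ε / (12 * L ^ 7) * ‖θ₀‖) :
    pathEst (gram X) (θ₀ + olsErr X e) δ = θ₀ + olsErr X e := by
  have hL0 : 0 < L := by linarith
  have hAp := hA.posDef (inv_pos.mpr hL0)
  have hXp := hX.posDef (inv_pos.mpr hL0)
  have hθ' : 0 < ‖θ₀‖ := norm_pos_iff.mpr hθ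
  set r := ε / (12 * L ^ 7) with hr
  have hr0 : 0 < r := by positivity
  have hr1 : 12 * L ^ 7 * r = ε := by rw [hr]; field_simp
  set S := gram X
  set η := olsErr X e
  set b := res A 0 θ₀
  set b' := res S 0 (θ₀ + η)
  have hη : ‖η‖ ≤ L * (r * ‖θ₀‖) := (norm_olsErr_le hL hX e).trans (by gcongr)
  have hLr : L * r ≤ 1 / 12 := by
    have : 12 * L ^ 7 * r ≤ 1 := by rw [hr1]; exact hε1
    have h7 : L ≤ L ^ 7 := le_self_pow₀ hL (by norm_num)
    nlinarith
  have ht : ‖θ₀‖ / 2 ≤ ‖θ₀ + η‖ := by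
    have := norm_sub_le_norm_add θ₀ η
    nlinarith
  have htne : θ₀ + η ≠ 0 := norm_pos_iff.mp (by linarith)
  have hb : b ≠ 0 := res_ne_zero hAp le_rfl hθ
  have hb' : b' ≠ 0 := res_ne_zero hXp le_rfl htne
  have hnb' : ‖θ₀‖ / 2 ≤ L * ‖b'‖ := by
    have := le_norm_res hL hX le_rfl (θ₀ + η)
    simp only [add_zero, mul_one] at this
    exact ht.trans this
  -- both base points solve linear systems with the matrix `S`
  have hdiff : b' - b = res S 0 (η - mulV (S - A) b) := by
    have hres : b = res S 0 (mulV S b) := by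
      rw [res, mulV_mulV]
      simp [Matrix.nonsing_inv_mul _ hXp.det_pos.ne'.isUnit]
    have h1 : res S 0 (η - mulV (S - A) b) = res S 0 (θ₀ + η) - res S 0 (mulV S b) := by
      have : η - mulV (S - A) b = (θ₀ + η) - mulV S b := by
        rw [sub_mulV, mulV_res_zero hAp]; abel
      rw [this, res, res, res, mulV_sub]
    rw [h1, ← hres]
  have hd : ‖b' - b‖ ≤ L * (L * (r * ‖θ₀‖) + r * ‖θ₀‖) := by
    rw [hdiff]
    have := norm_res_le hL hX le_rfl (η - mulV (S - A) b)
    simp only [add_zero, one_mul] at this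
    exact this.trans (by gcongr; exact (norm_sub_le _ _).trans (add_le_add hη hM))
  have hK := norm_mul_abs_ratio_sub_le hL hA hX hb hb'
  have hρ := le_ratio hL hA hb
  have hfin : |ratio S b' - ratio A b| ≤ ε * L⁻¹ := by
    have h1 : ‖b'‖ * |ratio S b' - ratio A b|
        ≤ 2 * L ^ 3 * (L * (L * (r * ‖θ₀‖) + r * ‖θ₀‖) + r * ‖θ₀‖) :=
      hK.trans (by gcongr)
    have h2 : ‖θ₀‖ / 2 * |ratio S b' - ratio A b| ≤ L * (2 * L ^ 3 * (L * (L * (r * ‖θ₀‖) + r * ‖θ₀‖)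
        + r * ‖θ₀‖)) := by
      calc _ ≤ L * ‖b'‖ * |ratio S b' - ratio A b| := by gcongr
        _ = L * (‖b'‖ * |ratio S b' - ratio A b|) := by ring
        _ ≤ _ := by gcongr
    have h3 : |ratio S b' - ratio A b| ≤ 4 * L ^ 4 * (L ^ 2 + L + 1) * r := by
      refine le_of_mul_le_mul_left (h2.trans (le_of_eq ?_)) (half_pos hθ')
      ring
    refine h3.trans ?_
    have h4 : L ^ 2 + L + 1 ≤ 3 * L ^ 2 := by nlinarith
    calc 4 * L ^ 4 * (L ^ 2 + L + 1) * r ≤ 4 * L ^ 4 * (3 * L ^ 2) * r := by gcongr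
      _ = (12 * L ^ 7 * r) * L⁻¹ := by field_simp; ring
      _ = _ := by rw [hr1]
  refine pathEst_of_le_delta1 hXp _ ?_
  rw [delta1_eq hXp]
  rw [delta1_eq hAp] at hδ
  refine hδ.trans ?_
  have h5 := (abs_le.mp hfin).1
  have h6 : (1 - ε) * ratio A b ≤ ratio S b' := by nlinarith
  have := mul_le_mul_of_nonneg_left h6 c0_pos.le
  linarith

/-- The squared score is controlled by the squared error, up to fourth moments and the event that
the sample covariance matrix is ill conditioned. -/
lemma sq_crossAvg_le (hn : 0 < n) (hL : 1 ≤ L) (hA : CovClass L⁻¹ L A) {θ₀ : Vec p} (hθ : θ₀ ≠ 0)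
    {δ ε τ : ℝ} (hδ0 : 0 ≤ δ) (hε : 0 < ε) (hε1 : ε ≤ 1) (hδ : δ ≤ (1 - ε) * delta1 A θ₀) (hτ : 0 < τ)
    (X : Fin n → Vec p) (e : Fin n → ℝ) :
    ENNReal.ofReal (‖score A 0 0 e X‖ ^ 2)
      ≤ ENNReal.ofReal (L ^ 2)
          * ENNReal.ofReal (‖twoStage δ (mkData θ₀ X e) - thetaStar A θ₀ δ‖ ^ 2)
        + (ENNReal.ofReal (((12 * L ^ 7 / ε) ^ 2 + τ⁻¹) / ‖θ₀‖ ^ 2)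
            * ENNReal.ofReal (‖score A 0 0 e X‖ ^ 4)
          + (ENNReal.ofReal (((12 * L ^ 7 / ε) ^ 2 + τ⁻¹) / ‖θ₀‖ ^ 2)
            * ENNReal.ofReal (‖score A 0 (res A 0 θ₀) 0 X‖ ^ 4)
          + {X | ¬ CovClass L⁻¹ L (gram X)}.indicator
            (fun _ => ENNReal.ofReal (τ * ‖θ₀‖ ^ 2)) X)) := by
  have hL0 : 0 < L := by linarith
  have hAp := hA.posDef (inv_pos.mpr hL0)
  have hθ' : 0 < ‖θ₀‖ := norm_pos_iff.mpr hθ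
  have eN : score A 0 0 e X = crossAvg X e := by simp [score]
  have eM : score A 0 (res A 0 θ₀) 0 X = mulV (gram X - A) (res A 0 θ₀) := by
    simp [score, crossAvg]
  rw [eN, eM]
  set N := ‖crossAvg X e‖
  set M := ‖mulV (gram X - A) (res A 0 θ₀)‖
  set Q := 12 * L ^ 7 / ε with hQ
  have hQ0 : 0 < Q := by positivity
  set Δ := ‖twoStage δ (mkData θ₀ X e) - thetaStar A θ₀ δ‖
  set T := ‖θ₀‖ ^ 2 with hT
  have hT0 : 0 < T := by positivity
  have hN0 : 0 ≤ N := norm_nonneg _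
  have hM0 : 0 ≤ M := norm_nonneg _
  by_cases hX : CovClass L⁻¹ L (gram X)
  · rw [Set.indicator_of_notMem (by simpa using hX), add_zero, ← ENNReal.ofReal_mul (by positivity),
      ← ENNReal.ofReal_mul (by positivity), ← ENNReal.ofReal_mul (by positivity),
      ← ENNReal.ofReal_add (by positivity) (by positivity),
      ← ENNReal.ofReal_add (by positivity) (by positivity)]
    apply ENNReal.ofReal_le_ofReal
    have hXp := hX.posDef (inv_pos.mpr hL0)
    have hrest : ∀ a : ℝ, 0 ≤ a → (Q ^ 2 + τ⁻¹) / T * a = Q ^ 2 * a / T + τ⁻¹ * a / T := by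
      intro a _; ring
    have p1 : 0 ≤ L ^ 2 * Δ ^ 2 := by positivity
    have p2 : 0 ≤ τ⁻¹ * N ^ 4 / T := by positivity
    have p3 : 0 ≤ τ⁻¹ * M ^ 4 / T := by positivity
    have p4 : 0 ≤ Q ^ 2 * N ^ 4 / T := by positivity
    have p5 : 0 ≤ Q ^ 2 * M ^ 4 / T := by positivity
    rw [hrest _ (by positivity), hrest _ (by positivity)]
    have hsmall : ∀ a : ℝ, 0 ≤ a → ε / (12 * L ^ 7) * ‖θ₀‖ < a → 1 ≤ Q ^ 2 * a ^ 2 / T := by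
      intro a ha h
      have h1 : ‖θ₀‖ ≤ Q * a := by
        have : ‖θ₀‖ = Q * (ε / (12 * L ^ 7) * ‖θ₀‖) := by rw [hQ]; field_simp
        rw [this]; gcongr
      rw [le_div_iff₀ hT0, one_mul, ← mul_pow]
      exact pow_le_pow_left₀ hθ'.le h1 2
    -- if one of the two averages is large compared with `‖θ₀‖`, the fourth moments dominate
    by_cases hNs : N ≤ ε / (12 * L ^ 7) * ‖θ₀‖
    · by_cases hMs : M ≤ ε / (12 * L ^ 7) * ‖θ₀‖
      · have h1 := pathEst_eq_of_small hL hA hX hθ hε hε1 hδ e hNs hMs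
        have h2 : thetaStar A θ₀ δ = θ₀ := by
          rw [thetaStar_eq hL hA θ₀ hδ0]
          refine pathEst_of_le_delta1 hAp _ (hδ.trans ?_)
          nlinarith [delta1_pos hL hA hθ]
        have h3 : Δ = ‖olsErr X e‖ := by
          simp only [Δ]
          rw [twoStage_mkData δ hn θ₀ e hXp, h1, h2, add_sub_cancel_left]
        have h4 : N ≤ L * Δ := by
          rw [h3]
          simp only [N]
          rw [← mulV_gram_olsErr hXp]
          exact hX.norm_mulV_le hL _
        have h5 : N ^ 2 ≤ L ^ 2 * Δ ^ 2 := by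
          rw [← mul_pow]; exact pow_le_pow_left₀ hN0 h4 2
        linarith
      · have h1 := hsmall M hM0 (not_le.mp hMs)
        have h2 : N ^ 2 ≤ N ^ 2 * (Q ^ 2 * M ^ 2 / T) := le_mul_of_one_le_right (sq_nonneg N) h1
        have h3 : N ^ 2 * (Q ^ 2 * M ^ 2 / T) ≤ Q ^ 2 * N ^ 4 / T + Q ^ 2 * M ^ 4 / T := by
          rw [← add_div, mul_div_assoc', div_le_div_iff_of_pos_right hT0]
          nlinarith [mul_nonneg (sq_nonneg Q) (sq_nonneg (N ^ 2 - M ^ 2)),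
            mul_nonneg (sq_nonneg Q) (sq_nonneg (N ^ 2)), mul_nonneg (sq_nonneg Q) (sq_nonneg (M ^ 2))]
        linarith
    · have h1 := hsmall N hN0 (not_le.mp hNs)
      have h2 : N ^ 2 ≤ N ^ 2 * (Q ^ 2 * N ^ 2 / T) := le_mul_of_one_le_right (sq_nonneg N) h1
      have h3 : N ^ 2 * (Q ^ 2 * N ^ 2 / T) = Q ^ 2 * N ^ 4 / T := by ring
      linarith
  · rw [Set.indicator_of_mem (by simpa using hX)]
    refine le_trans ?_ le_add_self
    refine le_trans ?_ (add_le_add_right le_add_self _)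
    rw [← ENNReal.ofReal_mul (by positivity), ← ENNReal.ofReal_add (by positivity) (by positivity)]
    apply ENNReal.ofReal_le_ofReal
    have h1 : (Q ^ 2 + τ⁻¹) / T * N ^ 4 = Q ^ 2 * N ^ 4 / T + N ^ 4 / (τ * T) := by
      field_simp
    have p4 : 0 ≤ Q ^ 2 * N ^ 4 / T := by positivity
    have h2 : N ^ 2 ≤ N ^ 4 / (τ * T) + τ * T := by
      have hs : 0 < τ * T := by positivity
      rw [div_add' _ _ _ hs.ne', le_div_iff₀ hs]
      nlinarith [sq_nonneg (N ^ 2 - τ * T), sq_nonneg (N ^ 2), sq_nonneg (τ * T)]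
    rw [h1]; linarith

end below

end AdvLinReg

namespace AdvLinReg

section below

variable {p n : ℕ}

lemma rate_eq (n : ℕ) (A : Matrix (Fin p) (Fin p) ℝ) (θ₀ : Vec p) (σ : ℝ) :
    rate n A θ₀ σ = (wnorm A θ₀ ^ 2 + σ ^ 2) * (p / n) := by rw [rate, mul_div_assoc]

/-- Lower bound for the mean squared error strictly below the lower threshold. -/
theorem le_mse_twoStage_of_le_delta1 {ℓ κ K ε : ℝ} (hℓ : 1 ≤ ℓ) (hκ : 0 < κ) (hK : 0 < K)
    (hε : 0 < ε) : ∃ c η : ℝ, 0 < c ∧ 0 < η ∧ ∀ {p n : ℕ}, LargeSample ℓ p n → (p / n : ℝ) ≤ η →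
      ∀ (A : Matrix (Fin p) (Fin p) ℝ) (θ₀ : Vec p) (σ : ℝ) (ν : Measure ℝ) (δ : ℝ),
        CovClass ℓ⁻¹ ℓ A → 0 ≤ σ → IsNoise ν σ → MemLp (fun e : ℝ => e) 4 ν →
        ∫ e, e ^ 4 ∂ν ≤ K * σ ^ 4 → κ * σ ≤ wnorm A θ₀ → wnorm A θ₀ ≤ K * σ →
        0 ≤ δ → δ ≤ (1 - ε) * delta1 A θ₀ →
          ENNReal.ofReal (c * rate n A θ₀ σ) ≤ mse (n := n) A θ₀ ν δ (twoStage δ) := by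
  set L := 16 * ℓ ^ 2 with hLdef
  have hL : 1 ≤ L := one_le_widen hℓ
  have hL0 : 0 < L := by linarith
  set ε' := min ε 1 with hε'
  have hε'0 : 0 < ε' := lt_min hε one_pos
  set τ := 1 / (4 * L ^ 3 * K ^ 2) with hτ
  have hτ0 : 0 < τ := by positivity
  set B := (12 * L ^ 7 / ε') ^ 2 + τ⁻¹ with hB
  have hB0 : 0 < B := by positivity
  set D := B * (21016 * L ^ 8) * (K * L ^ 2 / κ ^ 2 + L ^ 6 * K ^ 2) with hD
  have hD0 : 0 < D := by positivity
  refine ⟨1 / (2 * L ^ 3 * (K ^ 2 + 1)), 1 / (4 * L * D), by positivity, by positivity, ?_⟩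
  intro p n h hq A θ₀ σ ν δ hA hσ hν h4 hM4 hκW hWK hδ0 hδ
  have hprob := hν.1
  have hn := h.pos
  have hAL : CovClass L⁻¹ L A := hA.widen hℓ
  set W := wnorm A θ₀ with hW
  have hW0 : 0 ≤ W := wnorm_nonneg _ _
  rw [rate_eq]
  set q : ℝ := p / n with hqdef
  have hq0 : 0 ≤ q := by positivity
  rcases eq_or_ne θ₀ 0 with h0 | hθ
  · have hw : W = 0 := by rw [hW, h0, wnorm_zero]
    have : σ = 0 := by nlinarith
    simp [← hW, hw, this]
  have hθ' : 0 < ‖θ₀‖ := norm_pos_iff.mpr hθ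
  set T := ‖θ₀‖ ^ 2 with hT
  have hT0 : 0 < T := by positivity
  have hTW : T ≤ L ^ 2 * (K ^ 2 * σ ^ 2) := by
    rw [← mul_pow, ← mul_pow, hT]
    exact pow_le_pow_left₀ (norm_nonneg _) ((hAL.norm_le hL θ₀).trans (by gcongr)) 2
  have hσT : σ ^ 2 ≤ L ^ 2 * T / κ ^ 2 := by
    rw [le_div_iff₀ (by positivity), hT, ← mul_pow, ← mul_pow, mul_comm σ]
    exact pow_le_pow_left₀ (by positivity) (hκW.trans (hAL.wnorm_le hL θ₀)) 2
  have hδ' : δ ≤ (1 - ε') * delta1 A θ₀ := by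
    refine hδ.trans (mul_le_mul_of_nonneg_right ?_ (delta1_pos hL hAL hθ).le)
    linarith [min_le_left ε 1]
  set π := Measure.pi fun _ : Fin n => ν
  set b := res A 0 θ₀ with hb
  have hbn : ‖b‖ ^ 2 ≤ L ^ 2 * T := by
    have := norm_res_le hL hAL le_rfl θ₀
    simp only [add_zero, one_mul] at this
    rw [hT, ← mul_pow]
    exact pow_le_pow_left₀ (norm_nonneg _) this 2
  -- the three moments
  have m2 : ENNReal.ofReal (σ ^ 2 * q / L)
      ≤ ∫⁻ e, ∫⁻ X, ENNReal.ofReal (‖score A 0 0 e X‖ ^ 2) ∂(rowLaw n A) ∂π := by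
    calc ENNReal.ofReal (σ ^ 2 * q / L)
        = ENNReal.ofReal (q / L) * ∫⁻ e, ENNReal.ofReal (avgSq e) ∂π := by
          rw [lintegral_avgSq hn hν, ← ENNReal.ofReal_mul (by positivity)]
          congr 1; ring
      _ = ∫⁻ e, ENNReal.ofReal (q / L) * ENNReal.ofReal (avgSq e) ∂π := by
          rw [lintegral_const_mul _ measurable_avgSq.ennreal_ofReal]
      _ ≤ _ := by
          refine lintegral_mono fun e => ?_
          refine le_trans (le_of_eq ?_) (lintegral_norm_score_sq_ge hn hL hAL (Or.inr rfl) 0 e)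
          rw [← ENNReal.ofReal_mul (by positivity)]
          congr 1
          simp only [wnorm_zero, norm_zero, hqdef]
          field_simp
          ring
  have m4 : ∫⁻ e, ∫⁻ X, ENNReal.ofReal (‖score A 0 0 e X‖ ^ 4) ∂(rowLaw n A) ∂π
      ≤ ENNReal.ofReal (21016 * L ^ 8 * q ^ 2 * (K * σ ^ 4)) := by
    calc _ ≤ ∫⁻ e, ENNReal.ofReal (21016 * L ^ 8 * q ^ 2) * ENNReal.ofReal (avgSq e ^ 2) ∂π := by
          refine lintegral_mono fun e => ?_
          refine (lintegral_norm_score_four_le hn hL hAL (Or.inr rfl) 0 e).trans (le_of_eq ?_)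
          rw [← ENNReal.ofReal_mul (by positivity)]
          congr 1
          rw [norm_zero]; ring
      _ ≤ _ := by
          rw [lintegral_const_mul _ (measurable_avgSq.pow_const 2).ennreal_ofReal,
            ENNReal.ofReal_mul (p := 21016 * L ^ 8 * q ^ 2) (by positivity)]
          gcongr
          exact lintegral_avgSq_sq_le hn h4 hM4
  have mb : ∫⁻ X, ENNReal.ofReal (‖score A 0 b (0 : Fin n → ℝ) X‖ ^ 4) ∂(rowLaw n A)
      ≤ ENNReal.ofReal (21016 * L ^ 8 * q ^ 2 * (L ^ 4 * T ^ 2)) := by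
    refine (lintegral_norm_score_four_le hn hL hAL (Or.inr rfl) b 0).trans
      (ENNReal.ofReal_le_ofReal ?_)
    have : avgSq (0 : Fin n → ℝ) = 0 := by simp [avgSq]
    rw [this, add_zero]
    calc 21016 * L ^ 8 * (‖b‖ ^ 2) ^ 2 * q ^ 2 ≤ 21016 * L ^ 8 * (L ^ 2 * T) ^ 2 * q ^ 2 := by gcongr
      _ = _ := by ring
  have hms4 : Measurable fun z : (Fin n → ℝ) × (Fin n → Vec p) =>
      ENNReal.ofReal (‖score A 0 0 z.1 z.2‖ ^ 4) := by
    have hc : Continuous fun z : (Fin n → ℝ) × (Fin n → Vec p) => score A 0 0 z.1 z.2 := by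
      simp only [score, mulV_zero, zero_add, offProj_zero_left]
      unfold crossAvg; fun_prop
    exact (hc.measurable.norm.pow_const 4).ennreal_ofReal
  have hmse : Measurable fun z : (Fin n → ℝ) × (Fin n → Vec p) =>
      ENNReal.ofReal (‖twoStage δ (mkData θ₀ z.2 z.1) - thetaStar A θ₀ δ‖ ^ 2) := by
    have h1 : Measurable fun z : (Fin n → ℝ) × (Fin n → Vec p) => mkData θ₀ z.2 z.1 :=
      (continuous_mkData θ₀).measurable.comp measurable_swap
    exact ((((measurable_twoStage hn hδ0).comp h1).sub_const _).norm.pow_const 2).ennreal_ofReal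
  -- integrate the pointwise comparison
  have key : ENNReal.ofReal (σ ^ 2 * q / L) ≤ ENNReal.ofReal (L ^ 2) * mse (n := n) A θ₀ ν δ (twoStage δ)
      + (ENNReal.ofReal (B / T) * ENNReal.ofReal (21016 * L ^ 8 * q ^ 2 * (K * σ ^ 4))
        + (ENNReal.ofReal (B / T) * ENNReal.ofReal (21016 * L ^ 8 * q ^ 2 * (L ^ 4 * T ^ 2))
          + ENNReal.ofReal (τ * T) * ENNReal.ofReal q)) := by
    refine m2.trans ?_
    rw [mse_eq_swap (measurable_twoStage hn hδ0)]
    calc ∫⁻ e, ∫⁻ X, ENNReal.ofReal (‖score A 0 0 e X‖ ^ 2) ∂(rowLaw n A) ∂π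
        ≤ ∫⁻ e, ENNReal.ofReal (L ^ 2) * (∫⁻ X, ENNReal.ofReal
            (‖twoStage δ (mkData θ₀ X e) - thetaStar A θ₀ δ‖ ^ 2) ∂(rowLaw n A))
          + (ENNReal.ofReal (B / T) * (∫⁻ X, ENNReal.ofReal (‖score A 0 0 e X‖ ^ 4) ∂(rowLaw n A))
            + (ENNReal.ofReal (B / T) * ENNReal.ofReal (21016 * L ^ 8 * q ^ 2 * (L ^ 4 * T ^ 2))
              + ENNReal.ofReal (τ * T) * ENNReal.ofReal q)) ∂π := by
          refine lintegral_mono fun e => ?_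
          refine (lintegral_mono fun X => sq_crossAvg_le hn hL hAL hθ hδ0 hε'0 (min_le_right _ _)
            hδ' hτ0 X e).trans ?_
          have q1 := hmse.comp (measurable_prodMk_left (x := e))
          have q2 := hms4.comp (measurable_prodMk_left (x := e))
          have q3 : Measurable fun X : Fin n → Vec p =>
              ENNReal.ofReal (‖score A 0 b (0 : Fin n → ℝ) X‖ ^ 4) :=
            ((continuous_score A 0 b 0).measurable.norm.pow_const 4).ennreal_ofReal
          simp only [Function.comp_def] at q1 q2
          rw [lintegral_add_left (q1.const_mul _), lintegral_add_left (q2.const_mul _),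
            lintegral_add_left (q3.const_mul _), lintegral_const_mul _ q1,
            lintegral_const_mul _ q2, lintegral_const_mul _ q3]
          gcongr
          exact (lintegral_indicator_const_le _ _).trans (mul_le_mul_right (h.prob_le hℓ hA) _)
      _ ≤ _ := by
          have q1 := hmse.lintegral_prod_right'  (ν := rowLaw n A)
          have q2 := hms4.lintegral_prod_right' (ν := rowLaw n A)
          rw [lintegral_add_left (q1.const_mul _), lintegral_add_left (q2.const_mul _),
            lintegral_const_mul _ q1, lintegral_const_mul _ q2, lintegral_const, measure_univ, mul_one]
          gcongr
  -- for small `p / n` the remainder is at most half of the main term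
  have hrest : ENNReal.ofReal (B / T) * ENNReal.ofReal (21016 * L ^ 8 * q ^ 2 * (K * σ ^ 4))
        + (ENNReal.ofReal (B / T) * ENNReal.ofReal (21016 * L ^ 8 * q ^ 2 * (L ^ 4 * T ^ 2))
          + ENNReal.ofReal (τ * T) * ENNReal.ofReal q) ≤ ENNReal.ofReal (σ ^ 2 * q / L / 2) := by
    rw [← ENNReal.ofReal_mul (by positivity), ← ENNReal.ofReal_mul (by positivity),
      ← ENNReal.ofReal_mul (by positivity), ← ENNReal.ofReal_add (by positivity) (by positivity),
      ← ENNReal.ofReal_add (by positivity) (by positivity)]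
    apply ENNReal.ofReal_le_ofReal
    have r1 : σ ^ 4 / T ≤ σ ^ 2 * (L ^ 2 / κ ^ 2) := by
      rw [div_le_iff₀ hT0]
      calc σ ^ 4 = σ ^ 2 * σ ^ 2 := by ring
        _ ≤ σ ^ 2 * (L ^ 2 * T / κ ^ 2) := by gcongr
        _ = _ := by ring
    have r2 : τ * T ≤ σ ^ 2 / (4 * L) := by
      calc τ * T ≤ τ * (L ^ 2 * (K ^ 2 * σ ^ 2)) := by gcongr
        _ = _ := by rw [hτ]; field_simp
    have r3 : D * q ≤ 1 / (4 * L) := by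
      calc D * q ≤ D * (1 / (4 * L * D)) := by gcongr
        _ = _ := by field_simp
    calc _ = B * (21016 * L ^ 8) * q ^ 2 * (K * (σ ^ 4 / T) + L ^ 4 * T) + τ * T * q := by
          field_simp
          ring
      _ ≤ B * (21016 * L ^ 8) * q ^ 2 * (K * (σ ^ 2 * (L ^ 2 / κ ^ 2))
            + L ^ 4 * (L ^ 2 * (K ^ 2 * σ ^ 2))) + σ ^ 2 / (4 * L) * q := by gcongr
      _ = D * q * (σ ^ 2 * q) + σ ^ 2 / (4 * L) * q := by rw [hD]; ring
      _ ≤ 1 / (4 * L) * (σ ^ 2 * q) + σ ^ 2 / (4 * L) * q := by gcongr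
      _ = _ := by field_simp; ring
  have hfin := ofReal_le_of_le_add_half (by positivity : 0 < L ^ 2)
    (by positivity : 0 ≤ σ ^ 2 * q / L) key hrest
  refine le_trans (ENNReal.ofReal_le_ofReal ?_) hfin
  have hW2 : W ^ 2 ≤ K ^ 2 * σ ^ 2 := by rw [← mul_pow]; exact pow_le_pow_left₀ hW0 hWK 2
  calc 1 / (2 * L ^ 3 * (K ^ 2 + 1)) * ((W ^ 2 + σ ^ 2) * q)
      ≤ 1 / (2 * L ^ 3 * (K ^ 2 + 1)) * ((K ^ 2 * σ ^ 2 + σ ^ 2) * q) := by gcongr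
    _ = _ := by field_simp

end below

end AdvLinReg

namespace AdvLinReg

/-! ### The lower bound between the thresholds -/

section noise

variable {p n : ℕ}

/-- With probability at least one half, the noise has mean square at most `2σ²`. -/
lemma half_le_measure_avgSq {ν : Measure ℝ} (hn : 0 < n) {σ : ℝ} (hν : IsNoise ν σ) :
    (2 : ℝ≥0∞)⁻¹ ≤ (Measure.pi fun _ : Fin n => ν) {e | avgSq e ≤ 2 * σ ^ 2} := by
  have hprob := hν.1
  set π := Measure.pi fun _ : Fin n => ν
  have hms : MeasurableSet {e : Fin n → ℝ | avgSq e ≤ 2 * σ ^ 2} :=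
    measurable_avgSq measurableSet_Iic
  have hI := lintegral_avgSq hn hν
  have hc : π {e : Fin n → ℝ | avgSq e ≤ 2 * σ ^ 2}ᶜ ≤ 2⁻¹ := by
    rcases eq_or_ne σ 0 with h0 | h0
    · rw [h0] at hI ⊢
      simp only [ne_eq, OfNat.ofNat_ne_zero, not_false_eq_true, zero_pow, ENNReal.ofReal_zero] at hI
      rw [lintegral_eq_zero_iff measurable_avgSq.ennreal_ofReal] at hI
      have : π {e : Fin n → ℝ | avgSq e ≤ 2 * (0 : ℝ) ^ 2}ᶜ = 0 := by
        rw [← mem_ae_iff]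
        filter_upwards [hI] with e he
        have : avgSq e ≤ 0 := by simpa using he
        simpa using this
      rw [this]; exact zero_le
    · have hσ : 0 < 2 * σ ^ 2 := by positivity
      have h1 := mul_meas_ge_le_lintegral (μ := π) measurable_avgSq.ennreal_ofReal
        (ENNReal.ofReal (2 * σ ^ 2))
      rw [hI] at h1
      have h2 : π {e : Fin n → ℝ | avgSq e ≤ 2 * σ ^ 2}ᶜ
          ≤ π {e | ENNReal.ofReal (2 * σ ^ 2) ≤ ENNReal.ofReal (avgSq e)} := by
        refine measure_mono fun e he => ?_
        have : 2 * σ ^ 2 < avgSq e := by simpa using he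
        exact ENNReal.ofReal_le_ofReal this.le
      have h3 : ENNReal.ofReal (2 * σ ^ 2) * π {e : Fin n → ℝ | avgSq e ≤ 2 * σ ^ 2}ᶜ
          ≤ ENNReal.ofReal (2 * σ ^ 2) * 2⁻¹ := by
        calc _ ≤ ENNReal.ofReal (σ ^ 2) := le_trans (by gcongr) h1
          _ = ENNReal.ofReal (2 * σ ^ 2) * ENNReal.ofReal 2⁻¹ := by
              rw [← ENNReal.ofReal_mul hσ.le]; congr 1; ring
          _ = _ := by rw [ENNReal.ofReal_inv_of_pos two_pos]; simp
      exact (ENNReal.mul_le_mul_iff_right (ENNReal.ofReal_pos.mpr hσ).ne' ENNReal.ofReal_ne_top).mp h3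
  rw [prob_compl_eq_one_sub hms] at hc
  have := tsub_le_iff_right.mp hc
  rw [← ENNReal.inv_two_add_inv_two] at this
  exact (ENNReal.add_le_add_iff_left (by simp)).mp this

/-- Lower bounds for the error given the noise give lower bounds for the mean squared error. -/
lemma ofReal_half_le_mse {A : Matrix (Fin p) (Fin p) ℝ} {θ₀ : Vec p} {ν : Measure ℝ} (hn : 0 < n)
    {σ : ℝ} (hν : IsNoise ν σ) {δ m : ℝ} {T : Data p n → Vec p} (hT : Measurable T)
    (h : ∀ e : Fin n → ℝ, avgSq e ≤ 2 * σ ^ 2 → ENNReal.ofReal m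
      ≤ ∫⁻ X, ENNReal.ofReal (‖T (mkData θ₀ X e) - thetaStar A θ₀ δ‖ ^ 2) ∂(rowLaw n A)) :
    ENNReal.ofReal (m / 2) ≤ mse A θ₀ ν δ T := by
  have hprob := hν.1
  set π := Measure.pi fun _ : Fin n => ν
  have hms : MeasurableSet {e : Fin n → ℝ | avgSq e ≤ 2 * σ ^ 2} :=
    measurable_avgSq measurableSet_Iic
  rw [mse_eq_swap hT]
  calc ENNReal.ofReal (m / 2) = ENNReal.ofReal m * 2⁻¹ := by
        rw [div_eq_mul_inv, mul_comm, ENNReal.ofReal_mul (by norm_num),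
          ENNReal.ofReal_inv_of_pos two_pos, mul_comm]; simp
    _ ≤ ENNReal.ofReal m * π {e | avgSq e ≤ 2 * σ ^ 2} := by
        gcongr; exact half_le_measure_avgSq hn hν
    _ = ∫⁻ e, {e | avgSq e ≤ 2 * σ ^ 2}.indicator (fun _ => ENNReal.ofReal m) e ∂π :=
        (lintegral_indicator_const hms _).symm
    _ ≤ _ := by
        refine lintegral_mono fun e => ?_
        by_cases he : avgSq e ≤ 2 * σ ^ 2
        · rw [Set.indicator_of_mem (by simpa using he)]; exact h e he
        · rw [Set.indicator_of_notMem (by simpa using he)]; exact zero_le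

end noise

section between

variable {p n : ℕ} {L : ℝ} {A : Matrix (Fin p) (Fin p) ℝ}

/-- Well above the lower threshold, a solution of the equation for the level is bounded away
from `0`. -/
lemma level_ge (hL : 1 ≤ L) (hA : CovClass L⁻¹ L A) {t : Vec p} (ht : t ≠ 0) {δ ε l : ℝ}
    (hε : 0 < ε) (hδ : 0 < δ) (hl : 0 < l)
    (h1 : (1 + ε) * (c0 * ratio A (res A 0 t)) ≤ δ)
    (hp : l * (1 - δ * c0 / ratio A (res A l t)) = δ * (δ - c0 * ratio A (res A l t))) :
    c0 ^ 2 * ε / (4 * L ^ 7) ≤ l := by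
  have hL0 : 0 < L := by linarith
  have hAp := hA.posDef (inv_pos.mpr hL0)
  have ht' : 0 < ‖t‖ := norm_pos_iff.mpr ht
  have hc := c0_pos
  have hc1 := c0_sq_lt_one
  have hrne := res_ne_zero hAp hl.le ht
  have hρ := ratio_pos hL hA hrne
  by_contra hlow
  push Not at hlow
  have hr0 := res_ne_zero hAp le_rfl ht
  have hρ0 := le_ratio hL hA hr0
  have hk := norm_mul_abs_ratio_sub_le hL hA hA hr0 hrne
  have hd := norm_res_sub_res_le hL hA hl.le le_rfl t
  have hn := le_norm_res hL hA hl.le t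
  rw [sub_self, zero_mulV, norm_zero, add_zero] at hk
  rw [add_zero, one_mul, sub_zero, abs_of_pos hl] at hd
  set ρ := ratio A (res A l t)
  set ρ0 := ratio A (res A 0 t)
  -- at a small level the ratio is close to its value at level `0`, and the equation forces `l ≳ ε`
  have hdiff : |ρ - ρ0| ≤ 2 * L ^ 6 * l := by
    have k1 : ‖t‖ * |ρ - ρ0| ≤ ‖t‖ * (2 * L ^ 6 * l) := by
      calc ‖t‖ * |ρ - ρ0| ≤ L * (1 + l) * ‖res A l t‖ * |ρ - ρ0| := by gcongr
        _ = L * (1 + l) * (‖res A l t‖ * |ρ - ρ0|) := by ring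
        _ ≤ L * (1 + l) * (2 * L ^ 3 * ‖res A l t - res A 0 t‖) := by gcongr
        _ = 2 * L ^ 4 * ((1 + l) * ‖res A l t - res A 0 t‖) := by ring
        _ ≤ 2 * L ^ 4 * (L ^ 2 * (l * ‖t‖)) := by gcongr
        _ = _ := by ring
    exact le_of_mul_le_mul_left k1 ht'
  have h3 := (abs_le.mp hdiff).2
  have hl' : 4 * L ^ 7 * l < c0 ^ 2 * ε := by
    rw [lt_div_iff₀ (by positivity)] at hlow; linarith
  have h4 : 2 * L ^ 6 * l ≤ ε * L⁻¹ / 2 := by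
    have h : c0 ^ 2 * ε ≤ 1 * ε := by gcongr
    have e6 : 2 * L ^ 6 * l = (4 * L ^ 7 * l) * L⁻¹ / 2 := by field_simp; norm_num
    rw [e6]
    gcongr
    linarith
  have h5 : c0 * (ε * L⁻¹ / 2) ≤ δ - c0 * ρ := by
    have k1 : c0 * ρ ≤ c0 * (ρ0 + ε * L⁻¹ / 2) := by gcongr; linarith
    have k2 : ε * (c0 * L⁻¹) ≤ ε * (c0 * ρ0) := by gcongr
    linarith
  have h6 : c0 * L⁻¹ ≤ δ := by
    have k1 : c0 * L⁻¹ ≤ c0 * ρ0 := by gcongr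
    have k2 : 0 ≤ ε * (c0 * ρ0) := by
      have : 0 ≤ L⁻¹ := by positivity
      have : 0 ≤ ρ0 := this.trans hρ0
      positivity
    linarith
  have h7 : c0 * L⁻¹ * (c0 * (ε * L⁻¹ / 2)) ≤ δ * (δ - c0 * ρ) := by gcongr
  have h8 : l * (1 - δ * c0 / ρ) ≤ l := by
    refine mul_le_of_le_one_right hl.le ?_
    have : 0 ≤ δ * c0 / ρ := by positivity
    linarith
  have h9 : c0 ^ 2 * ε ≤ 2 * L ^ 2 * l := by
    have : c0 ^ 2 * ε * (L⁻¹ ^ 2) / 2 ≤ l := by linarith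
    calc c0 ^ 2 * ε = 2 * L ^ 2 * (c0 ^ 2 * ε * (L⁻¹ ^ 2) / 2) := by field_simp
      _ ≤ _ := by gcongr
  have h10 : L ^ 2 * l ≤ L ^ 7 * l :=
    mul_le_mul_of_nonneg_right (pow_le_pow_right₀ hL (by norm_num)) hl.le
  have h11 : 0 < L ^ 7 * l := by positivity
  linarith

/-- Well below the upper threshold, a solution of the equation for the level is bounded. -/
lemma level_le (hL : 1 ≤ L) (hA : CovClass L⁻¹ L A) {t : Vec p} (ht : t ≠ 0) {δ ε l : ℝ}
    (hε : 0 < ε) (hε1 : ε < 1) (hδ0 : 0 < δ) (hl : 0 < l) (h2 : δ ≤ (1 - ε) * (ratio A t / c0))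
    (hp : l * (1 - δ * c0 / ratio A (res A l t)) = δ * (δ - c0 * ratio A (res A l t))) :
    l ≤ 8 * L ^ 7 / (c0 ^ 2 * ε) := by
  have hL0 : 0 < L := by linarith
  have hAp := hA.posDef (inv_pos.mpr hL0)
  have ht' : 0 < ‖t‖ := norm_pos_iff.mpr ht
  have hc := c0_pos
  have hc1 := c0_sq_lt_one
  have hrne := res_ne_zero hAp hl.le ht
  have hρ := ratio_pos hL hA hrne
  by_contra hhigh
  push Not at hhigh
  have hbne := resc_ne_zero hAp hl.le ht
  have hk := norm_mul_abs_ratio_sub_le hL hA hA ht hbne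
  have hd := norm_resc_sub_self_le hL hA hl.le t
  have hn := le_norm_resc hL hA hl.le t
  rw [sub_self, zero_mulV, norm_zero, add_zero, ratio_resc A hl.le] at hk
  have hρiL := le_ratio hL hA ht
  have hρiL' := ratio_le hL hA t
  set ρ := ratio A (res A l t)
  set ρi := ratio A t
  -- at a large level the ratio is close to its value at level `∞`, and the equation bounds `ε l`
  have hdiff : (1 + l) * |ρ - ρi| ≤ 4 * L ^ 6 := by
    have k1 : ‖t‖ * ((1 + l) * |ρ - ρi|) ≤ ‖t‖ * (4 * L ^ 6) := by
      calc ‖t‖ * ((1 + l) * |ρ - ρi|) ≤ L * ‖resc A l t‖ * ((1 + l) * |ρ - ρi|) := by gcongr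
        _ = L * (1 + l) * (‖resc A l t‖ * |ρ - ρi|) := by ring
        _ ≤ L * (1 + l) * (2 * L ^ 3 * ‖resc A l t - t‖) := by gcongr
        _ = 2 * L ^ 4 * ((1 + l) * ‖resc A l t - t‖) := by ring
        _ ≤ 2 * L ^ 4 * (2 * L ^ 2 * ‖t‖) := by gcongr
        _ = _ := by ring
    exact le_of_mul_le_mul_left k1 ht'
  rw [div_lt_iff₀ (by positivity)] at hhigh
  have hεl : 8 * L ^ 7 ≤ ε * l := by
    have : c0 ^ 2 * (l * ε) ≤ 1 * (l * ε) := by gcongr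
    linarith
  have h3 : |ρ - ρi| ≤ ε * L⁻¹ / 2 := by
    have k1 : l * |ρ - ρi| ≤ 4 * L ^ 6 := by linarith [abs_nonneg (ρ - ρi)]
    have k2 : l * |ρ - ρi| ≤ l * (ε * L⁻¹ / 2) := by
      refine k1.trans ?_
      have : 4 * L ^ 6 = 8 * L ^ 7 * L⁻¹ / 2 := by field_simp; norm_num
      rw [this]
      calc 8 * L ^ 7 * L⁻¹ / 2 ≤ ε * l * L⁻¹ / 2 := by gcongr
        _ = _ := by ring
    exact le_of_mul_le_mul_left k2 hl
  have h4 := (abs_le.mp h3).1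
  have hi0 : 0 < ρi := (inv_pos.mpr hL0).trans_le hρiL
  have h5 : δ * c0 ≤ (1 - ε) * ρi := by
    rw [← mul_div_assoc, le_div_iff₀ hc] at h2; exact h2
  have h6 : δ * c0 / ρ ≤ 1 - ε / 2 := by
    rw [div_le_iff₀ hρ]
    have hy : (1 - ε / 2) * (ρi - ε * ρi / 2) ≤ (1 - ε / 2) * ρ := by
      have k1 : ε * L⁻¹ ≤ ε * ρi := by gcongr
      gcongr
      · linarith
      · linarith
    have hz : 0 ≤ ε ^ 2 * ρi := by positivity
    linarith
  have h7 : l * (ε / 2) ≤ l * (1 - δ * c0 / ρ) := by gcongr; linarith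
  have h8 : δ * (δ - c0 * ρ) ≤ δ * δ := by
    gcongr
    have : 0 < c0 * ρ := by positivity
    linarith
  have h9 : δ * c0 ≤ L := by
    have k1 : (1 - ε) * ρi ≤ 1 * L := by gcongr; linarith
    linarith
  have h10 : (δ * c0) ^ 2 ≤ L ^ 2 := by gcongr
  have h11 : L ^ 2 ≤ L ^ 7 := pow_le_pow_right₀ hL (by norm_num)
  have h12 : c0 ^ 2 * (l * (ε / 2)) ≤ c0 ^ 2 * (δ * δ) :=
    mul_le_mul_of_nonneg_left (by linarith) (sq_nonneg _)
  have h13 : 1 ≤ L ^ 7 := one_le_pow₀ hL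
  linarith

/-- Well between the thresholds, the level is bounded away from `0` and from `∞`. -/
lemma exists_level (hL : 1 ≤ L) (hA : CovClass L⁻¹ L A) {t : Vec p} (ht : t ≠ 0) {δ ε : ℝ}
    (hε : 0 < ε) (h1 : (1 + ε) * delta1 A t ≤ δ) (h2 : δ ≤ (1 - ε) * delta2 A t) :
    ∃ l, c0 ^ 2 * ε / (4 * L ^ 7) ≤ l ∧ l ≤ 8 * L ^ 7 / (c0 ^ 2 * ε)
      ∧ lambdaStar A t δ = ENNReal.ofReal l := by
  have hL0 : 0 < L := by linarith
  have hAp := hA.posDef (inv_pos.mpr hL0)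
  have hd1 := delta1_pos hL hA ht
  have hδ1 : delta1 A t < δ := by nlinarith
  have hδ0 : 0 < δ := hd1.trans hδ1
  have hρi := ratio_pos hL hA ht
  have hd2 : 0 < delta2 A t := by
    rw [delta2_eq hA.transpose_eq]; exact div_pos hρi c0_pos
  have hε1 : ε < 1 := by
    by_contra h
    nlinarith
  have hδ2 : δ < delta2 A t := by nlinarith
  rcases lambdaStar_cases hL hA ht δ with ⟨h, -⟩ | ⟨-, h, -⟩ | ⟨-, -, l, hl, hp, e⟩
  · exact absurd h hδ1.not_ge
  · exact absurd h hδ2.not_ge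
  rw [pathEq_iff hAp ht hl] at hp
  rw [delta1_eq hAp] at h1
  rw [delta2_eq hA.transpose_eq] at h2
  have hp' : l * (1 - δ * c0 / ratio A (res A l t)) = δ * (δ - c0 * ratio A (res A l t)) := by
    have : δ * c0 * (l / ratio A (res A l t)) = l * (δ * c0 / ratio A (res A l t)) := by ring
    rw [this] at hp; linarith
  exact ⟨l, level_ge hL hA ht hε hδ0 hl h1 hp', level_le hL hA ht hε hε1 hδ0 hl h2 hp', e⟩

/-- The first-order condition at the selected level. -/
lemma pathEst_equation {S : Matrix (Fin p) (Fin p) ℝ} (hS : S.PosDef) (t : Vec p) {δ : ℝ}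
    (h : lambdaStar S t δ ≠ ⊤) :
    mulV S (pathEst S t δ) + (lambdaStar S t δ).toReal • pathEst S t δ = mulV S t := by
  rw [pathEst]
  nth_rw 1 [← ENNReal.ofReal_toReal h]
  nth_rw 3 [← ENNReal.ofReal_toReal h]
  set l := (lambdaStar S t δ).toReal
  have hl : 0 ≤ l := ENNReal.toReal_nonneg
  rw [thetaPath_eq_mulV_res hS hl, ← mulV_smul, ← mulV_add, mulV_res_add hS hl]

/-- The error controls the score projected off the direction of the target, because the unknown
difference of the levels only acts in this direction. -/
lemma norm_score_le_of_equation {S : Matrix (Fin p) (Fin p) ℝ} (hL : 1 ≤ L) (hS : CovClass L⁻¹ L S)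
    {d θ₀ θs θh N : Vec p} (hd : ‖d‖ = 1 ∨ d = 0) {l k : ℝ} (hk : 0 ≤ k)
    (hs : mulV A θs + l • θs = mulV A θ₀) (hh : mulV S θh + k • θh = mulV S θ₀ + N)
    (hdθ : offProj d θs = 0) :
    ‖offProj d (mulV (S - A) (θ₀ - θs) + N)‖ ≤ (L + k) * ‖θh - θs‖ := by
  have e : mulV (S - A) (θ₀ - θs) + N = (mulV S (θh - θs) + k • (θh - θs)) + (k - l) • θs := by
    have h1 : mulV S (θh - θs) + k • (θh - θs) = mulV S θ₀ + N - mulV S θs - k • θs := by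
      rw [mulV_sub, smul_sub, ← hh]; abel
    have h2 : (k - l) • θs = k • θs - (mulV A θ₀ - mulV A θs) := by
      rw [sub_smul, ← hs]; abel
    rw [h1, h2, sub_mulV, mulV_sub, mulV_sub]; abel
  rw [e, offProj_add, offProj_smul, hdθ, smul_zero, add_zero]
  refine (norm_offProj_le hd _).trans ((norm_add_le _ _).trans ?_)
  rw [add_mul, norm_smul, Real.norm_of_nonneg hk]
  gcongr
  exact hS.norm_mulV_le hL _

lemma offProj_normalize {θ : Vec p} (hθ : θ ≠ 0) : offProj (‖θ‖⁻¹ • θ) θ = 0 := by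
  have : ‖θ‖ ≠ 0 := norm_ne_zero_iff.mpr hθ
  rw [offProj, inner_smul_right, real_inner_self_eq_norm_sq, smul_smul]
  have e : ‖θ‖⁻¹ * ‖θ‖ ^ 2 * ‖θ‖⁻¹ = 1 := by field_simp
  rw [e, one_smul, sub_self]

end between

end AdvLinReg

namespace AdvLinReg

section between

variable {p n : ℕ} {L : ℝ} {A : Matrix (Fin p) (Fin p) ℝ}

lemma norm_le_of_level (hL : 1 ≤ L) (hA : CovClass L⁻¹ L A) {t : Vec p} {δ l M : ℝ} (hl : 0 ≤ l)
    (hM : l ≤ M) (h : lambdaStar A t δ = ENNReal.ofReal l) :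
    ‖t‖ ≤ L ^ 2 * (1 + M) * ‖pathEst A t δ‖ := by
  have hAp := hA.posDef (inv_pos.mpr (by linarith))
  rw [pathEst, h, thetaPath_eq_mulV_res hAp hl]
  have h1 := le_norm_res hL hA hl t
  have h2 : ‖res A l t‖ ≤ L * ‖mulV A (res A l t)‖ := by
    have k1 := hAp.posSemidef
    have k2 := hA.le_inner (res A l t)
    have k3 := real_inner_le_norm (res A l t) (mulV A (res A l t))
    rcases eq_or_ne ‖res A l t‖ 0 with h0 | h0
    · rw [h0]; positivity
    · have hpos : 0 < ‖res A l t‖ := lt_of_le_of_ne (norm_nonneg _) h0.symm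
      rw [inv_mul_le_iff₀ (by linarith)] at k2
      refine le_of_mul_le_mul_left ?_ hpos
      calc ‖res A l t‖ * ‖res A l t‖ = ‖res A l t‖ ^ 2 := (sq _).symm
        _ ≤ L * (‖res A l t‖ * ‖mulV A (res A l t)‖) := k2.trans (by gcongr)
        _ = _ := by ring
  calc ‖t‖ ≤ L * (1 + l) * ‖res A l t‖ := h1
    _ ≤ L * (1 + M) * (L * ‖mulV A (res A l t)‖) := by
        have : 0 ≤ 1 + M := by linarith
        gcongr
    _ = _ := by ring

lemma le_norm_sub_of_level (hL : 1 ≤ L) (hA : CovClass L⁻¹ L A) {t : Vec p} {δ l M : ℝ} (hl : 0 ≤ l)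
    (hM : l ≤ M) (h : lambdaStar A t δ = ENNReal.ofReal l) :
    l * ‖t‖ ≤ L * (1 + M) * ‖t - pathEst A t δ‖ := by
  have hAp := hA.posDef (inv_pos.mpr (by linarith))
  have h1 := le_norm_res hL hA hl t
  rw [pathEst, h, thetaPath_ofReal hAp hl, sub_sub_cancel, norm_smul, Real.norm_of_nonneg hl]
  calc l * ‖t‖ ≤ l * (L * (1 + M) * ‖res A l t‖) := by
        gcongr
        exact h1.trans (by gcongr)
    _ = _ := by ring

lemma level_mul_norm_le {S : Matrix (Fin p) (Fin p) ℝ} (hL : 1 ≤ L) (hS : CovClass L⁻¹ L S)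
    {θ θ₀ N : Vec p} {k : ℝ} (h : mulV S θ + k • θ = mulV S θ₀ + N) :
    k * ‖θ‖ ≤ L * ‖θ₀‖ + ‖N‖ := by
  have hSp := hS.posDef (inv_pos.mpr (by linarith))
  have h1 : k * ‖θ‖ ^ 2 ≤ ‖θ‖ * ‖mulV S θ₀ + N‖ := by
    have k1 := PosSemidef.inner_mulV_nonneg hSp.posSemidef θ
    have k2 := real_inner_le_norm θ (mulV S θ₀ + N)
    rw [← h, inner_add_right, inner_smul_right, real_inner_self_eq_norm_sq, h] at k2
    linarith
  have h2 : ‖mulV S θ₀ + N‖ ≤ L * ‖θ₀‖ + ‖N‖ :=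
    (norm_add_le _ _).trans (by gcongr; exact hS.norm_mulV_le hL _)
  rcases eq_or_ne ‖θ‖ 0 with h0 | h0
  · rw [h0, mul_zero]; positivity
  · have hpos : 0 < ‖θ‖ := lt_of_le_of_ne (norm_nonneg _) h0.symm
    refine le_of_mul_le_mul_left ?_ hpos
    calc ‖θ‖ * (k * ‖θ‖) = k * ‖θ‖ ^ 2 := by ring
      _ ≤ _ := h1.trans (by gcongr)

/-- The squared score off the direction of the target is controlled by the squared error, up to
fourth moments and the event that the sample covariance matrix is ill conditioned. -/
lemma sq_score_le (hn : 0 < n) (hL : 1 ≤ L) (hA : CovClass L⁻¹ L A) {θ₀ : Vec p} (hθ : θ₀ ≠ 0)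
    {δ l M τ : ℝ} (hδ : 0 ≤ δ) (hl : 0 ≤ l) (hM : l ≤ M) (h : lambdaStar A θ₀ δ = ENNReal.ofReal l)
    (hτ : 0 < τ) {d u : Vec p} (hd : d = ‖pathEst A θ₀ δ‖⁻¹ • pathEst A θ₀ δ)
    (hu : u = θ₀ - pathEst A θ₀ δ) (X : Fin n → Vec p) (e : Fin n → ℝ) :
    ENNReal.ofReal (‖score A d u e X‖ ^ 2)
      ≤ ENNReal.ofReal ((L + 4 * L ^ 3 * (1 + M)) ^ 2 + 4 * (L ^ 2 * (1 + M)) ^ 2)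
          * ENNReal.ofReal (‖twoStage δ (mkData θ₀ X e) - thetaStar A θ₀ δ‖ ^ 2)
        + (ENNReal.ofReal ((1 + τ⁻¹) / ‖θ₀‖ ^ 2)
            * ENNReal.ofReal (‖score A d u e X‖ ^ 4)
          + (ENNReal.ofReal ((1 + τ⁻¹) / ‖θ₀‖ ^ 2)
            * ENNReal.ofReal (‖score A 0 0 e X‖ ^ 4)
          + {X | ¬ CovClass L⁻¹ L (gram X)}.indicator
            (fun _ => ENNReal.ofReal (τ * ‖θ₀‖ ^ 2)) X)) := by
  have hL0 : 0 < L := by linarith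
  have hAp := hA.posDef (inv_pos.mpr hL0)
  have hθ' : 0 < ‖θ₀‖ := norm_pos_iff.mpr hθ
  have eN : score A 0 0 e X = crossAvg X e := by simp [score]
  have hv := norm_le_of_level hL hA hl hM h
  rw [eN, thetaStar_eq hL hA θ₀ hδ]
  set θs := pathEst A θ₀ δ with hθs
  set N := ‖crossAvg X e‖
  set q := ‖score A d u e X‖
  set Δ := ‖twoStage δ (mkData θ₀ X e) - θs‖
  set T := ‖θ₀‖ ^ 2 with hT
  set V := L ^ 2 * (1 + M) with hV
  have hV0 : 0 < V := by have : 0 < 1 + M := by linarith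
                         positivity
  set H := L + 4 * L ^ 3 * (1 + M) with hH
  have hT0 : 0 < T := by positivity
  have hN0 : 0 ≤ N := norm_nonneg _
  have hq0 : 0 ≤ q := norm_nonneg _
  have hΔ0 : 0 ≤ Δ := norm_nonneg _
  have hθs0 : 0 < ‖θs‖ := by
    by_contra hcon
    have : ‖θs‖ = 0 := le_antisymm (not_lt.mp hcon) (norm_nonneg _)
    rw [this] at hv; linarith
  by_cases hX : CovClass L⁻¹ L (gram X)
  · rw [Set.indicator_of_notMem (by simpa using hX), add_zero, ← ENNReal.ofReal_mul (by positivity),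
      ← ENNReal.ofReal_mul (by positivity), ← ENNReal.ofReal_mul (by positivity),
      ← ENNReal.ofReal_add (by positivity) (by positivity),
      ← ENNReal.ofReal_add (by positivity) (by positivity)]
    apply ENNReal.ofReal_le_ofReal
    have hXp := hX.posDef (inv_pos.mpr hL0)
    have hrest : ∀ a : ℝ, 0 ≤ a → (1 + τ⁻¹) / T * a = a / T + τ⁻¹ * a / T := by
      intro a _; ring
    have p1 : 0 ≤ H ^ 2 * Δ ^ 2 := by positivity
    have p2 : 0 ≤ τ⁻¹ * N ^ 4 / T := by positivity
    have p3 : 0 ≤ τ⁻¹ * q ^ 4 / T := by positivity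
    have p4 : 0 ≤ N ^ 4 / T := by positivity
    have p5 : 0 ≤ q ^ 4 / T := by positivity
    have p6 : 0 ≤ 4 * V ^ 2 * Δ ^ 2 := by positivity
    rw [hrest _ (by positivity), hrest _ (by positivity)]
    -- a square is at most its own square over `T`, plus `T`
    have hq4 : q ^ 2 ≤ q ^ 4 / T + T := by
      rw [div_add' _ _ _ hT0.ne', le_div_iff₀ hT0]
      nlinarith [sq_nonneg (q ^ 2 - T), sq_nonneg (q ^ 2), sq_nonneg T]
    -- if the noise average is large compared with `‖θ₀‖`, its fourth moment dominates
    by_cases hNs : N ≤ ‖θ₀‖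
    -- a large error dominates `‖θ₀‖²` directly; a small one keeps the estimator away from the origin, so
    -- that it satisfies the first-order condition
    · by_cases hΔs : Δ < ‖θs‖ / 2
      · set θh := twoStage δ (mkData θ₀ X e) with hθh
        have e1 : θh = pathEst (gram X) (θ₀ + olsErr X e) δ := twoStage_mkData δ hn θ₀ e hXp
        have h1 : ‖θs‖ / 2 ≤ ‖θh‖ := by
          have := norm_sub_norm_le θs θh
          rw [norm_sub_rev] at this
          linarith
        have htop : lambdaStar (gram X) (θ₀ + olsErr X e) δ ≠ ⊤ := by
          intro hc
          rw [e1, pathEst, hc, thetaPath_top, norm_zero] at h1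
          linarith
        have heq := pathEst_equation hXp _ htop
        rw [← e1, mulV_add, mulV_gram_olsErr hXp] at heq
        set k := (lambdaStar (gram X) (θ₀ + olsErr X e) δ).toReal
        have hk0 : 0 ≤ k := ENNReal.toReal_nonneg
        have hk1 := level_mul_norm_le hL hX heq
        have hk : k ≤ 4 * L ^ 3 * (1 + M) := by
          refine le_of_mul_le_mul_right (a := ‖θs‖ / 2) ?_ (by positivity)
          have r1 : L * ‖θ₀‖ + N ≤ 2 * L * ‖θ₀‖ := by nlinarith
          calc k * (‖θs‖ / 2) ≤ k * ‖θh‖ := by gcongr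
            _ ≤ 2 * L * ‖θ₀‖ := hk1.trans r1
            _ ≤ 2 * L * (V * ‖θs‖) := by gcongr
            _ = _ := by rw [hV]; ring
        have hseq : mulV A θs + l • θs = mulV A θ₀ := by
          have := pathEst_equation hAp θ₀ (δ := δ) (by rw [h]; exact ENNReal.ofReal_ne_top)
          rwa [h, ENNReal.toReal_ofReal hl] at this
        have hθsne : θs ≠ 0 := norm_pos_iff.mp hθs0
        have hd1 : ‖d‖ = 1 := by
          rw [hd, norm_smul, norm_inv, norm_norm, inv_mul_cancel₀ hθs0.ne']
        have hfin := norm_score_le_of_equation hL hX (Or.inl hd1) hk0 hseq heq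
          (by rw [hd]; exact offProj_normalize hθsne)
        rw [← hu] at hfin
        have : q ≤ H * Δ := hfin.trans (by rw [hH]; gcongr)
        have h5 : q ^ 2 ≤ H ^ 2 * Δ ^ 2 := by
          rw [← mul_pow]; exact pow_le_pow_left₀ hq0 this 2
        linarith
      · have h1 : T ≤ 4 * V ^ 2 * Δ ^ 2 := by
          calc T ≤ (V * (2 * Δ)) ^ 2 := by
                rw [hT]
                exact pow_le_pow_left₀ hθ'.le (hv.trans (by gcongr; linarith)) 2
            _ = _ := by ring
        linarith
    · have h1 : T ≤ N ^ 4 / T := by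
        rw [le_div_iff₀ hT0, hT]
        calc ‖θ₀‖ ^ 2 * ‖θ₀‖ ^ 2 = ‖θ₀‖ ^ 4 := by ring
          _ ≤ _ := pow_le_pow_left₀ hθ'.le (not_le.mp hNs).le 4
      linarith
  · rw [Set.indicator_of_mem (by simpa using hX)]
    refine le_trans ?_ le_add_self
    refine le_trans ?_ (add_le_add_right le_add_self _)
    rw [← ENNReal.ofReal_mul (by positivity), ← ENNReal.ofReal_add (by positivity) (by positivity)]
    apply ENNReal.ofReal_le_ofReal
    have h1 : (1 + τ⁻¹) / T * q ^ 4 = q ^ 4 / T + q ^ 4 / (τ * T) := by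
      field_simp
    have p4 : 0 ≤ q ^ 4 / T := by positivity
    have h2 : q ^ 2 ≤ q ^ 4 / (τ * T) + τ * T := by
      have hs : 0 < τ * T := by positivity
      rw [div_add' _ _ _ hs.ne', le_div_iff₀ hs]
      nlinarith [sq_nonneg (q ^ 2 - τ * T), sq_nonneg (q ^ 2), sq_nonneg (τ * T)]
    rw [h1]; linarith

set_option maxHeartbeats 600000 in
/-- Lower bound for the mean squared error between the thresholds, in dimension at least two. -/
theorem le_mse_twoStage_between {ℓ κ ε : ℝ} (hℓ : 1 ≤ ℓ) (hκ : 0 < κ)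
    (hε : 0 < ε) : ∃ c η : ℝ, 0 < c ∧ 0 < η ∧ ∀ {p n : ℕ}, 2 ≤ p → LargeSample ℓ p n →
      (p / n : ℝ) ≤ η →
      ∀ (A : Matrix (Fin p) (Fin p) ℝ) (θ₀ : Vec p) (σ : ℝ) (ν : Measure ℝ) (δ : ℝ),
        CovClass ℓ⁻¹ ℓ A → IsNoise ν σ → θ₀ ≠ 0 → 0 ≤ σ → κ * σ ≤ wnorm A θ₀ →
        (1 + ε) * delta1 A θ₀ ≤ δ → δ ≤ (1 - ε) * delta2 A θ₀ →
          ENNReal.ofReal (c * rate n A θ₀ σ) ≤ mse (n := n) A θ₀ ν δ (twoStage δ) := by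
  set L := 16 * ℓ ^ 2 with hLdef
  have hL : 1 ≤ L := one_le_widen hℓ
  have hL0 : 0 < L := by linarith
  have hc0 := c0_pos
  set lo := c0 ^ 2 * ε / (4 * L ^ 7) with hlo
  set M := 8 * L ^ 7 / (c0 ^ 2 * ε) with hMdef
  have hlo0 : 0 < lo := by positivity
  have hM0 : 0 < M := by positivity
  -- the mean square of the score is at least `a ‖θ₀‖² p / n`
  set a := (lo / (L * (1 + M))) ^ 2 / (2 * L ^ 3) with ha
  have ha0 : 0 < a := by positivity
  set τ := a / 4 with hτ
  have hτ0 : 0 < τ := by positivity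
  set E := 4 + 2 * L ^ 2 / κ ^ 2 with hE
  have hE0 : 0 < E := by positivity
  set D := 2 * (1 + τ⁻¹) * (21016 * L ^ 8 * E ^ 2) with hD
  have hD0 : 0 < D := by positivity
  set C1 := (L + 4 * L ^ 3 * (1 + M)) ^ 2 + 4 * (L ^ 2 * (1 + M)) ^ 2 with hC1
  have hC10 : 0 < C1 := by positivity
  refine ⟨a / (4 * C1) / (L ^ 2 * (1 + 1 / κ ^ 2)), a / (4 * D), by positivity, by positivity, ?_⟩
  clear_value lo M a τ E D C1
  intro p n hp2 h hq A θ₀ σ ν δ hA hν hθ hσ hκW h1 h2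
  have hn := h.pos
  have hAL : CovClass L⁻¹ L A := hA.widen hℓ
  have hbad : (rowLaw n A) {X | ¬ CovClass L⁻¹ L (gram X)} ≤ ENNReal.ofReal (p / n) :=
    h.prob_le hℓ hA
  clear_value L
  have hd1 := delta1_pos hL hAL hθ
  have hδ0 : 0 ≤ δ := le_trans (by positivity) h1
  rw [rate_eq]
  set W := wnorm A θ₀ with hW
  set q : ℝ := p / n with hqdef
  have hq0 : 0 ≤ q := by positivity
  have hθ' : 0 < ‖θ₀‖ := norm_pos_iff.mpr hθ
  set T := ‖θ₀‖ ^ 2 with hT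
  have hT0 : 0 < T := by positivity
  have hWT : W ^ 2 ≤ L ^ 2 * T := by
    rw [hT, ← mul_pow]
    exact pow_le_pow_left₀ (wnorm_nonneg _ _) (hAL.wnorm_le hL θ₀) 2
  have hσT : σ ^ 2 ≤ L ^ 2 * T / κ ^ 2 := by
    rw [le_div_iff₀ (by positivity), hT, ← mul_pow, ← mul_pow, mul_comm σ]
    exact pow_le_pow_left₀ (by positivity) (hκW.trans (hAL.wnorm_le hL θ₀)) 2
  obtain ⟨l, hl1, hl2, hl⟩ := exists_level hL hAL hθ hε h1 h2
  rw [← hlo] at hl1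
  rw [← hMdef] at hl2
  have hl0 : 0 ≤ l := hlo0.le.trans hl1
  set θs := pathEst A θ₀ δ with hθs
  set d := ‖θs‖⁻¹ • θs with hd
  set u := θ₀ - θs with hu
  have hθsne : θs ≠ 0 := by
    intro hc
    have := norm_le_of_level hL hAL hl0 hl2 hl
    rw [← hθs, hc, norm_zero] at this
    linarith
  have hd1 : ‖d‖ = 1 := by
    rw [hd, norm_smul, norm_inv, norm_norm, inv_mul_cancel₀ (norm_ne_zero_iff.mpr hθsne)]
  have hu1 : (lo / (L * (1 + M))) ^ 2 * T ≤ ‖u‖ ^ 2 := by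
    have := le_norm_sub_of_level hL hAL hl0 hl2 hl
    rw [hT, ← mul_pow]
    refine pow_le_pow_left₀ (by positivity) ?_ 2
    rw [div_mul_eq_mul_div, div_le_iff₀ (by positivity)]
    calc lo * ‖θ₀‖ ≤ l * ‖θ₀‖ := by gcongr
      _ ≤ _ := this.trans (le_of_eq (by ring))
  have hu2 : ‖u‖ ^ 2 ≤ 4 * T := by
    have := norm_pathEst_le (hAL.posDef (inv_pos.mpr hL0)) θ₀ δ
    have k : ‖u‖ ≤ 2 * ‖θ₀‖ := (norm_sub_le _ _).trans (by linarith)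
    calc ‖u‖ ^ 2 ≤ (2 * ‖θ₀‖) ^ 2 := by gcongr
      _ = _ := by rw [hT]; ring
  have hmain : ∀ e : Fin n → ℝ, avgSq e ≤ 2 * σ ^ 2 → ENNReal.ofReal (a * q * T / (2 * C1))
      ≤ ∫⁻ X, ENNReal.ofReal (‖twoStage δ (mkData θ₀ X e) - thetaStar A θ₀ δ‖ ^ 2)
        ∂(rowLaw n A) := by
    intro e he
    have hw := avgSq_nonneg e
    have hE1 : ‖u‖ ^ 2 + avgSq e ≤ E * T := by
      calc ‖u‖ ^ 2 + avgSq e ≤ 4 * T + 2 * (L ^ 2 * T / κ ^ 2) := by linarith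
        _ = _ := by rw [hE]; ring
    have hE2 : ‖(0 : Vec p)‖ ^ 2 + avgSq e ≤ E * T := by
      rw [norm_zero]; nlinarith [sq_nonneg ‖u‖]
    have m2 : ENNReal.ofReal (a * q * T)
        ≤ ∫⁻ X, ENNReal.ofReal (‖score A d u e X‖ ^ 2) ∂(rowLaw n A) := by
      refine le_trans (ENNReal.ofReal_le_ofReal ?_)
        (lintegral_norm_score_sq_ge hn hL hAL (Or.inl hd1) u e)
      have hp2' : (2 : ℝ) ≤ p := by exact_mod_cast hp2
      have k1 : (p : ℝ) / 2 ≤ p - 1 := by linarith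
      have k2 : L⁻¹ ^ 2 * ‖u‖ ^ 2 ≤ wnorm A u ^ 2 := by
        rw [← mul_pow]
        refine pow_le_pow_left₀ (by positivity) ?_ 2
        rw [inv_mul_le_iff₀ hL0]; exact hAL.norm_le hL u
      have hn' : (0 : ℝ) < n := by positivity
      have k3 : 0 ≤ L⁻¹ * ((p : ℝ) - 1) := mul_nonneg (by positivity) (by linarith)
      rw [hd1, one_pow]
      calc a * q * T = L⁻¹ * (p / 2) * (L⁻¹ ^ 2 * ((lo / (L * (1 + M))) ^ 2 * T) + 0) / n := by
            rw [ha, hqdef]; field_simp; ring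
        _ ≤ L⁻¹ * (p - 1) * (L⁻¹ ^ 2 * ‖u‖ ^ 2 + avgSq e) / n := by gcongr
        _ ≤ _ := by gcongr
    have m4 : ∀ (d' u' : Vec p), (‖d'‖ = 1 ∨ d' = 0) → ‖u'‖ ^ 2 + avgSq e ≤ E * T →
        ∫⁻ X, ENNReal.ofReal (‖score A d' u' e X‖ ^ 4) ∂(rowLaw n A)
          ≤ ENNReal.ofReal (21016 * L ^ 8 * (E * T) ^ 2 * q ^ 2) := fun d' u' hd' hu' =>
      (lintegral_norm_score_four_le hn hL hAL hd' u' e).trans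
        (ENNReal.ofReal_le_ofReal (by gcongr))
    have hmse : Measurable fun X : Fin n → Vec p =>
        ENNReal.ofReal (‖twoStage δ (mkData θ₀ X e) - thetaStar A θ₀ δ‖ ^ 2) := by
      have h1 : Measurable fun X : Fin n → Vec p => mkData θ₀ X e :=
        (continuous_mkData θ₀).measurable.comp measurable_prodMk_right
      exact ((((measurable_twoStage hn hδ0).comp h1).sub_const _).norm.pow_const 2).ennreal_ofReal
    have hms : ∀ d' u' : Vec p, Measurable fun X : Fin n → Vec p =>
        ENNReal.ofReal (‖score A d' u' e X‖ ^ 4) := fun d' u' =>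
      ((continuous_score A d' u' e).measurable.norm.pow_const 4).ennreal_ofReal
    refine ofReal_le_of_le_add_half hC10 (by positivity)
      (r := ENNReal.ofReal ((1 + τ⁻¹) / T) * ENNReal.ofReal (21016 * L ^ 8 * (E * T) ^ 2 * q ^ 2)
        + (ENNReal.ofReal ((1 + τ⁻¹) / T) * ENNReal.ofReal (21016 * L ^ 8 * (E * T) ^ 2 * q ^ 2)
          + ENNReal.ofReal (τ * T) * ENNReal.ofReal q)) (m2.trans ?_) ?_
    · refine (lintegral_mono fun X => sq_score_le hn hL hAL hθ hδ0 hl0 hl2 hl hτ0 hd hu X e).trans ?_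
      rw [lintegral_add_left (hmse.const_mul _), lintegral_add_left ((hms d u).const_mul _),
        lintegral_add_left ((hms 0 0).const_mul _), lintegral_const_mul _ hmse,
        lintegral_const_mul _ (hms d u), lintegral_const_mul _ (hms 0 0), ← hC1]
      gcongr
      · exact m4 d u (Or.inl hd1) hE1
      · exact m4 0 0 (Or.inr rfl) hE2
      · exact (lintegral_indicator_const_le _ _).trans (mul_le_mul_right hbad _)
    -- for small `p / n` the remainder is at most half of the main term
    · rw [← ENNReal.ofReal_mul (by positivity), ← ENNReal.ofReal_mul (by positivity),
        ← ENNReal.ofReal_add (by positivity) (by positivity),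
        ← ENNReal.ofReal_add (by positivity) (by positivity)]
      apply ENNReal.ofReal_le_ofReal
      have r3 : D * q ≤ a / 4 := by
        calc D * q ≤ D * (a / (4 * D)) := by gcongr
          _ = _ := by field_simp
      calc _ = D * q * (q * T) + τ * T * q := by rw [hD]; field_simp; ring
        _ ≤ a / 4 * (q * T) + τ * T * q := by gcongr
        _ = _ := by rw [hτ]; ring
  refine le_trans (ENNReal.ofReal_le_ofReal ?_)
    (ofReal_half_le_mse hn hν (measurable_twoStage hn hδ0) hmain)
  calc a / (4 * C1) / (L ^ 2 * (1 + 1 / κ ^ 2)) * ((W ^ 2 + σ ^ 2) * q)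
      ≤ a / (4 * C1) / (L ^ 2 * (1 + 1 / κ ^ 2)) * ((L ^ 2 * T + L ^ 2 * T / κ ^ 2) * q) := by gcongr
    _ = _ := by field_simp; ring

end between

end AdvLinReg

namespace AdvLinReg

/-! ### The lower bound between the thresholds in dimension one -/

section shrink

/-- In dimension one the path estimator multiplies the signal by this factor, as a function of the
attack level `δ` and of the standard deviation `x` of the covariate. -/
noncomputable def shrink (δ x : ℝ) : ℝ :=
  if δ ≤ c0 * x then 1
  else if x ≤ c0 * δ then 0
  else x * (x - c0 * δ) / (x ^ 2 - 2 * c0 * δ * x + δ ^ 2)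

lemma shrink_denom_pos {δ : ℝ} (hδ : 0 < δ) (x : ℝ) : 0 < x ^ 2 - 2 * c0 * δ * x + δ ^ 2 := by
  have h := c0_sq_lt_one
  have : 0 < (1 - c0 ^ 2) * δ ^ 2 := mul_pos (by linarith) (by positivity)
  nlinarith [sq_nonneg (x - c0 * δ)]

/-- Well between the thresholds, the shrinkage factor separates standard deviations. -/
lemma mul_abs_sub_le_abs_shrink_sub {L ε δ x y : ℝ} (hL : 1 ≤ L) (hε : 0 < ε) (hy : L⁻¹ ≤ y)
    (hyL : y ≤ L) (hx : 0 ≤ x) (hxL : x ≤ L) (h1 : (1 + ε) * (c0 * y) ≤ δ)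
    (h2 : δ ≤ (1 - ε) * (y / c0)) :
    c0 ^ 2 * ε / (L ^ 3 * (2 * L ^ 2 / c0 ^ 2) ^ 2) * |x - y| ≤ |shrink δ x - shrink δ y| := by
  have hc := c0_pos
  have hc1 := c0_sq_lt_one
  have hL0 : 0 < L := by linarith
  have hi0 : 0 < L⁻¹ := by positivity
  have hy0 : 0 < y := hi0.trans_le hy
  have hcy : 0 < c0 * y := by positivity
  have hδy : c0 * y < δ := by nlinarith
  have hδ0 : 0 < δ := hcy.trans hδy
  have h2' : c0 * δ ≤ (1 - ε) * y := by
    rw [← mul_div_assoc, le_div_iff₀ hc] at h2; linarith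
  have hym : c0 * δ < y := by nlinarith
  have hδlo : c0 * L⁻¹ ≤ δ := le_trans (by gcongr) hδy.le
  have hδhi : c0 * δ ≤ L := by linarith
  set Dm := 2 * L ^ 2 / c0 ^ 2 with hDm
  have hDmdef : Dm * c0 ^ 2 = 2 * L ^ 2 := by rw [hDm]; field_simp
  have hDm1 : 1 ≤ Dm := by
    rw [hDm, one_le_div (by positivity)]
    nlinarith
  have hD : ∀ z, 0 ≤ z → z ≤ L → z ^ 2 - 2 * c0 * δ * z + δ ^ 2 ≤ Dm := by
    intro z hz hzL
    rw [hDm, le_div_iff₀ (by positivity)]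
    have k1 : z ^ 2 * c0 ^ 2 ≤ L ^ 2 * 1 := by gcongr
    have k2 : (c0 * δ) ^ 2 ≤ L ^ 2 := by gcongr
    have k3 : 0 ≤ 2 * c0 * δ * z * c0 ^ 2 := by positivity
    nlinarith
  have hDx := shrink_denom_pos hδ0 x
  have hDy := shrink_denom_pos hδ0 y
  have hDxm := hD x hx hxL
  have hDym := hD y hy0.le hyL
  have ey : shrink δ y = y * (y - c0 * δ) / (y ^ 2 - 2 * c0 * δ * y + δ ^ 2) := by
    rw [shrink, if_neg hδy.not_ge, if_neg hym.not_ge]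
  have hey : ε * L⁻¹ ≤ y - c0 * δ := by
    have : ε * L⁻¹ ≤ ε * y := by gcongr
    linarith
  have hxy : |x - y| ≤ L := abs_sub_le_iff.mpr ⟨by linarith, by linarith⟩
  have hconst : c0 ^ 2 * ε / (L ^ 3 * Dm ^ 2) * |x - y| ≤ c0 ^ 2 * ε * L⁻¹ ^ 2 / Dm := by
    calc c0 ^ 2 * ε / (L ^ 3 * Dm ^ 2) * |x - y| ≤ c0 ^ 2 * ε / (L ^ 3 * Dm ^ 1) * L := by
          gcongr
          norm_num
      _ = _ := by field_simp
  rcases le_or_gt δ (c0 * x) with hx1 | hx1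
  -- no shrinkage at `x`: the factor is `1`
  · rw [ey, shrink, if_pos hx1]
    refine hconst.trans (le_trans ?_ (le_abs_self _))
    have e : 1 - y * (y - c0 * δ) / (y ^ 2 - 2 * c0 * δ * y + δ ^ 2)
        = δ * (δ - c0 * y) / (y ^ 2 - 2 * c0 * δ * y + δ ^ 2) := by
      rw [eq_div_iff hDy.ne', sub_mul, div_mul_cancel₀ _ hDy.ne']; ring
    rw [e]
    have k : ε * (c0 * L⁻¹) ≤ δ - c0 * y := by
      have : ε * (c0 * L⁻¹) ≤ ε * (c0 * y) := by gcongr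
      linarith
    have k2 : 0 ≤ δ * (δ - c0 * y) := mul_nonneg hδ0.le (by linarith)
    calc c0 ^ 2 * ε * L⁻¹ ^ 2 / Dm = (c0 * L⁻¹) * (ε * (c0 * L⁻¹)) / Dm := by ring
      _ ≤ δ * (δ - c0 * y) / Dm := by gcongr
      _ ≤ _ := by gcongr
  rcases le_or_gt x (c0 * δ) with hx2 | hx2
  -- full shrinkage at `x`: the factor is `0`
  · rw [ey, shrink, if_neg hx1.not_ge, if_pos hx2, zero_sub, abs_neg]
    refine hconst.trans (le_trans ?_ (le_abs_self _))
    have k2 : 0 ≤ y * (y - c0 * δ) := mul_nonneg hy0.le (by linarith)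
    calc c0 ^ 2 * ε * L⁻¹ ^ 2 / Dm ≤ 1 * ε * L⁻¹ ^ 2 / Dm := by gcongr
      _ = L⁻¹ * (ε * L⁻¹) / Dm := by ring
      _ ≤ y * (y - c0 * δ) / Dm := by gcongr
      _ ≤ _ := by gcongr
  · have ex : shrink δ x = x * (x - c0 * δ) / (x ^ 2 - 2 * c0 * δ * x + δ ^ 2) := by
      rw [shrink, if_neg hx1.not_ge, if_neg hx2.not_ge]
    -- the difference factors, with a bracket that is bounded below between the thresholds
    set br := δ ^ 2 * (y - c0 * δ) + x * δ * (δ - c0 * y) with hbr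
    have e : shrink δ x - shrink δ y
        = (x - y) * (br / ((x ^ 2 - 2 * c0 * δ * x + δ ^ 2) * (y ^ 2 - 2 * c0 * δ * y + δ ^ 2))) := by
      rw [ex, ey, div_sub_div _ _ hDx.ne' hDy.ne', ← mul_div_assoc]
      congr 1
      rw [hbr]; ring
    have k : c0 ^ 2 * ε * L⁻¹ ^ 3 ≤ br := by
      have k1 : 0 ≤ x * δ * (δ - c0 * y) := by
        have : 0 ≤ δ - c0 * y := by linarith
        positivity
      calc c0 ^ 2 * ε * L⁻¹ ^ 3 = (c0 * L⁻¹) ^ 2 * (ε * L⁻¹) := by ring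
        _ ≤ δ ^ 2 * (y - c0 * δ) := by gcongr
        _ ≤ br := by rw [hbr]; linarith
    have hbr0 : 0 ≤ br := le_trans (by positivity) k
    have hq0 : 0 ≤ br / ((x ^ 2 - 2 * c0 * δ * x + δ ^ 2) * (y ^ 2 - 2 * c0 * δ * y + δ ^ 2)) := by
      positivity
    rw [e, abs_mul, mul_comm |x - y|, abs_of_nonneg hq0]
    refine mul_le_mul_of_nonneg_right ?_ (abs_nonneg _)
    calc c0 ^ 2 * ε / (L ^ 3 * Dm ^ 2) = c0 ^ 2 * ε * L⁻¹ ^ 3 / (Dm * Dm) := by field_simp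
      _ ≤ br / (Dm * Dm) := by gcongr
      _ ≤ _ := by gcongr

end shrink

section one

variable {n : ℕ} {L : ℝ} {A : Matrix (Fin 1) (Fin 1) ℝ}

lemma mulV_one_dim (A : Matrix (Fin 1) (Fin 1) ℝ) (x : Vec 1) : mulV A x = A 0 0 • x := by
  ext i
  fin_cases i
  simp [mulV, Matrix.mulVec, dotProduct]

lemma CovClass.bounds_one_dim (hA : CovClass L⁻¹ L A) : L⁻¹ ≤ A 0 0 ∧ A 0 0 ≤ L := by
  have h1 := hA.le_inner (unitVec 0)
  have h2 := hA.inner_le (unitVec 0)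
  rw [mulV_one_dim, inner_smul_right, real_inner_self_eq_norm_sq, norm_unitVec] at h1 h2
  constructor <;> linarith

lemma ratio_one_dim (hA : 0 < A 0 0) {b : Vec 1} (hb : b ≠ 0) : ratio A b = √(A 0 0) := by
  have hb' : 0 < ‖b‖ := norm_pos_iff.mpr hb
  have hs : 0 < √(A 0 0) := Real.sqrt_pos.mpr hA
  have e : wnorm A b = √(A 0 0) * ‖b‖ := by
    rw [wnorm, mulV_one_dim, inner_smul_right, real_inner_self_eq_norm_sq, Real.sqrt_mul hA.le,
      Real.sqrt_sq hb'.le]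
  rw [ratio, e, mulV_one_dim, norm_smul, Real.norm_of_nonneg hA.le, div_eq_iff (by positivity),
    ← mul_assoc, Real.mul_self_sqrt hA.le]

lemma pathEst_one_dim (hL : 1 ≤ L) (hA : CovClass L⁻¹ L A) (t : Vec 1) (δ : ℝ) :
    pathEst A t δ = shrink δ √(A 0 0) • t := by
  have hAp := hA.posDef (inv_pos.mpr (by linarith))
  have ha : 0 < A 0 0 := (inv_pos.mpr (by linarith)).trans_le hA.bounds_one_dim.1
  rcases eq_or_ne t 0 with rfl | ht
  · rw [pathEst_zero, smul_zero]
  have hs : 0 < √(A 0 0) := Real.sqrt_pos.mpr ha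
  have hss : √(A 0 0) ^ 2 = A 0 0 := Real.sq_sqrt ha.le
  have e1 : delta1 A t = c0 * √(A 0 0) := by
    rw [delta1_eq hAp, ratio_one_dim ha (res_ne_zero hAp le_rfl ht)]
  have e2 : delta2 A t = √(A 0 0) / c0 := by
    rw [delta2_eq hA.transpose_eq, ratio_one_dim ha ht]
  have hc := c0_pos
  rcases lambdaStar_cases hL hA ht δ with ⟨h, e⟩ | ⟨h, h', e⟩ | ⟨h, h', l, hl, hp, e⟩
  · rw [pathEst, e, thetaPath_zero_level hAp, shrink, if_pos (by rwa [← e1]), one_smul]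
  · have h3 : √(A 0 0) ≤ c0 * δ := by rw [e2, div_le_iff₀ hc] at h'; linarith
    rw [pathEst, e, thetaPath_top, shrink, if_neg (by rw [← e1]; exact h.not_ge), if_pos h3,
      zero_smul]
  · have h3 : c0 * δ < √(A 0 0) := by rw [e2, lt_div_iff₀ hc] at h'; linarith
    rw [e1] at h
    rw [pathEq_iff hAp ht hl, ratio_one_dim ha (res_ne_zero hAp hl.le ht)] at hp
    rw [pathEst, e, thetaPath_eq_mulV_res hAp hl.le, shrink, if_neg h.not_ge, if_neg h3.not_ge,
      mulV_one_dim]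
    have hδ : 0 < δ := lt_trans (by positivity) h
    have hD := shrink_denom_pos hδ √(A 0 0)
    have hr := mulV_res_add hAp hl.le t
    rw [mulV_one_dim, ← add_smul] at hr
    nth_rw 2 [← hr]
    rw [smul_smul]
    congr 1
    set x := √(A 0 0)
    rw [← hss, div_mul_eq_mul_div, eq_div_iff hD.ne']
    have hp' : l * (x - c0 * δ) = δ * x * (δ - c0 * x) := by
      field_simp at hp
      linarith
    linear_combination -x * hp'

end one

section neg

variable {p n : ℕ}

lemma CovClass.exists_mul_transpose {a b : ℝ} (ha : 0 < a) {A : Matrix (Fin p) (Fin p) ℝ}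
    (hA : CovClass a b A) : ∃ B : Matrix (Fin p) (Fin p) ℝ, A = B * Bᵀ := by
  obtain ⟨B, hB, -⟩ := exists_wnorm_eq_norm (hA.posDef ha).posSemidef
  exact ⟨Bᵀ, by rw [Matrix.transpose_transpose, hB]⟩

/-- The law of the covariates is symmetric. -/
lemma lintegral_rowLaw_neg (B : Matrix (Fin p) (Fin p) ℝ) {f : (Fin n → Vec p) → ℝ≥0∞}
    (hf : Measurable f) :
    ∫⁻ X, f (-X) ∂(rowLaw n (B * Bᵀ)) = ∫⁻ X, f X ∂(rowLaw n (B * Bᵀ)) := by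
  have e : B * Bᵀ = -B * (-B)ᵀ := by simp
  have hr : ∀ z : Fin n × Fin p → ℝ, -rowsOf B z = rowsOf (-B) z := fun z => by
    funext i
    simp only [rowsOf, Pi.neg_apply]
    rw [← zero_sub B, sub_mulV, zero_mulV, zero_sub]
  conv_rhs => rw [e, rowLaw_eq_map, lintegral_map hf (continuous_rowsOf _).measurable]
  rw [rowLaw_eq_map, lintegral_map (f := fun X => f (-X)) (hf.comp measurable_neg)
    (continuous_rowsOf _).measurable]
  simp_rw [hr]

lemma gram_neg (X : Fin n → Vec p) : gram (-X) = gram X := by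
  ext i j
  simp [gram, Matrix.mul_apply]

lemma olsErr_neg (X : Fin n → Vec p) (e : Fin n → ℝ) : olsErr (-X) e = -olsErr X e := by
  have : crossAvg (-X) e = -crossAvg X e := by simp [crossAvg]
  rw [olsErr, olsErr, gram_neg, this, mulV_neg]

end neg

section one

variable {n : ℕ} {L : ℝ} {A : Matrix (Fin 1) (Fin 1) ℝ}

/-- In dimension one, the squared score is controlled by the squared error at the covariates and at
their negatives: the contribution of the noise is odd and only adds to the sum of the two. -/
lemma sq_score_le_one_dim (hn : 0 < n) (hL : 1 ≤ L) (hA : CovClass L⁻¹ L A) {θ₀ : Vec 1}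
    (hθ : θ₀ ≠ 0) {δ ε τ : ℝ} (hε : 0 < ε) (hτ : 0 < τ) (h1 : (1 + ε) * delta1 A θ₀ ≤ δ)
    (h2 : δ ≤ (1 - ε) * delta2 A θ₀) (X : Fin n → Vec 1) (e : Fin n → ℝ) :
    ENNReal.ofReal (‖score A 0 θ₀ (0 : Fin n → ℝ) X‖ ^ 2)
      ≤ ENNReal.ofReal ((2 * L / (c0 ^ 2 * ε / (L ^ 3 * (2 * L ^ 2 / c0 ^ 2) ^ 2))) ^ 2 / 2)
          * (ENNReal.ofReal (‖twoStage δ (mkData θ₀ X e) - thetaStar A θ₀ δ‖ ^ 2)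
            + ENNReal.ofReal (‖twoStage δ (mkData θ₀ (-X) e) - thetaStar A θ₀ δ‖ ^ 2))
        + (ENNReal.ofReal (τ⁻¹ / ‖θ₀‖ ^ 2)
            * ENNReal.ofReal (‖score A 0 θ₀ (0 : Fin n → ℝ) X‖ ^ 4)
          + {X | ¬ CovClass L⁻¹ L (gram X)}.indicator
            (fun _ => ENNReal.ofReal (τ * ‖θ₀‖ ^ 2)) X) := by
  have hL0 : 0 < L := by linarith
  have hAp := hA.posDef (inv_pos.mpr hL0)
  have hθ' : 0 < ‖θ₀‖ := norm_pos_iff.mpr hθ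
  have hδ : 0 ≤ δ := by
    have := delta1_pos hL hA hθ
    exact le_trans (by positivity) h1
  set T := ‖θ₀‖ ^ 2 with hT
  have hT0 : 0 < T := by positivity
  by_cases hX : CovClass L⁻¹ L (gram X)
  · have hXp := hX.posDef (inv_pos.mpr hL0)
    have hXn : CovClass L⁻¹ L (gram (-X)) := by rwa [gram_neg]
    rw [Set.indicator_of_notMem (by simpa using hX), add_zero]
    refine le_trans ?_ le_self_add
    rw [← ENNReal.ofReal_add (by positivity) (by positivity), ← ENNReal.ofReal_mul (by positivity)]
    apply ENNReal.ofReal_le_ofReal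
    obtain ⟨ha1, ha2⟩ := hA.bounds_one_dim
    obtain ⟨hs1, hs2⟩ := hX.bounds_one_dim
    have hi0 : 0 < L⁻¹ := by positivity
    have hi1 : L⁻¹ ≤ 1 := inv_le_one_of_one_le₀ hL
    have hsq : ∀ s : ℝ, L⁻¹ ≤ s → s ≤ L → L⁻¹ ≤ √s ∧ √s ≤ L := fun s h h' =>
      ⟨Real.le_sqrt_of_sq_le (by nlinarith), Real.sqrt_le_iff.mpr ⟨hL0.le, by nlinarith⟩⟩
    have ea : ∀ b : Vec 1, b ≠ 0 → ratio A b = √(A 0 0) := fun b hb =>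
      ratio_one_dim (hi0.trans_le ha1) hb
    rw [delta1_eq hAp, ea _ (res_ne_zero hAp le_rfl hθ)] at h1
    rw [delta2_eq hA.transpose_eq, ea _ hθ] at h2
    have hk := mul_abs_sub_le_abs_shrink_sub hL hε (hsq _ ha1 ha2).1 (hsq _ ha1 ha2).2
      (Real.sqrt_nonneg (gram X 0 0)) (hsq _ hs1 hs2).2 h1 h2
    set C := c0 ^ 2 * ε / (L ^ 3 * (2 * L ^ 2 / c0 ^ 2) ^ 2) with hC
    have hC0 : 0 < C := by have := c0_pos; positivity
    have hsa : |gram X 0 0 - A 0 0| ≤ 2 * L * |√(gram X 0 0) - √(A 0 0)| := by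
      have e : gram X 0 0 - A 0 0
          = (√(gram X 0 0) + √(A 0 0)) * (√(gram X 0 0) - √(A 0 0)) := by
        nth_rw 1 [← Real.sq_sqrt (hi0.le.trans hs1), ← Real.sq_sqrt (hi0.le.trans ha1)]
        ring
      rw [e, abs_mul, abs_of_nonneg (by positivity)]
      gcongr
      linarith [(hsq _ ha1 ha2).2, (hsq _ hs1 hs2).2]
    have hsc : ‖score A 0 θ₀ (0 : Fin n → ℝ) X‖ = |gram X 0 0 - A 0 0| * ‖θ₀‖ := by
      simp [score, crossAvg, mulV_one_dim, norm_smul]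
    rw [hsc, twoStage_mkData δ hn θ₀ e hXp, twoStage_mkData δ hn θ₀ e (by rwa [gram_neg]),
      thetaStar_eq hL hA θ₀ hδ, pathEst_one_dim hL hX, pathEst_one_dim hL hXn,
      pathEst_one_dim hL hA, gram_neg, olsErr_neg]
    set k := shrink δ √(gram X 0 0)
    set k0 := shrink δ √(A 0 0)
    have e1 : k • (θ₀ + olsErr X e) - k0 • θ₀ = (k - k0) • θ₀ + k • olsErr X e := by
      rw [smul_add, sub_smul]; abel
    have e2 : k • (θ₀ + -olsErr X e) - k0 • θ₀ = (k - k0) • θ₀ - k • olsErr X e := by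
      rw [smul_add, sub_smul, smul_neg]; abel
    -- the noise changes sign with the covariates, so that it only adds to the sum of the two squares
    have hpar := parallelogram_law_with_norm ℝ ((k - k0) • θ₀) (k • olsErr X e)
    rw [e1, e2]
    have hge : 2 * (‖(k - k0) • θ₀‖ ^ 2) ≤ ‖(k - k0) • θ₀ + k • olsErr X e‖ ^ 2
        + ‖(k - k0) • θ₀ - k • olsErr X e‖ ^ 2 := by
      nlinarith [norm_nonneg (k • olsErr X e)]
    have hm : |gram X 0 0 - A 0 0| ≤ 2 * L / C * |k - k0| := by
      rw [div_mul_eq_mul_div, le_div_iff₀ hC0]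
      calc |gram X 0 0 - A 0 0| * C ≤ 2 * L * |√(gram X 0 0) - √(A 0 0)| * C := by gcongr
        _ = 2 * L * (C * |√(gram X 0 0) - √(A 0 0)|) := by ring
        _ ≤ _ := by gcongr
    calc (|gram X 0 0 - A 0 0| * ‖θ₀‖) ^ 2 ≤ (2 * L / C * |k - k0| * ‖θ₀‖) ^ 2 := by gcongr
      _ = (2 * L / C) ^ 2 / 2 * (2 * ‖(k - k0) • θ₀‖ ^ 2) := by
          rw [norm_smul, Real.norm_eq_abs]; ring
      _ ≤ _ := by gcongr
  · rw [Set.indicator_of_mem (by simpa using hX)]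
    refine le_trans ?_ le_add_self
    rw [← ENNReal.ofReal_mul (by positivity), ← ENNReal.ofReal_add (by positivity) (by positivity)]
    apply ENNReal.ofReal_le_ofReal
    set q := ‖score A 0 θ₀ (0 : Fin n → ℝ) X‖
    have h1 : τ⁻¹ / T * q ^ 4 = q ^ 4 / (τ * T) := by field_simp
    have hs : 0 < τ * T := by positivity
    rw [h1, div_add' _ _ _ hs.ne', le_div_iff₀ hs]
    nlinarith [sq_nonneg (q ^ 2 - τ * T), sq_nonneg (q ^ 2), sq_nonneg (τ * T)]

set_option maxHeartbeats 600000 in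
/-- Lower bound for the mean squared error between the thresholds, in dimension one. -/
theorem le_mse_twoStage_between_one_dim {ℓ κ ε : ℝ} (hℓ : 1 ≤ ℓ) (hκ : 0 < κ)
    (hε : 0 < ε) : ∃ c η : ℝ, 0 < c ∧ 0 < η ∧ ∀ {n : ℕ}, LargeSample ℓ 1 n →
      ((1 : ℕ) / n : ℝ) ≤ η →
      ∀ (A : Matrix (Fin 1) (Fin 1) ℝ) (θ₀ : Vec 1) (σ : ℝ) (ν : Measure ℝ) (δ : ℝ),
        CovClass ℓ⁻¹ ℓ A → IsNoise ν σ → θ₀ ≠ 0 → 0 ≤ σ → κ * σ ≤ wnorm A θ₀ →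
        (1 + ε) * delta1 A θ₀ ≤ δ → δ ≤ (1 - ε) * delta2 A θ₀ →
          ENNReal.ofReal (c * rate n A θ₀ σ) ≤ mse (n := n) A θ₀ ν δ (twoStage δ) := by
  set L := 16 * ℓ ^ 2 with hLdef
  have hL : 1 ≤ L := one_le_widen hℓ
  have hL0 : 0 < L := by linarith
  have hc0 := c0_pos
  set a := 1 / L ^ 3 with ha
  have ha0 : 0 < a := by positivity
  set τ := a / 4 with hτ
  have hτ0 : 0 < τ := by positivity
  set D := τ⁻¹ * (21016 * L ^ 8) with hD
  have hD0 : 0 < D := by positivity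
  set C1 := (2 * L / (c0 ^ 2 * ε / (L ^ 3 * (2 * L ^ 2 / c0 ^ 2) ^ 2))) ^ 2 / 2 with hC1
  have hC10 : 0 < C1 := by positivity
  refine ⟨a / (8 * C1) / (L ^ 2 * (1 + 1 / κ ^ 2)), a / (4 * D), by positivity, by positivity, ?_⟩
  clear_value a τ D C1
  intro n h hq A θ₀ σ ν δ hA hν hθ hσ hκW h1 h2
  have hn := h.pos
  have hAL : CovClass L⁻¹ L A := hA.widen hℓ
  have hbad : (rowLaw n A) {X | ¬ CovClass L⁻¹ L (gram X)} ≤ ENNReal.ofReal ((1 : ℕ) / n) :=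
    h.prob_le hℓ hA
  clear_value L
  have hd1 := delta1_pos hL hAL hθ
  have hδ0 : 0 ≤ δ := le_trans (by positivity) h1
  rw [rate_eq]
  set W := wnorm A θ₀ with hW
  set q : ℝ := (1 : ℕ) / n with hqdef
  have hq0 : 0 ≤ q := by positivity
  have hθ' : 0 < ‖θ₀‖ := norm_pos_iff.mpr hθ
  set T := ‖θ₀‖ ^ 2 with hT
  have hT0 : 0 < T := by positivity
  have hWT : W ^ 2 ≤ L ^ 2 * T := by
    rw [hT, ← mul_pow]
    exact pow_le_pow_left₀ (wnorm_nonneg _ _) (hAL.wnorm_le hL θ₀) 2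
  have hσT : σ ^ 2 ≤ L ^ 2 * T / κ ^ 2 := by
    rw [le_div_iff₀ (by positivity), hT, ← mul_pow, ← mul_pow, mul_comm σ]
    exact pow_le_pow_left₀ (by positivity) (hκW.trans (hAL.wnorm_le hL θ₀)) 2
  have h0 : avgSq (0 : Fin n → ℝ) = 0 := by simp [avgSq]
  obtain ⟨B, hB⟩ := hA.exists_mul_transpose (by positivity)
  have hmain : ∀ e : Fin n → ℝ, avgSq e ≤ 2 * σ ^ 2 → ENNReal.ofReal (a * q * T / (2 * (C1 * 2)))
      ≤ ∫⁻ X, ENNReal.ofReal (‖twoStage δ (mkData θ₀ X e) - thetaStar A θ₀ δ‖ ^ 2)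
        ∂(rowLaw n A) := by
    intro e _
    have m2 : ENNReal.ofReal (a * q * T)
        ≤ ∫⁻ X, ENNReal.ofReal (‖score A 0 θ₀ (0 : Fin n → ℝ) X‖ ^ 2) ∂(rowLaw n A) := by
      refine le_trans (ENNReal.ofReal_le_ofReal ?_)
        (lintegral_norm_score_sq_ge hn hL hAL (Or.inr rfl) θ₀ 0)
      have k2 : L⁻¹ ^ 2 * T ≤ wnorm A θ₀ ^ 2 := by
        rw [hT, ← mul_pow]
        refine pow_le_pow_left₀ (by positivity) ?_ 2
        rw [inv_mul_le_iff₀ hL0]; exact hAL.norm_le hL θ₀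
      rw [h0, norm_zero, add_zero]
      calc a * q * T = L⁻¹ * ((1 : ℕ) - 0 ^ 2) * (L⁻¹ ^ 2 * T) / n := by
            rw [ha, hqdef]; field_simp; norm_num
        _ ≤ _ := by gcongr
    have m4 : ∫⁻ X, ENNReal.ofReal (‖score A 0 θ₀ (0 : Fin n → ℝ) X‖ ^ 4) ∂(rowLaw n A)
          ≤ ENNReal.ofReal (21016 * L ^ 8 * T ^ 2 * q ^ 2) := by
      refine (lintegral_norm_score_four_le hn hL hAL (Or.inr rfl) θ₀ 0).trans (le_of_eq ?_)
      rw [h0, add_zero]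
    have hmse : Measurable fun X : Fin n → Vec 1 =>
        ENNReal.ofReal (‖twoStage δ (mkData θ₀ X e) - thetaStar A θ₀ δ‖ ^ 2) := by
      have h1 : Measurable fun X : Fin n → Vec 1 => mkData θ₀ X e :=
        (continuous_mkData θ₀).measurable.comp measurable_prodMk_right
      exact ((((measurable_twoStage hn hδ0).comp h1).sub_const _).norm.pow_const 2).ennreal_ofReal
    have hmn : Measurable fun X : Fin n → Vec 1 =>
        ENNReal.ofReal (‖twoStage δ (mkData θ₀ X e) - thetaStar A θ₀ δ‖ ^ 2)
          + ENNReal.ofReal (‖twoStage δ (mkData θ₀ (-X) e) - thetaStar A θ₀ δ‖ ^ 2) :=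
      hmse.add (hmse.comp measurable_neg)
    have hms : Measurable fun X : Fin n → Vec 1 =>
        ENNReal.ofReal (‖score A 0 θ₀ (0 : Fin n → ℝ) X‖ ^ 4) :=
      ((continuous_score A 0 θ₀ 0).measurable.norm.pow_const 4).ennreal_ofReal
    have hneg : ∫⁻ X, ENNReal.ofReal (‖twoStage δ (mkData θ₀ (-X) e) - thetaStar A θ₀ δ‖ ^ 2)
        ∂(rowLaw n A) = ∫⁻ X, ENNReal.ofReal (‖twoStage δ (mkData θ₀ X e) - thetaStar A θ₀ δ‖ ^ 2)
        ∂(rowLaw n A) := by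
      have := lintegral_rowLaw_neg B hmse
      rwa [← hB] at this
    refine ofReal_le_of_le_add_half (by positivity) (by positivity)
      (r := ENNReal.ofReal (τ⁻¹ / T) * ENNReal.ofReal (21016 * L ^ 8 * T ^ 2 * q ^ 2)
          + ENNReal.ofReal (τ * T) * ENNReal.ofReal q) (m2.trans ?_) ?_
    · refine (lintegral_mono fun X =>
        sq_score_le_one_dim hn hL hAL hθ hε hτ0 h1 h2 X e).trans ?_
      rw [lintegral_add_left (hmn.const_mul _),
        lintegral_add_left (hms.const_mul _),
        lintegral_const_mul _ hmn, lintegral_add_left hmse, hneg,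
        lintegral_const_mul _ hms, ← hC1, ← two_mul, ← mul_assoc, ENNReal.ofReal_mul hC10.le,
        ENNReal.ofReal_ofNat]
      gcongr
      exact (lintegral_indicator_const_le _ _).trans (mul_le_mul_right hbad _)
    · rw [← ENNReal.ofReal_mul (by positivity), ← ENNReal.ofReal_mul (by positivity),
        ← ENNReal.ofReal_add (by positivity) (by positivity)]
      apply ENNReal.ofReal_le_ofReal
      have r3 : D * q ≤ a / 4 := by
        calc D * q ≤ D * (a / (4 * D)) := by gcongr
          _ = _ := by field_simp
      calc _ = D * q * (q * T) + τ * T * q := by rw [hD]; field_simp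
        _ ≤ a / 4 * (q * T) + τ * T * q := by gcongr
        _ = _ := by rw [hτ]; ring
  refine le_trans (ENNReal.ofReal_le_ofReal ?_)
    (ofReal_half_le_mse hn hν (measurable_twoStage hn hδ0) hmain)
  calc a / (8 * C1) / (L ^ 2 * (1 + 1 / κ ^ 2)) * ((W ^ 2 + σ ^ 2) * q)
      ≤ a / (8 * C1) / (L ^ 2 * (1 + 1 / κ ^ 2)) * ((L ^ 2 * T + L ^ 2 * T / κ ^ 2) * q) := by gcongr
    _ = _ := by field_simp; ring

end one

end AdvLinReg

namespace AdvLinReg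

/-! ### Two-point lower bounds -/

section tilt

variable {E : Type*} [MeasurableSpace E] {μ : Measure E}

/-- The image of `μ` under `φ` has density `exp (2 y)` with respect to `μ`. The factor two makes
the comparison below symmetric in the two measures. -/
def TiltsTo (μ : Measure E) (φ : E → E) (y : E → ℝ) : Prop :=
  ∀ f : E → ℝ≥0∞, Measurable f →
    ∫⁻ x, f (φ x) ∂μ = ∫⁻ x, f x * ENNReal.ofReal (Real.exp (2 * y x)) ∂μ

lemma TiltsTo.pi [IsProbabilityMeasure μ] {φ : E → E} {y : E → ℝ} (hφ : Measurable φ)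
    (hy : Measurable y) (h : TiltsTo μ φ y) (n : ℕ) :
    TiltsTo (Measure.pi fun _ : Fin n => μ) (fun x i => φ (x i)) (fun x => ∑ i, y (x i)) := by
  induction n with
  | zero =>
    intro f hf
    have e : ∀ x : Fin 0 → E, (fun i => φ (x i)) = x := fun x => Subsingleton.elim _ _
    simp [e]
  | succ n ih =>
    intro f hf
    have hφ' : Measurable fun (x : Fin (n + 1) → E) i => φ (x i) := by fun_prop
    have hc : Measurable fun z : E × (Fin n → E) => (Fin.cons z.1 z.2 : Fin (n + 1) → E) :=
      measurable_pi_iff.mpr fun i => by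
        refine Fin.cases ?_ (fun j => ?_) i
        · simpa using measurable_fst
        · simpa using (by fun_prop : Measurable fun z : E × (Fin n → E) => z.2 j)
    rw [lintegral_pi_succ (f := fun x => f fun i => φ (x i)) (hf.comp hφ'),
      lintegral_pi_succ (by fun_prop)]
    have e : ∀ (x : E) (z : Fin n → E), (fun i => φ ((Fin.cons x z : Fin (n + 1) → E) i))
        = Fin.cons (φ x) fun i => φ (z i) := fun x z => by
      funext i; refine Fin.cases ?_ (fun j => ?_) i <;> simp
    simp_rw [e, Fin.sum_univ_succ, Fin.cons_zero, Fin.cons_succ]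
    have h1 : ∀ z : Fin n → E, ∫⁻ x, f (Fin.cons (φ x) fun i => φ (z i)) ∂μ
        = ∫⁻ x, f (Fin.cons x fun i => φ (z i)) * ENNReal.ofReal (Real.exp (2 * y x)) ∂μ := fun z =>
      h (fun x => f (Fin.cons x fun i => φ (z i))) (hf.comp (hc.comp measurable_prodMk_right))
    simp_rw [h1]
    rw [ih (fun z => ∫⁻ x, f (Fin.cons x z) * ENNReal.ofReal (Real.exp (2 * y x)) ∂μ)]
    · refine lintegral_congr fun z => ?_
      rw [← lintegral_mul_const]
      · refine lintegral_congr fun x => ?_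
        rw [mul_assoc, ← ENNReal.ofReal_mul (Real.exp_nonneg _), ← Real.exp_add, ← mul_add]
      · exact (hf.comp (hc.comp measurable_prodMk_right)).mul (by fun_prop)
    · refine Measurable.lintegral_prod_left' (f := fun w : E × (Fin n → E) =>
        f (Fin.cons w.1 w.2) * ENNReal.ofReal (Real.exp (2 * y w.1))) ?_
      exact (hf.comp hc).mul (by fun_prop)

/-- The pointwise inequality behind the two-point bound, a form of `cosh² y ≤ 1 / (1 - y²)`. -/
lemma two_point_pointwise (u β₁ β₂ y : ℝ) :
    ((β₁ - β₂) / 2) ^ 2 * (Real.exp (2 * y) + 1)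
      ≤ (u - β₁) ^ 2 * Real.exp (2 * y) + (u - β₂) ^ 2
        + ((β₁ - β₂) / 2) ^ 2 * (y ^ 2 * Real.exp (2 * y) + y ^ 2) := by
  set E := Real.exp (2 * y) with hE
  have hE0 : 0 < E := Real.exp_pos _
  have h1 : (1 - y ^ 2) * (E + 1) ^ 2 ≤ 4 * E := by
    have hc : Real.cosh y ^ 2 ≤ Real.exp (y ^ 2) := by
      calc Real.cosh y ^ 2 ≤ Real.exp (y ^ 2 / 2) ^ 2 :=
            pow_le_pow_left₀ (Real.cosh_pos y).le (Real.cosh_le_exp_half_sq y) 2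
        _ = _ := by rw [← Real.exp_nat_mul]; congr 1; push_cast; ring
    have hx : (1 - y ^ 2) * Real.exp (y ^ 2) ≤ 1 := by
      calc (1 - y ^ 2) * Real.exp (y ^ 2) ≤ Real.exp (-y ^ 2) * Real.exp (y ^ 2) := by
            gcongr; linarith [Real.add_one_le_exp (-y ^ 2)]
        _ = 1 := by rw [← Real.exp_add]; simp
    have hcosh : (E + 1) ^ 2 = 4 * E * Real.cosh y ^ 2 := by
      have e1 : E = Real.exp y ^ 2 := by rw [hE, ← Real.exp_nat_mul]; norm_num
      rw [Real.cosh_eq, Real.exp_neg, e1]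
      have := (Real.exp_pos y).ne'
      field_simp
      ring
    rw [hcosh]
    rcases le_or_gt (1 - y ^ 2) 0 with h | h
    · have : (1 - y ^ 2) * (4 * E * Real.cosh y ^ 2) ≤ 0 :=
        mul_nonpos_of_nonpos_of_nonneg h (by positivity)
      linarith
    · calc (1 - y ^ 2) * (4 * E * Real.cosh y ^ 2) = 4 * E * ((1 - y ^ 2) * Real.cosh y ^ 2) := by ring
        _ ≤ 4 * E * ((1 - y ^ 2) * Real.exp (y ^ 2)) := by gcongr
        _ ≤ 4 * E * 1 := by gcongr
        _ = _ := by ring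
  -- the weighted sum of squares is smallest at the weighted mean
  have h2 : E * (β₁ - β₂) ^ 2 ≤ ((u - β₁) ^ 2 * E + (u - β₂) ^ 2) * (E + 1) := by
    nlinarith [sq_nonneg ((u - β₁) * E + (u - β₂))]
  have h3 : ((β₁ - β₂) / 2) ^ 2 * (1 - y ^ 2) * (E + 1) ≤ (u - β₁) ^ 2 * E + (u - β₂) ^ 2 := by
    refine le_of_mul_le_mul_right ?_ (by linarith : 0 < E + 1)
    calc _ = (β₁ - β₂) ^ 2 / 4 * ((1 - y ^ 2) * (E + 1) ^ 2) := by ring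
      _ ≤ (β₁ - β₂) ^ 2 / 4 * (4 * E) := by gcongr
      _ = E * (β₁ - β₂) ^ 2 := by ring
      _ ≤ _ := h2
  linarith

/-- Two targets at a distance cannot both be estimated well when the log-likelihood ratio is small
in mean square. -/
lemma TiltsTo.two_point [IsProbabilityMeasure μ] {φ : E → E} {y : E → ℝ}
    (hy : Measurable y) (h : TiltsTo μ φ y)
    (h1 : ∫⁻ x, ENNReal.ofReal (y x ^ 2) ∂μ ≤ ENNReal.ofReal (1 / 2))
    (h2 : ∫⁻ x, ENNReal.ofReal (y (φ x) ^ 2) ∂μ ≤ ENNReal.ofReal (1 / 2))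
    {U : E → ℝ} (hU : Measurable U) (β₁ β₂ : ℝ) :
    ENNReal.ofReal (((β₁ - β₂) / 2) ^ 2) ≤ ∫⁻ x, ENNReal.ofReal ((U (φ x) - β₁) ^ 2) ∂μ
      + ∫⁻ x, ENNReal.ofReal ((U x - β₂) ^ 2) ∂μ := by
  set D := ((β₁ - β₂) / 2) ^ 2 with hD
  have hD0 : 0 ≤ D := sq_nonneg _
  have t1 := h (fun x => ENNReal.ofReal ((U x - β₁) ^ 2)) (by fun_prop)
  have t2 := h (fun x => ENNReal.ofReal (y x ^ 2)) (by fun_prop)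
  have t3 := h (fun _ => 1) measurable_const
  simp only [lintegral_const, measure_univ, mul_one, one_mul] at t3
  have key : ENNReal.ofReal D * (1 + 1) ≤ (∫⁻ x, ENNReal.ofReal ((U (φ x) - β₁) ^ 2) ∂μ
      + ∫⁻ x, ENNReal.ofReal ((U x - β₂) ^ 2) ∂μ)
      + ENNReal.ofReal D * (∫⁻ x, ENNReal.ofReal (y (φ x) ^ 2) ∂μ
        + ∫⁻ x, ENNReal.ofReal (y x ^ 2) ∂μ) := by
    have hl : ENNReal.ofReal D * (1 + 1) = ∫⁻ x, ENNReal.ofReal D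
        * (ENNReal.ofReal (Real.exp (2 * y x)) + 1) ∂μ := by
      rw [lintegral_const_mul _ (by fun_prop), lintegral_add_right _ measurable_const, ← t3]
      simp
    rw [hl, t1, t2, ← lintegral_add_left (by fun_prop), ← lintegral_add_left (by fun_prop),
      ← lintegral_const_mul _ (by fun_prop), ← lintegral_add_left (by fun_prop)]
    refine lintegral_mono fun x => ?_
    have e0 := (Real.exp_pos (2 * y x)).le
    rw [← ENNReal.ofReal_one, ← ENNReal.ofReal_add e0 zero_le_one, ← ENNReal.ofReal_mul hD0,
      ← ENNReal.ofReal_mul (sq_nonneg _), ← ENNReal.ofReal_mul (sq_nonneg _),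
      ← ENNReal.ofReal_add (by positivity) (by positivity),
      ← ENNReal.ofReal_add (by positivity) (by positivity), ← ENNReal.ofReal_mul hD0,
      ← ENNReal.ofReal_add (by positivity) (by positivity)]
    exact ENNReal.ofReal_le_ofReal (two_point_pointwise _ _ _ _)
  have hsum : ∫⁻ x, ENNReal.ofReal (y (φ x) ^ 2) ∂μ + ∫⁻ x, ENNReal.ofReal (y x ^ 2) ∂μ ≤ 1 := by
    refine (add_le_add h2 h1).trans (le_of_eq ?_)
    rw [← ENNReal.ofReal_add (by norm_num) (by norm_num)]; norm_num
  have h3 := key.trans (add_le_add_right (mul_le_mul_right hsum _) _)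
  rw [mul_add, mul_one] at h3
  exact (ENNReal.add_le_add_iff_right ENNReal.ofReal_ne_top).mp h3

/-- Second moment of a sum of independent variables that need not be centered. -/
lemma lintegral_sum_sq_le [IsProbabilityMeasure μ] {g G : E → ℝ} {m M : ℝ} (hg : Measurable g)
    (h1 : HasInt μ g m) (h2 : HasInt μ G M) (h : ∀ x, g x ^ 2 ≤ G x) (n : ℕ) :
    ∫⁻ x, ENNReal.ofReal ((∑ i, g (x i)) ^ 2) ∂(Measure.pi fun _ : Fin n => μ)
      ≤ ENNReal.ofReal (2 * (n * M + n ^ 2 * m ^ 2)) := by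
  have hi : Integrable (fun x => g x ^ 2) μ :=
    Integrable.mono' h2.1 (by fun_prop) (ae_of_all _ fun x => by
      rw [Real.norm_of_nonneg (sq_nonneg _)]; exact h x)
  have hic : Integrable (fun x => (g x - m) ^ 2) μ := by
    have : (fun x => (g x - m) ^ 2) = fun x => g x ^ 2 - 2 * m * g x + m ^ 2 := by
      funext x; ring
    rw [this]
    exact (hi.sub (h1.1.const_mul _)).add (integrable_const _)
  have hv : ∫ x, (g x - m) ^ 2 ∂μ ≤ M := by
    have e : ∫ x, (g x - m) ^ 2 ∂μ = ∫ x, g x ^ 2 ∂μ - m ^ 2 := by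
      have : (fun x => (g x - m) ^ 2) = fun x => (g x ^ 2 - 2 * m * g x) + m ^ 2 := by
        funext x; ring
      rw [this, integral_add (f := fun x => g x ^ 2 - 2 * m * g x) (hi.sub (h1.1.const_mul _))
        (integrable_const _), integral_sub hi (h1.1.const_mul _), integral_const_mul, h1.2]
      simp; ring
    have h3 : ∫ x, g x ^ 2 ∂μ ≤ M := by
      rw [← h2.2]; exact integral_mono hi h2.1 h
    rw [e]; linarith [sq_nonneg m]
  have hM : 0 ≤ M := le_trans (integral_nonneg fun _ => sq_nonneg _) hv
  set ψ : E → Vec 1 := fun x => (g x - m) • unitVec 0 with hψ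
  have hψn : ∀ x, ‖ψ x‖ ^ 2 = (g x - m) ^ 2 := fun x => by
    rw [hψ, norm_smul, norm_unitVec, mul_one, Real.norm_eq_abs, sq_abs]
  have hs := lintegral_norm_sum_sq (μ := μ) (fun _ : Fin n => ψ) (fun _ => by fun_prop)
    (fun _ => by simpa only [hψn] using hic)
    (fun _ => by
      rw [hψ, integral_smul_const, integral_sub h1.1 (integrable_const _), h1.2]; simp)
  simp only [hψn, Finset.sum_const, Finset.card_univ, Fintype.card_fin, nsmul_eq_mul] at hs
  have hsum : ∀ x : Fin n → E, ‖∑ i, ψ (x i)‖ ^ 2 = (∑ i, (g (x i) - m)) ^ 2 := fun x => by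
    rw [hψ, ← Finset.sum_smul, norm_smul, norm_unitVec, mul_one, Real.norm_eq_abs, sq_abs]
  simp only [hsum] at hs
  calc ∫⁻ x, ENNReal.ofReal ((∑ i, g (x i)) ^ 2) ∂(Measure.pi fun _ : Fin n => μ)
      ≤ ∫⁻ x, ENNReal.ofReal 2 * ENNReal.ofReal ((∑ i, (g (x i) - m)) ^ 2)
          + ENNReal.ofReal (2 * (n * m) ^ 2) ∂(Measure.pi fun _ : Fin n => μ) := by
        refine lintegral_mono fun x => ?_
        rw [← ENNReal.ofReal_mul (by norm_num), ← ENNReal.ofReal_add (by positivity) (by positivity)]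
        apply ENNReal.ofReal_le_ofReal
        have : ∑ i, g (x i) = ∑ i, (g (x i) - m) + n * m := by
          rw [Finset.sum_sub_distrib]; simp
        rw [this]
        nlinarith [sq_nonneg (∑ i, (g (x i) - m) - n * m)]
    _ = ENNReal.ofReal (2 * (n * ∫ x, (g x - m) ^ 2 ∂μ)) + ENNReal.ofReal (2 * (n * m) ^ 2) := by
        rw [lintegral_add_right _ measurable_const, lintegral_const_mul _ (by fun_prop), hs,
          ← ENNReal.ofReal_mul (by norm_num)]
        simp
    _ ≤ _ := by
        rw [← ENNReal.ofReal_add (by positivity) (by positivity)]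
        apply ENNReal.ofReal_le_ofReal
        have : n * ∫ x, (g x - m) ^ 2 ∂μ ≤ n * M := by gcongr
        nlinarith

end tilt

section coord

variable {p n : ℕ}

/-- Every Gaussian design is the image of the standard one. -/
lemma lintegral_rowLaw_mul_transpose (B : Matrix (Fin p) (Fin p) ℝ) {f : (Fin n → Vec p) → ℝ≥0∞}
    (hf : Measurable f) : ∫⁻ X, f X ∂(rowLaw n (B * Bᵀ))
      = ∫⁻ Z, f (fun i => mulV B (Z i)) ∂(rowLaw n 1) := by
  have hB : Measurable fun (Z : Fin n → Vec p) i => mulV B (Z i) :=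
    measurable_pi_lambda _ fun i => (continuous_mulV B).measurable.comp (measurable_pi_apply i)
  have e1 : (1 : Matrix (Fin p) (Fin p) ℝ) = 1 * 1ᵀ := by simp
  rw [rowLaw_eq_map, lintegral_map hf (continuous_rowsOf _).measurable]
  conv_rhs => rw [e1, rowLaw_eq_map,
    lintegral_map (f := fun Z => f fun i => mulV B (Z i)) (hf.comp hB)
      (continuous_rowsOf _).measurable]
  simp only [rowsOf, one_mulV]
  rfl

/-- The mean squared error of an estimator of a single number. -/
noncomputable def coordErr (n : ℕ) (A : Matrix (Fin p) (Fin p) ℝ) (θ₀ : Vec p) (ν : Measure ℝ)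
    (U : Data p n → ℝ) (β : ℝ) : ℝ≥0∞ :=
  ∫⁻ e, ∫⁻ X, ENNReal.ofReal ((U (mkData θ₀ X e) - β) ^ 2) ∂(rowLaw n A)
    ∂(Measure.pi fun _ : Fin n => ν)

lemma measurable_sq_mkData_right {θ₀ : Vec p} {U : Data p n → ℝ} (hU : Measurable U) (β : ℝ)
    (e : Fin n → ℝ) :
    Measurable fun X : Fin n → Vec p => ENNReal.ofReal ((U (mkData θ₀ X e) - β) ^ 2) := by
  have h1 : Measurable fun X : Fin n → Vec p => mkData θ₀ X e :=
    (continuous_mkData θ₀).measurable.comp measurable_prodMk_right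
  exact (((hU.comp h1).sub_const _).pow_const 2).ennreal_ofReal

lemma measurable_sq_mkData {θ₀ : Vec p} {U : Data p n → ℝ} (hU : Measurable U) (β : ℝ) :
    Measurable fun z : (Fin n → ℝ) × (Fin n → Vec p) =>
      ENNReal.ofReal ((U (mkData θ₀ z.2 z.1) - β) ^ 2) := by
  have h1 : Measurable fun z : (Fin n → ℝ) × (Fin n → Vec p) => mkData θ₀ z.2 z.1 :=
    (continuous_mkData θ₀).measurable.comp measurable_swap
  exact (((hU.comp h1).sub_const _).pow_const 2).ennreal_ofReal

/-- The errors of the coordinates add up. -/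
lemma sum_coordErr_le_mse {A : Matrix (Fin p) (Fin p) ℝ} {θ₀ : Vec p} {ν : Measure ℝ}
    [IsProbabilityMeasure ν] {δ : ℝ} {T : Data p n → Vec p} (hT : Measurable T)
    (s : Finset (Fin p)) :
    ∑ j ∈ s, coordErr n A θ₀ ν (fun D => T D j) (thetaStar A θ₀ δ j) ≤ mse A θ₀ ν δ T := by
  have hm : ∀ j, Measurable fun z : (Fin n → ℝ) × (Fin n → Vec p) =>
      ENNReal.ofReal ((T (mkData θ₀ z.2 z.1) j - thetaStar A θ₀ δ j) ^ 2) := fun j =>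
    measurable_sq_mkData (U := fun D => T D j) (by fun_prop) _
  rw [mse_eq_swap hT]
  simp only [coordErr]
  rw [← lintegral_finsetSum _ fun j _ => (hm j).lintegral_prod_right']
  refine lintegral_mono fun e => ?_
  dsimp only
  rw [← lintegral_finsetSum _ fun j _ =>
    measurable_sq_mkData_right (U := fun D => T D j) (by fun_prop) _ e]
  refine lintegral_mono fun X => ?_
  rw [← ENNReal.ofReal_sum_of_nonneg fun _ _ => sq_nonneg _, EuclideanSpace.real_norm_sq_eq]
  apply ENNReal.ofReal_le_ofReal
  exact Finset.sum_le_sum_of_subset_of_nonneg (Finset.subset_univ s) fun _ _ _ => sq_nonneg _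

/-- Two-point lower bound in the linear model: two designs that arise from the standard Gaussian by
linear maps which differ by a change of variables with small log-likelihood ratio. -/
lemma le_coordErr_add_coordErr {B₁ B₂ : Matrix (Fin p) (Fin p) ℝ} {φ : Vec p → Vec p}
    {y : Vec p → ℝ} (hφ : Measurable φ) (hy : Measurable y)
    (h : TiltsTo (multivariateGaussian (0 : Vec p) 1) φ y)
    (hB : ∀ z, mulV B₁ z = mulV B₂ (φ z))
    (h1 : ∫⁻ Z, ENNReal.ofReal ((∑ i, y (Z i)) ^ 2) ∂(rowLaw n 1) ≤ ENNReal.ofReal (1 / 2))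
    (h2 : ∫⁻ Z, ENNReal.ofReal ((∑ i, y (φ (Z i))) ^ 2) ∂(rowLaw n 1) ≤ ENNReal.ofReal (1 / 2))
    (θ₀ : Vec p) {ν : Measure ℝ} [IsProbabilityMeasure ν] {U : Data p n → ℝ} (hU : Measurable U)
    (β₁ β₂ : ℝ) :
    ENNReal.ofReal (((β₁ - β₂) / 2) ^ 2)
      ≤ coordErr n (B₁ * B₁ᵀ) θ₀ ν U β₁ + coordErr n (B₂ * B₂ᵀ) θ₀ ν U β₂ := by
  have hm := fun β => measurable_sq_mkData (θ₀ := θ₀) hU β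
  rw [coordErr, coordErr, ← lintegral_add_left (hm β₁).lintegral_prod_right']
  have hc : ENNReal.ofReal (((β₁ - β₂) / 2) ^ 2)
      = ∫⁻ _ : Fin n → ℝ, ENNReal.ofReal (((β₁ - β₂) / 2) ^ 2) ∂(Measure.pi fun _ => ν) := by simp
  rw [hc]
  refine lintegral_mono fun e => ?_
  have hB2 : Measurable fun (Z : Fin n → Vec p) i => mulV B₂ (Z i) :=
    measurable_pi_lambda _ fun i => (continuous_mulV B₂).measurable.comp (measurable_pi_apply i)
  have hUe : Measurable fun X : Fin n → Vec p => U (mkData θ₀ X e) :=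
    hU.comp ((continuous_mkData θ₀).measurable.comp measurable_prodMk_right)
  dsimp only
  rw [lintegral_rowLaw_mul_transpose B₁ (measurable_sq_mkData_right hU β₁ e),
    lintegral_rowLaw_mul_transpose B₂ (measurable_sq_mkData_right hU β₂ e)]
  simp only [hB]
  exact (h.pi hφ hy n).two_point (by fun_prop) h1 h2
    (U := fun Z => U (mkData θ₀ (fun i => mulV B₂ (Z i)) e)) (hUe.comp hB2) β₁ β₂

end coord

end AdvLinReg

namespace AdvLinReg

/-! ### Shears and dilations of Gaussian vectors -/

section real

lemma lintegral_gaussianReal {m : ℝ} {v : NNReal} (hv : v ≠ 0) {f : ℝ → ℝ≥0∞} (hf : Measurable f) :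
    ∫⁻ x, f x ∂(gaussianReal m v) = ∫⁻ x, ENNReal.ofReal (gaussianPDFReal m v x) * f x := by
  rw [gaussianReal_of_var_ne_zero _ hv, lintegral_withDensity_eq_lintegral_mul _
    (measurable_gaussianPDF m v) hf]
  rfl

/-- A change of mean of the standard Gaussian. -/
lemma lintegral_gaussian_add {f : ℝ → ℝ≥0∞} (hf : Measurable f) (a : ℝ) :
    ∫⁻ x, f (x + a) ∂(gaussianReal 0 1)
      = ∫⁻ x, f x * ENNReal.ofReal (Real.exp (a * x - a ^ 2 / 2)) ∂(gaussianReal 0 1) := by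
  rw [← lintegral_map (μ := gaussianReal 0 1) (g := fun x => x + a) hf (by fun_prop),
    gaussianReal_map_add_const, lintegral_gaussianReal one_ne_zero hf,
    lintegral_gaussianReal one_ne_zero (by fun_prop)]
  refine lintegral_congr fun x => ?_
  rw [mul_comm (f x), ← mul_assoc, ← ENNReal.ofReal_mul (gaussianPDFReal_nonneg _ _ _)]
  congr 2
  simp only [gaussianPDFReal, NNReal.coe_one]
  rw [mul_assoc (√_)⁻¹, ← Real.exp_add]
  congr 2; ring

/-- A change of variance of the standard Gaussian. -/
lemma lintegral_gaussian_mul {f : ℝ → ℝ≥0∞} (hf : Measurable f) {r : ℝ} (hr : 0 < r) :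
    ∫⁻ x, f (r * x) ∂(gaussianReal 0 1)
      = ∫⁻ x, f x * ENNReal.ofReal (Real.exp (2 * (-(1 / 2) * Real.log r
          + 1 / 4 * (1 - r⁻¹ ^ 2) * x ^ 2))) ∂(gaussianReal 0 1) := by
  have hv : NNReal.mk (r ^ 2) (sq_nonneg r) * 1 ≠ 0 := by
    rw [mul_one]; intro h
    have h' : r ^ 2 = 0 := congrArg NNReal.toReal h
    exact hr.ne' (by simpa using h')
  rw [← lintegral_map (μ := gaussianReal 0 1) (g := fun x => r * x) hf (by fun_prop),
    gaussianReal_map_const_mul, lintegral_gaussianReal hv hf,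
    lintegral_gaussianReal one_ne_zero (by fun_prop)]
  refine lintegral_congr fun x => ?_
  rw [mul_comm (f x), ← mul_assoc, ← ENNReal.ofReal_mul (gaussianPDFReal_nonneg _ _ _)]
  congr 2
  simp only [gaussianPDFReal, NNReal.coe_one, NNReal.coe_mk, mul_one, mul_zero,
    sub_zero]
  have e : Real.exp (2 * (-(1 / 2) * Real.log r + 1 / 4 * (1 - r⁻¹ ^ 2) * x ^ 2))
      = r⁻¹ * Real.exp (1 / 2 * (1 - r⁻¹ ^ 2) * x ^ 2) := by
    rw [show 2 * (-(1 / 2) * Real.log r + 1 / 4 * (1 - r⁻¹ ^ 2) * x ^ 2)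
      = -Real.log r + 1 / 2 * (1 - r⁻¹ ^ 2) * x ^ 2 by ring, Real.exp_add, Real.exp_neg,
      Real.exp_log hr]
  rw [e, Real.sqrt_mul (by positivity), Real.sqrt_sq hr.le, mul_inv]
  have e2 : -x ^ 2 / (2 * r ^ 2) = -x ^ 2 / 2 + 1 / 2 * (1 - r⁻¹ ^ 2) * x ^ 2 := by
    field_simp; ring
  rw [e2, Real.exp_add]; ring

end real

section row

variable {n : ℕ}

lemma lintegral_multivariateGaussian_one {k : ℕ} {f : Vec (k + 1) → ℝ≥0∞} (hf : Measurable f) :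
    ∫⁻ x, f x ∂(multivariateGaussian (0 : Vec (k + 1)) 1)
      = ∫⁻ w, ∫⁻ x, f (WithLp.toLp 2 (Fin.cons x w : Fin (k + 1) → ℝ)) ∂(gaussianReal 0 1)
        ∂(Measure.pi fun _ : Fin k => gaussianReal 0 1) := by
  have h := multivariateGaussian_eq_map (1 : Matrix (Fin (k + 1)) (Fin (k + 1)) ℝ)
  simp only [Matrix.transpose_one, mul_one, one_mulV] at h
  rw [h, lintegral_map hf (by fun_prop),
    lintegral_pi_succ (f := fun z => f (WithLp.toLp 2 z)) (by fun_prop)]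

/-- The shear `z₀ ↦ z₀ + 2 s zⱼ`. -/
noncomputable def shear {k : ℕ} (s : ℝ) (j : Fin k) (z : Vec (k + 1)) : Vec (k + 1) :=
  z + (2 * s * z j.succ) • unitVec 0

lemma shear_zero {k : ℕ} (s : ℝ) (j : Fin k) (z : Vec (k + 1)) :
    shear s j z 0 = z 0 + 2 * s * z j.succ := by
  simp [shear, unitVec]

lemma shear_succ {k : ℕ} (s : ℝ) (j i : Fin k) (z : Vec (k + 1)) :
    shear s j z i.succ = z i.succ := by
  simp [shear, unitVec]

/-- Half the log-likelihood ratio of the shear of a standard Gaussian vector. -/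
noncomputable def shearLog {k : ℕ} (s : ℝ) (j : Fin k) (z : Vec (k + 1)) : ℝ :=
  s * (z 0 * z j.succ) - s ^ 2 * z j.succ ^ 2

lemma tiltsTo_shear {k : ℕ} (s : ℝ) (j : Fin k) :
    TiltsTo (multivariateGaussian (0 : Vec (k + 1)) 1) (shear s j) (shearLog s j) := by
  intro f hf
  have hm1 : Measurable fun z => f (shear s j z) := by unfold shear; fun_prop
  have hm2 : Measurable fun z => f z * ENNReal.ofReal (Real.exp (2 * shearLog s j z)) := by
    unfold shearLog; fun_prop
  rw [lintegral_multivariateGaussian_one hm1, lintegral_multivariateGaussian_one hm2]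
  refine lintegral_congr fun w => ?_
  have hc : Measurable fun x : ℝ => f (WithLp.toLp 2 (Fin.cons x w : Fin (k + 1) → ℝ)) := by
    refine hf.comp ((WithLp.measurable_toLp 2 _).comp (measurable_pi_iff.mpr fun i => ?_))
    refine Fin.cases ?_ (fun i => ?_) i
    · simpa using measurable_id'
    · simp
  have e : ∀ x : ℝ, shear s j (WithLp.toLp 2 (Fin.cons x w : Fin (k + 1) → ℝ))
      = WithLp.toLp 2 (Fin.cons (x + 2 * s * w j) w : Fin (k + 1) → ℝ) := fun x => by
    ext i
    refine Fin.cases ?_ (fun i => ?_) i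
    · simp [shear_zero]
    · simp [shear_succ]
  simp_rw [e]
  rw [lintegral_gaussian_add hc]
  refine lintegral_congr fun x => ?_
  congr 3
  simp only [shearLog, Fin.cons_zero, Fin.cons_succ]
  ring

lemma hasInt_prod_coord {k : ℕ} (j : Fin k) :
    HasInt (multivariateGaussian (0 : Vec (k + 1)) 1) (fun z => z 0 * z j.succ) 0 := by
  refine (hasInt_inner_mul_inner PosSemidef.one (unitVec 0) (unitVec j.succ)).congr
    (fun x => by simp only [inner_unitVec]) ?_
  rw [one_mulV, inner_unitVec]
  simp [unitVec]

lemma hasInt_coord_sq {p : ℕ} (j : Fin p) :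
    HasInt (multivariateGaussian (0 : Vec p) 1) (fun z => z j ^ 2) 1 := by
  refine (hasInt_inner_sq PosSemidef.one (unitVec j)).congr
    (fun x => by simp only [inner_unitVec]) ?_
  rw [one_mulV, real_inner_self_eq_norm_sq, norm_unitVec, one_pow]

lemma hasInt_coord_four {p : ℕ} (j : Fin p) :
    HasInt (multivariateGaussian (0 : Vec p) 1) (fun z => z j ^ 4) 3 := by
  refine (hasInt_inner_four PosSemidef.one (unitVec j)).congr
    (fun x => by simp only [inner_unitVec]) ?_
  rw [one_mulV, real_inner_self_eq_norm_sq, norm_unitVec]; norm_num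

lemma hasInt_coord_sq_mul_sq {k : ℕ} (j : Fin k) :
    HasInt (multivariateGaussian (0 : Vec (k + 1)) 1) (fun z => z 0 ^ 2 * z j.succ ^ 2) 1 := by
  refine (hasInt_inner_sq_mul_inner_sq PosSemidef.one (unitVec 0) (unitVec j.succ)).congr
    (fun x => by simp only [inner_unitVec]) ?_
  rw [one_mulV, one_mulV, real_inner_self_eq_norm_sq, real_inner_self_eq_norm_sq, norm_unitVec,
    norm_unitVec, inner_unitVec]
  simp [unitVec]

lemma lintegral_sum_shearLog_le {k : ℕ} {s t : ℝ} (j : Fin k) (hn : 0 < n) (hs : 40 * n * s ^ 2 ≤ 1)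
    (ht : |t| ≤ 1) :
    ∫⁻ Z, ENNReal.ofReal ((∑ i : Fin n, (s * (Z i 0 * Z i j.succ) + t * s ^ 2 * Z i j.succ ^ 2)) ^ 2)
      ∂(rowLaw n 1) ≤ ENNReal.ofReal (1 / 2) := by
  have h1 := ((hasInt_prod_coord j).const_mul s).add
    ((hasInt_coord_sq (p := k + 1) j.succ).const_mul (t * s ^ 2))
  have h2 := ((hasInt_coord_sq_mul_sq j).const_mul (2 * s ^ 2)).add
    ((hasInt_coord_four (p := k + 1) j.succ).const_mul (2 * s ^ 4))
  have ht2 : t ^ 2 ≤ 1 := by rw [← sq_abs]; exact pow_le_one₀ (abs_nonneg t) ht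
  refine (lintegral_sum_sq_le (by fun_prop) h1 h2 (fun z => ?_) n).trans
    (ENNReal.ofReal_le_ofReal ?_)
  · set a := s * (z 0 * z j.succ)
    set b := s ^ 2 * z j.succ ^ 2
    have e1 : s * (z 0 * z j.succ) + t * s ^ 2 * z j.succ ^ 2 = a + t * b := by ring
    have e2 : 2 * s ^ 2 * (z 0 ^ 2 * z j.succ ^ 2) + 2 * s ^ 4 * z j.succ ^ 4
        = 2 * a ^ 2 + 2 * b ^ 2 := by ring
    have : t ^ 2 * b ^ 2 ≤ 1 * b ^ 2 := by gcongr
    have e3 : (a + t * b) ^ 2 ≤ 2 * a ^ 2 + 2 * b ^ 2 := by nlinarith [sq_nonneg (a - t * b)]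
    calc (a + t * s ^ 2 * z j.succ ^ 2) ^ 2 = (a + t * b) ^ 2 := by rw [← e1]
      _ ≤ 2 * a ^ 2 + 2 * b ^ 2 := e3
      _ = _ := e2.symm
  · have hn1 : (1 : ℝ) ≤ n := by exact_mod_cast hn
    set q := (n : ℝ) * s ^ 2 with hq
    have hq0 : 0 ≤ q := by positivity
    have hs1 : s ^ 2 ≤ q := le_mul_of_one_le_left (sq_nonneg s) hn1
    have e : 2 * (n * (2 * s ^ 2 * 1 + 2 * s ^ 4 * 3) + n ^ 2 * (s * 0 + t * s ^ 2 * 1) ^ 2)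
        = 4 * q + 12 * (q * s ^ 2) + 2 * (t ^ 2 * q ^ 2) := by rw [hq]; ring
    rw [e]
    have hq1 : q ≤ 1 / 40 := by linarith
    have k1 : q * s ^ 2 ≤ 1 / 40 * (1 / 40) := by gcongr; linarith
    have k2 : t ^ 2 * q ^ 2 ≤ 1 * (1 / 40) ^ 2 := by gcongr
    linarith

/-- Two designs that differ by a shear cannot be told apart by a sample of size `n` if the shear is
of order `n^(-1/2)`. -/
lemma le_coordErr_add_coordErr_of_shear {k : ℕ} {B₁ B₂ : Matrix (Fin (k + 1)) (Fin (k + 1)) ℝ}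
    {s : ℝ} {j : Fin k} (hn : 0 < n) (hs : 40 * n * s ^ 2 ≤ 1)
    (hB : ∀ z, mulV B₁ z = mulV B₂ (shear s j z)) (θ₀ : Vec (k + 1)) {ν : Measure ℝ}
    [IsProbabilityMeasure ν] {U : Data (k + 1) n → ℝ} (hU : Measurable U) (β₁ β₂ : ℝ) :
    ENNReal.ofReal (((β₁ - β₂) / 2) ^ 2)
      ≤ coordErr n (B₁ * B₁ᵀ) θ₀ ν U β₁ + coordErr n (B₂ * B₂ᵀ) θ₀ ν U β₂ := by
  refine le_coordErr_add_coordErr (by unfold shear; fun_prop) (by unfold shearLog; fun_prop)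
    (tiltsTo_shear s j) hB ?_ ?_ θ₀ hU β₁ β₂
  · refine le_trans (le_of_eq ?_) (lintegral_sum_shearLog_le j hn hs (t := -1) (by simp))
    refine lintegral_congr fun Z => ?_
    congr 2
    exact Finset.sum_congr rfl fun i _ => by rw [shearLog]; ring
  · refine le_trans (le_of_eq ?_) (lintegral_sum_shearLog_le j hn hs (t := 1) (by simp))
    refine lintegral_congr fun Z => ?_
    congr 2
    exact Finset.sum_congr rfl fun i _ => by rw [shearLog, shear_zero, shear_succ]; ring

lemma tiltsTo_dilation {r : ℝ} (hr : 0 < r) :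
    TiltsTo (multivariateGaussian (0 : Vec 1) 1) (fun z => r • z)
      (fun z => -(1 / 2) * Real.log r + 1 / 4 * (1 - r⁻¹ ^ 2) * z 0 ^ 2) := by
  intro f hf
  rw [lintegral_multivariateGaussian_one (f := fun z => f (r • z)) (by fun_prop),
    lintegral_multivariateGaussian_one (by fun_prop)]
  refine lintegral_congr fun w => ?_
  have hc : Measurable fun x : ℝ => f (WithLp.toLp 2 (Fin.cons x w : Fin 1 → ℝ)) := by
    refine hf.comp ((WithLp.measurable_toLp 2 _).comp (measurable_pi_iff.mpr fun i => ?_))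
    fin_cases i
    simpa using measurable_id'
  have e : ∀ x : ℝ, r • (WithLp.toLp 2 (Fin.cons x w : Fin 1 → ℝ))
      = WithLp.toLp 2 (Fin.cons (r * x) w : Fin 1 → ℝ) := fun x => by
    ext i; fin_cases i; simp
  simp_rw [e]
  rw [lintegral_gaussian_mul hc hr]
  simp

lemma lintegral_sum_dilation_le {h α β : ℝ} (hn : 0 < n) (hh : 20 * n * h ^ 2 ≤ 1)
    (hα : |α| ≤ h / 2) (hβ : |β| ≤ 3 / 4 * h) (hm : |α + β| ≤ h ^ 2) :
    ∫⁻ Z, ENNReal.ofReal ((∑ i : Fin n, (α + β * Z i 0 ^ 2)) ^ 2)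
      ∂(rowLaw n (1 : Matrix (Fin 1) (Fin 1) ℝ)) ≤ ENNReal.ofReal (1 / 2) := by
  have h1 := (hasInt_const (multivariateGaussian (0 : Vec 1) 1) α).add
    ((hasInt_coord_sq (p := 1) 0).const_mul β)
  have h2 := (hasInt_const (multivariateGaussian (0 : Vec 1) 1) (2 * α ^ 2)).add
    ((hasInt_coord_four (p := 1) 0).const_mul (2 * β ^ 2))
  refine (lintegral_sum_sq_le (by fun_prop) h1 h2 (fun z => ?_) n).trans
    (ENNReal.ofReal_le_ofReal ?_)
  · nlinarith [sq_nonneg (α - β * z 0 ^ 2)]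
  · set q := (n : ℝ) * h ^ 2 with hq
    have hq0 : 0 ≤ q := by positivity
    have hq1 : q ≤ 1 / 20 := by linarith
    have a1 : α ^ 2 ≤ (h / 2) ^ 2 := by rw [← sq_abs]; gcongr
    have a2 : β ^ 2 ≤ (3 / 4 * h) ^ 2 := by rw [← sq_abs]; gcongr
    have a3 : (α + β) ^ 2 ≤ (h ^ 2) ^ 2 := by rw [← sq_abs]; gcongr
    calc 2 * (n * (2 * α ^ 2 + 2 * β ^ 2 * 3) + n ^ 2 * (α + β * 1) ^ 2)
        ≤ 2 * (n * (2 * (h / 2) ^ 2 + 2 * (3 / 4 * h) ^ 2 * 3) + n ^ 2 * (h ^ 2) ^ 2) := by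
          rw [mul_one]; gcongr
      _ = 2 * (31 / 8 * q + q ^ 2) := by rw [hq]; ring
      _ ≤ 2 * (31 / 8 * (1 / 20) + (1 / 20) ^ 2) := by gcongr
      _ ≤ 1 / 2 := by norm_num

/-- Two variances at a distance of order `n^(-1/2)` cannot be told apart by a sample of size `n`. -/
lemma le_coordErr_add_coordErr_of_dilation {B₁ B₂ : Matrix (Fin 1) (Fin 1) ℝ}
    {h : ℝ} (hn : 0 < n) (hh0 : 0 ≤ h) (hh : 20 * n * h ^ 2 ≤ 1)
    (hB : ∀ z, mulV B₁ z = mulV B₂ ((1 + h) • z)) (θ₀ : Vec 1) {ν : Measure ℝ}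
    [IsProbabilityMeasure ν] {U : Data 1 n → ℝ} (hU : Measurable U) (β₁ β₂ : ℝ) :
    ENNReal.ofReal (((β₁ - β₂) / 2) ^ 2)
      ≤ coordErr n (B₁ * B₁ᵀ) θ₀ ν U β₁ + coordErr n (B₂ * B₂ᵀ) θ₀ ν U β₂ := by
  have hr : 0 < 1 + h := by linarith
  have hh1 : h ≤ 1 := by
    have : (1 : ℝ) ≤ n := by exact_mod_cast hn
    nlinarith [sq_nonneg h]
  set r := 1 + h with hrdef
  have hlog1 : Real.log r ≤ h := by linarith [Real.log_le_sub_one_of_pos hr]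
  have hlog2 : 1 - r⁻¹ ≤ Real.log r := Real.one_sub_inv_le_log_of_pos hr
  have hi : r⁻¹ * r = 1 := inv_mul_cancel₀ hr.ne'
  have hi0 : 0 < r⁻¹ := inv_pos.mpr hr
  have hi1 : r⁻¹ ≤ 1 := inv_le_one_of_one_le₀ (by linarith)
  have hir : 1 - r⁻¹ = h * r⁻¹ := by rw [hrdef] at hi ⊢; linarith
  have hi2 : 1 - r⁻¹ ≤ h := by rw [hir]; exact mul_le_of_le_one_right hh0 hi1
  have hlog0 : 0 ≤ Real.log r := by linarith
  have hα : |-(1 / 2) * Real.log r| ≤ h / 2 := by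
    rw [abs_le]; constructor <;> linarith
  refine le_coordErr_add_coordErr (by fun_prop) (by fun_prop)
    (tiltsTo_dilation hr) hB ?_ ?_ θ₀ hU β₁ β₂
  · refine lintegral_sum_dilation_le hn hh hα ?_ ?_
    · rw [abs_of_nonneg (by nlinarith)]; nlinarith
    · have e : 1 - r⁻¹ ^ 2 = 2 * (1 - r⁻¹) - (1 - r⁻¹) ^ 2 := by ring
      have k1 : h - (1 - r⁻¹) = h * (1 - r⁻¹) := by linarith
      have k2 : h * (1 - r⁻¹) ≤ h * h := by gcongr
      have k3 : (1 - r⁻¹) ^ 2 ≤ h ^ 2 := pow_le_pow_left₀ (by linarith) hi2 2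
      rw [abs_le]; constructor <;> nlinarith [sq_nonneg (1 - r⁻¹)]
  · have e : ∀ Z : Fin n → Vec 1, ∑ i, (-(1 / 2) * Real.log r
        + 1 / 4 * (1 - r⁻¹ ^ 2) * (r • Z i) 0 ^ 2)
        = ∑ i, (-(1 / 2) * Real.log r + 1 / 4 * (r ^ 2 - 1) * Z i 0 ^ 2) := fun Z => by
      refine Finset.sum_congr rfl fun i _ => ?_
      have : (1 - r⁻¹ ^ 2) * r ^ 2 = r ^ 2 - 1 := by field_simp
      simp only [PiLp.smul_apply, smul_eq_mul, mul_pow]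
      rw [← this]; ring
    simp_rw [e]
    refine lintegral_sum_dilation_le hn hh hα ?_ ?_
    · rw [abs_of_nonneg (by nlinarith)]; nlinarith
    · have k1 : h - (1 - r⁻¹) = h * (1 - r⁻¹) := by linarith
      have k2 : h * (1 - r⁻¹) ≤ h * h := by gcongr
      rw [abs_le, hrdef]; constructor <;> nlinarith

end row

end AdvLinReg

namespace AdvLinReg

/-! ### Least favorable correlations and the minimax bound in dimension at least two -/

section corr

variable {k : ℕ}

/-- The matrix `r (I + e₀ wᵀ)`: it adds the linear functional `w` to the coordinate zero. -/
noncomputable def corrFactor (r : ℝ) (w : Vec (k + 1)) : Matrix (Fin (k + 1)) (Fin (k + 1)) ℝ :=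
  r • (1 + Matrix.vecMulVec (WithLp.ofLp (unitVec 0 : Vec (k + 1))) (WithLp.ofLp w))

lemma mulV_corrFactor (r : ℝ) (w z : Vec (k + 1)) :
    mulV (corrFactor r w) z = r • (z + inner ℝ w z • unitVec 0) := by
  have h : mulV (Matrix.vecMulVec (WithLp.ofLp (unitVec 0 : Vec (k + 1))) (WithLp.ofLp w)) z
      = inner ℝ w z • unitVec 0 := by
    rw [mulV, Matrix.vecMulVec_mulVec, inner_eq_dotProduct]
    ext i; simp [mul_comm]
  rw [corrFactor, smul_mulV, add_mulV, one_mulV, h]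

lemma mulV_corrFactor_transpose (r : ℝ) (w v : Vec (k + 1)) :
    mulV (corrFactor r w)ᵀ v = r • (v + v 0 • w) := by
  have h : mulV (Matrix.vecMulVec (WithLp.ofLp w) (WithLp.ofLp (unitVec 0 : Vec (k + 1)))) v
      = v 0 • w := by
    rw [mulV, Matrix.vecMulVec_mulVec, ← inner_eq_dotProduct, real_inner_comm, inner_unitVec]
    ext i; simp [mul_comm]
  rw [corrFactor, Matrix.transpose_smul, Matrix.transpose_add, Matrix.transpose_one,
    Matrix.transpose_vecMulVec, smul_mulV, add_mulV, one_mulV, h]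

/-- The covariance matrix of `r (z + ⟨w, z⟩ e₀)` for a standard Gaussian `z`. -/
noncomputable def corrCov (r : ℝ) (w : Vec (k + 1)) : Matrix (Fin (k + 1)) (Fin (k + 1)) ℝ :=
  corrFactor r w * (corrFactor r w)ᵀ

lemma mulV_corrCov (r : ℝ) (w v : Vec (k + 1)) :
    mulV (corrCov r w) v
      = r ^ 2 • (v + v 0 • w + (inner ℝ w v + v 0 * ‖w‖ ^ 2) • unitVec 0) := by
  rw [corrCov, ← mulV_mulV, mulV_corrFactor_transpose, mulV_corrFactor, inner_smul_right,
    inner_add_right, inner_smul_right, real_inner_self_eq_norm_sq, mul_smul, ← smul_add, smul_smul,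
    ← sq]

lemma inner_mulV_corrCov (r : ℝ) (w v : Vec (k + 1)) :
    inner ℝ v (mulV (corrCov r w) v) = r ^ 2 * ‖v + v 0 • w‖ ^ 2 := by
  rw [corrCov, ← mulV_mulV, ← (corrFactor r w).transpose_transpose, ← inner_mulV_left,
    Matrix.transpose_transpose, mulV_corrFactor_transpose, real_inner_self_eq_norm_sq, norm_smul,
    mul_pow, Real.norm_eq_abs, sq_abs]

lemma norm_apply_le {p : ℕ} (v : Vec p) (j : Fin p) : |v j| ≤ ‖v‖ := by
  have := abs_real_inner_le_norm v (unitVec j)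
  rwa [inner_unitVec, norm_unitVec, mul_one] at this

lemma covClass_corrCov {r u : ℝ} {w : Vec (k + 1)} (hw : ‖w‖ ≤ u) (hu : u ≤ 1) :
    CovClass (r ^ 2 * (1 - u) ^ 2) (r ^ 2 * (1 + u) ^ 2) (corrCov r w) := by
  have hvw : ∀ v : Vec (k + 1), ‖v 0 • w‖ ≤ u * ‖v‖ := fun v => by
    rw [norm_smul, Real.norm_eq_abs, mul_comm]
    exact mul_le_mul hw (norm_apply_le v 0) (abs_nonneg _) ((norm_nonneg _).trans hw)
  refine covClass_of_inner (by rw [corrCov, Matrix.transpose_mul, Matrix.transpose_transpose])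
    (fun v => ?_) fun v => ?_
  · rw [inner_mulV_corrCov, mul_assoc, ← mul_pow]
    have h1 : (1 - u) * ‖v‖ ≤ ‖v + v 0 • w‖ := by
      have := norm_sub_le_norm_add v (v 0 • w)
      linarith [hvw v]
    have h2 : 0 ≤ (1 - u) * ‖v‖ := mul_nonneg (by linarith) (norm_nonneg _)
    exact mul_le_mul_of_nonneg_left (pow_le_pow_left₀ h2 h1 2) (sq_nonneg r)
  · rw [inner_mulV_corrCov, mul_assoc, ← mul_pow (1 + u)]
    have h1 : ‖v + v 0 • w‖ ≤ (1 + u) * ‖v‖ := by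
      linarith [norm_add_le v (v 0 • w), hvw v]
    exact mul_le_mul_of_nonneg_left (pow_le_pow_left₀ (norm_nonneg _) h1 2) (sq_nonneg r)

/-- The target in a coordinate other than zero has the sign of the correlation. -/
lemma thetaStar_corrCov {L r l M δ R : ℝ} (hL : 1 ≤ L) (hr : 0 < r) (hR : 0 ≤ R)
    {w : Vec (k + 1)} (hw0 : w 0 = 0) (hw : ‖w‖ ≤ 1) (hA : CovClass L⁻¹ L (corrCov r w))
    (hδ : 0 ≤ δ) {lo : ℝ} (hlo : 0 < lo) (hl : lo ≤ l) (hM : l ≤ M)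
    (h : lambdaStar (corrCov r w) (R • unitVec 0) δ = ENNReal.ofReal l) :
    ∃ β, lo * r ^ 2 * R / ((r ^ 2 + M) * (2 * r ^ 2 + M)) ≤ β ∧
      ∀ j, j ≠ 0 → thetaStar (corrCov r w) (R • unitVec 0) δ j = w j * β := by
  have hAp := hA.posDef (inv_pos.mpr (by linarith))
  have hl0 : 0 < l := hlo.trans_le hl
  have hr2 : 0 < r ^ 2 := by positivity
  set t : Vec (k + 1) := R • unitVec 0 with ht
  set x := res (corrCov r w) l t with hx
  have hres := mulV_res_add hAp hl0.le t
  rw [← hx, mulV_corrCov] at hres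
  have h0 := congrArg (fun v : Vec (k + 1) => v 0) hres
  have hin := congrArg (fun v : Vec (k + 1) => inner ℝ w v) hres
  have hwe : inner ℝ w (unitVec 0 : Vec (k + 1)) = 0 := by rw [inner_unitVec, hw0]
  simp only [ht, inner_add_right, inner_smul_right, hwe, real_inner_self_eq_norm_sq, mul_zero,
    add_zero] at hin
  simp only [ht, PiLp.add_apply, PiLp.smul_apply, smul_eq_mul, hw0, mul_zero, add_zero,
    unitVec, PiLp.single_apply, if_true, mul_one] at h0
  have hal : 0 < r ^ 2 + l := by positivity
  have hx0 : x 0 * ((r ^ 2 + l) + r ^ 2 * ‖w‖ ^ 2 * (l / (r ^ 2 + l))) = R := by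
    have e : inner ℝ w x = -(r ^ 2 * ‖w‖ ^ 2 * x 0 / (r ^ 2 + l)) := by
      rw [eq_neg_iff_add_eq_zero, ← mul_left_cancel_iff_of_pos hal]
      field_simp
      linarith
    rw [e] at h0
    rw [← h0]
    field_simp
    ring
  set den := (r ^ 2 + l) + r ^ 2 * ‖w‖ ^ 2 * (l / (r ^ 2 + l)) with hden
  have hden0 : 0 < den := by positivity
  have hden1 : den ≤ 2 * r ^ 2 + M := by
    have k1 : l / (r ^ 2 + l) ≤ 1 := by rw [div_le_one hal]; linarith
    have k2 : ‖w‖ ^ 2 ≤ 1 := pow_le_one₀ (norm_nonneg _) hw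
    have : r ^ 2 * ‖w‖ ^ 2 * (l / (r ^ 2 + l)) ≤ r ^ 2 * 1 * 1 := by gcongr
    linarith
  have hx0' : x 0 = R / den := by rw [eq_div_iff hden0.ne', hx0]
  refine ⟨l * r ^ 2 * (R / den) / (r ^ 2 + l), ?_, fun j hj => ?_⟩
  · have hM0 : 0 ≤ M := hl0.le.trans hM
    rw [mul_div_assoc', div_div, mul_comm den]
    gcongr
  · rw [thetaStar_eq hL hA t hδ, pathEst, h, thetaPath_ofReal hAp hl0.le, ← hx]
    have hj' := congrArg (fun v : Vec (k + 1) => v j) hres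
    simp only [ht, PiLp.add_apply, PiLp.sub_apply, PiLp.smul_apply, smul_eq_mul, unitVec,
      PiLp.single_apply, if_neg hj, mul_zero, add_zero] at hj' ⊢
    rw [← hx0']
    have : x j = -(r ^ 2 * x 0 * w j / (r ^ 2 + l)) := by
      rw [eq_neg_iff_add_eq_zero, ← mul_left_cancel_iff_of_pos hal]
      field_simp
      linarith
    rw [this]; ring

lemma ratio_smul_left {p : ℕ} {c : ℝ} (hc : 0 < c) (A : Matrix (Fin p) (Fin p) ℝ) (b : Vec p) :
    ratio (c • A) b = √c * ratio A b := by
  have e : wnorm (c • A) b = √c * wnorm A b := by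
    rw [wnorm, smul_mulV, inner_smul_right, Real.sqrt_mul hc.le, wnorm]
  have hs : 0 < √c := Real.sqrt_pos.mpr hc
  rw [ratio, ratio, e, smul_mulV, norm_smul, Real.norm_of_nonneg hc.le]
  nth_rw 1 [← Real.mul_self_sqrt hc.le]
  rw [mul_assoc, mul_div_mul_left _ _ hs.ne', mul_div_assoc]

lemma c0_le : c0 ≤ 9 / 11 := by
  rw [c0]
  refine Real.sqrt_le_iff.mpr ⟨by norm_num, ?_⟩
  rw [div_le_iff₀ Real.pi_pos]
  linarith [Real.pi_gt_three]

/-- For a covariance matrix close to `r² I`, the attack level `r` lies between the thresholds. -/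
lemma between_of_near_isotropic {p : ℕ} {r : ℝ} (hr : 0 < r) {G : Matrix (Fin p) (Fin p) ℝ}
    (hG : CovClass (11 / 10)⁻¹ (11 / 10) G) {t : Vec p} (ht : t ≠ 0)
    (hA : (r ^ 2 • G).PosDef) :
    (1 + 1 / 10) * delta1 (r ^ 2 • G) t ≤ r ∧ r ≤ (1 - 1 / 10) * delta2 (r ^ 2 • G) t := by
  have hr2 : 0 < r ^ 2 := by positivity
  have hc := c0_pos
  have hc1 := c0_le
  rw [delta1_eq hA, delta2_eq (PosSemidef.transpose_eq hA.posSemidef), ratio_smul_left hr2, ratio_smul_left hr2,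
    Real.sqrt_sq hr.le]
  have h1 := ratio_le (by norm_num : (1 : ℝ) ≤ 11 / 10) hG (res (r ^ 2 • G) 0 t)
  have h2 := le_ratio (by norm_num : (1 : ℝ) ≤ 11 / 10) hG ht
  constructor
  · have k1 : c0 * (r * ratio G (res (r ^ 2 • G) 0 t)) ≤ c0 * (r * (11 / 10)) := by gcongr
    have k2 : c0 * (r * (11 / 10)) ≤ 9 / 11 * (r * (11 / 10)) := by gcongr
    linarith
  · rw [← mul_div_assoc, le_div_iff₀ hc]
    have k1 : r * c0 ≤ r * (9 / 11) := by gcongr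
    have k2 : r * (11 / 10)⁻¹ ≤ r * ratio G t := by gcongr
    linarith

end corr

section cube

/-- The sign pattern with the sign `j` flipped. -/
def flipAt {k : ℕ} (j : Fin k) (b : Fin k → Bool) : Fin k → Bool := Function.update b j (!b j)

lemma flipAt_flipAt {k : ℕ} (j : Fin k) (b : Fin k → Bool) : flipAt j (flipAt j b) = b := by
  simp [flipAt]

/-- Assouad's lemma: if no coordinate can be estimated well at two neighbors in the cube, then the
sum over the coordinates is large somewhere. -/
lemma card_mul_le_of_neighbors {k : ℕ} {c : Fin k → (Fin k → Bool) → ℝ≥0∞} {D W : ℝ≥0∞}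
    (h : ∀ j b, D ≤ c j b + c j (flipAt j b)) (hW : ∀ b, ∑ j, c j b ≤ W) : k * D ≤ 2 * W := by
  have h1 : ∀ j, ∑ _b : Fin k → Bool, D ≤ 2 * ∑ b, c j b := fun j => by
    have e : ∑ b, c j (flipAt j b) = ∑ b, c j b :=
      Equiv.sum_comp (Function.Involutive.toPerm (flipAt j) (flipAt_flipAt j)) (c j)
    calc ∑ _b : Fin k → Bool, D ≤ ∑ b, (c j b + c j (flipAt j b)) :=
          Finset.sum_le_sum fun b _ => h j b
      _ = _ := by rw [Finset.sum_add_distrib, e, two_mul]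
  have h2 : ∑ _j : Fin k, ∑ _b : Fin k → Bool, D ≤ 2 * ∑ _b : Fin k → Bool, W := by
    calc _ ≤ ∑ j, 2 * ∑ b, c j b := Finset.sum_le_sum fun j _ => h1 j
      _ = 2 * ∑ b, ∑ j, c j b := by rw [← Finset.mul_sum, Finset.sum_comm]
      _ ≤ _ := by gcongr with b; exact hW b
  simp only [Finset.sum_const, Finset.card_univ, nsmul_eq_mul, Fintype.card_fin] at h2
  set m : ℝ≥0∞ := ((Fintype.card (Fin k → Bool) : ℕ) : ℝ≥0∞) with hm
  have hm0 : m ≠ 0 := by rw [hm]; exact_mod_cast Fintype.card_ne_zero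
  have hm1 : m ≠ ⊤ := ENNReal.natCast_ne_top _
  refine (ENNReal.mul_le_mul_iff_right hm0 hm1).mp ?_
  calc m * (k * D) = k * (m * D) := by ring
    _ ≤ 2 * (m * W) := h2
    _ = _ := by ring

end cube

section minimax

variable {k : ℕ}

/-- The vector of correlations `±s` with the given signs, and `0` in the coordinate zero. -/
noncomputable def corrVec (s : ℝ) (b : Fin k → Bool) : Vec (k + 1) :=
  WithLp.toLp 2 (Fin.cons 0 fun i => if b i then s else -s)

lemma corrVec_zero (s : ℝ) (b : Fin k → Bool) : corrVec s b 0 = 0 := by simp [corrVec]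

lemma corrVec_succ (s : ℝ) (b : Fin k → Bool) (i : Fin k) :
    corrVec s b i.succ = if b i then s else -s := by simp [corrVec]

lemma norm_corrVec_sq (s : ℝ) (b : Fin k → Bool) : ‖corrVec s b‖ ^ 2 = k * s ^ 2 := by
  rw [EuclideanSpace.real_norm_sq_eq, Fin.sum_univ_succ, corrVec_zero]
  have : ∀ i : Fin k, corrVec s b i.succ ^ 2 = s ^ 2 := fun i => by
    rw [corrVec_succ]; split_ifs <;> ring
  simp [this]

lemma corrVec_eq_add {s : ℝ} {b : Fin k → Bool} {j : Fin k} (hb : b j = true) :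
    corrVec s b = corrVec s (flipAt j b) + (2 * s) • unitVec j.succ := by
  ext i
  refine Fin.cases ?_ (fun i => ?_) i
  · simp [corrVec, unitVec]
  · rcases eq_or_ne i j with rfl | h
    · simp [corrVec, unitVec, flipAt, hb]; ring
    · simp [corrVec, unitVec, flipAt, h]

lemma mulV_corrFactor_shear {r s : ℝ} {b : Fin k → Bool} {j : Fin k} (hb : b j = true)
    (z : Vec (k + 1)) : mulV (corrFactor r (corrVec s b)) z
      = mulV (corrFactor r (corrVec s (flipAt j b))) (shear s j z) := by
  have e : inner ℝ (unitVec j.succ) z = z j.succ := by rw [real_inner_comm, inner_unitVec]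
  rw [mulV_corrFactor, mulV_corrFactor, corrVec_eq_add hb, shear, inner_add_left, inner_add_right,
    real_inner_smul_left, e, inner_smul_right, inner_unitVec, corrVec_zero]
  simp only [mul_zero, add_zero, add_smul]
  rw [add_assoc, add_comm (_ • _)]

/-- Minimax lower bound in dimension at least two. The covariance matrices differ in the signs of
the correlations, of order `n^(-1/2)`, between the coordinate that carries the signal and the
others; the sign of each coordinate of the target is that of the correlation. -/
theorem le_worstMse {ℓ c₁ c₂ : ℝ} (hℓ : 1 ≤ ℓ) (hc₁ : ℓ⁻¹ ≤ c₁) (hc : c₁ < c₂) (hc₂ : c₂ ≤ ℓ) :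
    ∃ c η : ℝ, 0 < c ∧ 0 < η ∧ ∀ {k n : ℕ}, 1 ≤ k → 0 < n → ((k + 1 : ℕ) / n : ℝ) ≤ η →
      ∀ (R σ : ℝ) (ν : Measure ℝ), 0 < R → IsNoise ν σ →
      ∀ T : ℝ → Data (k + 1) n → Vec (k + 1), (∀ δ, Measurable (T δ)) →
        ENNReal.ofReal (c * R ^ 2 * ((k + 1 : ℕ) / n)) ≤ worstMse c₁ c₂ R ν T := by
  have hℓ0 : 0 < ℓ := by linarith
  have hc₁0 : 0 < c₁ := (inv_pos.mpr hℓ0).trans_le hc₁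
  have hc0 := c0_pos
  set a := (c₁ + c₂) / 2 with ha
  have ha0 : 0 < a := by linarith
  set r := √a with hr
  have hr0 : 0 < r := Real.sqrt_pos.mpr ha0
  have hra : r ^ 2 = a := Real.sq_sqrt ha0.le
  -- correlations of total size `u` keep the eigenvalues in `[c₁, c₂]` and the thresholds away from `r`
  set u := min (1 / 25) ((c₂ - c₁) / (6 * a)) with hu
  have hu0 : 0 < u := lt_min (by norm_num) (div_pos (by linarith) (by linarith))
  have hu1 : u ≤ 1 / 25 := min_le_left _ _
  have hu2 : u * (6 * a) ≤ c₂ - c₁ := by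
    rw [← le_div_iff₀ (by linarith)]; exact min_le_right _ _
  -- bounds for the level, uniform over the class
  set lo := c0 ^ 2 * (1 / 10) / (4 * ℓ ^ 7) with hlo
  set M := 8 * ℓ ^ 7 / (c0 ^ 2 * (1 / 10)) with hM
  have hlo0 : 0 < lo := by positivity
  have hM0 : 0 < M := by positivity
  set B := lo * a / ((a + M) * (2 * a + M)) with hB
  have hB0 : 0 < B := by positivity
  clear_value u lo M B
  refine ⟨B ^ 2 / 160, u ^ 2, by positivity, by positivity, ?_⟩
  intro k n hk hn hq R σ ν hR hν T hT
  have hprob := hν.1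
  have hn' : (0 : ℝ) < n := by exact_mod_cast hn
  -- the largest correlation for which the two-point bound applies
  set s := 1 / √(40 * n) with hs
  have hs0 : 0 < s := by positivity
  have hs2 : s ^ 2 = 1 / (40 * n) := by rw [hs, div_pow, Real.sq_sqrt (by positivity), one_pow]
  clear_value s
  set A : (Fin k → Bool) → Matrix (Fin (k + 1)) (Fin (k + 1)) ℝ :=
    fun b => corrCov r (corrVec s b) with hA
  have hw : ∀ b : Fin k → Bool, ‖corrVec s b‖ ≤ u := fun b => by
    refine abs_le_of_sq_le_sq' ?_ hu0.le |>.2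
    rw [norm_corrVec_sq, hs2]
    refine le_trans ?_ hq
    push_cast
    rw [mul_one_div]
    gcongr
    · linarith
    · linarith
  have hcls : ∀ b, CovClass c₁ c₂ (A b) := fun b => by
    have h := covClass_corrCov (r := r) (hw b) (by linarith)
    rw [hra] at h
    refine h.mono ?_ ?_ h.transpose_eq
    · nlinarith [sq_nonneg u]
    · have : u ^ 2 ≤ u := by nlinarith
      nlinarith
  have hclsℓ : ∀ b, CovClass ℓ⁻¹ ℓ (A b) := fun b => (hcls b).mono hc₁ hc₂ (hcls b).transpose_eq
  set t : Vec (k + 1) := R • unitVec 0 with ht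
  have htn : ‖t‖ = R := by rw [ht, norm_smul, norm_unitVec, mul_one, Real.norm_of_nonneg hR.le]
  have ht0 : t ≠ 0 := norm_pos_iff.mp (by rw [htn]; exact hR)
  have htarget : ∀ b, ∃ β, B * R ≤ β ∧
      ∀ j, j ≠ 0 → thetaStar (A b) t r j = corrVec s b j * β := fun b => by
    have hG : CovClass (11 / 10)⁻¹ (11 / 10) (corrCov 1 (corrVec s b)) := by
      have h := covClass_corrCov (r := 1) (hw b) (by linarith)
      refine h.mono ?_ ?_ h.transpose_eq
      · nlinarith
      · nlinarith
    have e : A b = r ^ 2 • corrCov 1 (corrVec s b) := by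
      simp only [hA, corrCov, corrFactor, one_smul, Matrix.transpose_smul, Matrix.smul_mul,
        Matrix.mul_smul, smul_smul, sq]
    have hAp := (hclsℓ b).posDef (inv_pos.mpr hℓ0)
    have hbt := between_of_near_isotropic hr0 hG ht0 (by rwa [← e])
    rw [← e] at hbt
    obtain ⟨l, hl1, hl2, hl⟩ := exists_level hℓ (hclsℓ b) ht0 (by norm_num) hbt.1 hbt.2
    rw [← hlo] at hl1
    rw [← hM] at hl2
    obtain ⟨β, h1, h2⟩ := thetaStar_corrCov hℓ hr0 hR.le (corrVec_zero s b)
      ((hw b).trans (by linarith)) (hclsℓ b) hr0.le hlo0 hl1 hl2 hl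
    refine ⟨β, le_trans (le_of_eq ?_) h1, h2⟩
    rw [hB, hra]; ring
  choose β hβ hβ' using htarget
  set W := worstMse c₁ c₂ R ν T with hW
  have hWge : ∀ b, mse (A b) t ν r (T r) ≤ W := fun b => by
    rw [hW, worstMse]
    exact le_iSup_of_le (A b) (le_iSup_of_le (hcls b) (le_iSup_of_le t
      (le_iSup_of_le htn.le (le_iSup_of_le r (le_iSup_of_le hr0 le_rfl)))))
  have hpair : ∀ (j : Fin k) (b : Fin k → Bool), b j = true → ENNReal.ofReal ((s * (B * R)) ^ 2)
      ≤ coordErr n (A b) t ν (fun D => T r D j.succ) (thetaStar (A b) t r j.succ)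
        + coordErr n (A (flipAt j b)) t ν (fun D => T r D j.succ)
          (thetaStar (A (flipAt j b)) t r j.succ) := fun j b hb => by
    have hm : Measurable fun D => T r D j.succ := by have := hT r; fun_prop
    refine le_trans (ENNReal.ofReal_le_ofReal ?_) (le_coordErr_add_coordErr_of_shear hn
      (by rw [hs2]; field_simp; norm_num) (mulV_corrFactor_shear hb) t hm _ _)
    have hf : flipAt j b j = false := by simp [flipAt, hb]
    rw [hβ' b _ (Fin.succ_ne_zero j), hβ' _ _ (Fin.succ_ne_zero j), corrVec_succ, corrVec_succ, hb,
      hf]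
    simp only [if_true, Bool.false_eq_true, if_false]
    have h1 := hβ b
    have h2 := hβ (flipAt j b)
    refine pow_le_pow_left₀ (by positivity) ?_ 2
    have k1 : s * (B * R) ≤ s * β b := by gcongr
    have k2 : s * (B * R) ≤ s * β (flipAt j b) := by gcongr
    linarith
  have hass := card_mul_le_of_neighbors (k := k) (D := ENNReal.ofReal ((s * (B * R)) ^ 2)) (W := W)
    (c := fun j b => coordErr n (A b) t ν (fun D => T r D j.succ) (thetaStar (A b) t r j.succ))
    (fun j b => by
      cases hb : b j
      · have := hpair j (flipAt j b) (by simp [flipAt, hb])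
        rw [flipAt_flipAt, add_comm] at this
        exact this
      · exact hpair j b hb)
    (fun b => by
      have h := sum_coordErr_le_mse (A := A b) (θ₀ := t) (ν := ν) (δ := r) (hT r)
        (Finset.univ.map (Fin.succEmb k))
      rw [Finset.sum_map] at h
      exact h.trans (hWge b))
  have hfin : ENNReal.ofReal 2 * ENNReal.ofReal (B ^ 2 / 160 * R ^ 2 * ((k + 1 : ℕ) / n))
      ≤ ENNReal.ofReal 2 * W := by
    rw [ENNReal.ofReal_ofNat]
    refine le_trans ?_ hass
    rw [← ENNReal.ofReal_natCast, ← ENNReal.ofReal_mul (by positivity), ← ENNReal.ofReal_ofNat 2,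
      ← ENNReal.ofReal_mul (by norm_num)]
    apply ENNReal.ofReal_le_ofReal
    have hk' : ((k + 1 : ℕ) : ℝ) ≤ 2 * k := by exact_mod_cast (by omega : k + 1 ≤ 2 * k)
    calc 2 * (B ^ 2 / 160 * R ^ 2 * (((k + 1 : ℕ) : ℝ) / n))
        ≤ 2 * (B ^ 2 / 160 * R ^ 2 * (2 * k / n)) := by gcongr
      _ = k * (1 / (40 * n) * (B * R) ^ 2) := by field_simp; ring
      _ = _ := by rw [mul_pow s, hs2]
  exact (ENNReal.mul_le_mul_iff_right (by simp) ENNReal.ofReal_ne_top).mp hfin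

end minimax

end AdvLinReg

namespace AdvLinReg

/-! ### The minimax comparison -/

/-- Minimax lower bound in dimension one. Variances that differ by a factor `1 + O(n^(-1/2))` cannot
be told apart, and between the thresholds the target depends on the variance to first order. -/
theorem le_worstMse_one_dim {ℓ c₁ c₂ : ℝ} (hℓ : 1 ≤ ℓ) (hc₁ : ℓ⁻¹ ≤ c₁) (hc : c₁ < c₂)
    (hc₂ : c₂ ≤ ℓ) :
    ∃ c η : ℝ, 0 < c ∧ 0 < η ∧ ∀ {n : ℕ}, 0 < n → ((1 : ℕ) / n : ℝ) ≤ η →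
      ∀ (R σ : ℝ) (ν : Measure ℝ), 0 < R → IsNoise ν σ →
      ∀ T : ℝ → Data 1 n → Vec 1, (∀ δ, Measurable (T δ)) →
        ENNReal.ofReal (c * R ^ 2 * ((1 : ℕ) / n)) ≤ worstMse c₁ c₂ R ν T := by
  have hℓ0 : 0 < ℓ := by linarith
  have hc₁0 : 0 < c₁ := (inv_pos.mpr hℓ0).trans_le hc₁
  have hc0 := c0_pos
  have hc0' := c0_le
  set a := (c₁ + c₂) / 2 with ha
  have ha0 : 0 < a := by linarith
  set r := √a with hr
  have hr0 : 0 < r := Real.sqrt_pos.mpr ha0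
  have hra : r ^ 2 = a := Real.sq_sqrt ha0.le
  have hrℓ : ℓ⁻¹ ≤ r := by
    refine Real.le_sqrt_of_sq_le ?_
    have : (ℓ⁻¹) ^ 2 ≤ ℓ⁻¹ :=
      pow_le_of_le_one (inv_nonneg.mpr hℓ0.le) (inv_le_one_of_one_le₀ hℓ) two_ne_zero
    linarith
  -- dilations by at most `1 + u` keep the variance in `[c₁, c₂]`
  set u := min 1 ((c₂ - c₁) / (6 * a)) with hu
  have hu0 : 0 < u := lt_min one_pos (div_pos (by linarith) (by linarith))
  have hu1 : u ≤ 1 := min_le_left _ _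
  have hu2 : u * (6 * a) ≤ c₂ - c₁ := by
    rw [← le_div_iff₀ (by linarith)]; exact min_le_right _ _
  set q := c0 ^ 2 * (1 / 10) / (ℓ ^ 3 * (2 * ℓ ^ 2 / c0 ^ 2) ^ 2) with hq
  have hq0 : 0 < q := by positivity
  clear_value u
  refine ⟨(q * r) ^ 2 / 160, u ^ 2, by positivity, by positivity, ?_⟩
  intro n hn hnu R σ ν hR hν T hT
  have hprob := hν.1
  have hn' : (0 : ℝ) < n := by exact_mod_cast hn
  -- the largest dilation for which the two-point bound applies
  set h := 1 / √(20 * n) with hh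
  have hh0 : 0 < h := by positivity
  have hh2 : h ^ 2 = 1 / (20 * n) := by rw [hh, div_pow, Real.sq_sqrt (by positivity), one_pow]
  clear_value h
  have hhu : h ≤ u := by
    refine abs_le_of_sq_le_sq' ?_ hu0.le |>.2
    rw [hh2]
    refine le_trans ?_ hnu
    push_cast
    gcongr
    linarith
  have hcov : ∀ b : ℝ, (b • (1 : Matrix (Fin 1) (Fin 1) ℝ)) * (b • (1 : Matrix (Fin 1) (Fin 1) ℝ))ᵀ
      = b ^ 2 • 1 := fun b => by
    rw [Matrix.transpose_smul, Matrix.transpose_one, Matrix.smul_mul, Matrix.mul_smul, smul_smul,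
      mul_one, sq]
  have hcls : ∀ b : ℝ, c₁ ≤ b ^ 2 → b ^ 2 ≤ c₂ →
      CovClass c₁ c₂ (b ^ 2 • (1 : Matrix (Fin 1) (Fin 1) ℝ)) := fun b h1 h2 => by
    refine covClass_of_inner (by simp) (fun x => ?_) fun x => ?_
    all_goals
      rw [smul_mulV, one_mulV, inner_smul_right, real_inner_self_eq_norm_sq]
      gcongr
  have htgt : ∀ b : ℝ, 0 ≤ b → c₁ ≤ b ^ 2 → b ^ 2 ≤ c₂ → thetaStar
      (b ^ 2 • (1 : Matrix (Fin 1) (Fin 1) ℝ)) (R • unitVec 0) r 0 = shrink r b * R :=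
    fun b hb h1 h2 => by
      have h3 := hcls b h1 h2
      have h4 := h3.mono hc₁ hc₂ h3.transpose_eq
      rw [thetaStar_eq hℓ h4 _ hr0.le, pathEst_one_dim hℓ h4]
      simp [unitVec, Real.sqrt_sq hb]
  have hge : ∀ b : ℝ, c₁ ≤ b ^ 2 → b ^ 2 ≤ c₂ → coordErr n (b ^ 2 • (1 : Matrix (Fin 1) (Fin 1) ℝ))
      (R • unitVec 0) ν (fun D => T r D 0)
      (thetaStar (b ^ 2 • (1 : Matrix (Fin 1) (Fin 1) ℝ)) (R • unitVec 0) r 0)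
        ≤ worstMse c₁ c₂ R ν T := fun b h1 h2 => by
    have hs := sum_coordErr_le_mse (A := b ^ 2 • (1 : Matrix (Fin 1) (Fin 1) ℝ))
      (θ₀ := R • unitVec 0) (ν := ν) (δ := r) (hT r) Finset.univ
    rw [Fin.sum_univ_one] at hs
    refine hs.trans ?_
    rw [worstMse]
    exact le_iSup_of_le _ (le_iSup_of_le (hcls b h1 h2) (le_iSup_of_le (R • unitVec 0)
      (le_iSup_of_le (by rw [norm_smul, norm_unitVec, mul_one, Real.norm_of_nonneg hR.le])
        (le_iSup_of_le r (le_iSup_of_le hr0 le_rfl)))))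
  have hr1 : c₁ ≤ r ^ 2 := by linarith
  have hr2 : r ^ 2 ≤ c₂ := by linarith
  have hx1 : c₁ ≤ (r * (1 + h)) ^ 2 := by rw [mul_pow, hra]; nlinarith
  have hx2 : (r * (1 + h)) ^ 2 ≤ c₂ := by
    rw [mul_pow, hra]
    have k1 : (1 + h) ^ 2 ≤ 1 + 3 * u := by nlinarith
    have : a * (1 + h) ^ 2 ≤ a * (1 + 3 * u) := by gcongr
    linarith
  have hle : ∀ b : ℝ, b ^ 2 ≤ c₂ → b ≤ ℓ := fun b hb =>
    (abs_le_of_sq_le_sq' (by nlinarith) hℓ0.le).2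
  have hgap := mul_abs_sub_le_abs_shrink_sub (ε := 1 / 10) (δ := r) (x := r * (1 + h)) hℓ
    (by norm_num) hrℓ (hle r hr2) (by positivity) (hle _ hx2)
    (by
      have : c0 * r ≤ 9 / 11 * r := by gcongr
      linarith)
    (by
      rw [← mul_div_assoc, le_div_iff₀ hc0]
      have : r * c0 ≤ r * (9 / 11) := by gcongr
      linarith)
  rw [← hq, show r * (1 + h) - r = r * h by ring, abs_of_pos (by positivity)] at hgap
  have htwo := le_coordErr_add_coordErr_of_dilation (n := n) (h := h)
    (B₁ := (r * (1 + h)) • (1 : Matrix (Fin 1) (Fin 1) ℝ))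
    (B₂ := r • (1 : Matrix (Fin 1) (Fin 1) ℝ)) hn hh0.le (by rw [hh2]; field_simp; norm_num)
    (fun z => by rw [smul_mulV, smul_mulV, one_mulV, one_mulV, smul_smul]) (R • unitVec 0)
    (ν := ν) (U := fun D => T r D 0) (by have := hT r; fun_prop)
    (thetaStar ((r * (1 + h)) ^ 2 • (1 : Matrix (Fin 1) (Fin 1) ℝ)) (R • unitVec 0) r 0)
    (thetaStar (r ^ 2 • (1 : Matrix (Fin 1) (Fin 1) ℝ)) (R • unitVec 0) r 0)
  rw [hcov, hcov] at htwo
  have hW := htwo.trans (add_le_add (hge _ hx1 hx2) (hge _ hr1 hr2))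
  rw [htgt _ (by positivity) hx1 hx2, htgt _ hr0.le hr1 hr2, ← two_mul] at hW
  refine (ENNReal.mul_le_mul_iff_right (a := ENNReal.ofReal 2) (by simp)
    ENNReal.ofReal_ne_top).mp ?_
  rw [ENNReal.ofReal_ofNat 2]
  refine le_trans ?_ hW
  rw [← ENNReal.ofReal_ofNat 2, ← ENNReal.ofReal_mul (by norm_num)]
  apply ENNReal.ofReal_le_ofReal
  rw [← sub_mul, div_pow, mul_pow (_ - _), ← sq_abs (shrink _ _ - _)]
  have : (q * (r * h)) ^ 2 ≤ |shrink r (r * (1 + h)) - shrink r r| ^ 2 :=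
    pow_le_pow_left₀ (by positivity) hgap 2
  calc 2 * ((q * r) ^ 2 / 160 * R ^ 2 * (((1 : ℕ) : ℝ) / n))
      = (q * (r * h)) ^ 2 * R ^ 2 / 2 ^ 2 := by
        rw [show (q * (r * h)) ^ 2 = (q * r) ^ 2 * h ^ 2 by ring, hh2]
        push_cast
        field_simp
        norm_num
    _ ≤ _ := by gcongr

/-- The worst error of the two-stage estimator is of the order of the rate. -/
lemma worstMse_twoStage_le {ℓ c₁ c₂ K R σ : ℝ} {p n : ℕ} (h : LargeSample ℓ p n) (hℓ : 1 ≤ ℓ)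
    (hc₁ : ℓ⁻¹ ≤ c₁) (hc₂ : c₂ ≤ ℓ) {ν : Measure ℝ} (hσ0 : 0 ≤ σ) (hσ : σ ≤ K * R)
    (hν : IsNoise ν σ) :
    worstMse c₁ c₂ R ν (fun δ => twoStage (p := p) (n := n) δ)
      ≤ ENNReal.ofReal (riskConst ℓ * (ℓ + K ^ 2) * R ^ 2 * (p / n)) := by
  have hr := riskConst_pos hℓ
  rw [worstMse]
  refine iSup_le fun A => iSup_le fun hA => iSup_le fun θ₀ => iSup_le fun hθ => iSup_le fun δ =>
    iSup_le fun hδ => ?_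
  have hA' := hA.mono hc₁ hc₂ hA.transpose_eq
  refine (mse_twoStage_le h hℓ hA' θ₀ hν hδ.le).trans (ENNReal.ofReal_le_ofReal ?_)
  have h1 : wnorm A θ₀ ^ 2 ≤ ℓ * R ^ 2 := by
    rw [wnorm_sq (hA'.posDef (inv_pos.mpr (by linarith))).posSemidef]
    refine (hA'.inner_le θ₀).trans ?_
    gcongr
  have h2 : σ ^ 2 ≤ K ^ 2 * R ^ 2 := by rw [← mul_pow]; exact pow_le_pow_left₀ hσ0 hσ 2
  rw [rate, mul_assoc (riskConst ℓ), mul_assoc (riskConst ℓ), mul_div_assoc]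
  gcongr
  linarith

end AdvLinReg

namespace AdvLinReg

/-! ### The dense regime and the assembled bounds -/

lemma DenseRegime.tendsto_dim_div {p : ℕ → ℕ} (h : DenseRegime p) :
    Tendsto (fun n : ℕ => (p n / n : ℝ)) atTop (𝓝 0) := by
  refine squeeze_zero' (Eventually.of_forall fun n => by positivity) ?_ h.2
  filter_upwards [eventually_ge_atTop 3] with n hn
  have h3 : (3 : ℝ) ≤ n := by exact_mod_cast hn
  have h1 : 1 ≤ Real.log n := by
    rw [Real.le_log_iff_exp_le (by linarith)]
    linarith [Real.exp_one_lt_d9]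
  gcongr
  nlinarith [Nat.cast_nonneg (α := ℝ) (p n)]

lemma DenseRegime.eventually_largeSample {p : ℕ → ℕ} (h : DenseRegime p) {ℓ : ℝ} (hℓ : 1 ≤ ℓ) :
    ∀ᶠ n in atTop, LargeSample ℓ (p n) n := by
  filter_upwards [eventually_ge_atTop 400, h.2.eventually_le_const (by norm_num : (0 : ℝ) < 1 / 20),
    h.tendsto_dim_div.eventually_le_const (by positivity : 0 < 1 / (10 * ℓ ^ 2))] with n h1 h2 h3
  have hn : (0 : ℝ) < n := by exact_mod_cast (by omega : 0 < n)
  refine ⟨h.1 n, h1, ?_, ?_⟩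
  · rw [div_le_div_iff₀ hn (by positivity)] at h3
    linarith
  · rw [div_le_iff₀ hn] at h2
    linarith

lemma DenseRegime.eventually {p : ℕ → ℕ} (h : DenseRegime p) {ℓ η : ℝ} (hℓ : 1 ≤ ℓ) (hη : 0 < η) :
    ∀ᶠ n in atTop, LargeSample ℓ (p n) n ∧ (p n / n : ℝ) ≤ η :=
  (h.eventually_largeSample hℓ).and (h.tendsto_dim_div.eventually_le_const hη)

lemma rate_le_rate {p n : ℕ} {c c' σ : ℝ} (h : c ≤ c') (A : Matrix (Fin p) (Fin p) ℝ)
    (θ₀ : Vec p) : c * rate n A θ₀ σ ≤ c' * rate n A θ₀ σ :=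
  mul_le_mul_of_nonneg_right h (by rw [rate]; positivity)

/-- Between the thresholds the error is at least of the order of the rate, in every dimension. -/
theorem rate_le_mse_of_between {ℓ κ ε : ℝ} (hℓ : 1 ≤ ℓ) (hκ : 0 < κ) (hε : 0 < ε) :
    ∃ c η : ℝ, 0 < c ∧ 0 < η ∧ ∀ {p n : ℕ}, LargeSample ℓ p n → (p / n : ℝ) ≤ η →
      ∀ (A : Matrix (Fin p) (Fin p) ℝ) (θ₀ : Vec p) (σ : ℝ) (ν : Measure ℝ) (δ : ℝ),
        CovClass ℓ⁻¹ ℓ A → 0 ≤ σ → IsNoise ν σ → κ * σ ≤ wnorm A θ₀ →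
        (1 + ε) * delta1 A θ₀ ≤ δ → δ ≤ (1 - ε) * delta2 A θ₀ →
          ENNReal.ofReal (c * rate n A θ₀ σ) ≤ mse (n := n) A θ₀ ν δ (twoStage δ) := by
  obtain ⟨c, η, hc, hη, H⟩ := le_mse_twoStage_between hℓ hκ hε
  obtain ⟨c', η', hc', hη', H'⟩ := le_mse_twoStage_between_one_dim hℓ hκ hε
  refine ⟨min c c', min η η', lt_min hc hc', lt_min hη hη', ?_⟩
  intro p n hL hq A θ₀ σ ν δ hA hσ hν hκσ h1 h2
  rcases eq_or_ne θ₀ 0 with rfl | ht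
  · have hw : wnorm A (0 : Vec p) = 0 := by simp [wnorm]
    rw [hw] at hκσ
    have hσ0 : σ = 0 := le_antisymm (by nlinarith) hσ
    rw [rate, hw, hσ0]
    simp
  rcases hL.one_le.eq_or_lt with rfl | hp
  · exact (ENNReal.ofReal_le_ofReal (rate_le_rate (min_le_right _ _) A θ₀)).trans
      (H' hL (hq.trans (min_le_right _ _)) A θ₀ σ ν δ hA hν ht hσ hκσ h1 h2)
  · exact (ENNReal.ofReal_le_ofReal (rate_le_rate (min_le_left _ _) A θ₀)).trans
      (H hp hL (hq.trans (min_le_left _ _)) A θ₀ σ ν δ hA hν ht hσ hκσ h1 h2)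

/-- The minimax lower bound, in every dimension. -/
theorem rate_le_worstMse {ℓ c₁ c₂ : ℝ} (hℓ : 1 ≤ ℓ) (hc₁ : ℓ⁻¹ ≤ c₁) (hc : c₁ < c₂)
    (hc₂ : c₂ ≤ ℓ) :
    ∃ c η : ℝ, 0 < c ∧ 0 < η ∧ ∀ {p n : ℕ}, 1 ≤ p → 0 < n → (p / n : ℝ) ≤ η →
      ∀ (R σ : ℝ) (ν : Measure ℝ), 0 < R → IsNoise ν σ →
      ∀ T : ℝ → Data p n → Vec p, (∀ δ, Measurable (T δ)) →
        ENNReal.ofReal (c * R ^ 2 * (p / n)) ≤ worstMse c₁ c₂ R ν T := by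
  obtain ⟨c, η, hc0, hη, H⟩ := le_worstMse hℓ hc₁ hc hc₂
  obtain ⟨c', η', hc0', hη', H'⟩ := le_worstMse_one_dim hℓ hc₁ hc hc₂
  refine ⟨min c c', min η η', lt_min hc0 hc0', lt_min hη hη', ?_⟩
  intro p n hp hn hq R σ ν hR hν T hT
  rcases hp.eq_or_lt with rfl | hp
  · refine le_trans (ENNReal.ofReal_le_ofReal ?_)
      (H' hn (hq.trans (min_le_right _ _)) R σ ν hR hν T hT)
    gcongr
    exact min_le_right _ _
  · obtain ⟨k, rfl⟩ : ∃ k, p = k + 1 := ⟨p - 1, by omega⟩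
    refine le_trans (ENNReal.ofReal_le_ofReal ?_)
      (H (by omega) hn (hq.trans (min_le_left _ _)) R σ ν hR hν T hT)
    gcongr
    exact min_le_left _ _

end AdvLinReg
open AdvLinReg in
theorem corollary1 (c₁ c₂ : ℝ) (hc₁ : 0 < c₁) (hc : c₁ < c₂) :
    -- upper bound, at every attack level
    (∃ C : ℝ, 0 < C ∧ ∀ p : ℕ → ℕ, DenseRegime p → ∀ᶠ n : ℕ in atTop,
      ∀ (A : Matrix (Fin (p n)) (Fin (p n)) ℝ) (θ₀ : Vec (p n)) (σ : ℝ) (ν : Measure ℝ) (δ : ℝ),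
        CovClass c₁ c₂ A → 0 ≤ σ → IsNoise ν σ → 0 ≤ δ →
          AEMeasurable (twoStage (p := p n) (n := n) δ) (dataLaw n A θ₀ ν) ∧
          mse (n := n) A θ₀ ν δ (twoStage δ) ≤ ENNReal.ofReal (C * rate n A θ₀ σ)) ∧
    -- matching lower bound, at every attack level between the two thresholds
    (∀ κ : ℝ, 0 < κ → ∀ ε : ℝ, 0 < ε → ∃ c : ℝ, 0 < c ∧
      ∀ p : ℕ → ℕ, DenseRegime p → ∀ᶠ n : ℕ in atTop,
      ∀ (A : Matrix (Fin (p n)) (Fin (p n)) ℝ) (θ₀ : Vec (p n)) (σ : ℝ) (ν : Measure ℝ) (δ : ℝ),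
        CovClass c₁ c₂ A → 0 ≤ σ → IsNoise ν σ → κ * σ ≤ wnorm A θ₀ →
        (1 + ε) * delta1 A θ₀ ≤ δ → δ ≤ (1 - ε) * delta2 A θ₀ →
          ENNReal.ofReal (c * rate n A θ₀ σ) ≤ mse (n := n) A θ₀ ν δ (twoStage δ)) ∧
    -- matching lower bound below the lower threshold, for a bounded signal-to-noise ratio
    (∀ κ : ℝ, 0 < κ → ∀ K : ℝ, 0 < K → ∀ ε : ℝ, 0 < ε → ∃ c : ℝ, 0 < c ∧
      ∀ p : ℕ → ℕ, DenseRegime p → ∀ᶠ n : ℕ in atTop,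
      ∀ (A : Matrix (Fin (p n)) (Fin (p n)) ℝ) (θ₀ : Vec (p n)) (σ : ℝ) (ν : Measure ℝ) (δ : ℝ),
        CovClass c₁ c₂ A → 0 ≤ σ → IsNoise ν σ →
        MemLp (fun e : ℝ => e) 4 ν → ∫ e, e ^ 4 ∂ν ≤ K * σ ^ 4 →
        κ * σ ≤ wnorm A θ₀ → wnorm A θ₀ ≤ K * σ →
        0 ≤ δ → δ ≤ (1 - ε) * delta1 A θ₀ →
          ENNReal.ofReal (c * rate n A θ₀ σ) ≤ mse (n := n) A θ₀ ν δ (twoStage δ)) ∧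
    -- minimax rate optimality
    (∀ K : ℝ, 0 < K → ∃ C : ℝ, 0 < C ∧ ∀ p : ℕ → ℕ, DenseRegime p → ∀ᶠ n : ℕ in atTop,
      ∀ (R σ : ℝ) (ν : Measure ℝ), 0 < R → 0 ≤ σ → σ ≤ K * R → IsNoise ν σ →
      ∀ T : ℝ → Data (p n) n → Vec (p n), (∀ δ, Measurable (T δ)) →
        worstMse c₁ c₂ R ν (fun δ => twoStage (p := p n) (n := n) δ)
          ≤ ENNReal.ofReal C * worstMse c₁ c₂ R ν T) := by
  -- one parameter `ℓ` controls both ends of the spectrum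
  set ℓ := max 1 (max c₁⁻¹ c₂) with hℓdef
  have hℓ : 1 ≤ ℓ := le_max_left _ _
  have h₁ : ℓ⁻¹ ≤ c₁ := inv_le_of_inv_le₀ hc₁ ((le_max_left _ _).trans (le_max_right _ _))
  have h₂ : c₂ ≤ ℓ := (le_max_right _ _).trans (le_max_right _ _)
  clear_value ℓ
  have hcls : ∀ {p : ℕ} {A : Matrix (Fin p) (Fin p) ℝ}, CovClass c₁ c₂ A → CovClass ℓ⁻¹ ℓ A :=
    fun hA => hA.mono h₁ h₂ hA.transpose_eq
  refine ⟨⟨riskConst ℓ, riskConst_pos hℓ, fun p hp => ?_⟩, fun κ hκ ε hε => ?_,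
    fun κ hκ K hK ε hε => ?_, fun K hK => ?_⟩
  · filter_upwards [hp.eventually_largeSample hℓ] with n hn A θ₀ σ ν δ hA hσ hν hδ
    exact ⟨(measurable_twoStage hn.pos hδ).aemeasurable, mse_twoStage_le hn hℓ (hcls hA) θ₀ hν hδ⟩
  · obtain ⟨c, η, hc', hη, H⟩ := rate_le_mse_of_between hℓ hκ hε
    refine ⟨c, hc', fun p hp => ?_⟩
    filter_upwards [hp.eventually hℓ hη] with n hn A θ₀ σ ν δ hA
    exact H hn.1 hn.2 A θ₀ σ ν δ (hcls hA)
  · obtain ⟨c, η, hc', hη, H⟩ := le_mse_twoStage_of_le_delta1 hℓ hκ hK hε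
    refine ⟨c, hc', fun p hp => ?_⟩
    filter_upwards [hp.eventually hℓ hη] with n hn A θ₀ σ ν δ hA
    exact H hn.1 hn.2 A θ₀ σ ν δ (hcls hA)
  · obtain ⟨c, η, hc', hη, H⟩ := rate_le_worstMse hℓ h₁ hc h₂
    have hr := riskConst_pos hℓ
    have hℓ0 : 0 < ℓ := by linarith
    refine ⟨riskConst ℓ * (ℓ + K ^ 2) / c, by positivity, fun p hp => ?_⟩
    filter_upwards [hp.eventually hℓ hη] with n hn R σ ν hR hσ0 hσ hν T hT
    refine (worstMse_twoStage_le hn.1 hℓ h₁ h₂ hσ0 hσ hν).trans ?_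
    refine le_trans (le_of_eq ?_)
      (mul_le_mul_right (H (hp.1 n) hn.1.pos hn.2 R σ ν hR hν T hT) _)
    rw [← ENNReal.ofReal_mul (by positivity)]
    congr 1
    field_simp
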